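/- Let $K$ be a field. **Preshuffle bialgebras.** A preshuffle algebra is a graded vector space $A=\bigoplus_{n\ge 0}A_n$ with linear maps $\bullet_i\colon A\otimes A_m\to A$ ($0\le i\le m$), $A_n\bullet_i A_m\subseteq A_{n+m}$, such that $(x\bullet_i y)\bullet_j z=x\bullet_{i+j}(y\bullet_j z)$ for $0\le i\le |y|$, $0\le j\le|z|$. A preshuffle bialgebra is a positively graded ($A_0=0$) preshuffle algebra with a graded coassociative (not necessarily counital) coproduct $\Delta(x)=\sum x_{(1)}\otimes x_{(2)}$ such that, for homogeneous $x,y$, $$\Delta(x\bullet_0y)=\sum x_{(1)}\otimes(x_{(2)}\bullet_0y)+x\otimes y+\sum(x\bullet_0y_{(1)})\otimes y_{(2)},$$ $$\Delta(x\bullet_iy)=\sum_{|y_{(1)}|\le i}y_{(1)}\otimes(x\bullet_{i-|y_{(1)}|}y_{(2)})+\sum_{|y_{(1)}|=i}(x_{(1)}\bullet_iy_{(1)})\otimes(x_{(2)}\bullet_0y_{(2)})+\sum_{|y_{(1)}|\ge i}(x\bullet_iy_{(1)})\otimes y_{(2)}\quad(0<i<|y|),$$ $$\Delta(x\bullet_{|y|}y)=\sum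 y_{(1)}\otimes(x\bullet_{|y_{(2)}|}y_{(2)})+y\otimes x+\sum(x_{(1)}\bullet_{|y|}y)\otimes x_{(2)}.$$ Put $\mathrm{Prim}(A)=\ker\Delta=F_1A$ and $F_{p}A=\{x\mid\Delta(x)\in F_{p-1}A\otimes F_{p-1}A\}$; $A$ is connected if $A=\bigcup_pF_pA$. Morphisms are the degree-preserving linear maps compatible with all $\bullet_i$ and $\Delta$. **Operations.** In a preshuffle algebra put, for homogeneous $x_1,\dots,x_q,y,z$ and $1\le p\le|y|$, $L_0^p(y;z)=z\bullet_py$ if $p<|y|$, $\;L_0^{|y|}(y;z)=z\bullet_{|y|}y-y\bullet_0z$, and for $q\ge1$ $$L_q^p(x_1,\dots,x_q;y;z)=z\bullet_{p+|x_1|+\dots+|x_q|}(x_1\bullet_0\cdots\bullet_0x_q\bullet_0y)-x_1\bullet_0\bigl(z\bullet_{p+|x_2|+\dots+|x_q|}(x_2\bullet_0\cdots\bullet_0x_q\bullet_0y)\bigr).$$ **$\mathrm{Prim}_{psh}$ algebras.** A $\mathrm{Prim}_{psh}$ algebra is a positively graded vector space $V$ with degree-preserving linear operations $L_n^j\colon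 V^{\otimes n}\otimes V_m\otimes V\to V$ ($n\ge0$, $1\le j\le m$) satisfying relations (A) and (B) below; morphisms are the degree-preserving linear maps compatible with all $L_n^j$. For a finite sequence $\mathbf x=(x_1,\dots,x_n)$ of homogeneous elements put $|\mathbf x|=\sum|x_i|$, $\mathbf x_{\le r}=(x_1,\dots,x_r)$, $\mathbf x_{>r}=(x_{r+1},\dots,x_n)$, and write $L^j(\mathbf x;y;z)=L_n^j(x_1,\dots,x_n;y;z)$. Put $N^j(\mathbf x;y;z_1)=L^j(\mathbf x;y;z_1)$ and, for $m\ge2$, $$N^j(\mathbf x;y;z_1,\dots,z_m)=\sum_{r=0}^nL^{j+|\mathbf x_{>r}|}\bigl(\mathbf x_{\le r};N^j(\mathbf x_{>r};y;z_2,\dots,z_m);z_1\bigr).$$ For $\mathbf z=(z_1,\dots,z_m)$, $m\ge0$, put $$G(\mathbf x,\mathbf z)=\sum_{r=0}^nL^{j+k+|\mathbf x_{>r}|+|\mathbf z|}\bigl(\mathbf x_{\le r};N^j(\mathbf x_{>r};y;\mathbf z,w);t\bigr),$$ $$D(\mathbf x,\mathbf z)=\sum_{l=1}^m\sum_{r=0}^nL^k\bigl(\mathbf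 x_{\le r},N^{|y|}(\mathbf x_{>r};y;\mathbf z_{\le l}),\mathbf z_{>l};w;t\bigr)+L^k(\mathbf x,y,\mathbf z;w;t).$$ The relations, for all homogeneous elements, $1\le j\le|y|$ and $1\le k\le|w|$, are (A) $L^j(\mathbf x;y;L_0^k(w;t))=\sum_{r=0}^nL^{j+k+|\mathbf x_{>r}|}(\mathbf x_{\le r};L^j(\mathbf x_{>r};y;w);t)+\delta_{j,|y|}L^k(\mathbf x,y;w;t)-\delta_{k,|w|}\sum_{r=0}^nL^{j+|\mathbf x_{>r}|}(\mathbf x_{\le r};L^j(\mathbf x_{>r};y;t);w)$; (B) for $m\ge1$, $L^j(\mathbf x;y;L^k(\mathbf z;w;t))=G(\mathbf x,\mathbf z)-\sum_{r=0}^nL^{j+|\mathbf x_{>r}|}(\mathbf x_{\le r};G(\mathbf x_{>r},\mathbf z_{>1});z_1)+\delta_{j,|y|}\Bigl(D(\mathbf x,\mathbf z)-\sum_{r=0}^nL^{|y|+|\mathbf x_{>r}|}(\mathbf x_{\le r};D(\mathbf x_{>r},\mathbf z_{>1});z_1)\Bigr)$. **The free preshuffle algebra.** For a set $X$ graded in degrees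 $\ge 1$, let $K[\mathcal K_\infty,X]$ have as basis in degree $n\ge1$ the tuples $(f;x_1,\dots,x_r)$, $r\ge1$, $x_a\in X$, where $f\colon\{1,\dots,n\}\to\{1,\dots,r\}$ satisfies $|f^{-1}(a)|=|x_a|$ for all $a$, and $f(c)\le f(a)$ whenever $f(a)=f(b)$ and $a\le c\le b$. For $g$ defined on $\{1,\dots,m\}$ put $$(f;\mathbf x)\bullet_i(g;\mathbf y)=\bigl((g(1)+r,\dots,g(i)+r,f(1),\dots,f(n),g(i+1)+r,\dots,g(m)+r);\mathbf x,\mathbf y\bigr).$$ An element $x\in X$ is identified with $(f;x)$, $f$ constant. The coproduct of $(f;\mathbf x)$ is the sum, over all $0<p<n$ for which $f(1),\dots,f(p)$ and $f(p+1),\dots,f(n)$ have no common value, of $(f';\mathbf x')\otimes(f'';\mathbf x'')$, where $f'$ and $f''$ are the two words with values renumbered increasingly from $1$, and $\mathbf x',\mathbf x''$ consist of the $x_a$ with $a$ a value of the respective word; so the elements of $X$ are primitive. **The enveloping bialgebra.** For a $\mathrm{Prim}_{psh}$ algebra $(V,\overline L{}_q^i)$ with a homogeneous basis $X$, let $\mathcal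 U_{Psh}(V)$ be the quotient of the bialgebra $K[\mathcal K_\infty,X]$ by the ideal generated by all $L_q^i(x_1,\dots,x_q;y;z)-\overline L{}_q^i(x_1,\dots,x_q;y;z)$ with $x_1,\dots,x_q,y,z\in X$, $q\ge0$, $1\le i\le|y|$. **Theorem.** For every connected preshuffle bialgebra $H$, the space $\mathrm{Prim}(H)$ is a $\mathrm{Prim}_{psh}$ algebra under the operations $L_q^p$ of $H$. For every $\mathrm{Prim}_{psh}$ algebra $V$, the quotient $\mathcal U_{Psh}(V)$ is a connected preshuffle bialgebra, which does not depend, up to isomorphism compatible with the maps from $V$, on the choice of the homogeneous basis. Moreover: a) every connected preshuffle bialgebra $H$ is isomorphic to $\mathcal U_{Psh}(\mathrm{Prim}(H))$; b) every $\mathrm{Prim}_{psh}$ algebra $V$ is isomorphic to $\mathrm{Prim}(\mathcal U_{Psh}(V))$; c) $\mathrm{Prim}$ (restriction of morphisms to the primitive elements) and $\mathcal U_{Psh}$ (extension of morphisms from $V$) are mutually quasi-inverse equivalences between the category of connected preshuffle bialgebras and the category of $\mathrm{Prim}_{psh}$ algebras. -/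

import Mathlib

open scoped TensorProduct

universe u v w

/-- A graded vector space `A = ⨁ₙ Aₙ` over `K`. -/
structure GrSpace (K : Type u) [Field K] where
  carrier : Type v
  [acg : AddCommGroup carrier]
  [mod : Module K carrier]
  gr : ℕ → Submodule K carrier
  internal : DirectSum.IsInternal gr

attribute [instance] GrSpace.acg GrSpace.mod

namespace GrSpace

variable {K : Type u} [Field K]

/-- A homogeneous element together with its degree. -/
structure Homog (A : GrSpace.{u, v} K) where
  deg : ℕ
  val : A.carrier
  mem : val ∈ A.gr deg

/-- `|x₁| + ⋯ + |x_q|`. -/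
def degSum {A : GrSpace.{u, v} K} (xs : List A.Homog) : ℕ := (xs.map Homog.deg).sum

/-- The list of underlying elements. -/
def vals {A : GrSpace.{u, v} K} (xs : List A.Homog) : List A.carrier := xs.map Homog.val

/-- The projection of `A` onto its component of degree `n`. -/
noncomputable def proj (A : GrSpace.{u, v} K) (n : ℕ) : A.carrier →ₗ[K] A.carrier :=
  (A.gr n).subtype ∘ₗ DirectSum.component K ℕ (fun i => A.gr i) n ∘ₗ
    ((LinearEquiv.ofBijective (DirectSum.coeLinearMap A.gr) A.internal).symm :
      A.carrier →ₗ[K] DirectSum ℕ (fun i => A.gr i))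

end GrSpace

/-- A linear map of graded vector spaces, preserving the degree. -/
@[ext]
structure GrHom {K : Type u} [Field K] (A : GrSpace.{u, v} K) (B : GrSpace.{u, w} K) where
  lin : A.carrier →ₗ[K] B.carrier
  map_gr : ∀ n x, x ∈ A.gr n → lin x ∈ B.gr n

/-- The image of a homogeneous element under a degree-preserving map. -/
def GrHom.onHomog {K : Type u} [Field K] {A : GrSpace.{u, v} K} {B : GrSpace.{u, w} K}
    (f : GrHom A B) (x : A.Homog) : B.Homog :=
  ⟨x.deg, f.lin x.val, f.map_gr _ _ x.mem⟩

/-! ### Preshuffle algebras and bialgebras -/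

/-- A preshuffle algebra. The operation `•ᵢ`, given by linear maps `A ⊗ A_m → A` for all `m ≥ i`,
is encoded as the bilinear map `op i` on `A × A` that is extended by zero to `A × A_m`
for `m < i`. -/
structure PreshuffleAlgebra (K : Type u) [Field K] extends GrSpace.{u, v} K where
  op : ℕ → carrier →ₗ[K] carrier →ₗ[K] carrier
  op_mem : ∀ i n m x y, x ∈ gr n → y ∈ gr m → i ≤ m → op i x y ∈ gr (n + m)
  op_eq_zero : ∀ i m x y, y ∈ gr m → m < i → op i x y = 0
  op_assoc : ∀ i j m r x y z, y ∈ gr m → z ∈ gr r → i ≤ m → j ≤ r →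
    op j (op i x y) z = op (i + j) x (op j y z)

namespace PreshuffleAlgebra

variable {K : Type u} [Field K] (A : PreshuffleAlgebra.{u, v} K)

/-- `x₁ •₀ (x₂ •₀ ⋯ (x_q •₀ y))`. -/
def word (xs : List A.carrier) (y : A.carrier) : A.carrier :=
  xs.foldr (fun a b => A.op 0 a b) y

/-- The operation `L_q^p(x₁, …, x_q; y; z)` of a preshuffle algebra, for `1 ≤ p ≤ |y|`:
* `z •_p y` if `q = 0` and `p < |y|`;
* `z •_p y - y •₀ z` if `q = 0` and `p = |y|`;
* `z •_{p+n} (x₁ •₀ ⋯ •₀ x_q •₀ y) - x₁ •₀ (z •_{p+n'} (x₂ •₀ ⋯ •₀ x_q •₀ y))` if `q ≥ 1`, where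
  `n = |x₁| + ⋯ + |x_q|` and `n' = |x₂| + ⋯ + |x_q|`. -/
def Lop (p : ℕ) :
    List A.toGrSpace.Homog → A.toGrSpace.Homog → A.carrier → A.carrier
  | [], y, z =>
      if p < y.deg then A.op p z y.val
      else A.op p z y.val - A.op 0 y.val z
  | x :: xs, y, z =>
      A.op (p + GrSpace.degSum (x :: xs)) z (A.word (GrSpace.vals (x :: xs)) y.val)
        - A.op 0 x.val (A.op (p + GrSpace.degSum xs) z (A.word (GrSpace.vals xs) y.val))

end PreshuffleAlgebra

/-- `∑_{|x₍₁₎| = a} x₍₁₎ ⊗ x₍₂₎`, for `Δ x = ∑ x₍₁₎ ⊗ x₍₂₎`. -/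
noncomputable def GrSpace.copPart {K : Type u} [Field K] (A : GrSpace.{u, v} K)
    (Δ : A.carrier →ₗ[K] A.carrier ⊗[K] A.carrier) (a : ℕ) (x : A.carrier) :
    A.carrier ⊗[K] A.carrier :=
  (A.proj a).rTensor A.carrier (Δ x)

/-- A preshuffle bialgebra: a positively graded preshuffle algebra with a graded coassociative
coproduct satisfying the three compatibility conditions, for `i = 0`, `0 < i < |y|` and
`i = |y|` respectively. -/
structure PreshuffleBialgebra (K : Type u) [Field K] extends PreshuffleAlgebra.{u, v} K where
  positive : gr 0 = ⊥
  Δ : carrier →ₗ[K] carrier ⊗[K] carrier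
  Δ_graded : ∀ n x, x ∈ gr n → Δ x ∈
    ⨆ p : {p : ℕ × ℕ // p.1 + p.2 = n},
      LinearMap.range (TensorProduct.map (gr p.1.1).subtype (gr p.1.2).subtype)
  coassoc : ∀ x, TensorProduct.assoc K carrier carrier carrier (Δ.rTensor carrier (Δ x)) =
    Δ.lTensor carrier (Δ x)
  Δ_op_zero : ∀ x y, Δ (op 0 x y) =
    ((op 0).flip y).lTensor carrier (Δ x) + x ⊗ₜ[K] y + (op 0 x).rTensor carrier (Δ y)
  Δ_op_mid : ∀ i m x y, y ∈ gr m → 0 < i → i < m → Δ (op i x y) =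
    ∑ a ∈ Finset.range (i + 1),
        (op (i - a) x).lTensor carrier (toGrSpace.copPart Δ a y)
      + TensorProduct.map₂ (op i) (op 0) (Δ x) (toGrSpace.copPart Δ i y)
      + ∑ a ∈ Finset.Icc i m, (op i x).rTensor carrier (toGrSpace.copPart Δ a y)
  Δ_op_top : ∀ m x y, y ∈ gr m → Δ (op m x y) =
    ∑ a ∈ Finset.range (m + 1),
        (op (m - a) x).lTensor carrier (toGrSpace.copPart Δ a y)
      + y ⊗ₜ[K] x
      + ((op m).flip y).rTensor carrier (Δ x)

namespace PreshuffleBialgebra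

variable {K : Type u} [Field K] (H : PreshuffleBialgebra.{u, v} K)

/-- The coradical-type filtration: `filt p` is `F_{p+1} H`, where `F₁ H = Prim(H) = ker Δ` and
`F_{p+1} H = {x | Δ x ∈ F_p H ⊗ F_p H}`. -/
def filt : ℕ → Submodule K H.carrier
  | 0 => LinearMap.ker H.Δ
  | p + 1 => (LinearMap.range
      (TensorProduct.map (filt p).subtype (filt p).subtype)).comap H.Δ

/-- `H` is connected if it is the union of the filtration. -/
def IsConnected : Prop := ∀ x, ∃ p, x ∈ H.filt p

end PreshuffleBialgebra

/-- Connected preshuffle bialgebras. -/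
structure ConnPshBialg (K : Type u) [Field K] extends PreshuffleBialgebra.{u, v} K where
  connected : toPreshuffleBialgebra.IsConnected

/-- Morphisms of preshuffle bialgebras. -/
@[ext]
structure PshBialgHom {K : Type u} [Field K] (H H' : ConnPshBialg.{u, v} K) extends
    GrHom H.toGrSpace H'.toGrSpace where
  map_op : ∀ i x y, lin (H.op i x y) = H'.op i (lin x) (lin y)
  map_Δ : ∀ x, H'.Δ (lin x) = TensorProduct.map lin lin (H.Δ x)

/-- The category of connected preshuffle bialgebras. -/
instance ConnPshBialg.category (K : Type u) [Field K] :
    CategoryTheory.Category (ConnPshBialg.{u, v} K) where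
  Hom H H' := PshBialgHom H H'
  id H :=
    { lin := LinearMap.id
      map_gr := fun _ _ h => h
      map_op := fun _ _ _ => rfl
      map_Δ := fun x => by simp }
  comp f g :=
    { lin := g.lin ∘ₗ f.lin
      map_gr := fun n x h => g.map_gr n _ (f.map_gr n x h)
      map_op := fun i x y => by simp [f.map_op, g.map_op]
      map_Δ := fun x => by
        simp [f.map_Δ, g.map_Δ, TensorProduct.map_comp] }

/-! ### `Prim_psh` algebras -/

/-- The data of a graded vector space with operations
`L_n^j : V^{⊗n} ⊗ V_m ⊗ V → V`, for `n ≥ 0` and `1 ≤ j ≤ m`, encoded as multilinear maps on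
`Vⁿ × V × V` that are extended by zero to `Vⁿ × V_m × V` for the other `j`. -/
structure PrimOps (K : Type u) [Field K] extends GrSpace.{u, v} K where
  L : (n j : ℕ) → MultilinearMap K (fun _ : Fin n => carrier) (carrier →ₗ[K] carrier →ₗ[K] carrier)

namespace PrimOps

variable {K : Type u} [Field K] (V : PrimOps.{u, v} K)

/-- `L_n^j(x₁, …, x_n; y; z)`, the arguments `x₁, …, x_n` being given as a list. -/
def Lw (j : ℕ) (xs : List V.carrier) (y z : V.carrier) : V.carrier :=
  V.L xs.length j xs.get y z

open GrSpace

/-- For `z = (z₁, …, z_m)` with `m ≥ 1`, `nest j x y z` is the sum `∑_p L_p^j(x, y, z)` over all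
`p = (p₁, …, p_m)` with `p_i ≥ 0` and `p₁ + ⋯ + p_m = n`, where
`L_p^j(x, y, z) = L_{p₁}^{j + |x_{p₁+1}| + ⋯ + |x_n|}(x₁, …, x_{p₁}; L_{(p₂, …, p_m)}^j(
  (x_{p₁+1}, …, x_n), y, (z₂, …, z_m)); z₁)` and, for `m = 1`,
`L_{(n)}^j(x, y, z₁) = L_n^j(x₁, …, x_n; y; z₁)`.
The value at `m = 0` (`y` if `n = 0`, and `0` otherwise) makes the recursion valid
for `m = 1` too. -/
def nest (j : ℕ) : List V.toGrSpace.Homog → V.carrier → List V.carrier → V.carrier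
  | [], y, [] => y
  | _ :: _, _, [] => 0
  | xs, y, z :: zs =>
      ∑ r ∈ Finset.range (xs.length + 1),
        V.Lw (j + degSum (xs.drop r)) (vals (xs.take r)) (nest j (xs.drop r) y zs) z

/-- For `z = (z₁, …, z_m)`, the sum, over all `p = (p₁, …, p_{m+2})` with `p_i ≥ 0` and
`p₁ + ⋯ + p_{m+2} = n`, of
`L_{p₁}^{j + k + |x_{p₁+1}| + ⋯ + |x_n| + |z₁| + ⋯ + |z_m|}(x₁, …, x_{p₁};
  L_{(p₂, …, p_{m+2})}^j((x_{p₁+1}, …, x_n), y, (z₁, …, z_m, w)); t)`. -/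
def nestTop (j k : ℕ) (xs : List V.toGrSpace.Homog) (y : V.carrier)
    (zs : List V.toGrSpace.Homog) (w t : V.carrier) : V.carrier :=
  ∑ r ∈ Finset.range (xs.length + 1),
    V.Lw (j + k + degSum (xs.drop r) + degSum zs) (vals (xs.take r))
      (V.nest j (xs.drop r) y (vals zs ++ [w])) t

/-- For `z = (z₁, …, z_m)`, the sum, over `1 ≤ l ≤ m` and all `q = (q₁, …, q_{l+1})` with `q_i ≥ 0`
and `q₁ + ⋯ + q_{l+1} = n`, of
`L_{q₁+m-l+1}^k(x₁, …, x_{q₁}, L_{(q₂, …, q_{l+1})}^{|y|}((x_{q₁+1}, …, x_n), y, (z₁, …, z_l)),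
  z_{l+1}, …, z_m; w; t)`. -/
def nestMid (k : ℕ) (xs : List V.toGrSpace.Homog) (y : V.toGrSpace.Homog)
    (zs : List V.toGrSpace.Homog) (w t : V.carrier) : V.carrier :=
  ∑ l ∈ Finset.Icc 1 zs.length, ∑ r ∈ Finset.range (xs.length + 1),
    V.Lw k (vals (xs.take r) ++ V.nest y.deg (xs.drop r) y.val (vals (zs.take l)) ::
      vals (zs.drop l)) w t

/-- The relation for `L_n^j(x₁, …, x_n; y; L_0^k(w; t))`. -/
def RelA (j k : ℕ) (xs : List V.toGrSpace.Homog) (y w : V.toGrSpace.Homog) (t : V.carrier) :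
    Prop :=
  V.Lw j (vals xs) y.val (V.Lw k [] w.val t) =
    ∑ r ∈ Finset.range (xs.length + 1),
        V.Lw (j + k + degSum (xs.drop r)) (vals (xs.take r))
          (V.Lw j (vals (xs.drop r)) y.val w.val) t
      + (if j = y.deg then V.Lw k (vals xs ++ [y.val]) w.val t else 0)
      - (if k = w.deg then
          ∑ r ∈ Finset.range (xs.length + 1),
            V.Lw (j + degSum (xs.drop r)) (vals (xs.take r))
              (V.Lw j (vals (xs.drop r)) y.val t) w.val
         else 0)

/-- The relation for `L_n^j(x₁, …, x_n; y; L_m^k(z₁, …, z_m; w; t))`, where `m ≥ 1`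
and `zs = (z₂, …, z_m)`. -/
def RelB (j k : ℕ) (xs : List V.toGrSpace.Homog) (y z₁ : V.toGrSpace.Homog)
    (zs : List V.toGrSpace.Homog) (w : V.toGrSpace.Homog) (t : V.carrier) : Prop :=
  V.Lw j (vals xs) y.val (V.Lw k (vals (z₁ :: zs)) w.val t) =
    V.nestTop j k xs y.val (z₁ :: zs) w.val t
      - ∑ r ∈ Finset.range (xs.length + 1),
          V.Lw (j + degSum (xs.drop r)) (vals (xs.take r))
            (V.nestTop j k (xs.drop r) y.val zs w.val t) z₁.val
      + (if j = y.deg then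
          V.nestMid k xs y (z₁ :: zs) w.val t
            + V.Lw k (vals xs ++ y.val :: vals (z₁ :: zs)) w.val t
            - ∑ r ∈ Finset.range (xs.length + 1),
                V.Lw (y.deg + degSum (xs.drop r)) (vals (xs.take r))
                  (V.nestMid k (xs.drop r) y zs w.val t) z₁.val
            - ∑ r ∈ Finset.range (xs.length + 1),
                V.Lw (y.deg + degSum (xs.drop r)) (vals (xs.take r))
                  (V.Lw k (vals (xs.drop r) ++ y.val :: vals zs) w.val t) z₁.val
         else 0)

end PrimOps

/-- A `Prim_psh` algebra: a positively graded vector space with operations `L_n^j`, compatible with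
the degrees, that satisfy the two families of relations. -/
structure PrimPshAlgebra (K : Type u) [Field K] extends PrimOps.{u, v} K where
  positive : gr 0 = ⊥
  L_mem : ∀ j (xs : List toGrSpace.Homog) (y z : toGrSpace.Homog), 1 ≤ j → j ≤ y.deg →
    toPrimOps.Lw j (GrSpace.vals xs) y.val z.val ∈ gr (GrSpace.degSum xs + y.deg + z.deg)
  L_eq_zero : ∀ n j (x : Fin n → carrier) m y z, y ∈ gr m → ¬ (1 ≤ j ∧ j ≤ m) → L n j x y z = 0
  relA : ∀ j k (xs : List toGrSpace.Homog) (y w : toGrSpace.Homog) (t : carrier),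
    1 ≤ j → j ≤ y.deg → 1 ≤ k → k ≤ w.deg → toPrimOps.RelA j k xs y w t
  relB : ∀ j k (xs : List toGrSpace.Homog) (y z₁ : toGrSpace.Homog)
    (zs : List toGrSpace.Homog) (w : toGrSpace.Homog) (t : carrier),
    1 ≤ j → j ≤ y.deg → 1 ≤ k → k ≤ w.deg → toPrimOps.RelB j k xs y z₁ zs w t

/-- Morphisms of `Prim_psh` algebras. -/
@[ext]
structure PrimPshHom {K : Type u} [Field K] (V W : PrimPshAlgebra.{u, v} K) extends
    GrHom V.toGrSpace W.toGrSpace where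
  map_L : ∀ n j (x : Fin n → V.carrier) (y z : V.carrier),
    lin (V.L n j x y z) = W.L n j (fun i => lin (x i)) (lin y) (lin z)

/-- The category of `Prim_psh` algebras. -/
instance PrimPshAlgebra.category (K : Type u) [Field K] :
    CategoryTheory.Category (PrimPshAlgebra.{u, v} K) where
  Hom V W := PrimPshHom V W
  id V :=
    { lin := LinearMap.id
      map_gr := fun _ _ h => h
      map_L := fun _ _ _ _ _ => rfl }
  comp f g :=
    { lin := g.lin ∘ₗ f.lin
      map_gr := fun n x h => g.map_gr n _ (f.map_gr n x h)
      map_L := fun n j x y z => by simp [f.map_L, g.map_L] }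

/-! ### The free preshuffle algebra on a graded set -/

/-- Basis elements `(f; x₁, …, x_r)` of the free preshuffle algebra on a set `X` graded by `deg`:
`f : {1, …, n} → {1, …, r}` is given by the list of its values (shifted to `0, …, r - 1`),
`|f⁻¹(i)| = |x_i|` for all `i`, and `f` satisfies the condition:
if `f(i) = f(j)` and `i ≤ k ≤ j` then `f(k) ≤ f(i)`. -/
@[ext]
structure KWord (X : Type w) (deg : X → ℕ) where
  f : List ℕ
  xs : List X
  xs_ne : xs ≠ []
  lt_length : ∀ a ∈ f, a < xs.length
  count_eq : ∀ (i : ℕ) (hi : i < xs.length), f.count i = deg xs[i]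
  nested : ∀ (i k j : ℕ) (hj : j < f.length) (hik : i ≤ k) (hkj : k ≤ j),
    f[i] = f[j] → f[k] ≤ f[i]

namespace KWord

variable {X : Type w} {deg : X → ℕ}

/-- The generator `(ξ_n; x)`, with `n = |x|` and `ξ_n` constant. -/
def gen (deg : X → ℕ) (x : X) : KWord X deg where
  f := List.replicate (deg x) 0
  xs := [x]
  xs_ne := by simp
  lt_length := by intro a ha; simp [List.eq_of_mem_replicate ha]
  count_eq := by
    intro i hi
    have : i = 0 := by simpa using hi
    subst this
    simp
  nested := by intro i k j hj hik hkj h; simp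

/-- The values of `f •ᵢ g`, where `f` takes its values in `0, …, r - 1`:
`(g(1) + r, …, g(i) + r, f(1), …, f(n), g(i+1) + r, …, g(m) + r)`. -/
def insFun (i r : ℕ) (f g : List ℕ) : List ℕ :=
  (g.take i).map (· + r) ++ (f ++ (g.drop i).map (· + r))

theorem insFun_length (i r : ℕ) (f g : List ℕ) :
    (insFun i r f g).length = f.length + g.length := by
  simp [insFun]; omega

theorem count_map_add (r c : ℕ) (g : List ℕ) :
    (g.map (· + r)).count c = if c < r then 0 else g.count (c - r) := by
  induction g with
  | nil => simp
  | cons a g ih =>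
    simp only [List.map_cons, List.count_cons, ih, beq_iff_eq]
    split_ifs <;> omega

theorem insFun_nested (i r : ℕ) (f g : List ℕ)
    (ha : ∀ (i k j : ℕ) (hj : j < f.length) (hik : i ≤ k) (hkj : k ≤ j),
      f[i] = f[j] → f[k] ≤ f[i])
    (hb : ∀ (i k j : ℕ) (hj : j < g.length) (hik : i ≤ k) (hkj : k ≤ j),
      g[i] = g[j] → g[k] ≤ g[i])
    (hl : ∀ a ∈ f, a < r) (p k q : ℕ)
    (hq : q < (insFun i r f g).length) (hpk : p ≤ k) (hkq : k ≤ q)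
    (h : (insFun i r f g)[p] = (insFun i r f g)[q]) :
    (insFun i r f g)[k] ≤ (insFun i r f g)[p] := by
  have hl' : ∀ (j : ℕ) (hj : j < f.length), f[j] < r := fun j hj => hl _ (List.getElem_mem hj)
  have key : ∀ s (hs : s < (insFun i r f g).length),
     (∃ (_ : s < i) (h' : s < g.length), (insFun i r f g)[s] = g[s] + r) ∨
     (∃ (_ : min i g.length ≤ s) (h' : s - min i g.length < f.length),
        (insFun i r f g)[s] = f[s - min i g.length]) ∨
     (∃ (_ : min i g.length + f.length ≤ s) (h' : s - f.length < g.length),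
        (insFun i r f g)[s] = g[s - f.length] + r) := by
    intro s hs
    have hs' := hs
    rw [insFun_length] at hs'
    simp only [insFun] at hs ⊢
    rcases lt_or_ge s (min i g.length) with h1 | h1
    · left
      refine ⟨by omega, by omega, ?_⟩
      rw [List.getElem_append_left (by simpa using h1)]
      simp
    · right
      rcases lt_or_ge s (min i g.length + f.length) with h2 | h2
      · left
        refine ⟨h1, by omega, ?_⟩
        rw [List.getElem_append_right (by simpa using h1),
          List.getElem_append_left (by simp; omega)]
        simp
      · right
        refine ⟨h2, by omega, ?_⟩
        rw [List.getElem_append_right (by simpa using h1),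
          List.getElem_append_right (by simp; omega)]
        simp only [List.getElem_map, List.getElem_drop, List.length_map, List.length_take]
        congr 2
        omega
  rcases key p (by omega) with ⟨_, _, e1⟩ | ⟨_, _, e1⟩ | ⟨_, _, e1⟩ <;>
  rcases key q (by omega) with ⟨_, _, e2⟩ | ⟨_, _, e2⟩ | ⟨_, _, e2⟩ <;>
  rw [e1, e2] at h <;>
  (try have := hl' (q - min i g.length) (by omega)) <;>
  (try have := hl' (p - min i g.length) (by omega)) <;>
  (try omega) <;>
  rcases key k (by omega) with ⟨_, _, e3⟩ | ⟨_, _, e3⟩ | ⟨_, _, e3⟩ <;>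
  rw [e1, e3] <;>
  (try have := hl' (k - min i g.length) (by omega)) <;>
  (try omega) <;>
  (try have := hb p k q (by omega) (by omega) (by omega) (by omega)) <;>
  (try have := hb p k (q - f.length) (by omega) (by omega) (by omega) (by omega)) <;>
  (try have := hb p (k - f.length) (q - f.length) (by omega) (by omega) (by omega) (by omega)) <;>
  (try have := hb (p - f.length) (k - f.length) (q - f.length) (by omega) (by omega) (by omega)
        (by omega)) <;>
  (try have := ha (p - min i g.length) (k - min i g.length) (q - min i g.length) (by omega)
        (by omega) (by omega) (by omega)) <;>
  omega

/-- `(f; x) •ᵢ (g; y)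
  = ((g(1) + r, …, g(i) + r, f(1), …, f(n), g(i+1) + r, …, g(m) + r); x, y)`. -/
def ins (i : ℕ) (a b : KWord X deg) : KWord X deg where
  f := insFun i a.xs.length a.f b.f
  xs := a.xs ++ b.xs
  xs_ne := by simp [a.xs_ne]
  lt_length := by
    intro c hc
    have ha := a.lt_length
    have hb := b.lt_length
    simp only [insFun, List.mem_append, List.mem_map, List.length_append] at hc ⊢
    rcases hc with ⟨d, hd, rfl⟩ | hc | ⟨d, hd, rfl⟩
    · have := hb d (List.mem_of_mem_take hd); omega
    · have := ha c hc; omega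
    · have := hb d (List.mem_of_mem_drop hd); omega
  count_eq := by
    intro c hc
    have h2 : ∀ d, (b.f.take i).count d + (b.f.drop i).count d = b.f.count d := fun d => by
      rw [← List.count_append, List.take_append_drop]
    simp only [insFun, List.count_append, count_map_add]
    by_cases h : c < a.xs.length
    · simp only [h, if_true, List.getElem_append_left h, ← a.count_eq c h]; omega
    · have h0 : a.f.count c = 0 :=
        List.count_eq_zero.2 fun hm => h (a.lt_length c hm)
      rw [List.length_append] at hc
      simp only [h, if_false, h0, List.getElem_append_right (not_lt.1 h)]
      rw [← b.count_eq _ (by omega), ← h2]; omega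
  nested := insFun_nested i _ _ _ a.nested b.nested a.lt_length

/-- The labels that occur in the word `g`, in increasing order. -/
def labels (r : ℕ) (g : List ℕ) : List ℕ := (List.range r).filter (· ∈ g)

/-- The restriction of `(f; x₁, …, x_r)` to a subword `g` of `f` that contains each of its values
as often as `f`: the values of `g` are renumbered increasingly, and only the `x_i` with `i` a value
of `g` are kept. -/
def restrict (a : KWord X deg) (g : List ℕ) (hne : g ≠ []) (hmem : ∀ c ∈ g, c < a.xs.length)
    (hcount : ∀ c ∈ g, g.count c = a.f.count c)
    (hnested : ∀ (i k j : ℕ) (hj : j < g.length) (hik : i ≤ k) (hkj : k ≤ j),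
      g[i] = g[j] → g[k] ≤ g[i]) : KWord X deg where
  f := g.map (labels a.xs.length g).idxOf
  xs := (labels a.xs.length g).pmap (fun c hc => a.xs[c])
    (fun c hc => by simpa using (List.mem_filter.1 hc).1)
  xs_ne := by
    obtain ⟨c, hc⟩ := List.exists_mem_of_ne_nil g hne
    have : c ∈ labels a.xs.length g := by simp [labels, hc, hmem c hc]
    simpa using List.ne_nil_of_mem this
  lt_length := by
    intro d hd
    obtain ⟨c, hc, rfl⟩ := List.mem_map.1 hd
    have hc' : c ∈ labels a.xs.length g := by simp [labels, hc, hmem c hc]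
    simpa using List.idxOf_lt_length_iff.2 hc'
  count_eq := by
    intro i hi
    have hi' : i < (labels a.xs.length g).length := by simpa using hi
    have hnd : (labels a.xs.length g).Nodup := (List.nodup_range).filter _
    have hm := List.getElem_mem hi'
    have hg : (labels a.xs.length g)[i] ∈ g := by simpa using (List.mem_filter.1 hm).2
    simp only [List.getElem_pmap]
    rw [← a.count_eq, ← hcount _ hg, List.count, List.count, List.countP_map]
    apply List.countP_congr
    intro c hc
    have hc' : c ∈ labels a.xs.length g := by simp [labels, hc, hmem c hc]
    simp only [Function.comp_apply, beq_iff_eq]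
    constructor
    · intro h; subst h; exact (List.getElem_idxOf (List.idxOf_lt_length_iff.2 hc')).symm
    · intro h; rw [h]; exact hnd.idxOf_getElem i hi'
  nested := by
    have hnd : (labels a.xs.length g).Nodup := (List.nodup_range).filter _
    have hs : (labels a.xs.length g).Pairwise (· < ·) := (List.pairwise_lt_range).filter _
    have hl : ∀ c ∈ g, c ∈ labels a.xs.length g := fun c hc => by simp [labels, hc, hmem c hc]
    intro i k j hj hik hkj h
    simp only [List.length_map] at hj
    simp only [List.getElem_map] at h ⊢
    have hgi := hl _ (List.getElem_mem (show i < g.length by omega))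
    have hgk := hl _ (List.getElem_mem (show k < g.length by omega))
    have h1 := (List.idxOf_inj hgi).1 h
    have h2 := hnested i k j hj hik hkj h1
    by_contra hlt
    push Not at hlt
    have h3 := List.pairwise_iff_getElem.1 hs _ _ (List.idxOf_lt_length_iff.2 hgi)
      (List.idxOf_lt_length_iff.2 hgk) hlt
    simp only [List.getElem_idxOf] at h3
    omega

/-- The position `p` cuts `f` into two nonempty words without common values. -/
abbrev IsCut (a : KWord X deg) (p : ℕ) : Prop :=
  0 < p ∧ p < a.f.length ∧ ∀ c ∈ a.f.take p, c ∉ a.f.drop p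

/-- The part of `(f; x₁, …, x_r)` to the left of a cut. -/
def left (a : KWord X deg) (p : ℕ) (h : a.IsCut p) : KWord X deg :=
  a.restrict (a.f.take p)
    (by
      intro h0
      have h1 := congrArg List.length h0
      have := h.1
      have := h.2.1
      simp only [List.length_take, List.length_nil] at h1
      omega)
    (fun c hc => a.lt_length c (List.mem_of_mem_take hc))
    (fun c hc => by
      conv_rhs => rw [← List.take_append_drop p a.f]
      rw [List.count_append, List.count_eq_zero.2 (h.2.2 c hc), add_zero])
    (fun i k j hj hik hkj he => by
      simp only [List.length_take] at hj
      simp only [List.getElem_take] at he ⊢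
      exact a.nested i k j (by omega) hik hkj he)

/-- The part of `(f; x₁, …, x_r)` to the right of a cut. -/
def right (a : KWord X deg) (p : ℕ) (h : a.IsCut p) : KWord X deg :=
  a.restrict (a.f.drop p)
    (by intro h0; have := List.drop_eq_nil_iff.1 h0; have := h.2.1; omega)
    (fun c hc => a.lt_length c (List.mem_of_mem_drop hc))
    (fun c hc => by
      conv_rhs => rw [← List.take_append_drop p a.f]
      rw [List.count_append, List.count_eq_zero.2 (fun hc' => h.2.2 c hc' hc), zero_add])
    (fun i k j hj hik hkj he => by
      simp only [List.length_drop] at hj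
      simp only [List.getElem_drop] at he ⊢
      exact a.nested (p + i) (p + k) (p + j) (by omega) (by omega) (by omega) he)

theorem ins_length (i : ℕ) (a b : KWord X deg) :
    (ins i a b).f.length = a.f.length + b.f.length := insFun_length _ _ _ _

theorem ins_assoc (i j : ℕ) (a b c : KWord X deg) (hi : i ≤ b.f.length) (hj : j ≤ c.f.length) :
    ins j (ins i a b) c = ins (i + j) a (ins j b c) := by
  ext1
  · have e : ∀ r, ((c.f.take j).map (· + r)).length = j := by simp [hj]
    have e1 : ∀ r, ((c.f.take j).map (· + r)).take (i + j) = (c.f.take j).map (· + r) := fun r =>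
      List.take_of_length_le (by rw [e]; omega)
    have e2 : ∀ r, ((c.f.take j).map (· + r)).drop (i + j) = [] := fun r =>
      List.drop_of_length_le (by rw [e]; omega)
    have e3 : i + j - j = i := by omega
    have e4 : i - b.f.length = 0 := by omega
    have e5 : (fun x => x + b.xs.length + a.xs.length) =
        fun x => x + (a.xs.length + b.xs.length) := by funext x; omega
    simp only [ins, insFun, List.length_append, List.take_append, List.drop_append, e, e1, e2, e3,
      e4, List.take_zero, List.drop_zero, List.map_append, List.map_map, Function.comp_def, e5,
      List.append_assoc, List.append_nil, List.nil_append]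
  · simp [ins]

end KWord

section Free

variable (K : Type u) [Field K] {X : Type w} (deg : X → ℕ)

/-- The component of degree `n` of the free preshuffle algebra. -/
noncomputable def freeGr (n : ℕ) : Submodule K (KWord X deg →₀ K) :=
  Finsupp.supported K K {a : KWord X deg | a.f.length = n}

theorem freeGr_isInternal : DirectSum.IsInternal (freeGr K deg) := by
  apply DirectSum.isInternal_submodule_of_iSupIndep_of_iSup_eq_top
  · intro n
    have h : (⨆ j, ⨆ (_ : j ≠ n), freeGr K deg j) ≤
        Finsupp.supported K K {a : KWord X deg | a.f.length ≠ n} :=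
      iSup₂_le fun j hj => Finsupp.supported_mono fun a (ha : a.f.length = j) => by
        simpa [ha] using hj
    refine Disjoint.mono_right h ((Finsupp.disjoint_supported_supported ?_))
    exact Set.disjoint_left.2 fun a ha hb => hb ha
  · unfold freeGr
    rw [← Finsupp.supported_iUnion, ← Finsupp.supported_univ]
    congr 1
    ext a
    simp

/-- Linear maps that agree on the basis elements of degree `n` agree in degree `n`. -/
theorem freeGr_ext {M : Type*} [AddCommGroup M] [Module K M] (n : ℕ)
    (φ ψ : (KWord X deg →₀ K) →ₗ[K] M)
    (h : ∀ a : KWord X deg, a.f.length = n → φ (Finsupp.single a 1) = ψ (Finsupp.single a 1))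
    (x : KWord X deg →₀ K) (hx : x ∈ freeGr K deg n) : φ x = ψ x := by
  rw [freeGr, Finsupp.supported_eq_span_single] at hx
  have : freeGr K deg n ≤ LinearMap.eqLocus φ ψ := by
    rw [freeGr, Finsupp.supported_eq_span_single, Submodule.span_le]
    rintro _ ⟨a, ha, rfl⟩
    exact h a ha
  rw [← Finsupp.supported_eq_span_single] at hx
  exact this hx

/-- The operation `•ᵢ` of the free preshuffle algebra, on basis elements `(f; x)` and `(g; y)`
with `i ≤ |g|` (and extended by zero for `i > |g|`). -/
noncomputable def freeOp (i : ℕ) :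
    (KWord X deg →₀ K) →ₗ[K] (KWord X deg →₀ K) →ₗ[K] (KWord X deg →₀ K) :=
  Finsupp.linearCombination K fun a => Finsupp.linearCombination K fun b =>
    if i ≤ b.f.length then Finsupp.single (KWord.ins i a b) 1 else 0

theorem freeOp_single (i : ℕ) (a b : KWord X deg) :
    freeOp K deg i (Finsupp.single a 1) (Finsupp.single b 1) =
      if i ≤ b.f.length then Finsupp.single (KWord.ins i a b) 1 else 0 := by
  simp [freeOp]

/-- The free preshuffle algebra on the graded set `X`. -/
noncomputable def freePsh : PreshuffleAlgebra.{u, max u w} K where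
  carrier := KWord X deg →₀ K
  gr := freeGr K deg
  internal := freeGr_isInternal K deg
  op := freeOp K deg
  op_mem := by
    intro i n m x y hx hy hi
    have key : ∀ a : KWord X deg, a.f.length = n →
        freeGr K deg m ≤ (freeGr K deg (n + m)).comap (freeOp K deg i (Finsupp.single a 1)) := by
      intro a ha
      conv_lhs => rw [freeGr, Finsupp.supported_eq_span_single]
      rw [Submodule.span_le]
      rintro _ ⟨b, hb, rfl⟩
      have hb' : b.f.length = m := hb
      simp only [SetLike.mem_coe, Submodule.mem_comap, freeOp_single]
      rw [if_pos (by omega)]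
      refine Finsupp.single_mem_supported K _ ?_
      simp [KWord.ins_length, ha, hb']
    have key2 : freeGr K deg n ≤ (freeGr K deg (n + m)).comap ((freeOp K deg i).flip y) := by
      conv_lhs => rw [freeGr, Finsupp.supported_eq_span_single]
      rw [Submodule.span_le]
      rintro _ ⟨a, ha, rfl⟩
      exact key a ha hy
    exact key2 hx
  op_eq_zero := by
    intro i m x y hy hi
    have : (freeOp K deg i).flip y = 0 := by
      ext1 a
      ext1
      simp only [LinearMap.comp_apply, Finsupp.lsingle_apply, LinearMap.flip_apply,
        LinearMap.zero_apply]
      refine freeGr_ext K deg m (freeOp K deg i (Finsupp.single a 1)) 0 (fun b hb => ?_) y hy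
      rw [freeOp_single, if_neg (by omega)]; rfl
    exact LinearMap.congr_fun this x
  op_assoc := by
    intro i j m r x y z hy hz hi hj
    have key : ∀ a b : KWord X deg, b.f.length = m → ∀ z ∈ freeGr K deg r,
        freeOp K deg j (freeOp K deg i (Finsupp.single a 1) (Finsupp.single b 1)) z =
        freeOp K deg (i + j) (Finsupp.single a 1) (freeOp K deg j (Finsupp.single b 1) z) := by
      intro a b hb z hz
      refine freeGr_ext K deg r
        (freeOp K deg j (freeOp K deg i (Finsupp.single a 1) (Finsupp.single b 1)))
        (freeOp K deg (i + j) (Finsupp.single a 1) ∘ₗ freeOp K deg j (Finsupp.single b 1))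
        (fun c hc => ?_) z hz
      simp only [LinearMap.comp_apply, freeOp_single]
      rw [if_pos (by omega), if_pos (by omega), freeOp_single, freeOp_single, if_pos (by omega),
        if_pos (by rw [KWord.ins_length]; omega), KWord.ins_assoc i j a b c (by omega) (by omega)]
    have key2 : ∀ a : KWord X deg,
        freeOp K deg j (freeOp K deg i (Finsupp.single a 1) y) z =
        freeOp K deg (i + j) (Finsupp.single a 1) (freeOp K deg j y z) := by
      intro a
      exact freeGr_ext K deg m
        ((freeOp K deg j).flip z ∘ₗ freeOp K deg i (Finsupp.single a 1))
        (freeOp K deg (i + j) (Finsupp.single a 1) ∘ₗ (freeOp K deg j).flip z)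
        (fun b hb => key a b hb z hz) y hy
    have key3 : (freeOp K deg j).flip z ∘ₗ (freeOp K deg i).flip y =
        (freeOp K deg (i + j)).flip (freeOp K deg j y z) := by
      ext1 a
      ext1
      exact key2 a
    exact LinearMap.congr_fun key3 x

/-- The coproduct of the free preshuffle algebra for which the generators are primitive:
`Δ(f; x)` is the sum of the tensors `left ⊗ right` over all cuts. -/
noncomputable def freeΔ :
    (freePsh K deg).carrier →ₗ[K] (freePsh K deg).carrier ⊗[K] (freePsh K deg).carrier :=
  Finsupp.linearCombination K fun a : KWord X deg => ∑ p ∈ Finset.range a.f.length,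
    if h : a.IsCut p then
      (Finsupp.single (a.left p h) (1 : K) : (freePsh K deg).carrier) ⊗ₜ[K]
        (Finsupp.single (a.right p h) (1 : K) : (freePsh K deg).carrier)
    else 0

/-- A generator as a homogeneous element of the free preshuffle algebra. -/
noncomputable def freeGen (x : X) : (freePsh K deg).toGrSpace.Homog where
  deg := deg x
  val := (Finsupp.single (KWord.gen deg x) (1 : K) : KWord X deg →₀ K)
  mem := Finsupp.single_mem_supported K _ (by simp [KWord.gen])

end Free

/-! ### Primitive elements and the enveloping bialgebra -/

/-- `P`, with the inclusion `ι`, is the `Prim_psh` algebra `Prim(H)`: the subspace `ker Δ` of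
primitive elements of `H`, with the grading and the operations `L_n^j` of `H`. -/
structure IsPrim {K : Type u} [Field K] (H : PreshuffleBialgebra.{u, v} K)
    (P : PrimPshAlgebra.{u, w} K) (ι : GrHom P.toGrSpace H.toGrSpace) : Prop where
  injective : Function.Injective ι.lin
  range_eq : LinearMap.range ι.lin = LinearMap.ker H.Δ
  map_L : ∀ (j : ℕ) (xs : List P.toGrSpace.Homog) (y z : P.toGrSpace.Homog),
    1 ≤ j → j ≤ y.deg →
    ι.lin (P.Lw j (GrSpace.vals xs) y.val z.val) =
      H.Lop j (xs.map ι.onHomog) (ι.onHomog y) (ι.lin z.val)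

/-- A homogeneous basis of a graded vector space, that is a graded set `X` with
a basis `(b x)_{x ∈ X}`, where `b x` is homogeneous of degree `|x|`. -/
structure HomogBasis {K : Type u} [Field K] (V : GrSpace.{u, v} K) where
  X : Type w
  deg : X → ℕ
  b : Module.Basis X K V.carrier
  mem : ∀ x, b x ∈ V.gr (deg x)

section Enveloping

variable {K : Type u} [Field K] (V : PrimPshAlgebra.{u, v} K)
  (B : HomogBasis.{u, v, w} V.toGrSpace)

/-- The linear map from `V` to the free preshuffle algebra on the basis `X` of `V` that sends each
basis element to the corresponding generator. -/
noncomputable def basisToFree : V.carrier →ₗ[K] (freePsh K B.deg).carrier :=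
  B.b.constr K fun x => (freeGen K B.deg x).val

/-- The elements `L_q^i(x₁, …, x_q; y; z) - L̄_q^i(x₁, …, x_q; y; z)`, for `x₁, …, x_q, y, z ∈ X`,
`q ≥ 0` and `1 ≤ i ≤ |y|`, where `L` is the operation of the free preshuffle algebra and `L̄` the
operation of `V`. -/
def envRelators : Set (freePsh K B.deg).carrier :=
  {c | ∃ (i : ℕ) (xs : List B.X) (y z : B.X), 1 ≤ i ∧ i ≤ B.deg y ∧
    c = (freePsh K B.deg).Lop i (xs.map (freeGen K B.deg)) (freeGen K B.deg y)
          (freeGen K B.deg z).val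
        - basisToFree V B (V.Lw i (xs.map B.b) (B.b y) (B.b z))}

/-- A subspace is an ideal of a preshuffle algebra if it is closed under
the operations `•ᵢ` with an arbitrary element on either side. -/
def PreshuffleAlgebra.IsIdeal (A : PreshuffleAlgebra.{u, v} K) (J : Submodule K A.carrier) : Prop :=
  ∀ i a c, c ∈ J → A.op i a c ∈ J ∧ A.op i c a ∈ J

/-- The ideal of the free preshuffle algebra generated by the relators. -/
noncomputable def envIdeal : Submodule K (freePsh K B.deg).carrier :=
  sInf {J | (freePsh K B.deg).IsIdeal J ∧ envRelators V B ⊆ J}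

/-- `U`, with the map `η : V → U`, is the enveloping bialgebra `U_Psh(V)`: the quotient, via a map
`φ` that extends `η`, of the free preshuffle algebra on the homogeneous basis `X` of `V`, with the
coproduct for which the generators are primitive, by the ideal generated by the relators. -/
def IsEnveloping (U : PreshuffleBialgebra.{u, v} K) (η : GrHom V.toGrSpace U.toGrSpace) : Prop :=
  ∃ φ : GrHom (freePsh K B.deg).toGrSpace U.toGrSpace,
    (∀ i a c, φ.lin ((freePsh K B.deg).op i a c) = U.op i (φ.lin a) (φ.lin c)) ∧
    (∀ a, U.Δ (φ.lin a) = TensorProduct.map φ.lin φ.lin (freeΔ K B.deg a)) ∧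
    Function.Surjective φ.lin ∧
    LinearMap.ker φ.lin = envIdeal V B ∧
    ∀ x, φ.lin (freeGen K B.deg x).val = η.lin (B.b x)

end Enveloping

/-! ### Graded vector spaces -/

namespace GrSpace

variable {K : Type u} [Field K] (A : GrSpace.{u, v} K)

/-! The theorem is of Cartier–Milnor–Moore type. As a coalgebra, a connected preshuffle bialgebra
consists of the nonempty words in its primitive elements with the deconcatenation coproduct, where a
word `x₁ ⋯ x_n` stands for `x₁ •₀ ⋯ •₀ x_n`. The operations `•ᵢ` can then be recovered from the
operations `L` on letters, because the definition of `L_q^p` telescopes. Suppose that the position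
`d + p` lies in the letter `y` of a word `a y s`, with `a = x₁ ⋯ x_n`, `|a| = d` and `1 ≤ p ≤ |y|`.
Then `z •_{d+p} (a y s)` is the sum over `r` of the words `x₁ ⋯ x_r L^p(x_{r+1}, …, x_n; y; z) s`,
plus the word `a y z s` if `p = |y|`.

For an arbitrary `V` this formula defines operators `insOp i z` on the tensor algebra. The algebra
homomorphism `opHom i` that extends `z ↦ insOp i z` then inserts whole words. The relations (A) and
(B) amount to associativity: `insOp_insOp_sub` and `insOp_insSeq_sub` express the failure of
associativity on a word ending in `y` as a `tailSum` whose coefficients are the failures of the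
relations, and `tailSum_injective` shows that no information is lost. Hence the relations imply
`opHom_opHom`. The coproduct of a product of words is computed in `deconc_opHom_words`, and its
reduced form gives the three compatibility conditions. So the nonempty words over `V` form a
connected preshuffle bialgebra. Its primitive elements are the letters (`range_letter`), and its
operations `L` on letters are those of `V` (`augPsh_Lop`).

Conversely, let `H` be a connected preshuffle bialgebra. Its primitive elements are closed under `L`
by `Δ_Lop`. The comparison map `augMap`, from words of primitive elements to `H`, is compatible with
coproducts. It is injective because it is injective on letters (`injective_of_augΔ`). It is
surjective because the coalgebra of words has no cohomology in degree two (`augΔ_contr`), so that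
elements of `H` can be corrected step by step along the filtration. Injectivity transports the
associativity of `H` back to words, and the computation of the previous paragraph, read backwards,
yields (A) and (B) for the primitive elements. Then `augMap` is an isomorphism of bialgebras, so a
morphism out of `H` is determined by its restriction to the primitive elements, and every morphism
of `Prim_psh` algebras between primitive parts extends. Thus taking primitive elements is full,
faithful and essentially surjective.

The inverse functor is identified with the enveloping bialgebra by `IsPrim.isEnveloping`: any
connected `H` with primitive part `V` is the required quotient of the free preshuffle algebra, for
any homogeneous basis of `V`. Modulo the relators, every basis element of the free algebra reduces
to a combination of `•₀`-products of generators (`exists_freeWord_sub_zeroMap_mem`). The images of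
these products are linearly independent in `H`, so the kernel is no larger than the ideal. -/

/-- The decomposition of a graded vector space into its components. -/
noncomputable def decomp : A.carrier ≃ₗ[K] DirectSum ℕ (fun i => A.gr i) :=
  (LinearEquiv.ofBijective (DirectSum.coeLinearMap A.gr) A.internal).symm

theorem decomp_of_mem {n : ℕ} {x : A.carrier} (hx : x ∈ A.gr n) :
    A.decomp x = DirectSum.lof K ℕ (fun i => A.gr i) n ⟨x, hx⟩ := by
  refine (LinearEquiv.symm_apply_eq _).2 ?_
  exact (DirectSum.coeLinearMap_lof A.gr n ⟨x, hx⟩).symm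

theorem proj_of_mem {n : ℕ} {x : A.carrier} (hx : x ∈ A.gr n) : A.proj n x = x := by
  have : A.proj n x = (DirectSum.component K ℕ (fun i => A.gr i) n (A.decomp x) : A.carrier) := rfl
  rw [this, decomp_of_mem A hx, DirectSum.component.lof_self]

theorem proj_of_mem_ne {m n : ℕ} {x : A.carrier} (hx : x ∈ A.gr m) (h : m ≠ n) :
    A.proj n x = 0 := by
  have : A.proj n x = (DirectSum.component K ℕ (fun i => A.gr i) n (A.decomp x) : A.carrier) := rfl
  rw [this, decomp_of_mem A hx, DirectSum.component.of, dif_neg h]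
  rfl

theorem proj_of_mem_eq_ite {m n : ℕ} {x : A.carrier} (hx : x ∈ A.gr m) :
    A.proj n x = if m = n then x else 0 := by
  split_ifs with h
  · subst h; exact A.proj_of_mem hx
  · exact A.proj_of_mem_ne hx h

theorem proj_mem (n : ℕ) (x : A.carrier) : A.proj n x ∈ A.gr n := Subtype.property _

theorem iSup_gr : ⨆ n, A.gr n = ⊤ := A.internal.submodule_iSup_eq_top

/-- Every element is a sum of homogeneous elements. -/
@[elab_as_elim]
theorem induction_homog {p : A.carrier → Prop} (x : A.carrier)
    (hom : ∀ n, ∀ x ∈ A.gr n, p x) (add : ∀ x y, p x → p y → p (x + y)) : p x := by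
  have hx : x ∈ ⨆ n, A.gr n := by rw [A.iSup_gr]; trivial
  exact Submodule.iSup_induction A.gr (motive := p) hx hom (hom 0 0 (zero_mem _)) add

variable {A} in
theorem linearMap_ext {M : Type*} [AddCommGroup M] [Module K M] {f g : A.carrier →ₗ[K] M}
    (h : ∀ n, ∀ x ∈ A.gr n, f x = g x) : f = g := by
  ext x
  induction x using A.induction_homog with
  | hom n x hx => exact h n x hx
  | add x y hx hy => rw [map_add, map_add, hx, hy]

theorem exists_sum_proj (x : A.carrier) :
    ∃ N, ∀ M, N ≤ M → ∑ n ∈ Finset.range M, A.proj n x = x := by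
  induction x using A.induction_homog with
  | hom n x hx =>
    refine ⟨n + 1, fun M hM => ?_⟩
    rw [Finset.sum_eq_single_of_mem n (Finset.mem_range.2 hM)
      fun m _ hm => A.proj_of_mem_ne hx hm.symm, A.proj_of_mem hx]
  | add x y hx hy =>
    obtain ⟨N, hN⟩ := hx
    obtain ⟨N', hN'⟩ := hy
    refine ⟨max N N', fun M hM => ?_⟩
    simp only [map_add, Finset.sum_add_distrib]
    rw [hN M (by omega), hN' M (by omega)]

/-- Independence holds because `p n` vanishes on the sum of the other components and is the identity
on `G n`. -/
theorem isInternal_of_proj {M : Type*} [AddCommGroup M] [Module K M] (G : ℕ → Submodule K M)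
    (p : ℕ → M →ₗ[K] M) (hp : ∀ n, ∀ x ∈ G n, p n x = x)
    (hp' : ∀ m n, m ≠ n → ∀ x ∈ G m, p n x = 0) (htop : ∀ x, x ∈ ⨆ n, G n) :
    DirectSum.IsInternal G := by
  apply DirectSum.isInternal_submodule_of_iSupIndep_of_iSup_eq_top
  · intro n
    have h : ⨆ j, ⨆ (_ : j ≠ n), G j ≤ LinearMap.ker (p n) :=
      iSup₂_le fun j hj x hx => hp' j n hj x hx
    rw [Submodule.disjoint_def]
    intro x hx hx'
    rw [← hp n x hx]
    exact h hx'
  · exact (Submodule.eq_top_iff').2 htop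

/-- Submodules that contain the homogeneous components of their elements are graded. -/
theorem isInternal_comap (S : Submodule K A.carrier) (hS : ∀ n, ∀ x ∈ S, A.proj n x ∈ S) :
    DirectSum.IsInternal (fun n => (A.gr n).comap S.subtype) := by
  refine isInternal_of_proj _ (fun n => (A.proj n).restrict (hS n)) ?_ ?_ ?_
  · rintro n ⟨x, hx⟩ h
    exact Subtype.ext (A.proj_of_mem h)
  · rintro m n hmn ⟨x, hx⟩ h
    exact Subtype.ext (A.proj_of_mem_ne h hmn)
  · intro x
    obtain ⟨N, hN⟩ := A.exists_sum_proj x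
    have : x = ∑ n ∈ Finset.range N, (A.proj n).restrict (hS n) x := by
      apply Subtype.ext
      conv_lhs => rw [← hN N le_rfl]
      simp
    rw [this]
    exact Submodule.sum_mem _ fun n _ => Submodule.mem_iSup_of_mem n (A.proj_mem n x)

theorem exists_homogBasis : Nonempty (HomogBasis.{u, v, v} A) := by
  refine ⟨⟨Σ i, Module.Basis.ofVectorSpaceIndex K (A.gr i), fun a => a.1,
    A.internal.collectedBasis fun i => Module.Basis.ofVectorSpace K (A.gr i), fun x => ?_⟩⟩
  exact A.internal.collectedBasis_mem _ x

theorem degSum_nil : degSum ([] : List A.Homog) = 0 := rfl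

theorem degSum_cons {A : GrSpace.{u, v} K} (x : A.Homog) (xs : List A.Homog) :
    degSum (x :: xs) = x.deg + degSum xs := by simp [degSum]

theorem degSum_append {A : GrSpace.{u, v} K} (xs ys : List A.Homog) :
    degSum (xs ++ ys) = degSum xs + degSum ys := by simp [degSum]

theorem degSum_take_add_drop {A : GrSpace.{u, v} K} (r : ℕ) (xs : List A.Homog) :
    degSum (xs.take r) + degSum (xs.drop r) = degSum xs := by
  rw [← degSum_append, List.take_append_drop]

end GrSpace

namespace HomogBasis

variable {K : Type u} [Field K] {V : GrSpace.{u, v} K} (B : HomogBasis.{u, v, w} V)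

/-- Composition with `proj d` kills the basis vectors of the other degrees. Identities whose very
form depends on the degree of an argument can therefore be checked on basis vectors of that degree.
-/
theorem ext_of_mem {M : Type*} [AddCommGroup M] [Module K M] {f g : V.carrier →ₗ[K] M} {d : ℕ}
    (h : ∀ x, B.deg x = d → f (B.b x) = g (B.b x)) {v : V.carrier} (hv : v ∈ V.gr d) :
    f v = g v := by
  have : f ∘ₗ V.proj d = g ∘ₗ V.proj d := by
    refine B.b.ext fun x => ?_
    rw [LinearMap.comp_apply, LinearMap.comp_apply, V.proj_of_mem_eq_ite (B.mem x)]
    split_ifs with hx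
    · exact h x hx
    · simp
  rw [← V.proj_of_mem hv]
  exact LinearMap.congr_fun this v

theorem deg_pos (hV : V.gr 0 = ⊥) (x : B.X) : 0 < B.deg x := by
  rcases Nat.eq_zero_or_pos (B.deg x) with h | h
  · have := B.mem x
    rw [h, hV, Submodule.mem_bot] at this
    exact absurd this (B.b.ne_zero x)
  · exact h

/-- A basis element as a homogeneous element. -/
noncomputable def homog (x : B.X) : V.Homog := ⟨B.deg x, B.b x, B.mem x⟩

end HomogBasis

/-! ### Words in the tensor algebra -/

namespace HomogBasis

variable {K : Type u} [Field K] {V : GrSpace.{u, v} K} (B : HomogBasis.{u, v, w} V)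

open TensorAlgebra

/-- The basis of the tensor algebra that consists of the words in the basis elements. -/
noncomputable def words : Module.Basis (List B.X) K (TensorAlgebra K V.carrier) :=
  B.b.tensorAlgebra.reindex FreeMonoid.toList

theorem words_apply (xs : List B.X) : B.words xs = (xs.map fun x => ι K (B.b x)).prod := by
  have h : ∀ l : FreeMonoid B.X, FreeAlgebra.basisFreeMonoid K B.X l =
      (l.toList.map (FreeAlgebra.ι K)).prod := by
    intro l
    have h1 : FreeAlgebra.basisFreeMonoid K B.X l =
        MonoidAlgebra.lift K (FreeAlgebra K B.X) (FreeMonoid B.X)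
          (FreeMonoid.lift (FreeAlgebra.ι K)) (MonoidAlgebra.single l 1) := by
      simp only [FreeAlgebra.basisFreeMonoid, Module.Basis.map_apply, Finsupp.coe_basisSingleOne]
      rfl
    rw [h1, MonoidAlgebra.lift_single, one_smul, FreeMonoid.lift_apply]
  rw [words, Module.Basis.reindex_apply, Module.Basis.tensorAlgebra, Module.Basis.map_apply, h]
  simp [List.map_map, Function.comp_def, map_list_prod]

theorem words_nil : B.words [] = 1 := by simp [words_apply]

theorem words_cons (x : B.X) (xs : List B.X) : B.words (x :: xs) = ι K (B.b x) * B.words xs := by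
  simp [words_apply]

theorem words_append (xs ys : List B.X) : B.words (xs ++ ys) = B.words xs * B.words ys := by
  simp [words_apply]

/-- The degree of a word. -/
def wdeg (xs : List B.X) : ℕ := (xs.map B.deg).sum

theorem wdeg_nil : B.wdeg [] = 0 := rfl

theorem wdeg_cons (x : B.X) (xs : List B.X) : B.wdeg (x :: xs) = B.deg x + B.wdeg xs := by
  simp [wdeg]

theorem wdeg_append (xs ys : List B.X) : B.wdeg (xs ++ ys) = B.wdeg xs + B.wdeg ys := by
  simp [wdeg]

/-- The component of degree `n` of the tensor algebra. -/
def tgr (n : ℕ) : Submodule K (TensorAlgebra K V.carrier) :=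
  Submodule.span K (B.words '' {xs | B.wdeg xs = n})

theorem words_mem_tgr (xs : List B.X) : B.words xs ∈ B.tgr (B.wdeg xs) :=
  Submodule.subset_span ⟨xs, rfl, rfl⟩

theorem tgr_le {M : Submodule K (TensorAlgebra K V.carrier)} {d : ℕ}
    (h : ∀ xs, B.wdeg xs = d → B.words xs ∈ M) : B.tgr d ≤ M := by
  refine Submodule.span_le.2 ?_
  rintro _ ⟨xs, hxs, rfl⟩
  exact h xs hxs

theorem ext_of_mem_tgr {M : Type*} [AddCommGroup M] [Module K M]
    {f g : TensorAlgebra K V.carrier →ₗ[K] M} {d : ℕ}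
    (h : ∀ xs, B.wdeg xs = d → f (B.words xs) = g (B.words xs)) {a : TensorAlgebra K V.carrier}
    (ha : a ∈ B.tgr d) : f a = g a :=
  B.tgr_le (M := LinearMap.eqLocus f g) h ha

theorem one_mem_tgr : 1 ∈ B.tgr 0 := by
  rw [← words_nil]; exact B.words_mem_tgr []

theorem ι_mem_tgr {d : ℕ} {v : V.carrier} (hv : v ∈ V.gr d) : ι K v ∈ B.tgr d := by
  -- Membership is rephrased as the vanishing of a linear map to the quotient, which can be tested
  -- on basis vectors.
  have := B.ext_of_mem (f := (B.tgr d).mkQ ∘ₗ ι K) (g := 0) (d := d) (fun x hx => ?_) hv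
  · simpa using this
  · have := B.words_mem_tgr [x]
    rw [words_cons, words_nil, mul_one, wdeg_cons, wdeg_nil, add_zero, hx] at this
    simpa using this

theorem mul_mem_tgr {d e : ℕ} {a b : TensorAlgebra K V.carrier} (ha : a ∈ B.tgr d)
    (hb : b ∈ B.tgr e) : a * b ∈ B.tgr (d + e) := by
  have h1 : ∀ xs, B.wdeg xs = d → B.words xs * b ∈ B.tgr (d + e) := by
    intro xs hxs
    refine B.tgr_le (M := (B.tgr (d + e)).comap (LinearMap.mulLeft K (B.words xs)))
      (fun ys hys => ?_) hb
    have := B.words_mem_tgr (xs ++ ys)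
    rw [words_append, wdeg_append, hxs, hys] at this
    exact this
  exact B.tgr_le (M := (B.tgr (d + e)).comap (LinearMap.mulRight K b)) h1 ha

/-- The product of a list of elements of `V` in the tensor algebra. -/
def _root_.GrSpace.tword {V : GrSpace.{u, v} K} (vs : List V.carrier) : TensorAlgebra K V.carrier :=
  (vs.map (ι K)).prod

theorem _root_.GrSpace.tword_nil : GrSpace.tword ([] : List V.carrier) = 1 := rfl

theorem _root_.GrSpace.tword_cons (v : V.carrier) (vs : List V.carrier) :
    GrSpace.tword (v :: vs) = ι K v * GrSpace.tword vs := by simp [GrSpace.tword]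

theorem _root_.GrSpace.tword_append (vs ws : List V.carrier) :
    GrSpace.tword (vs ++ ws) = GrSpace.tword vs * GrSpace.tword ws := by simp [GrSpace.tword]

theorem words_eq_tword (xs : List B.X) : B.words xs = GrSpace.tword (xs.map B.b) := by
  simp [words_apply, GrSpace.tword, Function.comp_def]

theorem tword_mem_tgr (xs : List V.Homog) :
    GrSpace.tword (GrSpace.vals xs) ∈ B.tgr (GrSpace.degSum xs) := by
  induction xs with
  | nil => exact B.one_mem_tgr
  | cons x xs ih =>
    rw [GrSpace.degSum_cons]
    exact mul_mem_tgr B (ι_mem_tgr B x.mem) ih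

end HomogBasis

/-! ### The operations `L` as linear maps on the tensor algebra -/

namespace PrimOps

open TensorAlgebra GrSpace

variable {K : Type u} [Field K]

/-- The operations `L_n^j` of `V` are compatible with the degrees, and `V` is positively graded. -/
structure IsGraded (V : PrimOps.{u, v} K) : Prop where
  positive : V.gr 0 = ⊥
  L_mem : ∀ j (xs : List V.toGrSpace.Homog) (y z : V.toGrSpace.Homog), 1 ≤ j → j ≤ y.deg →
    V.Lw j (GrSpace.vals xs) y.val z.val ∈ V.gr (GrSpace.degSum xs + y.deg + z.deg)
  L_eq_zero : ∀ n j (x : Fin n → V.carrier) m y z, y ∈ V.gr m → ¬ (1 ≤ j ∧ j ≤ m) →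
    V.L n j x y z = 0

variable {V : PrimOps.{u, v} K} (B : HomogBasis.{u, v, w} V.toGrSpace)

theorem Lw_eq_of_length {n p : ℕ} (xs : List V.carrier) (h : xs.length = n) (y z : V.carrier) :
    V.Lw p xs y z = V.L n p (fun i => xs[i]) y z := by
  subst h; rfl

theorem Lw_ofFn {n : ℕ} (p : ℕ) (v : Fin n → V.carrier) (y z : V.carrier) :
    V.Lw p (List.ofFn v) y z = V.L n p v y z := by
  rw [Lw_eq_of_length _ (List.length_ofFn)]
  simp

/-- The operations `L_n^p` for all `n` as a linear map on the tensor algebra. -/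
noncomputable def Lhat (p : ℕ) :
    TensorAlgebra K V.carrier →ₗ[K] V.carrier →ₗ[K] V.carrier →ₗ[K] V.carrier :=
  B.words.constr K fun xs => V.L (xs.map B.b).length p (xs.map B.b).get

theorem Lhat_words (p : ℕ) (xs : List B.X) (y z : V.carrier) :
    Lhat B p (B.words xs) y z = V.Lw p (xs.map B.b) y z := by
  rw [Lhat, Module.Basis.constr_basis]; rfl

/-- Both sides are multilinear in the letters. Hence `Lhat`, although defined on words in the basis,
is independent of the basis. -/
theorem Lhat_tword (p : ℕ) (vs : List V.carrier) (y z : V.carrier) :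
    Lhat B p (tword vs) y z = V.Lw p vs y z := by
  have h : (Lhat B p).compMultilinearMap (tprod K V.carrier vs.length) = V.L vs.length p := by
    refine Module.Basis.ext_multilinear (fun _ => B.b) fun v => ?_
    ext y z
    have h1 : tprod K V.carrier vs.length (fun i => B.b (v i)) = B.words (List.ofFn v) := by
      rw [TensorAlgebra.tprod_apply, HomogBasis.words_apply, List.map_ofFn]; rfl
    rw [LinearMap.compMultilinearMap_apply, h1, Lhat_words, List.map_ofFn, Lw_ofFn]
    rfl
  have h1 : tprod K V.carrier vs.length vs.get = tword vs := by
    rw [TensorAlgebra.tprod_apply, tword]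
    conv_rhs => rw [← List.ofFn_get vs, List.map_ofFn]
    rfl
  rw [← h1]
  exact LinearMap.congr_fun (LinearMap.congr_fun (congrFun (congrArg DFunLike.coe h) vs.get) y) z

end PrimOps

/-! ### Insertion operators on the tensor algebra -/

namespace PrimOps

open TensorAlgebra GrSpace

variable {K : Type u} [Field K] {V : PrimOps.{u, v} K} (B : HomogBasis.{u, v, w} V.toGrSpace)

/-- The part of the insertion of `z` at the position `i` of a word that starts with an element
`L^p(x₁, …, x_q; y; z)`, where `x₁, …, x_q` begins with `acc`. -/
noncomputable def insHead :
    List B.X → ℕ → List B.X → V.carrier →ₗ[K] TensorAlgebra K V.carrier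
  | _, _, [] => 0
  | acc, i, y :: s =>
      -- With a start at `i ≥ 1` the remaining position stays at least `1` in the other branch, so
      -- `L` is only evaluated at superscripts between `1` and `|y|`.
      if i ≤ B.deg y then
        LinearMap.mulRight K (B.words s) ∘ₗ ι K ∘ₗ Lhat B i (B.words acc) (B.b y)
      else insHead (acc ++ [y]) (i - B.deg y) s

/-- The insertion of `z` at the position `i` of a word. -/
noncomputable def insWord : ℕ → List B.X → V.carrier →ₗ[K] TensorAlgebra K V.carrier
  | i, [] => if i = 0 then ι K else 0
  | i, y :: s =>
      if i = 0 then LinearMap.mulRight K (B.words (y :: s)) ∘ₗ ι K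
      -- The case `i = |y|` belongs to both summands; here it contributes the word `y z s`, the
      -- counterpart of the product `y •₀ z` that is subtracted in `L_0^{|y|}(y; z)`.
      else (if B.deg y ≤ i then
          LinearMap.mulLeft K (ι K (B.b y)) ∘ₗ insWord (i - B.deg y) s else 0)
        + insHead B [] i (y :: s)

/-- The insertion of `z` at the position `i`, as an operator on the tensor algebra. -/
noncomputable def insOp (i : ℕ) : V.carrier →ₗ[K] Module.End K (TensorAlgebra K V.carrier) :=
  LinearMap.flip (B.words.constr K (insWord B i))

theorem insOp_words (i : ℕ) (z : V.carrier) (xs : List B.X) :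
    insOp B i z (B.words xs) = insWord B i xs z := by
  rw [insOp, LinearMap.flip_apply, Module.Basis.constr_basis]

theorem insOp_zero (z : V.carrier) (a : TensorAlgebra K V.carrier) :
    insOp B 0 z a = ι K z * a := by
  have : insOp B 0 z = LinearMap.mulLeft K (ι K z) := by
    refine B.words.ext fun xs => ?_
    rw [insOp_words]
    cases xs with
    | nil => simp [insWord, HomogBasis.words_nil]
    | cons y s => simp [insWord]
  rw [this]; rfl

theorem insOp_words_cons {i : ℕ} (hi : i ≠ 0) (z : V.carrier) (y : B.X) (s : List B.X) :
    insOp B i z (B.words (y :: s)) =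
      (if B.deg y ≤ i then ι K (B.b y) * insOp B (i - B.deg y) z (B.words s) else 0)
        + insHead B [] i (y :: s) z := by
  rw [insOp_words, insWord, if_neg hi, LinearMap.add_apply, insOp_words]
  split_ifs <;> simp

/-- `thetaWord p x y z` is the sum of the `x₁ ⋯ x_r L^p(x_{r+1}, …, x_n; y; z)`. -/
noncomputable def thetaWord (p : ℕ) :
    List B.X → V.carrier →ₗ[K] V.carrier →ₗ[K] TensorAlgebra K V.carrier
  | [] => (Lhat B p 1).compr₂ (ι K)
  | x :: xs => (thetaWord p xs).compr₂ (LinearMap.mulLeft K (ι K (B.b x)))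
      + (Lhat B p (B.words (x :: xs))).compr₂ (ι K)

/-- The linear extension of `thetaWord`. -/
noncomputable def theta (p : ℕ) : TensorAlgebra K V.carrier →ₗ[K]
    V.carrier →ₗ[K] V.carrier →ₗ[K] TensorAlgebra K V.carrier :=
  B.words.constr K (thetaWord B p)

theorem theta_one (p : ℕ) (y z : V.carrier) : theta B p 1 y z = ι K (Lhat B p 1 y z) := by
  rw [← B.words_nil, theta, Module.Basis.constr_basis, thetaWord, B.words_nil]; rfl

theorem theta_ι_mul (p : ℕ) (v : V.carrier) (a : TensorAlgebra K V.carrier) (y z : V.carrier) :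
    theta B p (ι K v * a) y z = ι K v * theta B p a y z + ι K (Lhat B p (ι K v * a) y z) := by
  have h : ∀ (x : B.X) (a : TensorAlgebra K V.carrier), theta B p (ι K (B.b x) * a) y z =
      ι K (B.b x) * theta B p a y z + ι K (Lhat B p (ι K (B.b x) * a) y z) := by
    intro x a
    have : (theta B p).flip y ∘ₗ LinearMap.mulLeft K (ι K (B.b x)) =
        ((theta B p).flip y).compr₂ (LinearMap.mulLeft K (ι K (B.b x))) +
        ((Lhat B p).flip y ∘ₗ LinearMap.mulLeft K (ι K (B.b x))).compr₂ (ι K) := by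
      refine B.words.ext fun xs => ?_
      ext z
      simp only [LinearMap.comp_apply, LinearMap.add_apply, LinearMap.compr₂_apply,
        LinearMap.flip_apply, LinearMap.mulLeft_apply]
      rw [← B.words_cons, theta, Module.Basis.constr_basis, Module.Basis.constr_basis, thetaWord]
      rfl
    exact LinearMap.congr_fun (LinearMap.congr_fun this a) z
  have h2 : ((theta B p).flip y).flip z ∘ₗ LinearMap.mulRight K a ∘ₗ ι K =
      LinearMap.mulRight K (theta B p a y z) ∘ₗ ι K +
      ι K ∘ₗ ((Lhat B p).flip y).flip z ∘ₗ LinearMap.mulRight K a ∘ₗ ι K :=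
    B.b.ext fun x => h x a
  exact LinearMap.congr_fun h2 v

theorem insHead_append (acc xs : List B.X) (y : B.X) (s : List B.X) {p : ℕ} (hp : 1 ≤ p)
    (hp' : p ≤ B.deg y) (z : V.carrier) :
    insHead B acc (B.wdeg xs + p) (xs ++ y :: s) z =
      ι K (Lhat B p (B.words (acc ++ xs)) (B.b y) z) * B.words s := by
  induction xs generalizing acc with
  | nil => simp [insHead, B.wdeg_nil, hp']
  | cons x xs ih =>
    rw [List.cons_append, insHead, B.wdeg_cons, if_neg (by omega),
      show B.deg x + B.wdeg xs + p - B.deg x = B.wdeg xs + p by omega, ih]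
    simp

/-- Unrolling the recursion over the letters in front of `y`: each of them may be the first letter
of the tail that is absorbed, together with `y` and `z`, in a new letter, and these choices add up
to `theta`. If the position is the right end of `y`, there is one more possibility, in which `z` is
placed behind `y` as a letter of its own. -/
theorem insOp_words_append (xs : List B.X) (y : B.X) (s : List B.X) {p : ℕ} (hp : 1 ≤ p)
    (hp' : p ≤ B.deg y) (z : V.carrier) :
    insOp B (B.wdeg xs + p) z (B.words (xs ++ y :: s)) =
      theta B p (B.words xs) (B.b y) z * B.words s +
        if p = B.deg y then B.words xs * ι K (B.b y) * ι K z * B.words s else 0 := by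
  induction xs with
  | nil =>
    rw [List.nil_append, insOp_words_cons _ (by omega), B.wdeg_nil, zero_add, B.words_nil,
      theta_one, insHead, if_pos hp', B.words_nil, add_comm]
    congr 1
    rcases eq_or_ne p (B.deg y) with h | h
    · rw [if_pos h.ge, if_pos h, h, Nat.sub_self, insOp_zero, one_mul, mul_assoc]
    · rw [if_neg (by omega), if_neg h]
  | cons x xs ih =>
    have h1 := insHead_append B [] (x :: xs) y s hp hp' z
    rw [List.cons_append] at h1
    rw [List.cons_append, insOp_words_cons _ (by rw [B.wdeg_cons]; omega), h1, B.wdeg_cons,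
      if_pos (by omega), show B.deg x + B.wdeg xs + p - B.deg x = B.wdeg xs + p by omega, ih,
      B.words_cons, theta_ι_mul, List.nil_append, B.words_cons]
    split_ifs
    · simp only [mul_add, add_mul, mul_assoc]; abel
    · simp only [add_mul, mul_assoc, add_zero]

/-- The insertion of `z` at a position in the homogeneous factor `y` of `a y s`. -/
theorem insOp_mul_mul {d m p : ℕ} {a : TensorAlgebra K V.carrier} (ha : a ∈ B.tgr d)
    {y : V.carrier} (hy : y ∈ V.gr m) (hp : 1 ≤ p) (hp' : p ≤ m) (z : V.carrier)
    (s : TensorAlgebra K V.carrier) :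
    insOp B (d + p) z (a * ι K y * s) = theta B p a y z * s +
      if p = m then a * ι K y * ι K z * s else 0 := by
  -- The formula for words is extended linearly in `s`, then in `y`, then in `a`. The last two
  -- extensions keep the degree fixed, since the position depends on it.
  have h1 : ∀ (xs : List B.X) (y : B.X), B.deg y = m → B.wdeg xs = d →
      insOp B (d + p) z (B.words xs * ι K (B.b y) * s) =
        theta B p (B.words xs) (B.b y) z * s +
        if p = m then B.words xs * ι K (B.b y) * ι K z * s else 0 := by
    rintro xs y rfl rfl
    have : insOp B (B.wdeg xs + p) z ∘ₗ LinearMap.mulLeft K (B.words xs * ι K (B.b y)) =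
        LinearMap.mulLeft K (theta B p (B.words xs) (B.b y) z) +
        if p = B.deg y then LinearMap.mulLeft K (B.words xs * ι K (B.b y) * ι K z) else 0 := by
      refine B.words.ext fun s => ?_
      have := insOp_words_append B xs y s hp hp' z
      rw [B.words_append, B.words_cons, ← mul_assoc] at this
      simp only [LinearMap.comp_apply, LinearMap.add_apply, LinearMap.mulLeft_apply, this]
      split_ifs <;> simp [mul_assoc]
    have := LinearMap.congr_fun this s
    simp only [LinearMap.comp_apply, LinearMap.add_apply, LinearMap.mulLeft_apply] at this
    rw [this]
    split_ifs <;> simp [mul_assoc]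
  have h2 : ∀ (xs : List B.X), B.wdeg xs = d →
      insOp B (d + p) z (B.words xs * ι K y * s) =
        theta B p (B.words xs) y z * s +
        if p = m then B.words xs * ι K y * ι K z * s else 0 := by
    intro xs hxs
    have := B.ext_of_mem
      (f := insOp B (d + p) z ∘ₗ LinearMap.mulRight K s ∘ₗ LinearMap.mulLeft K (B.words xs) ∘ₗ ι K)
      (g := LinearMap.mulRight K s ∘ₗ (theta B p (B.words xs)).flip z +
        if p = m then LinearMap.mulRight K (ι K z * s) ∘ₗ LinearMap.mulLeft K (B.words xs) ∘ₗ ι K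
        else 0) (d := m) (fun y hy => ?_) hy
    · simp only [LinearMap.comp_apply, LinearMap.add_apply, LinearMap.mulLeft_apply,
        LinearMap.mulRight_apply, LinearMap.flip_apply] at this
      rw [this]
      split_ifs <;> simp [mul_assoc]
    · simp only [LinearMap.comp_apply, LinearMap.add_apply, LinearMap.mulLeft_apply,
        LinearMap.mulRight_apply, LinearMap.flip_apply, h1 xs y hy hxs]
      split_ifs <;> simp [mul_assoc]
  have := B.ext_of_mem_tgr
    (f := insOp B (d + p) z ∘ₗ LinearMap.mulRight K s ∘ₗ LinearMap.mulRight K (ι K y))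
    (g := LinearMap.mulRight K s ∘ₗ ((theta B p).flip y).flip z +
        if p = m then LinearMap.mulRight K (ι K y * ι K z * s)
        else 0) (d := d) (fun xs hxs => ?_) ha
  · simp only [LinearMap.comp_apply, LinearMap.add_apply,
      LinearMap.mulRight_apply, LinearMap.flip_apply] at this
    rw [this]
    split_ifs <;> simp [mul_assoc]
  · simp only [LinearMap.comp_apply, LinearMap.add_apply,
      LinearMap.mulRight_apply, LinearMap.flip_apply, h2 xs hxs]
    split_ifs <;> simp [mul_assoc]

end PrimOps

/-! ### Sums over the tails of a word -/

namespace PrimOps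

open TensorAlgebra GrSpace

variable {K : Type u} [Field K] {V : PrimOps.{u, v} K} (B : HomogBasis.{u, v, w} V.toGrSpace)

/-- The sum of the `x₁ ⋯ x_r g(x_{r+1}, …, x_n)` in the tensor algebra, for `0 ≤ r ≤ n`. -/
noncomputable def tailSum (g : List V.toGrSpace.Homog → V.carrier) :
    List V.toGrSpace.Homog → TensorAlgebra K V.carrier
  | [] => ι K (g [])
  | x :: xs => ι K (g (x :: xs)) + ι K x.val * tailSum g xs

theorem tailSum_eq_sum (g : List V.toGrSpace.Homog → V.carrier) (xs : List V.toGrSpace.Homog) :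
    tailSum g xs = ∑ r ∈ Finset.range (xs.length + 1),
      tword (vals (xs.take r)) * ι K (g (xs.drop r)) := by
  induction xs with
  | nil => simp [tailSum, vals, tword_nil]
  | cons x xs ih =>
    rw [tailSum, ih, List.length_cons, Finset.sum_range_succ' _ (xs.length + 1), add_comm,
      Finset.mul_sum]
    congr 1
    · refine Finset.sum_congr rfl fun r _ => ?_
      simp [vals, tword_cons, mul_assoc]
    · simp [vals, tword_nil]

theorem tailSum_add (g g' : List V.toGrSpace.Homog → V.carrier) (xs : List V.toGrSpace.Homog) :
    tailSum (fun us => g us + g' us) xs = tailSum g xs + tailSum g' xs := by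
  simp [tailSum_eq_sum, mul_add, Finset.sum_add_distrib]

theorem tailSum_sub (g g' : List V.toGrSpace.Homog → V.carrier) (xs : List V.toGrSpace.Homog) :
    tailSum (fun us => g us - g' us) xs = tailSum g xs - tailSum g' xs := by
  simp [tailSum_eq_sum, mul_sub, Finset.sum_sub_distrib]

theorem tailSum_sum {α : Type*} (s : Finset α) (g : α → List V.toGrSpace.Homog → V.carrier)
    (xs : List V.toGrSpace.Homog) :
    tailSum (fun us => ∑ a ∈ s, g a us) xs = ∑ a ∈ s, tailSum (g a) xs := by
  simp only [tailSum_eq_sum, map_sum, Finset.mul_sum]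
  exact Finset.sum_comm

theorem tailSum_zero (xs : List V.toGrSpace.Homog) :
    tailSum (fun _ => (0 : V.carrier)) xs = 0 := by
  simp [tailSum_eq_sum]

theorem theta_tword (p : ℕ) (xs : List V.toGrSpace.Homog) (y z : V.carrier) :
    theta B p (tword (vals xs)) y z = tailSum (fun us => V.Lw p (vals us) y z) xs := by
  induction xs with
  | nil => rw [tailSum, vals, List.map_nil, tword_nil, theta_one, ← Lhat_tword B]; rfl
  | cons x xs ih =>
    rw [tailSum, ← ih, vals, List.map_cons, tword_cons, theta_ι_mul, ← tword_cons, Lhat_tword,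
      add_comm]
    rfl

/-- Both sides sum over pairs of cut points of `xs`; the left side fixes the second one first, the
right side the first one. -/
theorem sum_tailSum_take
    (F : List V.toGrSpace.Homog → List V.toGrSpace.Homog → V.carrier)
    (xs : List V.toGrSpace.Homog) :
    ∑ r ∈ Finset.range (xs.length + 1), tailSum (fun us => F us (xs.drop r)) (xs.take r) =
      tailSum (fun us => ∑ r ∈ Finset.range (us.length + 1), F (us.take r) (us.drop r)) xs := by
  induction xs generalizing F with
  | nil => simp [tailSum]
  | cons x xs ih =>
    rw [tailSum, List.length_cons, Finset.sum_range_succ' _ (xs.length + 1),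
      Finset.sum_range_succ' _ (xs.length + 1), ← ih]
    simp only [List.drop_succ_cons, List.take_succ_cons, tailSum, List.take_zero, List.drop_zero,
      Finset.sum_add_distrib, map_add, map_sum, Finset.mul_sum]
    abel

/-- A tail of the long word either contains `h` or starts behind it. -/
theorem tailSum_append_cons (g : List V.toGrSpace.Homog → V.carrier)
    (xs : List V.toGrSpace.Homog) (h : V.toGrSpace.Homog) (zs : List V.toGrSpace.Homog) :
    tailSum g (xs ++ h :: zs) = tailSum (fun us => g (us ++ h :: zs)) xs +
      tword (vals xs) * (ι K h.val * tailSum g zs) := by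
  induction xs with
  | nil => simp [tailSum, vals, tword_nil]
  | cons x xs ih =>
    rw [List.cons_append, tailSum, ih, tailSum]
    simp [vals, tword_cons, mul_add, mul_assoc, add_assoc]

/-- The map is the projection to the words of length one. In a `tailSum` only the summand with empty
prefix has length one: the remaining sum is a letter times a tensor without constant term, which
`algebraMapInv` detects. -/
theorem exists_linearMap_tailSum : ∃ π : TensorAlgebra K V.carrier →ₗ[K] V.carrier,
    ∀ g xs, π (tailSum (V := V) g xs) = g xs := by
  obtain ⟨B⟩ := V.toGrSpace.exists_homogBasis
  let π : TensorAlgebra K V.carrier →ₗ[K] V.carrier :=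
    B.words.constr K fun xs => match xs with
      | [x] => B.b x
      | _ => 0
  have h1 : ∀ v a, π (ι K v * a) = algebraMapInv a • v := by
    intro v a
    have h : ∀ x, π ∘ₗ LinearMap.mulLeft K (ι K (B.b x)) =
        LinearMap.toSpanSingleton K _ (B.b x) ∘ₗ (algebraMapInv (R := K)).toLinearMap := by
      intro x
      refine B.words.ext fun xs => ?_
      rw [LinearMap.comp_apply, LinearMap.mulLeft_apply, ← B.words_cons, Module.Basis.constr_basis]
      cases xs with
      | nil => simp [HomogBasis.words_nil]
      | cons y ys => simp [HomogBasis.words_cons, algebraMapInv]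
    have h2 : π ∘ₗ LinearMap.mulRight K a ∘ₗ ι K = algebraMapInv a • LinearMap.id :=
      B.b.ext fun x => LinearMap.congr_fun (h x) a
    exact LinearMap.congr_fun h2 v
  have h2 : ∀ v, π (ι K v) = v := fun v => by simpa using h1 v 1
  have h3 : ∀ g xs, algebraMapInv (tailSum (V := V) g xs) = 0 := by
    intro g xs
    cases xs <;> simp [tailSum, algebraMapInv]
  refine ⟨π, fun g xs => ?_⟩
  cases xs <;> simp [tailSum, h1, h2, h3]

/-- This turns an identity between operators on the tensor algebra back into a relation between
elements of `V`. -/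
theorem tailSum_injective {g g' : List V.toGrSpace.Homog → V.carrier}
    {xs : List V.toGrSpace.Homog} (h : tailSum g xs = tailSum g' xs) : g xs = g' xs := by
  obtain ⟨π, hπ⟩ := exists_linearMap_tailSum (V := V)
  rw [← hπ g, h, hπ]

theorem tailSum_mem_tgr {g : List V.toGrSpace.Homog → V.carrier} {e : ℕ}
    (hg : ∀ us, g us ∈ V.gr (degSum us + e)) (xs : List V.toGrSpace.Homog) :
    tailSum g xs ∈ B.tgr (degSum xs + e) := by
  induction xs with
  | nil => exact B.ι_mem_tgr (hg [])
  | cons x xs ih =>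
    refine add_mem (B.ι_mem_tgr (hg _)) ?_
    rw [degSum_cons, add_assoc]
    exact B.mul_mem_tgr (B.ι_mem_tgr x.mem) ih

/-- The insertion of `z` in the last factors of the summands of a `tailSum`. -/
theorem insOp_tailSum_mul {g : List V.toGrSpace.Homog → V.carrier} {e : ℕ}
    (hg : ∀ us, g us ∈ V.gr (degSum us + e)) {j : ℕ} (hj : 1 ≤ j) (hj' : j ≤ e) (z : V.carrier)
    (xs : List V.toGrSpace.Homog) (s : TensorAlgebra K V.carrier) :
    insOp B (degSum xs + j) z (tailSum g xs * s) =
      tailSum (fun us => ∑ r ∈ Finset.range (us.length + 1),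
        V.Lw (j + degSum (us.drop r)) (vals (us.take r)) (g (us.drop r)) z) xs * s +
      if j = e then tailSum g xs * ι K z * s else 0 := by
  rw [← sum_tailSum_take (fun us vs => V.Lw (j + degSum vs) (vals us) (g vs) z),
    tailSum_eq_sum g]
  simp only [Finset.sum_mul, map_sum]
  have : ∀ r ∈ Finset.range (xs.length + 1),
      insOp B (degSum xs + j) z (tword (vals (xs.take r)) * ι K (g (xs.drop r)) * s) =
      tailSum (fun us => V.Lw (j + degSum (xs.drop r)) (vals us) (g (xs.drop r)) z) (xs.take r) * s
      + if j = e then tword (vals (xs.take r)) * ι K (g (xs.drop r)) * ι K z * s else 0 := by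
    intro r _
    have h := degSum_take_add_drop r xs
    rw [show degSum xs + j = degSum (xs.take r) + (j + degSum (xs.drop r)) by omega,
      insOp_mul_mul B (B.tword_mem_tgr _) (hg _) (by omega) (by omega), theta_tword]
    congr 2
    apply propext
    omega
  rw [Finset.sum_congr rfl this, Finset.sum_add_distrib]
  split_ifs <;> simp

/-- The insertion of `t` in the last factor of the words `x₁ ⋯ x_r g(x_{r+1}, …, x_n) z₁ ⋯ z_m w`. -/
theorem insOp_tailSum_mul_tword {g : List V.toGrSpace.Homog → V.carrier} {e : ℕ}
    (hg : ∀ us, g us ∈ V.gr (degSum us + e)) (zs : List V.toGrSpace.Homog)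
    (w : V.toGrSpace.Homog) {k : ℕ} (hk : 1 ≤ k) (hk' : k ≤ w.deg) (t : V.carrier)
    (xs : List V.toGrSpace.Homog) :
    insOp B (degSum xs + e + (degSum zs + k)) t (tailSum g xs * (tword (vals zs) * ι K w.val)) =
      tailSum (fun us => ∑ r ∈ Finset.range (us.length + 1),
        V.Lw k (vals (us.take r) ++ g (us.drop r) :: vals zs) w.val t) xs +
      tailSum g xs * insOp B (degSum zs + k) t (tword (vals zs) * ι K w.val) := by
  rw [← sum_tailSum_take (fun us vs => V.Lw k (vals us ++ g vs :: vals zs) w.val t),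
    tailSum_eq_sum g]
  simp only [Finset.sum_mul, map_sum]
  rw [← Finset.sum_add_distrib]
  refine Finset.sum_congr rfl fun r _ => ?_
  have h := degSum_take_add_drop r xs
  have h0 := insOp_mul_mul B (B.tword_mem_tgr zs) w.mem hk hk' t 1
  -- The value of `g` is treated as one letter of a longer word that ends in `w`. The tails of that
  -- word that contain this letter give the first sum; those starting behind it give the insertion
  -- into `z₁ ⋯ z_m w`.
  let y : V.toGrSpace.Homog := ⟨_, _, hg (xs.drop r)⟩
  have h1 := insOp_mul_mul B (B.tword_mem_tgr (xs.take r ++ y :: zs)) w.mem hk hk' t 1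
  have h2 : degSum (xs.take r ++ y :: zs) + k = degSum xs + e + (degSum zs + k) := by
    rw [degSum_append, degSum_cons, ← h]
    simp only [y]
    omega
  have h3 : tword (vals (xs.take r ++ y :: zs)) =
      tword (vals (xs.take r)) * (ι K y.val * tword (vals zs)) := by
    simp [vals, tword_append, tword_cons]
  rw [theta_tword, mul_one, mul_one] at h0 h1
  rw [mul_one] at h0 h1
  rw [h2, h3, tailSum_append_cons] at h1
  simp only [mul_assoc] at h0 h1 ⊢
  rw [h0, h1]
  simp only [mul_add, y, vals, List.map_append, List.map_cons, add_assoc]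
  split_ifs <;> simp

end PrimOps

/-! ### Repeated insertions at the same position -/

namespace PrimOps

open TensorAlgebra GrSpace

variable {K : Type u} [Field K] {V : PrimOps.{u, v} K}

theorem Lw_zero_right (j : ℕ) (xs : List V.carrier) (y : V.carrier) : V.Lw j xs y 0 = 0 := by
  simp [Lw]

theorem Lw_zero_mid (j : ℕ) (xs : List V.carrier) (z : V.carrier) : V.Lw j xs 0 z = 0 := by
  simp [Lw]

theorem Lw_append_zero_cons (j : ℕ) (xs ys : List V.carrier) (y z : V.carrier) :
    V.Lw j (xs ++ 0 :: ys) y z = 0 := by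
  have : V.L (xs ++ 0 :: ys).length j (xs ++ 0 :: ys).get = 0 :=
    (V.L _ j).map_coord_zero ⟨xs.length, by simp⟩ (by simp)
  rw [Lw, this]; rfl

theorem nest_nil_nil (j : ℕ) (y : V.carrier) : V.nest j [] y [] = y := by simp [nest]

theorem nest_cons_nil (j : ℕ) (x : V.toGrSpace.Homog) (xs : List V.toGrSpace.Homog)
    (y : V.carrier) : V.nest j (x :: xs) y [] = 0 := by simp [nest]

theorem nest_cons (j : ℕ) (xs : List V.toGrSpace.Homog) (y z : V.carrier) (zs : List V.carrier) :
    V.nest j xs y (z :: zs) = ∑ r ∈ Finset.range (xs.length + 1),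
      V.Lw (j + degSum (xs.drop r)) (vals (xs.take r)) (V.nest j (xs.drop r) y zs) z := by
  cases xs <;> simp [nest]

theorem nest_eq_zero_of_mem (j : ℕ) (xs : List V.toGrSpace.Homog) (y : V.carrier)
    (zs : List V.carrier) (h : 0 ∈ zs) : V.nest j xs y zs = 0 := by
  induction zs generalizing xs with
  | nil => simp at h
  | cons z zs ih =>
    rw [nest_cons]
    refine Finset.sum_eq_zero fun r _ => ?_
    rcases List.mem_cons.1 h with rfl | h
    · exact Lw_zero_right _ _ _
    · rw [ih _ h, Lw_zero_mid]

/-- For each index the only summand of `nest j xs y []` is `y`. -/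
theorem sum_nest_nil {M : Type*} [AddCommMonoid M] (j : ℕ) (xs : List V.toGrSpace.Homog)
    (y : V.carrier) (f : ℕ → V.carrier → M) (hf : ∀ r, f r 0 = 0) :
    ∑ r ∈ Finset.range (xs.length + 1), f r (V.nest j (xs.drop r) y []) = f xs.length y := by
  rw [Finset.sum_range_succ, Finset.sum_eq_zero, zero_add, List.drop_length, nest_nil_nil]
  intro r hr
  have : xs.drop r ≠ [] := by
    rw [Ne, List.drop_eq_nil_iff]; simpa using hr
  obtain ⟨x, us, hx⟩ := List.exists_cons_of_ne_nil this
  rw [hx, nest_cons_nil, hf]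

theorem nest_singleton (j : ℕ) (xs : List V.toGrSpace.Homog) (y z : V.carrier) :
    V.nest j xs y [z] = V.Lw j (vals xs) y z := by
  rw [nest_cons, sum_nest_nil j xs y
    (fun r v => V.Lw (j + degSum (xs.drop r)) (vals (xs.take r)) v z)
    fun r => Lw_zero_mid _ _ _]
  simp [degSum_nil]

theorem nest_mem (hV : V.IsGraded) {j : ℕ} (y : V.toGrSpace.Homog) (hj : 1 ≤ j) (hj' : j ≤ y.deg)
    (zs xs : List V.toGrSpace.Homog) :
    V.nest j xs y.val (vals zs) ∈ V.gr (degSum xs + (y.deg + degSum zs)) := by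
  induction zs generalizing xs with
  | nil =>
    cases xs with
    | nil => simpa [vals, nest_nil_nil, degSum_nil] using y.mem
    | cons x xs => rw [vals, List.map_nil, nest_cons_nil]; exact zero_mem _
  | cons z zs ih =>
    rw [vals, List.map_cons, nest_cons]
    refine Submodule.sum_mem _ fun r _ => ?_
    have h := degSum_take_add_drop r xs
    have := hV.L_mem (j + degSum (xs.drop r)) (xs.take r) ⟨_, _, ih (xs.drop r)⟩ z (by omega)
      (by simp only; omega)
    simp only at this
    rw [degSum_cons]
    convert this using 2
    · omega
    · rfl

theorem tailSum_nest_nil (j : ℕ) (xs : List V.toGrSpace.Homog) (y : V.carrier) :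
    tailSum (fun us => V.nest j us y []) xs = tword (vals xs) * ι K y := by
  rw [tailSum_eq_sum, sum_nest_nil j xs y
    (fun r v => tword (vals (xs.take r)) * ι K v) (fun r => by simp), List.take_length]

theorem deg_pos_or_val_eq_zero (hV : V.IsGraded) (z : V.toGrSpace.Homog) :
    0 < z.deg ∨ z.val = 0 := by
  rcases Nat.eq_zero_or_pos z.deg with h | h
  · have := z.mem
    rw [h, hV.positive, Submodule.mem_bot] at this
    exact Or.inr this
  · exact Or.inl h

variable (B : HomogBasis.{u, v, w} V.toGrSpace)

/-- One more insertion at the same position adds one more level of nesting, by the very recursion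
that defines `nest`. The additional word, with `z` placed behind the last factor, can only appear
while that factor is still `y` itself, since nesting makes it longer. -/
theorem insOp_tailSum_nest (hV : V.IsGraded) {j : ℕ} (y : V.toGrSpace.Homog) (hj : 1 ≤ j)
    (hj' : j ≤ y.deg) (zs xs : List V.toGrSpace.Homog) (z : V.carrier)
    (s : TensorAlgebra K V.carrier) :
    insOp B (degSum xs + j) z (tailSum (fun us => V.nest j us y.val (vals zs)) xs * s) =
      tailSum (fun us => V.nest j us y.val (z :: vals zs)) xs * s +
      if j = y.deg ∧ zs = [] then tword (vals xs) * ι K y.val * (ι K z * s) else 0 := by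
  rw [insOp_tailSum_mul B (nest_mem hV y hj hj' zs) hj (by omega)]
  simp only [nest_cons]
  congr 1
  cases zs with
  | nil =>
    rw [vals, List.map_nil, tailSum_nest_nil, degSum_nil, add_zero]
    simp [mul_assoc]
  | cons h zs =>
    rw [if_neg (show ¬ (j = y.deg ∧ h :: zs = []) by simp)]
    -- If `|h| > 0`, the position `j ≤ |y|` is strictly before the end of the nested factor. An
    -- element of degree `0` is zero, and then the whole nested expression vanishes.
    rcases deg_pos_or_val_eq_zero hV h with h1 | h1
    · rw [if_neg (by rw [degSum_cons]; omega)]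
    · simp only [nest_eq_zero_of_mem j _ y.val (vals (h :: zs)) (by simp [vals, h1]),
        tailSum_zero, zero_mul, ite_self]

/-- The successive insertion of `z_m, …, z₁` at the same position. -/
noncomputable def insSeq (d : ℕ) (zs : List V.carrier) (a : TensorAlgebra K V.carrier) :
    TensorAlgebra K V.carrier :=
  zs.foldr (fun z b => insOp B d z b) a

theorem insSeq_nil (d : ℕ) (a : TensorAlgebra K V.carrier) : insSeq B d [] a = a := rfl

theorem insSeq_cons (d : ℕ) (z : V.carrier) (zs : List V.carrier)
    (a : TensorAlgebra K V.carrier) :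
    insSeq B d (z :: zs) a = insOp B d z (insSeq B d zs a) := rfl

theorem insSeq_of_lt (hV : V.IsGraded) {j : ℕ} (y : V.toGrSpace.Homog) (hj : 1 ≤ j)
    (hj' : j < y.deg) (zs xs : List V.toGrSpace.Homog) (s : TensorAlgebra K V.carrier) :
    insSeq B (degSum xs + j) (vals zs) (tword (vals xs) * ι K y.val * s) =
      tailSum (fun us => V.nest j us y.val (vals zs)) xs * s := by
  induction zs with
  | nil => rw [vals, List.map_nil, insSeq_nil, tailSum_nest_nil]
  | cons z zs ih =>
    rw [vals, List.map_cons, insSeq_cons]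
    rw [vals] at ih
    rw [ih, ← vals, insOp_tailSum_nest B hV y hj hj'.le, if_neg (by omega), add_zero]

/-- The insertions start with `z_m`. At the right end of `y`, each element is either put behind `y`
as a letter or absorbed in `y`. After the first absorption the position is interior, so all later
elements are absorbed too. The index `l` counts the absorbed ones. -/
theorem insSeq_deg (hV : V.IsGraded) (y : V.toGrSpace.Homog) (hy : 1 ≤ y.deg)
    (zs xs : List V.toGrSpace.Homog) (s : TensorAlgebra K V.carrier) :
    insSeq B (degSum xs + y.deg) (vals zs) (tword (vals xs) * ι K y.val * s) =
      ∑ l ∈ Finset.range (zs.length + 1),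
        tailSum (fun us => V.nest y.deg us y.val (vals (zs.take l))) xs *
          (tword (vals (zs.drop l)) * s) := by
  induction zs with
  | nil => simp [vals, insSeq_nil, tailSum_nest_nil, tword_nil]
  | cons z zs ih =>
    have h : vals (z :: zs) = z.val :: vals zs := rfl
    rw [h, insSeq_cons, ih, map_sum]
    simp only [insOp_tailSum_nest B hV y hy le_rfl]
    rw [Finset.sum_add_distrib, List.length_cons, Finset.sum_range_succ' _ (zs.length + 1)]
    congr 1
    -- Only for `l = 0` has nothing been absorbed, so that `z` can still be put directly behind `y`.
    rw [Finset.sum_eq_single_of_mem 0 (by simp)]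
    · simp [vals, tailSum_nest_nil, tword_cons, mul_assoc]
    · intro l hl hl0
      rw [if_neg]
      rintro ⟨-, h1⟩
      rw [List.take_eq_nil_iff] at h1
      rcases h1 with h1 | h1
      · exact hl0 h1
      · subst h1; simp at hl; exact hl0 hl

/-! ### The relations of a `Prim_psh` algebra as identities between insertion operators -/

/-- The contribution to both kinds of relations that comes from the insertion of `t` after
the insertion of `z₁, …, z_m, w`. -/
def relTop (j k : ℕ) (xs : List V.toGrSpace.Homog) (y : V.toGrSpace.Homog)
    (zs : List V.toGrSpace.Homog) (w : V.toGrSpace.Homog) (t : V.carrier) : V.carrier :=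
  V.nestTop j k xs y.val zs w.val t + if j = y.deg then
    V.nestMid k xs y zs w.val t + V.Lw k (vals xs ++ y.val :: vals zs) w.val t else 0

theorem relA_iff (j k : ℕ) (xs : List V.toGrSpace.Homog) (y w : V.toGrSpace.Homog)
    (t : V.carrier) : V.RelA j k xs y w t ↔
    V.Lw j (vals xs) y.val (V.Lw k [] w.val t) = relTop j k xs y [] w t -
      if k = w.deg then V.nest j xs y.val [w.val, t] else 0 := by
  rw [RelA, relTop, nestTop, nestMid, nest_cons]
  simp [nest_singleton, vals, degSum_nil]

/-- The terms `G` and `δ D` always occur together, and the second pair arises from the first by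
dropping `z₁` and applying the operation with last argument `z₁`. In this shape the relation can be
compared with insertions. -/
theorem relB_iff (j k : ℕ) (xs : List V.toGrSpace.Homog) (y z₁ : V.toGrSpace.Homog)
    (zs : List V.toGrSpace.Homog) (w : V.toGrSpace.Homog) (t : V.carrier) :
    V.RelB j k xs y z₁ zs w t ↔
    V.Lw j (vals xs) y.val (V.Lw k (vals (z₁ :: zs)) w.val t) = relTop j k xs y (z₁ :: zs) w t -
      ∑ r ∈ Finset.range (xs.length + 1), V.Lw (j + degSum (xs.drop r)) (vals (xs.take r))
        (relTop j k (xs.drop r) y zs w t) z₁.val := by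
  rw [RelB]
  by_cases hj : j = y.deg
  · subst hj
    simp only [relTop, if_true]
    have : ∀ (p : ℕ) (us : List V.carrier) (a b c z : V.carrier), V.Lw p us (a + (b + c)) z =
      V.Lw p us a z + (V.Lw p us b z + V.Lw p us c z) := by simp [Lw]
    simp only [this, Finset.sum_add_distrib]
    rw [← sub_eq_zero, ← sub_eq_zero (b := _ - _)]
    apply Eq.congr_left
    abel
  · simp [relTop, hj]

/-- The separate term is the summand `l = 0`: with no `z` to absorb, `nest` vanishes unless its list
is empty, and then it is `y`. -/
theorem nestMid_add_eq_sum (k : ℕ) (xs : List V.toGrSpace.Homog) (y : V.toGrSpace.Homog)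
    (zs : List V.toGrSpace.Homog) (w t : V.carrier) :
    V.nestMid k xs y zs w t + V.Lw k (vals xs ++ y.val :: vals zs) w t =
    ∑ l ∈ Finset.range (zs.length + 1), ∑ r ∈ Finset.range (xs.length + 1),
      V.Lw k (vals (xs.take r) ++ V.nest y.deg (xs.drop r) y.val (vals (zs.take l)) ::
        vals (zs.drop l)) w t := by
  rw [Finset.range_eq_Ico, Finset.sum_eq_sum_Ico_succ_bot (by omega), nestMid, add_comm]
  congr 1
  have h := sum_nest_nil y.deg xs y.val
    (fun r v => V.Lw k (vals (xs.take r) ++ v :: vals zs) w t)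
    fun r => Lw_append_zero_cons _ _ _ _ _
  simpa [vals] using h.symm

theorem nestMid_add_mem (hV : V.IsGraded) {k : ℕ} (xs : List V.toGrSpace.Homog)
    (y : V.toGrSpace.Homog) (zs : List V.toGrSpace.Homog) (w t : V.toGrSpace.Homog)
    (hy : 1 ≤ y.deg) (hk : 1 ≤ k) (hk' : k ≤ w.deg) :
    V.nestMid k xs y zs w.val t.val + V.Lw k (vals xs ++ y.val :: vals zs) w.val t.val ∈
      V.gr (degSum xs + (y.deg + degSum zs + w.deg + t.deg)) := by
  rw [nestMid_add_eq_sum]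
  refine Submodule.sum_mem _ fun l _ => Submodule.sum_mem _ fun r _ => ?_
  let h : V.toGrSpace.Homog := ⟨_, _, nest_mem hV y hy le_rfl (zs.take l) (xs.drop r)⟩
  have := hV.L_mem k (xs.take r ++ h :: zs.drop l) w t hk hk'
  have h1 := degSum_take_add_drop r xs
  have h2 := degSum_take_add_drop l zs
  convert this using 2
  · rw [degSum_append, degSum_cons]
    simp only [h]
    omega
  · simp [vals, h]

theorem relTop_mem (hV : V.IsGraded) {j k : ℕ} (xs : List V.toGrSpace.Homog)
    (y : V.toGrSpace.Homog) (zs : List V.toGrSpace.Homog) (w t : V.toGrSpace.Homog)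
    (hj : 1 ≤ j) (hj' : j ≤ y.deg) (hk : 1 ≤ k) (hk' : k ≤ w.deg) :
    relTop j k xs y zs w t.val ∈ V.gr (degSum xs + (y.deg + degSum zs + w.deg + t.deg)) := by
  rw [relTop]
  refine add_mem ?_ ?_
  · refine Submodule.sum_mem _ fun r _ => ?_
    have h := degSum_take_add_drop r xs
    have h0 : vals zs ++ [w.val] = vals (zs ++ [w]) := by simp [vals]
    rw [h0]
    have := hV.L_mem (j + k + degSum (xs.drop r) + degSum zs) (xs.take r)
      ⟨_, _, nest_mem hV y hj hj' (zs ++ [w]) (xs.drop r)⟩ t (by omega)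
      (by simp only [degSum_append, degSum_cons, degSum_nil]; omega)
    convert this using 2
    simp only [degSum_append, degSum_cons, degSum_nil]
    omega
  · split_ifs
    · exact nestMid_add_mem hV xs y zs w t (by omega) hk hk'
    · exact zero_mem _

/-- The part of the insertion of `t` after the insertion of `z₁, …, z_m, w` that does not
contribute to the relations. -/
noncomputable def relRest (j k : ℕ) (xs : List V.toGrSpace.Homog) (y : V.toGrSpace.Homog)
    (zs : List V.toGrSpace.Homog) (w : V.toGrSpace.Homog) (t : V.carrier) :
    TensorAlgebra K V.carrier :=
  (if j = y.deg ∧ k = w.deg then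
    tailSum (fun us => V.nest j us y.val (vals (zs ++ [w]))) xs * ι K t else 0) +
  if j = y.deg then ∑ l ∈ Finset.range (zs.length + 1),
    tailSum (fun us => V.nest y.deg us y.val (vals (zs.take l))) xs *
      insOp B (degSum (zs.drop l) + k) t (tword (vals (zs.drop l)) * ι K w.val) else 0

/-- If all of `z₁, …, z_m, w` have been absorbed in `y`, the insertion of `t` nests once more and
gives `nestTop`. For `j = |y|` there are also words in which `z_{l+1}, …, z_m, w` are letters, and
`t` falls into `w`. The absorbed tails that reach back to the nested letter give `nestMid` and its
`l = 0` term. Those starting behind it, and the words in which `t` ends up behind the fully nested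
letter, go into `relRest`. -/
theorem insOp_insSeq (hV : V.IsGraded) {j k : ℕ} (xs : List V.toGrSpace.Homog)
    (y : V.toGrSpace.Homog) (zs : List V.toGrSpace.Homog) (w : V.toGrSpace.Homog) (t : V.carrier)
    (hj : 1 ≤ j) (hj' : j ≤ y.deg) (hk : 1 ≤ k) (hk' : k ≤ w.deg) :
    insOp B (degSum xs + j + (degSum zs + k)) t
      (insSeq B (degSum xs + j) (vals (zs ++ [w])) (tword (vals xs) * ι K y.val)) =
      tailSum (fun us => relTop j k us y zs w t) xs + relRest B j k xs y zs w t := by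
  have hd : degSum (zs ++ [w]) = degSum zs + w.deg := by
    simp [degSum_append, degSum_cons, degSum_nil]
  have h1 : insOp B (degSum xs + j + (degSum zs + k)) t
      (tailSum (fun us => V.nest j us y.val (vals (zs ++ [w]))) xs * 1) =
      tailSum (fun us => V.nestTop j k us y.val zs w.val t) xs +
      if j = y.deg ∧ k = w.deg then
        tailSum (fun us => V.nest j us y.val (vals (zs ++ [w]))) xs * ι K t else 0 := by
    rw [add_assoc, insOp_tailSum_mul B (nest_mem hV y hj hj' (zs ++ [w])) (by omega)
      (by rw [hd]; omega)]
    simp only [mul_one]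
    congr 1
    · congr 1
      funext us
      refine Finset.sum_congr rfl fun r _ => ?_
      rw [show j + (degSum zs + k) + degSum (us.drop r) = j + k + degSum (us.drop r) + degSum zs
        by omega]
      simp [vals]
    · congr 1
      rw [hd]
      apply propext
      omega
  rcases hj'.lt_or_eq with hlt | rfl
  · rw [← mul_one (tword (vals xs) * ι K y.val), insSeq_of_lt B hV y hj hlt, h1]
    simp [relTop, relRest, hlt.ne]
  · have h2 := insSeq_deg B hV y hj (zs ++ [w]) xs 1
    rw [List.length_append, List.length_singleton, Finset.sum_range_succ,
      List.take_of_length_le (by simp), List.drop_of_length_le (by simp)] at h2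
    rw [← mul_one (tword (vals xs) * ι K y.val), h2, map_add]
    have h3 : tword (vals ([] : List V.toGrSpace.Homog)) * 1 =
      (1 : TensorAlgebra K V.carrier) := by simp [vals, tword_nil]
    rw [h3, h1, map_sum]
    have h4 : ∀ l ∈ Finset.range (zs.length + 1),
        insOp B (degSum xs + y.deg + (degSum zs + k)) t
          (tailSum (fun us => V.nest y.deg us y.val (vals ((zs ++ [w]).take l))) xs *
            (tword (vals ((zs ++ [w]).drop l)) * 1)) =
        tailSum (fun us => ∑ r ∈ Finset.range (us.length + 1),
          V.Lw k (vals (us.take r) ++ V.nest y.deg (us.drop r) y.val (vals (zs.take l)) ::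
            vals (zs.drop l)) w.val t) xs +
        tailSum (fun us => V.nest y.deg us y.val (vals (zs.take l))) xs *
          insOp B (degSum (zs.drop l) + k) t (tword (vals (zs.drop l)) * ι K w.val) := by
      intro l hl
      have hl' : l ≤ zs.length := by simpa [Nat.lt_succ_iff] using hl
      have h5 : tword (vals (zs.drop l ++ [w])) = tword (vals (zs.drop l)) * ι K w.val := by
        simp [vals, tword_append, tword_cons, tword_nil]
      have h6 := degSum_take_add_drop l zs
      rw [List.take_append_of_le_length hl', List.drop_append_of_le_length hl', mul_one, h5,
        ← insOp_tailSum_mul_tword B (nest_mem hV y hj le_rfl (zs.take l)) (zs.drop l) w hk hk' t xs]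
      congr 3
      omega
    rw [Finset.sum_congr rfl h4, Finset.sum_add_distrib]
    simp only [relTop, relRest, if_true, nestMid_add_eq_sum, tailSum_add, tailSum_sum, true_and]
    abel

/-- The only tail not already present for `zs` is the full one, starting at `z`. This is the
definition of `L_q^k` for `q ≥ 1`, read in the tensor algebra. -/
theorem insOp_tword_cons_mul_mul (z : V.toGrSpace.Homog) (zs : List V.toGrSpace.Homog)
    (w : V.toGrSpace.Homog) {k : ℕ} (hk : 1 ≤ k) (hk' : k ≤ w.deg) (t : V.carrier)
    (s : TensorAlgebra K V.carrier) :
    insOp B (degSum (z :: zs) + k) t (tword (vals (z :: zs)) * ι K w.val * s) =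
      ι K (V.Lw k (vals (z :: zs)) w.val t) * s +
      ι K z.val * insOp B (degSum zs + k) t (tword (vals zs) * ι K w.val * s) := by
  rw [insOp_mul_mul B (B.tword_mem_tgr zs) w.mem hk hk' t s,
    insOp_mul_mul B (B.tword_mem_tgr (z :: zs)) w.mem hk hk' t s, theta_tword, theta_tword, tailSum]
  simp only [vals, List.map_cons, tword_cons]
  split_ifs <;> simp [mul_add, add_mul, mul_assoc, add_assoc]

theorem insOp_tword_cons_mul (z : V.toGrSpace.Homog) (zs : List V.toGrSpace.Homog)
    (w : V.toGrSpace.Homog) {k : ℕ} (hk : 1 ≤ k) (hk' : k ≤ w.deg) (t : V.carrier) :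
    insOp B (degSum (z :: zs) + k) t (tword (vals (z :: zs)) * ι K w.val) =
      ι K (V.Lw k (vals (z :: zs)) w.val t) +
      ι K z.val * insOp B (degSum zs + k) t (tword (vals zs) * ι K w.val) := by
  simpa using insOp_tword_cons_mul_mul B z zs w hk hk' t 1

theorem insOp_ι_mul (w : V.toGrSpace.Homog) {k : ℕ} (hk : 1 ≤ k) (hk' : k ≤ w.deg)
    (t : V.carrier) (s : TensorAlgebra K V.carrier) :
    insOp B k t (ι K w.val * s) =
      ι K (V.Lw k [] w.val t) * s + if k = w.deg then ι K w.val * ι K t * s else 0 := by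
  have h := insOp_mul_mul B B.one_mem_tgr w.mem hk hk' t s
  have hL := Lhat_tword B k [] w.val t
  rw [tword_nil] at hL
  simpa only [one_mul, zero_add, theta_one, hL] using h

theorem insOp_ι (w : V.toGrSpace.Homog) {k : ℕ} (hk : 1 ≤ k) (hk' : k ≤ w.deg) (t : V.carrier) :
    insOp B k t (ι K w.val) =
      ι K (V.Lw k [] w.val t) + if k = w.deg then ι K w.val * ι K t else 0 := by
  simpa using insOp_ι_mul B w hk hk' t 1

/-- Inserting `z` shifts the index `l` by one, so the remainders cancel except at `l = 0`. There the
difference between inserting `t` into `z z₂ ⋯ w` and `z` times its insertion into `z₂ ⋯ w` is a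
single letter. It matches the word in which that letter, inserted as a whole, stands behind `y`. -/
theorem insOp_relRest (hV : V.IsGraded) {j k : ℕ} (xs : List V.toGrSpace.Homog)
    (y z : V.toGrSpace.Homog) (zs : List V.toGrSpace.Homog) (w : V.toGrSpace.Homog) (t : V.carrier)
    (hj : 1 ≤ j) (hj' : j ≤ y.deg) (hk : 1 ≤ k) (hk' : k ≤ w.deg) :
    relRest B j k xs y (z :: zs) w t - insOp B (degSum xs + j) z.val (relRest B j k xs y zs w t) =
      if j = y.deg then tword (vals xs) * ι K y.val * ι K (V.Lw k (vals (z :: zs)) w.val t)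
      else 0 := by
  by_cases h : j = y.deg
  · subst h
    simp only [relRest, if_true, true_and, map_add, map_sum]
    have h1 : insOp B (degSum xs + y.deg) z.val (if k = w.deg then
        tailSum (fun us => V.nest y.deg us y.val (vals (zs ++ [w]))) xs * ι K t else 0) =
        if k = w.deg then tailSum (fun us => V.nest y.deg us y.val (vals (z :: zs ++ [w]))) xs *
          ι K t else 0 := by
      split_ifs
      · rw [insOp_tailSum_nest B hV y hj le_rfl, if_neg (by simp), add_zero]; rfl
      · simp
    rw [h1, List.length_cons, Finset.sum_range_succ' _ (zs.length + 1)]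
    simp only [insOp_tailSum_nest B hV y hj le_rfl]
    rw [Finset.sum_add_distrib]
    have h4 : ∑ l ∈ Finset.range (zs.length + 1), (if True ∧ zs.take l = [] then
        tword (vals xs) * ι K y.val * (ι K z.val * insOp B (degSum (zs.drop l) + k) t
          (tword (vals (zs.drop l)) * ι K w.val)) else 0) =
        tword (vals xs) * ι K y.val * (ι K z.val * insOp B (degSum zs + k) t
          (tword (vals zs) * ι K w.val)) := by
      rw [Finset.sum_eq_single_of_mem 0 (by simp)]
      · simp
      · intro l hl hl0
        rw [if_neg]
        rintro ⟨-, h1⟩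
        rw [List.take_eq_nil_iff] at h1
        rcases h1 with h1 | h1
        · exact hl0 h1
        · subst h1; simp at hl; exact hl0 hl
    rw [h4]
    simp only [List.take_zero, List.drop_zero, List.take_succ_cons, List.drop_succ_cons]
    have h5 := insOp_tword_cons_mul B z zs w hk hk' t
    rw [h5]
    have h6 : tailSum (fun us => V.nest y.deg us y.val (vals ([] : List V.toGrSpace.Homog))) xs =
      tword (vals xs) * ι K y.val := tailSum_nest_nil _ _ _
    rw [h6, mul_add]
    have h7 : ∀ l, vals (z :: zs.take l) = z.val :: vals (zs.take l) := fun l => rfl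
    simp only [h7]
    abel
  · simp [relRest, h]

theorem insOp_tword_mul {j : ℕ} (xs : List V.toGrSpace.Homog) (y : V.toGrSpace.Homog)
    (hj : 1 ≤ j) (hj' : j ≤ y.deg) (v : V.carrier) :
    insOp B (degSum xs + j) v (tword (vals xs) * ι K y.val) =
      tailSum (fun us => V.Lw j (vals us) y.val v) xs +
      if j = y.deg then tword (vals xs) * ι K y.val * ι K v else 0 := by
  simpa [theta_tword] using insOp_mul_mul B (B.tword_mem_tgr xs) y.mem hj hj' v 1

/-- The bridge between relation (B) and associativity: the left side compares three operators on the
word `x₁ ⋯ x_n y`, and the coefficients on the right side are the differences of the two sides of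
(B) for the tails of `x₁, …, x_n`. It serves in both directions, to deduce associativity from the
relations and the relations from associativity. -/
theorem insOp_insSeq_sub (hV : V.IsGraded) {j k : ℕ} (xs : List V.toGrSpace.Homog)
    (y z : V.toGrSpace.Homog) (zs : List V.toGrSpace.Homog) (w t : V.toGrSpace.Homog)
    (hj : 1 ≤ j) (hj' : j ≤ y.deg) (hk : 1 ≤ k) (hk' : k ≤ w.deg) :
    insOp B (degSum xs + j + (degSum (z :: zs) + k)) t.val
        (insSeq B (degSum xs + j) (vals (z :: zs ++ [w])) (tword (vals xs) * ι K y.val)) -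
      insOp B (degSum xs + j) z.val (insOp B (degSum xs + j + (degSum zs + k)) t.val
        (insSeq B (degSum xs + j) (vals (zs ++ [w])) (tword (vals xs) * ι K y.val))) -
      insOp B (degSum xs + j) (V.Lw k (vals (z :: zs)) w.val t.val)
        (tword (vals xs) * ι K y.val) =
    tailSum (fun us => relTop j k us y (z :: zs) w t.val -
      ∑ r ∈ Finset.range (us.length + 1), V.Lw (j + degSum (us.drop r)) (vals (us.take r))
        (relTop j k (us.drop r) y zs w t.val) z.val -
      V.Lw j (vals us) y.val (V.Lw k (vals (z :: zs)) w.val t.val)) xs := by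
  rw [insOp_insSeq B hV xs y (z :: zs) w t.val hj hj' hk hk',
    insOp_insSeq B hV xs y zs w t.val hj hj' hk hk', insOp_tword_mul B xs y hj hj', map_add,
    tailSum_sub, tailSum_sub, ← insOp_relRest B hV xs y z zs w t.val hj hj' hk hk']
  have := insOp_tailSum_mul B (fun us => relTop_mem hV us y zs w t hj hj' hk hk') hj (by omega)
    z.val xs 1
  -- The position is not at the end of the letter `relTop`, because `j ≤ |y|` while `|w| ≥ k ≥ 1`.
  rw [if_neg (by omega)] at this
  simp only [mul_one, add_zero] at this
  rw [this]
  abel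

/-- The same bridge for relation (A). The letter `L_0^k(w; t)` involves the correction `w •₀ t` for
`k = |w|`, which acts as two insertions at the same position. -/
theorem insOp_insOp_sub (hV : V.IsGraded) {j k : ℕ} (xs : List V.toGrSpace.Homog)
    (y w t : V.toGrSpace.Homog)
    (hj : 1 ≤ j) (hj' : j ≤ y.deg) (hk : 1 ≤ k) (hk' : k ≤ w.deg) :
    insOp B (degSum xs + j + k) t.val
        (insOp B (degSum xs + j) w.val (tword (vals xs) * ι K y.val)) -
      (if k = w.deg then insOp B (degSum xs + j) w.val (insOp B (degSum xs + j) t.val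
        (tword (vals xs) * ι K y.val)) else 0) -
      insOp B (degSum xs + j) (V.Lw k [] w.val t.val) (tword (vals xs) * ι K y.val) =
    tailSum (fun us => relTop j k us y [] w t.val -
      (if k = w.deg then V.nest j us y.val [w.val, t.val] else 0) -
      V.Lw j (vals us) y.val (V.Lw k [] w.val t.val)) xs := by
  have h0 : ∀ a b : V.toGrSpace.Homog, vals ([] ++ [a]) = [a.val] ∧
    vals [a, b] = [a.val, b.val] := fun a b => ⟨rfl, rfl⟩
  have h1 := insOp_insSeq B hV xs y [] w t.val hj hj' hk hk'
  have h2 := insOp_ι B w hk hk' t.val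
  have h3 : (if k = w.deg then insOp B (degSum xs + j) w.val (insOp B (degSum xs + j) t.val
        (tword (vals xs) * ι K y.val)) else 0) =
      (if k = w.deg then tailSum (fun us => V.nest j us y.val [w.val, t.val]) xs else 0) +
      if j = y.deg ∧ k = w.deg then tword (vals xs) * ι K y.val * (ι K w.val * ι K t.val) +
        tailSum (fun us => V.nest j us y.val [w.val]) xs * ι K t.val else 0 := by
    by_cases hkw : k = w.deg
    · simp only [hkw, if_true, and_true]
      rcases hj'.lt_or_eq with hlt | rfl
      · have := insSeq_of_lt B hV y hj hlt [w, t] xs 1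
        simp only [mul_one, (h0 w t).2, insSeq_cons, insSeq_nil] at this
        rw [this, if_neg hlt.ne, add_zero]
      · have := insSeq_deg B hV y hj [w, t] xs 1
        simp only [mul_one, (h0 w t).2, insSeq_cons, insSeq_nil, List.length_cons, List.length_nil,
          Finset.sum_range_succ, Finset.sum_range_zero] at this
        rw [this, if_pos rfl]
        simp only [vals, List.take_zero, List.take_succ_cons, List.map_cons, List.map_nil,
          List.drop_zero, List.drop_succ_cons, tailSum_nest_nil, tword_cons, tword_nil]
        simp only [zero_add, mul_one]
        abel
    · simp [hkw]
  rw [degSum_nil, zero_add, (h0 w t).1, insSeq_cons, insSeq_nil] at h1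
  rw [h3, h1, insOp_tword_mul B xs y hj hj', tailSum_sub, tailSum_sub, relRest]
  have h4 : tailSum (fun us => if k = w.deg then V.nest j us y.val [w.val, t.val] else 0) xs =
      if k = w.deg then tailSum (fun us => V.nest j us y.val [w.val, t.val]) xs else 0 := by
    split_ifs
    · rfl
    · exact tailSum_zero xs
  have h5 : ∑ l ∈ Finset.range (([] : List V.toGrSpace.Homog).length + 1),
      tailSum (fun us => V.nest y.deg us y.val (vals (([] : List V.toGrSpace.Homog).take l))) xs *
      insOp B (degSum (([] : List V.toGrSpace.Homog).drop l) + k) t.val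
        (tword (vals (([] : List V.toGrSpace.Homog).drop l)) * ι K w.val) =
      tword (vals xs) * ι K y.val * (ι K (V.Lw k [] w.val t.val) +
        if k = w.deg then ι K w.val * ι K t.val else 0) := by
    rw [← h2]
    simp [vals, degSum_nil, tword_nil, tailSum_nest_nil]
  rw [h4, h5, (h0 w t).1]
  by_cases hj1 : j = y.deg <;> by_cases hk1 : k = w.deg <;>
    simp only [hj1, hk1, if_true, if_false, and_true, and_false, mul_add, add_zero,
      zero_add, sub_zero, and_self] <;> abel

end PrimOps

/-! ### Associativity of the insertion operators -/

namespace PrimOps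

open TensorAlgebra GrSpace

variable {K : Type u} [Field K] {V : PrimOps.{u, v} K} (B : HomogBasis.{u, v, w} V.toGrSpace)

/-- A position between two letters is attributed to the letter on its left, whence `1 ≤ p ≤ |y|`. -/
theorem _root_.HomogBasis.exists_split (xs : List B.X) {i : ℕ} (hi : 0 < i)
    (hi' : i ≤ B.wdeg xs) : ∃ us y vs p, xs = us ++ y :: vs ∧ i = B.wdeg us + p ∧ 1 ≤ p ∧
      p ≤ B.deg y := by
  induction xs generalizing i with
  | nil => rw [B.wdeg_nil] at hi'; omega
  | cons x xs ih =>
    rw [B.wdeg_cons] at hi'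
    rcases le_or_gt i (B.deg x) with h | h
    · exact ⟨[], x, xs, i, rfl, by simp [B.wdeg_nil], hi, h⟩
    · obtain ⟨us, y, vs, p, rfl, h1, h2, h3⟩ := ih (i := i - B.deg x) (by omega) (by omega)
      exact ⟨x :: us, y, vs, p, rfl, by rw [B.wdeg_cons]; omega, h2, h3⟩

theorem _root_.HomogBasis.words_eq_tword_homog {V : GrSpace.{u, v} K}
    (B : HomogBasis.{u, v, w} V) (xs : List B.X) :
    B.words xs = tword (vals (xs.map B.homog)) := by
  rw [B.words_eq_tword, vals, List.map_map]; rfl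

theorem _root_.HomogBasis.degSum_homog {V : GrSpace.{u, v} K} (B : HomogBasis.{u, v, w} V)
    (xs : List B.X) :
    degSum (xs.map B.homog) = B.wdeg xs := by
  rw [degSum, List.map_map]; rfl

/-- Insertion affects nothing to the right of the letter that contains the position. This is the
identity `z •ᵢ (b •₀ s) = (z •ᵢ b) •₀ s`. -/
theorem insOp_mul_right {i m : ℕ} (hi : 0 < i) (hi' : i ≤ m) (z : V.carrier)
    {b : TensorAlgebra K V.carrier} (hb : b ∈ B.tgr m) (s : TensorAlgebra K V.carrier) :
    insOp B i z (b * s) = insOp B i z b * s := by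
  refine B.ext_of_mem_tgr (f := insOp B i z ∘ₗ LinearMap.mulRight K s)
    (g := LinearMap.mulRight K s ∘ₗ insOp B i z) (fun xs hxs => ?_) hb
  obtain ⟨us, y, vs, p, rfl, rfl, hp, hp'⟩ := B.exists_split xs hi (hi'.trans hxs.ge)
  have h1 := insOp_mul_mul B (B.words_mem_tgr us) (B.mem y) hp hp' z (B.words vs * s)
  have h2 := insOp_mul_mul B (B.words_mem_tgr us) (B.mem y) hp hp' z (B.words vs)
  simp only [LinearMap.comp_apply, LinearMap.mulRight_apply, B.words_append, B.words_cons]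
  simp only [← mul_assoc] at h1 h2 ⊢
  rw [h1, h2, add_mul]
  split_ifs <;> simp

theorem insOp_mem (hV : V.IsGraded) {i m : ℕ} (hi : i ≤ m) (z : V.toGrSpace.Homog)
    {b : TensorAlgebra K V.carrier} (hb : b ∈ B.tgr m) :
    insOp B i z.val b ∈ B.tgr (z.deg + m) := by
  rcases Nat.eq_zero_or_pos i with rfl | h0
  · rw [insOp_zero]
    exact B.mul_mem_tgr (B.ι_mem_tgr z.mem) hb
  refine B.tgr_le (M := (B.tgr (z.deg + m)).comap (insOp B i z.val)) (fun xs hxs => ?_) hb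
  obtain ⟨us, y, vs, p, rfl, rfl, hp, hp'⟩ := B.exists_split xs h0 (hi.trans hxs.ge)
  rw [Submodule.mem_comap, insOp_words_append B us y vs hp hp']
  rw [B.wdeg_append, B.wdeg_cons] at hxs
  refine add_mem ?_ ?_
  · rw [B.words_eq_tword_homog us, theta_tword]
    have := tailSum_mem_tgr B (g := fun us => V.Lw p (vals us) (B.b y) z.val)
      (e := B.deg y + z.deg) (fun us => by
        rw [← add_assoc]; exact hV.L_mem p us (B.homog y) z hp hp') (us.map B.homog)
    have := B.mul_mem_tgr this (B.words_mem_tgr vs)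
    rw [B.degSum_homog] at this
    convert this using 2
    omega
  · split_ifs
    · have := B.mul_mem_tgr (B.mul_mem_tgr (B.mul_mem_tgr (B.words_mem_tgr us)
        (B.ι_mem_tgr (B.mem y))) (B.ι_mem_tgr z.mem)) (B.words_mem_tgr vs)
      convert this using 2
      omega
    · exact zero_mem _

theorem insHead_eq_zero (acc xs : List B.X) {i : ℕ} (hi : B.wdeg xs < i) :
    insHead B acc i xs = 0 := by
  induction xs generalizing acc i with
  | nil => rfl
  | cons x xs ih =>
    rw [B.wdeg_cons] at hi
    rw [insHead, if_neg (by omega), ih _ (by omega)]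

theorem insOp_words_eq_zero (z : V.carrier) (xs : List B.X) {i : ℕ} (hi : B.wdeg xs < i) :
    insOp B i z (B.words xs) = 0 := by
  induction xs generalizing i with
  | nil => rw [insOp_words, insWord, if_neg (by omega)]; rfl
  | cons x xs ih =>
    rw [insOp_words_cons B (by omega), insHead_eq_zero B _ _ hi]
    rw [B.wdeg_cons] at hi
    rw [ih (by omega)]
    simp

/-- The successive insertion of the letters of a word at the position `i`, from the last letter to
the first, as an algebra homomorphism. -/
noncomputable def opHom (i : ℕ) :
    TensorAlgebra K V.carrier →ₐ[K] Module.End K (TensorAlgebra K V.carrier) :=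
  TensorAlgebra.lift K (insOp B i)

theorem opHom_ι_mul (i : ℕ) (v : V.carrier) (a b : TensorAlgebra K V.carrier) :
    opHom B i (ι K v * a) b = insOp B i v (opHom B i a b) := by
  rw [map_mul, opHom, lift_ι_apply]; rfl

theorem opHom_one (i : ℕ) (b : TensorAlgebra K V.carrier) : opHom B i 1 b = b := by
  rw [map_one]; rfl

theorem opHom_ι (i : ℕ) (v : V.carrier) (b : TensorAlgebra K V.carrier) :
    opHom B i (ι K v) b = insOp B i v b := by
  rw [opHom, lift_ι_apply]

theorem opHom_mul (i : ℕ) (a b c : TensorAlgebra K V.carrier) :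
    opHom B i (a * b) c = opHom B i a (opHom B i b c) := by
  rw [map_mul]; rfl

theorem opHom_tword (i : ℕ) (zs : List V.carrier) (a : TensorAlgebra K V.carrier) :
    opHom B i (tword zs) a = insSeq B i zs a := by
  induction zs with
  | nil => rw [tword_nil, opHom_one, insSeq_nil]
  | cons z zs ih => rw [tword_cons, opHom_ι_mul, ih, insSeq_cons]

theorem opHom_zero (a b : TensorAlgebra K V.carrier) : opHom B 0 a b = a * b := by
  have : (opHom B 0).toLinearMap = LinearMap.mul K (TensorAlgebra K V.carrier) := by
    refine B.words.ext fun xs => ?_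
    ext b
    induction xs with
    | nil => simp [B.words_nil]
    | cons x xs ih =>
      rw [AlgHom.toLinearMap_apply] at ih ⊢
      rw [B.words_cons, opHom_ι_mul, ih, insOp_zero]; simp [mul_assoc]
  exact LinearMap.congr_fun (LinearMap.congr_fun this a) b

theorem opHom_mem (hV : V.IsGraded) {i m d : ℕ} (hi : i ≤ m) {a b : TensorAlgebra K V.carrier}
    (ha : a ∈ B.tgr d) (hb : b ∈ B.tgr m) : opHom B i a b ∈ B.tgr (d + m) := by
  refine B.tgr_le (M := (B.tgr (d + m)).comap ((opHom B i).toLinearMap.flip b))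
    (fun xs hxs => ?_) ha
  rw [Submodule.mem_comap, LinearMap.flip_apply, AlgHom.toLinearMap_apply]
  clear ha
  induction xs generalizing d with
  | nil =>
    rw [B.wdeg_nil] at hxs
    subst hxs
    rw [B.words_nil, opHom_one, zero_add]
    exact hb
  | cons x xs ih =>
    rw [B.wdeg_cons] at hxs
    rw [B.words_cons, opHom_ι_mul]
    have := insOp_mem B hV (by omega) (B.homog x) (ih rfl)
      (i := i)
    rw [← hxs, add_assoc]
    exact this

theorem opHom_mul_right (hV : V.IsGraded) {i m : ℕ} (hi : 0 < i) (hi' : i ≤ m)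
    (a : TensorAlgebra K V.carrier)
    {b : TensorAlgebra K V.carrier} (hb : b ∈ B.tgr m) (s : TensorAlgebra K V.carrier) :
    opHom B i a (b * s) = opHom B i a b * s := by
  have : (opHom B i).toLinearMap.flip (b * s) =
      LinearMap.mulRight K s ∘ₗ (opHom B i).toLinearMap.flip b := by
    refine B.words.ext fun xs => ?_
    rw [LinearMap.comp_apply, LinearMap.flip_apply, LinearMap.flip_apply,
      AlgHom.toLinearMap_apply, LinearMap.mulRight_apply]
    induction xs with
    | nil => rw [B.words_nil, opHom_one, opHom_one]
    | cons x xs ih =>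
      rw [B.words_cons, opHom_ι_mul, opHom_ι_mul, ih,
        insOp_mul_right B hi (hi'.trans (Nat.le_add_left _ _)) _
          (opHom_mem B hV hi' (B.words_mem_tgr xs) hb)]
  exact LinearMap.congr_fun this a

end PrimOps

namespace PrimPshAlgebra

open TensorAlgebra GrSpace PrimOps

variable {K : Type u} [Field K] (V : PrimPshAlgebra.{u, v} K)

theorem isGraded : V.toPrimOps.IsGraded := ⟨V.positive, V.L_mem, V.L_eq_zero⟩

variable {V} (B : HomogBasis.{u, v, w} V.toGrSpace)

/-- Relation (B) in operator form. A general word is cut behind the letter `y` that contains the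
position; on the part up to `y` the difference is a `tailSum` with coefficients zero by (B), and the
part behind `y` is carried along as a right factor. -/
theorem insOp_Lw_cons {j k n : ℕ} (z : V.toGrSpace.Homog)
    (zs : List V.toGrSpace.Homog) (w t : V.toGrSpace.Homog) (hk : 1 ≤ k) (hk' : k ≤ w.deg)
    {a : TensorAlgebra K V.carrier} (ha : a ∈ B.tgr n) (hj : j ≤ n) :
    insOp B j (V.Lw k (vals (z :: zs)) w.val t.val) a =
      insOp B (degSum (z :: zs) + k + j) t.val
        (opHom B j (tword (vals (z :: zs)) * ι K w.val) a) -
      insOp B j z.val (insOp B (degSum zs + k + j) t.val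
        (opHom B j (tword (vals zs) * ι K w.val) a)) := by
  -- At `j = 0` insertion is left multiplication, and no relation is needed.
  rcases Nat.eq_zero_or_pos j with rfl | hj0
  · rw [opHom_zero, opHom_zero, add_zero, add_zero, insOp_zero, insOp_zero,
      insOp_tword_cons_mul_mul B z zs w hk hk']
    abel
  refine B.ext_of_mem_tgr (f := insOp B j (V.Lw k (vals (z :: zs)) w.val t.val))
    (g := insOp B (degSum (z :: zs) + k + j) t.val ∘ₗ
        opHom B j (tword (vals (z :: zs)) * ι K w.val) -
      insOp B j z.val ∘ₗ insOp B (degSum zs + k + j) t.val ∘ₗ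
        opHom B j (tword (vals zs) * ι K w.val)) (fun xs hxs => ?_) ha
  obtain ⟨us, y, vs, p, rfl, rfl, hp, hp'⟩ := B.exists_split xs hj0 (hj.trans hxs.ge)
  have h1 : ∀ us : List V.toGrSpace.Homog, relTop p k us (B.homog y) (z :: zs) w t.val -
      ∑ r ∈ Finset.range (us.length + 1), V.Lw (p + degSum (us.drop r)) (vals (us.take r))
        (relTop p k (us.drop r) (B.homog y) zs w t.val) z.val -
      V.Lw p (vals us) (B.homog y).val (V.Lw k (vals (z :: zs)) w.val t.val) = 0 := by
    intro us
    rw [← (relB_iff _ _ _ _ _ _ _ _).1 (V.relB p k us (B.homog y) z zs w t.val hp hp' hk hk'),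
      sub_self]
  have h2 := insOp_insSeq_sub B V.isGraded (us.map B.homog) (B.homog y) z zs w t hp hp' hk hk'
  simp only [h1, tailSum_zero, B.degSum_homog, ← opHom_tword] at h2
  have h4 : ∀ l : List V.toGrSpace.Homog, tword (vals (l ++ [w])) =
      tword (vals l) * ι K w.val := fun l => by
    simp [vals, tword_append, tword_cons, tword_nil]
  rw [h4, h4] at h2
  have h3 : B.words (us ++ y :: vs) =
      (tword (vals (us.map B.homog)) * ι K (B.homog y).val) * B.words vs := by
    rw [B.words_append, B.words_cons, ← B.words_eq_tword_homog, mul_assoc]; rfl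
  have h5 : tword (vals (us.map B.homog)) * ι K (B.homog y).val ∈
      B.tgr (B.wdeg us + B.deg y) := by
    rw [← B.words_eq_tword_homog]
    exact B.mul_mem_tgr (B.words_mem_tgr us) (B.ι_mem_tgr (B.mem y))
  have h6 : ∀ l : List V.toGrSpace.Homog,
      opHom B (B.wdeg us + p) (tword (vals l) * ι K w.val)
        (tword (vals (us.map B.homog)) * ι K (B.homog y).val) ∈
      B.tgr (degSum l + w.deg + (B.wdeg us + B.deg y)) := fun l =>
    opHom_mem B V.isGraded (by omega) (B.mul_mem_tgr (B.tword_mem_tgr l) (B.ι_mem_tgr w.mem)) h5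
  rw [h3]
  simp only [LinearMap.sub_apply, LinearMap.comp_apply]
  rw [opHom_mul_right B V.isGraded (by omega) (by omega) _ h5,
    opHom_mul_right B V.isGraded (by omega) (by omega) _ h5,
    insOp_mul_right B (by omega) (by omega) _ h5,
    insOp_mul_right B (by omega) (by omega) _ (h6 (z :: zs)),
    insOp_mul_right B (by omega) (by omega) _ (h6 zs),
    insOp_mul_right B (by omega) (by omega) _
      (insOp_mem B V.isGraded (by omega) t (h6 zs)), ← sub_mul]
  congr 1
  rw [sub_eq_zero] at h2
  rw [← h2, add_comm (degSum (z :: zs) + k), add_comm (degSum zs + k)]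

/-- Relation (A) in operator form, by the same reduction. -/
theorem insOp_Lw_nil {j k n : ℕ} (w t : V.toGrSpace.Homog) (hk : 1 ≤ k) (hk' : k ≤ w.deg)
    {a : TensorAlgebra K V.carrier} (ha : a ∈ B.tgr n) (hj : j ≤ n) :
    insOp B j (V.Lw k [] w.val t.val) a =
      insOp B (k + j) t.val (insOp B j w.val a) -
      if k = w.deg then insOp B j w.val (insOp B j t.val a) else 0 := by
  rcases Nat.eq_zero_or_pos j with rfl | hj0
  · simp only [add_zero, insOp_zero]
    rw [insOp_ι_mul B w hk hk']
    split_ifs <;> simp [mul_assoc]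
  have h0 := B.ext_of_mem_tgr (f := insOp B j (V.Lw k [] w.val t.val))
    (g := insOp B (k + j) t.val ∘ₗ insOp B j w.val -
      if k = w.deg then insOp B j w.val ∘ₗ insOp B j t.val else 0) (fun xs hxs => ?_) ha
  · rw [h0]
    split_ifs <;> simp
  obtain ⟨us, y, vs, p, rfl, rfl, hp, hp'⟩ := B.exists_split xs hj0 (hj.trans hxs.ge)
  have h1 : ∀ us : List V.toGrSpace.Homog, relTop p k us (B.homog y) [] w t.val -
      (if k = w.deg then V.nest p us (B.homog y).val [w.val, t.val] else 0) -
      V.Lw p (vals us) (B.homog y).val (V.Lw k [] w.val t.val) = 0 := by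
    intro us
    rw [← (relA_iff _ _ _ _ _ _).1 (V.relA p k us (B.homog y) w t.val hp hp' hk hk'), sub_self]
  have h2 := insOp_insOp_sub B V.isGraded (us.map B.homog) (B.homog y) w t hp hp' hk hk'
  simp only [h1, tailSum_zero, B.degSum_homog] at h2
  have h3 : B.words (us ++ y :: vs) =
      (tword (vals (us.map B.homog)) * ι K (B.homog y).val) * B.words vs := by
    rw [B.words_append, B.words_cons, ← B.words_eq_tword_homog, mul_assoc]; rfl
  have h5 : tword (vals (us.map B.homog)) * ι K (B.homog y).val ∈
      B.tgr (B.wdeg us + B.deg y) := by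
    rw [← B.words_eq_tword_homog]
    exact B.mul_mem_tgr (B.words_mem_tgr us) (B.ι_mem_tgr (B.mem y))
  have h6 : ∀ h : V.toGrSpace.Homog, _ := fun h =>
    insOp_mem B V.isGraded (show B.wdeg us + p ≤ B.wdeg us + B.deg y by omega) h h5
  rw [h3, insOp_mul_right B (by omega) (by omega) _ h5]
  rw [sub_eq_zero] at h2
  rw [← h2, sub_mul, add_comm k, LinearMap.sub_apply, LinearMap.comp_apply,
    insOp_mul_right B (by omega) (by omega) _ h5,
    insOp_mul_right B (by omega) (by omega) _ (h6 w)]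
  congr 1
  split_ifs
  · rw [LinearMap.comp_apply, insOp_mul_right B (by omega) (by omega) _ h5,
      insOp_mul_right B (by omega) (by omega) _ (h6 t)]
  · simp

/-- Insertion of `t` into `z z₂ ⋯ y` produces the new letter `L^p(z, …; y; t)` and `z` times a
shorter insertion. By `insOp_Lw_cons` the new letter acts as the desired operator minus a second
one, and the induction hypothesis identifies the shorter insertion with that second operator. -/
theorem opHom_insOp_tword {p j n : ℕ} (zs : List V.toGrSpace.Homog) (y t : V.toGrSpace.Homog)
    (hp : 1 ≤ p) (hp' : p ≤ y.deg) {a : TensorAlgebra K V.carrier} (ha : a ∈ B.tgr n)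
    (hj : j ≤ n) :
    opHom B j (insOp B (degSum zs + p) t.val (tword (vals zs) * ι K y.val)) a =
      insOp B (degSum zs + p + j) t.val (opHom B j (tword (vals zs) * ι K y.val) a) := by
  induction zs with
  | nil =>
    rw [degSum_nil, zero_add, vals, List.map_nil, tword_nil, one_mul, insOp_ι B y hp hp', map_add,
      LinearMap.add_apply, opHom_ι, opHom_ι, insOp_Lw_nil B y t hp hp' ha hj]
    split_ifs
    · rw [opHom_ι_mul, opHom_ι]; abel
    · simp
  | cons z zs ih =>
    rw [insOp_tword_cons_mul B z zs y hp hp', map_add, LinearMap.add_apply, opHom_ι, opHom_ι_mul,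
      ih, insOp_Lw_cons B z zs y t hp hp' ha hj]
    abel

/-- The part of `u` behind the letter that receives `t` acts on `a` first. Replacing `a` by the
result reduces the claim to words whose last letter receives `t`. -/
theorem opHom_insOp {i j m n : ℕ} (t : V.toGrSpace.Homog) {u a : TensorAlgebra K V.carrier}
    (hu : u ∈ B.tgr m) (hi : i ≤ m) (ha : a ∈ B.tgr n) (hj : j ≤ n) :
    opHom B j (insOp B i t.val u) a = insOp B (i + j) t.val (opHom B j u a) := by
  rcases Nat.eq_zero_or_pos i with rfl | hi0
  · rw [insOp_zero, opHom_ι_mul, zero_add]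
  refine B.ext_of_mem_tgr (f := (opHom B j).toLinearMap.flip a ∘ₗ insOp B i t.val)
    (g := insOp B (i + j) t.val ∘ₗ (opHom B j).toLinearMap.flip a) (fun xs hxs => ?_) hu
  obtain ⟨us, y, vs, p, rfl, rfl, hp, hp'⟩ := B.exists_split xs hi0 (hi.trans hxs.ge)
  have h3 : B.words (us ++ y :: vs) =
      (tword (vals (us.map B.homog)) * ι K (B.homog y).val) * B.words vs := by
    rw [B.words_append, B.words_cons, ← B.words_eq_tword_homog, mul_assoc]; rfl
  have h5 : tword (vals (us.map B.homog)) * ι K (B.homog y).val ∈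
      B.tgr (B.wdeg us + B.deg y) := by
    rw [← B.words_eq_tword_homog]
    exact B.mul_mem_tgr (B.words_mem_tgr us) (B.ι_mem_tgr (B.mem y))
  have h6 := opHom_insOp_tword B (us.map B.homog) (B.homog y) t hp hp'
    (opHom_mem B V.isGraded hj (B.words_mem_tgr vs) ha) (hj.trans (Nat.le_add_left _ _))
  rw [B.degSum_homog] at h6
  simp only [LinearMap.comp_apply, LinearMap.flip_apply, AlgHom.toLinearMap_apply]
  rw [h3, insOp_mul_right B (by omega) (by omega) _ h5, opHom_mul, h6]
  simp only [opHom_mul]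

/-- The associativity of the operations `•ᵢ` on the tensor algebra. -/
theorem opHom_opHom {i j m n : ℕ} (x : TensorAlgebra K V.carrier) {u a : TensorAlgebra K V.carrier}
    (hu : u ∈ B.tgr m) (hi : i ≤ m) (ha : a ∈ B.tgr n) (hj : j ≤ n) :
    opHom B j (opHom B i x u) a = opHom B (i + j) x (opHom B j u a) := by
  have : (opHom B j).toLinearMap.flip a ∘ₗ (opHom B i).toLinearMap.flip u =
      (opHom B (i + j)).toLinearMap.flip (opHom B j u a) := by
    refine B.words.ext fun xs => ?_
    simp only [LinearMap.comp_apply, LinearMap.flip_apply, AlgHom.toLinearMap_apply]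
    induction xs with
    | nil => rw [B.words_nil, opHom_one, opHom_one]
    | cons x xs ih =>
      rw [B.words_cons, opHom_ι_mul, opHom_ι_mul, ← ih]
      exact opHom_insOp B (B.homog x) (opHom_mem B V.isGraded hi (B.words_mem_tgr xs) hu)
        (hi.trans (Nat.le_add_left _ _)) ha hj
  exact LinearMap.congr_fun this x

end PrimPshAlgebra

/-! ### Deconcatenation -/

namespace HomogBasis

open TensorAlgebra TensorProduct

variable {K : Type u} [Field K] {V : GrSpace.{u, v} K} (B : HomogBasis.{u, v, w} V)

/-- The deconcatenation coproduct of a word. -/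
noncomputable def deconcWord :
    List B.X → TensorAlgebra K V.carrier ⊗[K] TensorAlgebra K V.carrier
  | [] => 1 ⊗ₜ 1
  | x :: xs => 1 ⊗ₜ B.words (x :: xs) +
      (LinearMap.mulLeft K (ι K (B.b x))).rTensor _ (deconcWord xs)

/-- The deconcatenation coproduct of the tensor algebra. -/
noncomputable def deconc : TensorAlgebra K V.carrier →ₗ[K]
    TensorAlgebra K V.carrier ⊗[K] TensorAlgebra K V.carrier :=
  B.words.constr K B.deconcWord

theorem deconc_words (xs : List B.X) : B.deconc (B.words xs) = B.deconcWord xs := by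
  rw [deconc, Module.Basis.constr_basis]

theorem deconc_one : B.deconc 1 = 1 ⊗ₜ 1 := by
  rw [← B.words_nil, deconc_words, deconcWord, B.words_nil]

theorem deconc_ι_mul (v : V.carrier) (a : TensorAlgebra K V.carrier) :
    B.deconc (ι K v * a) = 1 ⊗ₜ (ι K v * a) +
      (LinearMap.mulLeft K (ι K v)).rTensor _ (B.deconc a) := by
  have h : ∀ x, B.deconc ∘ₗ LinearMap.mulLeft K (ι K (B.b x)) =
      TensorProduct.mk K _ _ 1 ∘ₗ LinearMap.mulLeft K (ι K (B.b x)) +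
      (LinearMap.mulLeft K (ι K (B.b x))).rTensor _ ∘ₗ B.deconc := by
    intro x
    refine B.words.ext fun xs => ?_
    simp only [LinearMap.comp_apply, LinearMap.mulLeft_apply, LinearMap.add_apply,
      TensorProduct.mk_apply]
    rw [← B.words_cons, deconc_words, deconc_words, deconcWord]
  have h2 : B.deconc ∘ₗ LinearMap.mulRight K a ∘ₗ ι K =
      TensorProduct.mk K _ _ 1 ∘ₗ LinearMap.mulRight K a ∘ₗ ι K +
      ((LinearMap.rTensorHom _).flip (B.deconc a)) ∘ₗ
        LinearMap.mul K (TensorAlgebra K V.carrier) ∘ₗ ι K := by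
    refine B.b.ext fun x => ?_
    exact LinearMap.congr_fun (h x) a
  exact LinearMap.congr_fun h2 v

theorem deconc_words_eq_sum (xs : List B.X) : B.deconc (B.words xs) =
    ∑ r ∈ Finset.range (xs.length + 1), B.words (xs.take r) ⊗ₜ B.words (xs.drop r) := by
  induction xs with
  | nil => simp [B.words_nil, deconc_one]
  | cons x xs ih =>
    rw [B.words_cons, deconc_ι_mul, ih, List.length_cons, Finset.sum_range_succ' _ (xs.length + 1),
      map_sum, add_comm]
    simp [B.words_cons, B.words_nil]

theorem deconc_coassoc (a : TensorAlgebra K V.carrier) :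
    TensorProduct.assoc K _ _ _ (B.deconc.rTensor _ (B.deconc a)) =
      B.deconc.lTensor _ (B.deconc a) := by
  have : (TensorProduct.assoc K _ _ _).toLinearMap ∘ₗ B.deconc.rTensor _ ∘ₗ B.deconc =
      B.deconc.lTensor _ ∘ₗ B.deconc := by
    refine B.words.ext fun xs => ?_
    simp only [LinearMap.comp_apply, LinearEquiv.coe_coe]
    induction xs with
    | nil => simp [B.words_nil, deconc_one]
    | cons x xs ih =>
      have h1 : ∀ c, TensorProduct.assoc K _ _ _ (B.deconc.rTensor (TensorAlgebra K V.carrier)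
          ((LinearMap.mulLeft K (ι K (B.b x))).rTensor _ c)) =
          1 ⊗ₜ[K] (LinearMap.mulLeft K (ι K (B.b x))).rTensor _ c +
          (LinearMap.mulLeft K (ι K (B.b x))).rTensor _
            (TensorProduct.assoc K _ _ _ (B.deconc.rTensor _ c)) := by
        intro c
        induction c with
        | zero => simp
        | add c d hc hd => simp only [map_add, hc, hd, tmul_add]; abel
        | tmul c d =>
          simp only [LinearMap.rTensor_tmul, LinearMap.mulLeft_apply, deconc_ι_mul, add_tmul,
            map_add, TensorProduct.assoc_tmul]
          congr 1
          generalize B.deconc c = e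
          induction e with
          | zero => simp
          | add e f he hf => simp only [map_add, add_tmul, he, hf]
          | tmul e f => simp
      rw [B.words_cons, deconc_ι_mul, map_add, map_add, h1, ih]
      simp only [LinearMap.rTensor_tmul, deconc_one, TensorProduct.assoc_tmul, map_add,
        LinearMap.lTensor_tmul, deconc_ι_mul, tmul_add]
      rw [add_assoc]
      congr 2
      generalize B.deconc (B.words xs) = c
      induction c with
      | zero => simp
      | add c d hc hd => simp only [map_add, hc, hd]
      | tmul c d => simp
  exact LinearMap.congr_fun this a

end HomogBasis

/-! ### The deconcatenation of an insertion -/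

namespace PrimOps

open TensorAlgebra GrSpace TensorProduct

variable {K : Type u} [Field K] {V : PrimOps.{u, v} K} (B : HomogBasis.{u, v, w} V.toGrSpace)

/-- The linear extension of `insHead`. -/
noncomputable def headOp (acc : List B.X) (i : ℕ) (z : V.carrier) :
    Module.End K (TensorAlgebra K V.carrier) :=
  B.words.constr K fun xs => insHead B acc i xs z

theorem headOp_words (acc : List B.X) (i : ℕ) (z : V.carrier) (xs : List B.X) :
    headOp B acc i z (B.words xs) = insHead B acc i xs z := by
  rw [headOp, Module.Basis.constr_basis]

theorem headOp_comp_mulLeft (acc : List B.X) (i : ℕ) (z : V.carrier) (y : B.X) :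
    headOp B acc i z ∘ₗ LinearMap.mulLeft K (ι K (B.b y)) = if i ≤ B.deg y then
      LinearMap.mulLeft K (ι K (Lhat B i (B.words acc) (B.b y) z))
      else headOp B (acc ++ [y]) (i - B.deg y) z := by
  refine B.words.ext fun xs => ?_
  rw [LinearMap.comp_apply, LinearMap.mulLeft_apply, ← B.words_cons, headOp_words, insHead]
  split_ifs
  · simp
  · rw [headOp_words]

/-- The first letter of the new word absorbs everything up to the letter that receives `z`. The word
is cut before this letter or behind it; in the second case the left part arises in the same way from
the left part of `xs`. Cuts of `xs` before the receiving letter contribute nothing, since `insHead`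
vanishes when the letters run out. -/
theorem deconc_insHead (acc : List B.X) (i : ℕ) (z : V.carrier) (xs : List B.X) :
    B.deconc (insHead B acc i xs z) = 1 ⊗ₜ insHead B acc i xs z +
      (headOp B acc i z).rTensor _ (B.deconc (B.words xs)) := by
  have h1 : ∀ acc i, headOp B acc i z 1 = 0 := fun acc i => by
    rw [← B.words_nil, headOp_words]; rfl
  induction xs generalizing acc i with
  | nil => simp [insHead, B.words_nil, B.deconc_one, h1]
  | cons y s ih =>
    rw [B.words_cons, B.deconc_ι_mul, map_add, LinearMap.rTensor_tmul, h1, zero_tmul, zero_add,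
      ← LinearMap.comp_apply (f := LinearMap.rTensor _ (headOp B acc i z)), ← LinearMap.rTensor_comp,
      headOp_comp_mulLeft, insHead]
    split_ifs with h
    · simp [B.deconc_ι_mul]
    · exact ih _ _

/-- The effect of the insertion of `z` at the position `i` on a tensor `a ⊗ b`, according to
the degree of `a`. -/
noncomputable def pairOp (i : ℕ) (z : V.carrier) :
    TensorAlgebra K V.carrier ⊗[K] TensorAlgebra K V.carrier →ₗ[K]
      TensorAlgebra K V.carrier ⊗[K] TensorAlgebra K V.carrier :=
  TensorProduct.lift (B.words.constr K fun xs =>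
    (if B.wdeg xs ≤ i then
      TensorProduct.mk K _ _ (B.words xs) ∘ₗ insOp B (i - B.wdeg xs) z else 0) +
    if i ≤ B.wdeg xs then TensorProduct.mk K _ _ (insOp B i z (B.words xs)) else 0)

theorem pairOp_words_tmul (i : ℕ) (z : V.carrier) (xs : List B.X)
    (b : TensorAlgebra K V.carrier) : pairOp B i z (B.words xs ⊗ₜ b) =
      (if B.wdeg xs ≤ i then B.words xs ⊗ₜ insOp B (i - B.wdeg xs) z b else 0) +
      if i ≤ B.wdeg xs then insOp B i z (B.words xs) ⊗ₜ b else 0 := by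
  rw [pairOp, TensorProduct.lift.tmul, Module.Basis.constr_basis, LinearMap.add_apply]
  split_ifs <;> simp

theorem pairOp_tmul (i : ℕ) (z : V.carrier) {d : ℕ} {a : TensorAlgebra K V.carrier}
    (ha : a ∈ B.tgr d) (b : TensorAlgebra K V.carrier) : pairOp B i z (a ⊗ₜ b) =
      (if d ≤ i then a ⊗ₜ insOp B (i - d) z b else 0) +
      if i ≤ d then insOp B i z a ⊗ₜ b else 0 := by
  have := B.ext_of_mem_tgr (f := pairOp B i z ∘ₗ (TensorProduct.mk K _ _).flip b)
    (g := (if d ≤ i then (TensorProduct.mk K _ _).flip (insOp B (i - d) z b) else 0) +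
      if i ≤ d then (TensorProduct.mk K _ _).flip b ∘ₗ insOp B i z else 0) (fun xs hxs => ?_) ha
  · simp only [LinearMap.comp_apply, LinearMap.add_apply, LinearMap.flip_apply,
      TensorProduct.mk_apply] at this
    rw [this]
    split_ifs <;> simp
  · subst hxs
    simp only [LinearMap.comp_apply, LinearMap.add_apply, LinearMap.flip_apply,
      TensorProduct.mk_apply, pairOp_words_tmul]
    split_ifs <;> simp

/-- This is the recursion of `insOp` over the first letter, applied to the left tensor factor. When
that factor is too short to contain the position, its head part vanishes, which makes the case
distinctions on both sides agree. -/
theorem pairOp_comp_rTensor {i : ℕ} (hi : 0 < i) (z : V.carrier) (x : B.X) :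
    pairOp B i z ∘ₗ (LinearMap.mulLeft K (ι K (B.b x))).rTensor _ =
      (if B.deg x ≤ i then (LinearMap.mulLeft K (ι K (B.b x))).rTensor _ ∘ₗ
        pairOp B (i - B.deg x) z else 0) +
      (headOp B [] i z ∘ₗ LinearMap.mulLeft K (ι K (B.b x))).rTensor _ := by
  refine TensorProduct.ext ?_
  refine B.words.ext fun xs => LinearMap.ext fun b => ?_
  have h := insOp_words_cons B hi.ne' z x xs
  have h' := fun h => insHead_eq_zero B [] (x :: xs) (i := i) h
  rw [LinearMap.compr₂ₛₗ_apply, LinearMap.compr₂ₛₗ_apply, TensorProduct.mk_apply,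
    LinearMap.comp_apply, LinearMap.add_apply, LinearMap.rTensor_tmul, LinearMap.rTensor_tmul,
    LinearMap.comp_apply, LinearMap.mulLeft_apply]
  simp only [← B.words_cons, pairOp_words_tmul, headOp_words]
  rw [h]
  rw [B.wdeg_cons] at h' ⊢
  by_cases h1 : B.deg x ≤ i
  · simp only [h1, if_true, LinearMap.comp_apply, pairOp_words_tmul, map_add]
    rw [show i - (B.deg x + B.wdeg xs) = i - B.deg x - B.wdeg xs by omega]
    by_cases h2 : B.deg x + B.wdeg xs < i
    · rw [h' h2, if_pos (by omega), if_neg (by omega), if_pos (by omega), if_neg (by omega)]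
      simp [B.words_cons]
    · rw [if_pos (c := i ≤ _) (by omega), if_pos (c := i - _ ≤ _) (by omega)]
      by_cases h3 : B.deg x + B.wdeg xs ≤ i
      · rw [if_pos h3, if_pos (by omega)]
        simp [B.words_cons, add_tmul, add_assoc]
      · rw [if_neg h3, if_neg (by omega)]
        simp [add_tmul]
  · rw [if_neg h1, if_neg (by omega), if_neg h1, if_pos (by omega)]
    simp

/-- At position `0` the letter `z` enters the left factor for every cut, and it can enter the right
one only if the left factor has degree `0`. By positivity of the degrees this means that the left
factor is empty. -/
theorem deconc_insOp_zero (hV : V.IsGraded) (z : V.carrier) (xs : List B.X) :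
    B.deconc (insOp B 0 z (B.words xs)) = pairOp B 0 z (B.deconc (B.words xs)) := by
  rw [insOp_zero, B.deconc_ι_mul, B.deconc_words_eq_sum, map_sum, map_sum]
  have : ∀ r ∈ Finset.range (xs.length + 1),
      pairOp B 0 z (B.words (xs.take r) ⊗ₜ B.words (xs.drop r)) =
      (if r = 0 then 1 ⊗ₜ (ι K z * B.words xs) else 0) +
      (LinearMap.mulLeft K (ι K z)).rTensor _ (B.words (xs.take r) ⊗ₜ B.words (xs.drop r)) := by
    intro r hr
    rw [pairOp_words_tmul, if_pos (Nat.zero_le (B.wdeg _)), insOp_zero]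
    congr 1
    rcases Nat.eq_zero_or_pos r with rfl | hr0
    · rw [List.take_zero, B.wdeg_nil, if_pos le_rfl, if_pos rfl, insOp_zero, B.words_nil,
        List.drop_zero]
    · rw [if_neg, if_neg hr0.ne']
      cases xs with
      | nil => simp at hr; omega
      | cons x xs =>
        obtain ⟨r, rfl⟩ : ∃ r', r = r' + 1 := ⟨r - 1, by omega⟩
        have := B.deg_pos hV.positive x
        rw [List.take_succ_cons, B.wdeg_cons]
        omega
  rw [Finset.sum_congr rfl this, Finset.sum_add_distrib]
  simp

theorem deconc_insOp_words (hV : V.IsGraded) (i : ℕ) (z : V.carrier) (xs : List B.X) :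
    B.deconc (insOp B i z (B.words xs)) = pairOp B i z (B.deconc (B.words xs)) := by
  have h1 : ∀ i, 0 < i → ∀ b, pairOp B i z (1 ⊗ₜ b) = 1 ⊗ₜ insOp B i z b := fun i hi b => by
    rw [pairOp_tmul B i z B.one_mem_tgr, if_pos (Nat.zero_le _), if_neg (by omega), add_zero,
      Nat.sub_zero]
  induction xs generalizing i with
  | nil =>
    rcases Nat.eq_zero_or_pos i with rfl | hi
    · exact deconc_insOp_zero B hV z []
    · have h2 := insOp_words_eq_zero B z [] (i := i) (by rw [B.wdeg_nil]; exact hi)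
      rw [h2, B.words_nil, B.deconc_one, h1 i hi, ← B.words_nil, h2]
      simp
  | cons x xs ih =>
    rcases Nat.eq_zero_or_pos i with rfl | hi
    · exact deconc_insOp_zero B hV z (x :: xs)
    have e1 := B.deconc_ι_mul (B.b x) (B.words xs)
    rw [← B.words_cons] at e1
    have e3 := LinearMap.congr_fun (pairOp_comp_rTensor B hi z x) (B.deconc (B.words xs))
    have h0 : headOp B [] i z 1 = 0 := by rw [← B.words_nil, headOp_words]; rfl
    have e4 := deconc_insHead B [] i z (x :: xs)
    rw [e1, map_add, LinearMap.rTensor_tmul, h0, zero_tmul, zero_add, ← LinearMap.comp_apply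
      (f := LinearMap.rTensor _ (headOp B [] i z)), ← LinearMap.rTensor_comp] at e4
    rw [LinearMap.comp_apply] at e3
    rw [e1, map_add, e3, h1 i hi, insOp_words_cons B hi.ne', map_add, e4]
    split_ifs with h
    · rw [B.deconc_ι_mul, ih, LinearMap.add_apply, LinearMap.comp_apply, tmul_add]
      abel
    · simp

end PrimOps

/-! ### The deconcatenation of a product of two words -/

namespace PrimOps

open TensorAlgebra GrSpace TensorProduct

variable {K : Type u} [Field K] {V : PrimOps.{u, v} K} (B : HomogBasis.{u, v, w} V.toGrSpace)

theorem deconc_insOp (hV : V.IsGraded) (i : ℕ) (z : V.carrier) (a : TensorAlgebra K V.carrier) :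
    B.deconc (insOp B i z a) = pairOp B i z (B.deconc a) := by
  have : B.deconc ∘ₗ insOp B i z = pairOp B i z ∘ₗ B.deconc :=
    B.words.ext fun xs => deconc_insOp_words B hV i z xs
  exact LinearMap.congr_fun this a

theorem _root_.HomogBasis.wdeg_pos (hV : V.gr 0 = ⊥) {xs : List B.X} (h : xs ≠ []) :
    0 < B.wdeg xs := by
  cases xs with
  | nil => exact absurd rfl h
  | cons x xs =>
    have := B.deg_pos hV x
    rw [B.wdeg_cons]; omega

/-- The contribution of a splitting of a word into `w₁` and `w₂` to the coproduct. -/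
noncomputable def splitTerm (i : ℕ) (us w₁ w₂ : List B.X) :
    TensorAlgebra K V.carrier ⊗[K] TensorAlgebra K V.carrier :=
  if B.wdeg w₁ < i then B.words w₁ ⊗ₜ opHom B (i - B.wdeg w₁) (B.words us) (B.words w₂)
  else if B.wdeg w₁ = i then ∑ s ∈ Finset.range (us.length + 1),
    opHom B i (B.words (us.take s)) (B.words w₁) ⊗ₜ (B.words (us.drop s) * B.words w₂)
  else opHom B i (B.words us) (B.words w₁) ⊗ₜ B.words w₂

/-- Letters are inserted from the last to the first. When the cut is exactly at the position `i`, a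
letter can go to the right only while the left factor still has degree `i`. As soon as a letter has
gone to the left, so do all later ones. So the letters on the left form an initial segment of `us`,
and adding `x` only splits the summand in which this segment is empty. -/
theorem pairOp_splitTerm (hV : V.IsGraded) (i : ℕ) (x : B.X) (us w₁ w₂ : List B.X) :
    pairOp B i (B.b x) (splitTerm B i us w₁ w₂) = splitTerm B i (x :: us) w₁ w₂ := by
  unfold splitTerm
  split_ifs with h1 h2
  · rw [pairOp_words_tmul, if_pos h1.le, if_neg (by omega), add_zero, B.words_cons, opHom_ι_mul]
  · rw [map_sum, List.length_cons, Finset.sum_range_succ' _ (us.length + 1),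
      Finset.sum_range_succ', Finset.sum_range_succ' _ us.length]
    rw [List.take_zero, List.take_zero, B.words_nil, opHom_one, pairOp_words_tmul,
      if_pos h2.le, if_pos h2.ge, h2, Nat.sub_self, insOp_zero]
    have : ∀ s ∈ Finset.range us.length, pairOp B i (B.b x)
        (opHom B i (B.words (us.take (s + 1))) (B.words w₁) ⊗ₜ
          (B.words (us.drop (s + 1)) * B.words w₂)) =
        opHom B i (B.words ((x :: us).take (s + 1 + 1))) (B.words w₁) ⊗ₜ
          (B.words ((x :: us).drop (s + 1 + 1)) * B.words w₂) := by
      intro s hs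
      have h3 : 0 < B.wdeg (us.take (s + 1)) := by
        refine B.wdeg_pos hV.positive ?_
        rw [Ne, List.take_eq_nil_iff]
        rintro (h | rfl)
        · omega
        · simp at hs
      rw [pairOp_tmul B i _ (opHom_mem B hV h2.ge (B.words_mem_tgr _) (B.words_mem_tgr _)),
        if_neg (by omega), if_pos (by omega), zero_add, List.take_succ_cons, List.drop_succ_cons,
        B.words_cons, opHom_ι_mul]
    rw [Finset.sum_congr rfl this]
    simp only [List.drop_zero, zero_add, List.take_succ_cons, List.drop_succ_cons, List.take_zero,
      B.words_cons, B.words_nil, mul_one, opHom_ι, opHom_ι_mul, mul_assoc]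
    abel
  · rw [pairOp_tmul B i _ (opHom_mem B hV (by omega) (B.words_mem_tgr _) (B.words_mem_tgr _)),
      if_neg (by omega), if_pos (by omega), zero_add, B.words_cons, opHom_ι_mul]

theorem deconc_opHom_words (hV : V.IsGraded) (i : ℕ) (us ws : List B.X) :
    B.deconc (opHom B i (B.words us) (B.words ws)) =
      ∑ r ∈ Finset.range (ws.length + 1), splitTerm B i us (ws.take r) (ws.drop r) := by
  induction us with
  | nil =>
    rw [B.words_nil, opHom_one, B.deconc_words_eq_sum]
    refine Finset.sum_congr rfl fun r _ => ?_
    unfold splitTerm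
    split_ifs <;> simp [B.words_nil]
  | cons x us ih =>
    rw [B.words_cons, opHom_ι_mul, deconc_insOp B hV, ih, map_sum]
    exact Finset.sum_congr rfl fun r _ => pairOp_splitTerm B hV i x us _ _

end PrimOps

/-! ### The augmentation ideal of the tensor algebra as a preshuffle bialgebra -/

theorem Finsupp.isInternal_supported (K : Type*) [Field K] {α : Type*} (d : α → ℕ) :
    DirectSum.IsInternal fun n => Finsupp.supported K K {a : α | d a = n} := by
  apply DirectSum.isInternal_submodule_of_iSupIndep_of_iSup_eq_top
  · intro n
    have h : (⨆ j, ⨆ (_ : j ≠ n), Finsupp.supported K K {a : α | d a = j}) ≤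
        Finsupp.supported K K {a : α | d a ≠ n} :=
      iSup₂_le fun j hj => Finsupp.supported_mono fun a (ha : d a = j) => by
        simpa [ha] using hj
    refine Disjoint.mono_right h ((Finsupp.disjoint_supported_supported ?_))
    exact Set.disjoint_left.2 fun a ha hb => hb ha
  · rw [← Finsupp.supported_iUnion, ← Finsupp.supported_univ]
    congr 1
    ext a
    simp

namespace HomogBasis

open TensorAlgebra TensorProduct

variable {K : Type u} [Field K] {V : GrSpace.{u, v} K} (B : HomogBasis.{u, v, w} V)

/-- The nonempty words. -/
abbrev NEWord : Type w := {xs : List B.X // xs ≠ []}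

/-- The vector space spanned by the nonempty words. -/
abbrev Aug : Type (max u w) := B.NEWord →₀ K

/-- The component of degree `n` of the span of the nonempty words. -/
def augGr (n : ℕ) : Submodule K B.Aug := Finsupp.supported K K {a | B.wdeg a.1 = n}

theorem augGr_isInternal : DirectSum.IsInternal B.augGr :=
  Finsupp.isInternal_supported K fun a : B.NEWord => B.wdeg a.1

/-- The inclusion of the span of the nonempty words in the tensor algebra. -/
noncomputable def incl : B.Aug →ₗ[K] TensorAlgebra K V.carrier :=
  Finsupp.linearCombination K fun a : B.NEWord => B.words a.1

/-- The projection of the tensor algebra to the span of the nonempty words. -/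
noncomputable def aug : TensorAlgebra K V.carrier →ₗ[K] B.Aug :=
  B.words.constr K fun xs => if h : xs ≠ [] then Finsupp.single ⟨xs, h⟩ 1 else 0

theorem incl_single (a : B.NEWord) : B.incl (Finsupp.single a 1) = B.words a.1 := by
  simp [incl]

theorem aug_words {xs : List B.X} (h : xs ≠ []) :
    B.aug (B.words xs) = Finsupp.single ⟨xs, h⟩ 1 := by
  rw [aug, Module.Basis.constr_basis, dif_pos h]

theorem aug_one : B.aug 1 = 0 := by
  rw [← B.words_nil, aug, Module.Basis.constr_basis, dif_neg (by simp)]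

theorem aug_incl (x : B.Aug) : B.aug (B.incl x) = x := by
  have : B.aug ∘ₗ B.incl = LinearMap.id := by
    ext a : 2
    simp only [LinearMap.comp_apply, Finsupp.lsingle_apply, incl_single]
    exact B.aug_words a.2
  exact LinearMap.congr_fun this x

theorem incl_aug_words {xs : List B.X} (h : xs ≠ []) :
    B.incl (B.aug (B.words xs)) = B.words xs := by
  rw [B.aug_words h, incl_single]

theorem incl_aug_of_mem {n : ℕ} (hn : 0 < n) {a : TensorAlgebra K V.carrier} (ha : a ∈ B.tgr n) :
    B.incl (B.aug a) = a := by
  refine B.ext_of_mem_tgr (f := B.incl ∘ₗ B.aug) (g := LinearMap.id) (fun xs hxs => ?_) ha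
  refine B.incl_aug_words ?_
  rintro rfl
  rw [B.wdeg_nil] at hxs
  omega

theorem augGr_le {n : ℕ} {M : Submodule K B.Aug}
    (h : ∀ a : B.NEWord, B.wdeg a.1 = n → Finsupp.single a 1 ∈ M) : B.augGr n ≤ M := by
  rw [augGr, Finsupp.supported_eq_span_single, Submodule.span_le]
  rintro _ ⟨a, ha, rfl⟩
  exact h a ha

theorem single_mem_augGr (a : B.NEWord) :
    (Finsupp.single a 1 : B.Aug) ∈ B.augGr (B.wdeg a.1) :=
  Finsupp.single_mem_supported K _ rfl

theorem incl_mem {n : ℕ} {x : B.Aug} (hx : x ∈ B.augGr n) : B.incl x ∈ B.tgr n := by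
  refine B.augGr_le (M := (B.tgr n).comap B.incl) (fun a ha => ?_) hx
  rw [Submodule.mem_comap, incl_single, ← ha]
  exact B.words_mem_tgr _

theorem aug_mem {n : ℕ} {a : TensorAlgebra K V.carrier} (ha : a ∈ B.tgr n) :
    B.aug a ∈ B.augGr n := by
  refine B.tgr_le (M := (B.augGr n).comap B.aug) (fun xs hxs => ?_) ha
  rw [Submodule.mem_comap]
  by_cases h : xs = []
  · subst h
    rw [B.words_nil, aug_one]
    exact zero_mem _
  · rw [B.aug_words h, ← hxs]
    exact B.single_mem_augGr ⟨xs, h⟩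

theorem augGr_zero (hV : V.gr 0 = ⊥) : B.augGr 0 = ⊥ := by
  rw [eq_bot_iff]
  refine B.augGr_le fun a ha => ?_
  exfalso
  obtain ⟨xs, hxs⟩ := a
  cases xs with
  | nil => exact hxs rfl
  | cons x xs =>
    have := B.deg_pos hV x
    rw [B.wdeg_cons] at ha
    omega

/-- The reduced deconcatenation coproduct. -/
noncomputable def augΔ : B.Aug →ₗ[K] B.Aug ⊗[K] B.Aug :=
  TensorProduct.map B.aug B.aug ∘ₗ B.deconc ∘ₗ B.incl

theorem augΔ_single (a : B.NEWord) : B.augΔ (Finsupp.single a 1) =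
    ∑ r ∈ Finset.range (a.1.length + 1),
      B.aug (B.words (a.1.take r)) ⊗ₜ B.aug (B.words (a.1.drop r)) := by
  rw [augΔ, LinearMap.comp_apply, LinearMap.comp_apply, incl_single, deconc_words_eq_sum, map_sum]
  rfl

theorem augΔ_aug (a : TensorAlgebra K V.carrier) :
    B.augΔ (B.aug a) = TensorProduct.map B.aug B.aug (B.deconc a) := by
  have : B.augΔ ∘ₗ B.aug = TensorProduct.map B.aug B.aug ∘ₗ B.deconc := by
    refine B.words.ext fun xs => ?_
    rw [LinearMap.comp_apply, LinearMap.comp_apply]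
    by_cases h : xs = []
    · subst h
      rw [B.words_nil, aug_one, map_zero, deconc_one, TensorProduct.map_tmul, aug_one, zero_tmul]
    · rw [augΔ, LinearMap.comp_apply, LinearMap.comp_apply, B.incl_aug_words h]
  exact LinearMap.congr_fun this a

theorem augΔ_coassoc (x : B.Aug) : TensorProduct.assoc K _ _ _ (B.augΔ.rTensor _ (B.augΔ x)) =
    B.augΔ.lTensor _ (B.augΔ x) := by
  have h1 : ∀ c, B.augΔ.rTensor _ (TensorProduct.map B.aug B.aug c) =
      TensorProduct.map (TensorProduct.map B.aug B.aug) B.aug (B.deconc.rTensor _ c) := by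
    intro c
    induction c with
    | zero => simp
    | add c d hc hd => simp only [map_add, hc, hd]
    | tmul c d => simp [augΔ_aug]
  have h2 : ∀ c, B.augΔ.lTensor _ (TensorProduct.map B.aug B.aug c) =
      TensorProduct.map B.aug (TensorProduct.map B.aug B.aug) (B.deconc.lTensor _ c) := by
    intro c
    induction c with
    | zero => simp
    | add c d hc hd => simp only [map_add, hc, hd]
    | tmul c d => simp [augΔ_aug]
  have h3 : B.augΔ x = TensorProduct.map B.aug B.aug (B.deconc (B.incl x)) := rfl
  rw [h3, h1, h2, ← deconc_coassoc, TensorProduct.map_map_assoc]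

theorem augΔ_graded {n : ℕ} {x : B.Aug} (hx : x ∈ B.augGr n) : B.augΔ x ∈
    ⨆ p : {p : ℕ × ℕ // p.1 + p.2 = n}, LinearMap.range
      (TensorProduct.map (B.augGr p.1.1).subtype (B.augGr p.1.2).subtype) := by
  rw [← Submodule.mem_comap]
  refine B.augGr_le (fun a ha => ?_) hx
  rw [Submodule.mem_comap, augΔ_single]
  refine Submodule.sum_mem _ fun r _ => ?_
  refine Submodule.mem_iSup_of_mem
    ⟨(B.wdeg (a.1.take r), B.wdeg (a.1.drop r)), ?_⟩ ?_
  · rw [← B.wdeg_append, List.take_append_drop, ha]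
  · exact ⟨⟨_, B.aug_mem (B.words_mem_tgr _)⟩ ⊗ₜ ⟨_, B.aug_mem (B.words_mem_tgr _)⟩, rfl⟩

end HomogBasis

/-! ### The operations on the nonempty words -/

namespace PrimOps

open TensorAlgebra GrSpace TensorProduct

variable {K : Type u} [Field K] {V : PrimOps.{u, v} K} (B : HomogBasis.{u, v, w} V.toGrSpace)

/-- The operation `•ᵢ` on the span of the nonempty words. -/
noncomputable def augOp (i : ℕ) : B.Aug →ₗ[K] B.Aug →ₗ[K] B.Aug :=
  ((opHom B i).toLinearMap.compl₁₂ B.incl B.incl).compr₂ B.aug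

theorem augOp_apply (i : ℕ) (x y : B.Aug) :
    augOp B i x y = B.aug (opHom B i (B.incl x) (B.incl y)) := rfl

theorem augOp_aug_aug (i : ℕ) {us ws : List B.X} (hu : us ≠ []) (hw : ws ≠ []) :
    augOp B i (B.aug (B.words us)) (B.aug (B.words ws)) =
      B.aug (opHom B i (B.words us) (B.words ws)) := by
  rw [augOp_apply, B.incl_aug_words hu, B.incl_aug_words hw]

theorem incl_augOp (hV : V.IsGraded) {i m : ℕ} (x : B.Aug) {y : B.Aug} (hy : y ∈ B.augGr m)
    (hi : i ≤ m) : B.incl (augOp B i x y) = opHom B i (B.incl x) (B.incl y) := by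
  rcases Nat.eq_zero_or_pos m with rfl | hm
  · rw [B.augGr_zero hV.positive, Submodule.mem_bot] at hy
    simp [hy]
  have : B.incl ∘ₗ (augOp B i).flip y = (opHom B i).toLinearMap.flip (B.incl y) ∘ₗ B.incl := by
    ext a : 2
    simp only [LinearMap.comp_apply, LinearMap.flip_apply, augOp_apply, Finsupp.lsingle_apply,
      AlgHom.toLinearMap_apply, B.incl_single]
    exact B.incl_aug_of_mem (by omega)
      (opHom_mem B hV hi (B.words_mem_tgr a.1) (B.incl_mem hy))
  exact LinearMap.congr_fun this x

theorem augOp_mem (hV : V.IsGraded) {i n m : ℕ} {x y : B.Aug} (hx : x ∈ B.augGr n)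
    (hy : y ∈ B.augGr m) (hi : i ≤ m) : augOp B i x y ∈ B.augGr (n + m) :=
  B.aug_mem (opHom_mem B hV hi (B.incl_mem hx) (B.incl_mem hy))

/-- The last letter of the left factor is inserted first, and already for it the position is out of
range. -/
theorem augOp_eq_zero {i m : ℕ} (x : B.Aug) {y : B.Aug} (hy : y ∈ B.augGr m) (hi : m < i) :
    augOp B i x y = 0 := by
  have h : ∀ us : List B.X, us ≠ [] → ∀ a ∈ B.tgr m, opHom B i (B.words us) a = 0 := by
    intro us
    induction us with
    | nil => intro h; exact absurd rfl h
    | cons u us ih =>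
      intro _ a ha
      rw [B.words_cons, opHom_ι_mul]
      by_cases h0 : us = []
      · subst h0
        rw [B.words_nil, opHom_one]
        exact B.ext_of_mem_tgr (g := 0)
          (fun xs hxs => insOp_words_eq_zero B _ xs (hxs.trans_lt hi)) ha
      · rw [ih h0 a ha, map_zero]
  have : (augOp B i).flip y = 0 := by
    ext a : 2
    simp only [LinearMap.comp_apply, LinearMap.flip_apply, augOp_apply, Finsupp.lsingle_apply,
      B.incl_single, h a.1 a.2 _ (B.incl_mem hy), map_zero, LinearMap.zero_apply]
  exact LinearMap.congr_fun this x

end PrimOps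

namespace PrimPshAlgebra

open TensorAlgebra GrSpace TensorProduct PrimOps

variable {K : Type u} [Field K] (V : PrimPshAlgebra.{u, v} K)
  (B : HomogBasis.{u, v, w} V.toGrSpace)

/-- The augmentation ideal of the tensor algebra of `V` as a preshuffle algebra. -/
noncomputable def augPsh : PreshuffleAlgebra.{u, max u w} K where
  carrier := B.Aug
  gr := B.augGr
  internal := B.augGr_isInternal
  op := augOp B
  op_mem := fun _ _ _ _ _ hx hy hi => augOp_mem B V.isGraded hx hy hi
  op_eq_zero := fun _ _ x _ hy hi => augOp_eq_zero B x hy hi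
  op_assoc := fun i j m r x y z hy hz hi hj => by
    rw [augOp_apply B j, incl_augOp B V.isGraded x hy hi,
      opHom_opHom B _ (B.incl_mem hy) hi (B.incl_mem hz) hj, augOp_apply B (i + j),
      incl_augOp B V.isGraded y hz hj]

end PrimPshAlgebra

/-! ### The compatibility conditions as bilinear identities -/

namespace PreshuffleAlgebra

open TensorProduct

variable {K : Type u} [Field K] (A : PreshuffleAlgebra.{u, v} K)
  (Δ : A.carrier →ₗ[K] A.carrier ⊗[K] A.carrier)

/-- The right-hand side of the compatibility condition for `0 < i < |y|`. -/
noncomputable def midRhs (i m : ℕ) (x y : A.carrier) : A.carrier ⊗[K] A.carrier :=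
  ∑ a ∈ Finset.range (i + 1), (A.op (i - a) x).lTensor A.carrier (A.toGrSpace.copPart Δ a y)
    + TensorProduct.map₂ (A.op i) (A.op 0) (Δ x) (A.toGrSpace.copPart Δ i y)
    + ∑ a ∈ Finset.Icc i m, (A.op i x).rTensor A.carrier (A.toGrSpace.copPart Δ a y)

/-- The right-hand side of the compatibility condition for `i = |y|`. -/
noncomputable def topRhs (m : ℕ) (x y : A.carrier) : A.carrier ⊗[K] A.carrier :=
  ∑ a ∈ Finset.range (m + 1), (A.op (m - a) x).lTensor A.carrier (A.toGrSpace.copPart Δ a y)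
    + y ⊗ₜ[K] x + ((A.op m).flip y).rTensor A.carrier (Δ x)

/-- The right-hand side of the compatibility condition for `i = 0`. -/
noncomputable def zeroRhs (x y : A.carrier) : A.carrier ⊗[K] A.carrier :=
  ((A.op 0).flip y).lTensor A.carrier (Δ x) + x ⊗ₜ[K] y + (A.op 0 x).rTensor A.carrier (Δ y)

theorem copPart_add (a : ℕ) (y y' : A.carrier) : A.toGrSpace.copPart Δ a (y + y') =
    A.toGrSpace.copPart Δ a y + A.toGrSpace.copPart Δ a y' := by simp [GrSpace.copPart]

theorem copPart_smul (a : ℕ) (c : K) (y : A.carrier) : A.toGrSpace.copPart Δ a (c • y) =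
    c • A.toGrSpace.copPart Δ a y := by simp [GrSpace.copPart]

end PreshuffleAlgebra

namespace PreshuffleAlgebra

open TensorProduct

variable {K : Type u} [Field K] (A : PreshuffleAlgebra.{u, v} K)
  (Δ : A.carrier →ₗ[K] A.carrier ⊗[K] A.carrier)

/-- `midRhs` as a bilinear map. -/
theorem midRhs_bilin (i m : ℕ) : ∃ F : A.carrier →ₗ[K] A.carrier →ₗ[K] A.carrier ⊗[K] A.carrier,
    ∀ x y, F x y = A.midRhs Δ i m x y := by
  refine ⟨LinearMap.mk₂ K (A.midRhs Δ i m) ?_ ?_ ?_ ?_, fun x y => rfl⟩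
  · intro x x' y
    simp only [midRhs, map_add, LinearMap.lTensor_add, LinearMap.rTensor_add, LinearMap.add_apply,
      Finset.sum_add_distrib]
    abel
  · intro c x y
    simp only [midRhs, map_smul, LinearMap.lTensor_smul, LinearMap.rTensor_smul,
      LinearMap.smul_apply, ← Finset.smul_sum, smul_add]
  · intro x y y'
    simp only [midRhs, map_add, copPart_add, Finset.sum_add_distrib]
    abel
  · intro c x y
    simp only [midRhs, map_smul, copPart_smul, ← Finset.smul_sum, smul_add]

theorem topRhs_bilin (m : ℕ) : ∃ F : A.carrier →ₗ[K] A.carrier →ₗ[K] A.carrier ⊗[K] A.carrier,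
    ∀ x y, F x y = A.topRhs Δ m x y := by
  refine ⟨LinearMap.mk₂ K (A.topRhs Δ m) ?_ ?_ ?_ ?_, fun x y => rfl⟩
  · intro x x' y
    simp only [topRhs, map_add, LinearMap.lTensor_add, LinearMap.add_apply, tmul_add,
      Finset.sum_add_distrib]
    abel
  · intro c x y
    simp only [topRhs, map_smul, LinearMap.lTensor_smul, tmul_smul,
      LinearMap.smul_apply, ← Finset.smul_sum, smul_add]
  · intro x y y'
    simp only [topRhs, map_add, copPart_add, Finset.sum_add_distrib, add_tmul,
      LinearMap.rTensor_add, LinearMap.add_apply]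
    abel
  · intro c x y
    simp only [topRhs, map_smul, copPart_smul, ← Finset.smul_sum, smul_add, smul_tmul',
      LinearMap.rTensor_smul, LinearMap.smul_apply]

theorem zeroRhs_bilin : ∃ F : A.carrier →ₗ[K] A.carrier →ₗ[K] A.carrier ⊗[K] A.carrier,
    ∀ x y, F x y = A.zeroRhs Δ x y := by
  refine ⟨LinearMap.mk₂ K (A.zeroRhs Δ) ?_ ?_ ?_ ?_, fun x y => rfl⟩
  · intro x x' y
    simp only [zeroRhs, map_add, LinearMap.rTensor_add, LinearMap.add_apply, add_tmul]
    abel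
  · intro c x y
    simp only [zeroRhs, map_smul, LinearMap.rTensor_smul, smul_tmul',
      LinearMap.smul_apply, smul_add]
  · intro x y y'
    simp only [zeroRhs, map_add, tmul_add, LinearMap.lTensor_add, LinearMap.add_apply]
    abel
  · intro c x y
    simp only [zeroRhs, map_smul, smul_add, tmul_smul, LinearMap.lTensor_smul,
      LinearMap.smul_apply]

end PreshuffleAlgebra

/-! ### The compatibility conditions for words -/

namespace PrimOps

open TensorAlgebra GrSpace TensorProduct

variable {K : Type u} [Field K] {V : PrimOps.{u, v} K} (B : HomogBasis.{u, v, w} V.toGrSpace)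

theorem _root_.HomogBasis.aug_words_nil {V : GrSpace.{u, v} K} (B : HomogBasis.{u, v, w} V) :
    B.aug (B.words []) = 0 := by
  rw [B.words_nil, B.aug_one]

theorem map_aug_splitTerm_lt {i : ℕ} {us w₁ w₂ : List B.X} (hu : us ≠ []) (hw : w₂ ≠ [])
    (h : B.wdeg w₁ < i) : TensorProduct.map B.aug B.aug (splitTerm B i us w₁ w₂) =
      B.aug (B.words w₁) ⊗ₜ augOp B (i - B.wdeg w₁) (B.aug (B.words us)) (B.aug (B.words w₂)) := by
  rw [splitTerm, if_pos h, TensorProduct.map_tmul, augOp_aug_aug B _ hu hw]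

theorem map_aug_splitTerm_gt {i : ℕ} {us w₁ w₂ : List B.X} (hu : us ≠ []) (hw : w₁ ≠ [])
    (h : i < B.wdeg w₁) : TensorProduct.map B.aug B.aug (splitTerm B i us w₁ w₂) =
      augOp B i (B.aug (B.words us)) (B.aug (B.words w₁)) ⊗ₜ B.aug (B.words w₂) := by
  rw [splitTerm, if_neg (by omega), if_neg (by omega), TensorProduct.map_tmul,
    augOp_aug_aug B _ hu hw]

theorem take_ne_nil {α : Type*} {us : List α} {s : ℕ} (hu : us ≠ []) (hs : s ≠ 0) :
    us.take s ≠ [] := by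
  rw [Ne, List.take_eq_nil_iff]; tauto

theorem drop_ne_nil {α : Type*} {us : List α} {s : ℕ} (hs : s < us.length) :
    us.drop s ≠ [] := by
  rw [Ne, List.drop_eq_nil_iff]; omega

/-- The proper splittings of `us` give the middle sum of the condition for `0 < i < |y|`. The two
improper ones, which the reduced coproduct of `us` omits, are the terms of the first and the last
sum with `|y₍₁₎| = i`. -/
theorem map_aug_splitTerm_eq {i : ℕ} {us w₁ w₂ : List B.X} (hu : us ≠ []) (hw₁ : w₁ ≠ [])
    (hw₂ : w₂ ≠ []) (h : B.wdeg w₁ = i) :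
    TensorProduct.map B.aug B.aug (splitTerm B i us w₁ w₂) =
      B.aug (B.words w₁) ⊗ₜ augOp B 0 (B.aug (B.words us)) (B.aug (B.words w₂)) +
      TensorProduct.map₂ (augOp B i) (augOp B 0)
        (∑ s ∈ Finset.range (us.length + 1),
          B.aug (B.words (us.take s)) ⊗ₜ B.aug (B.words (us.drop s)))
        (B.aug (B.words w₁) ⊗ₜ B.aug (B.words w₂)) +
      augOp B i (B.aug (B.words us)) (B.aug (B.words w₁)) ⊗ₜ B.aug (B.words w₂) := by
  have hl : us.length ≠ 0 := by simpa using hu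
  have hul : ∀ s ∈ Finset.range (us.length + 1), TensorProduct.map B.aug B.aug
      (opHom B i (B.words (us.take s)) (B.words w₁) ⊗ₜ (B.words (us.drop s) * B.words w₂)) =
      (if s = 0 then
        B.aug (B.words w₁) ⊗ₜ augOp B 0 (B.aug (B.words us)) (B.aug (B.words w₂)) else 0) +
      TensorProduct.map₂ (augOp B i) (augOp B 0)
        (B.aug (B.words (us.take s)) ⊗ₜ B.aug (B.words (us.drop s)))
        (B.aug (B.words w₁) ⊗ₜ B.aug (B.words w₂)) +
      (if s = us.length then
        augOp B i (B.aug (B.words us)) (B.aug (B.words w₁)) ⊗ₜ B.aug (B.words w₂) else 0) := by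
    intro s hs
    rw [Finset.mem_range] at hs
    rw [TensorProduct.map_tmul, TensorProduct.map₂_apply_tmul, TensorProduct.map_tmul,
      ← opHom_zero B]
    by_cases h0 : s = 0
    · subst h0
      rw [if_pos rfl, if_neg (Ne.symm hl), List.take_zero, List.drop_zero, B.aug_words_nil,
        B.words_nil, opHom_one, map_zero, LinearMap.zero_apply, zero_tmul,
        augOp_aug_aug B _ hu hw₂, add_zero, add_zero]
    · rw [if_neg h0, zero_add]
      by_cases h1 : s = us.length
      · subst h1
        rw [if_pos rfl, List.take_length, List.drop_length, B.aug_words_nil, map_zero,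
          LinearMap.zero_apply, tmul_zero, zero_add, B.words_nil, opHom_one,
          augOp_aug_aug B _ hu hw₁]
      · rw [if_neg h1, add_zero, augOp_aug_aug B _ (take_ne_nil hu h0) hw₁,
          augOp_aug_aug B _ (drop_ne_nil (by omega)) hw₂]
  rw [splitTerm, if_neg (by omega), if_pos h, map_sum, Finset.sum_congr rfl hul,
    Finset.sum_add_distrib, Finset.sum_add_distrib, Finset.sum_ite_eq', Finset.sum_ite_eq',
    if_pos (by simp), if_pos (by simp), map_sum, LinearMap.sum_apply]

/-- The cut at the very end of the second word, relevant for `i = |y|`: if all of `us` goes to the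
right, the term is `y ⊗ x`; the term with all of `us` on the left has an empty right factor and is
lost in the reduction. -/
theorem map_aug_splitTerm_nil {i : ℕ} {us w₁ : List B.X} (hu : us ≠ []) (hw₁ : w₁ ≠ [])
    (h : B.wdeg w₁ = i) :
    TensorProduct.map B.aug B.aug (splitTerm B i us w₁ []) =
      B.aug (B.words w₁) ⊗ₜ B.aug (B.words us) +
      ((augOp B i).flip (B.aug (B.words w₁))).rTensor _
        (∑ s ∈ Finset.range (us.length + 1),
          B.aug (B.words (us.take s)) ⊗ₜ B.aug (B.words (us.drop s))) := by
  have hul : ∀ s ∈ Finset.range (us.length + 1), TensorProduct.map B.aug B.aug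
      (opHom B i (B.words (us.take s)) (B.words w₁) ⊗ₜ (B.words (us.drop s) * B.words [])) =
      (if s = 0 then B.aug (B.words w₁) ⊗ₜ B.aug (B.words us) else 0) +
      ((augOp B i).flip (B.aug (B.words w₁))).rTensor _
        (B.aug (B.words (us.take s)) ⊗ₜ B.aug (B.words (us.drop s))) := by
    intro s hs
    rw [Finset.mem_range] at hs
    rw [TensorProduct.map_tmul, B.words_nil, mul_one, LinearMap.rTensor_tmul, LinearMap.flip_apply]
    by_cases h0 : s = 0
    · subst h0
      rw [if_pos rfl, List.take_zero, List.drop_zero, B.aug_words_nil, B.words_nil, opHom_one,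
        map_zero, LinearMap.zero_apply, zero_tmul, add_zero]
    · rw [if_neg h0, zero_add, augOp_aug_aug B _ (take_ne_nil hu h0) hw₁]
  rw [splitTerm, if_neg (by omega), if_pos h, map_sum, Finset.sum_congr rfl hul,
    Finset.sum_add_distrib, Finset.sum_ite_eq', if_pos (by simp), map_sum]

/-- The cut at the very beginning of the second word, relevant for `i = 0`: the term with all of
`us` on the left is `x ⊗ y`, and the proper splittings give the first sum of the condition. -/
theorem map_aug_splitTerm_zero {us w₂ : List B.X} (hw₂ : w₂ ≠ []) :
    TensorProduct.map B.aug B.aug (splitTerm B 0 us [] w₂) =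
      ((augOp B 0).flip (B.aug (B.words w₂))).lTensor _
        (∑ s ∈ Finset.range (us.length + 1),
          B.aug (B.words (us.take s)) ⊗ₜ B.aug (B.words (us.drop s))) +
      B.aug (B.words us) ⊗ₜ B.aug (B.words w₂) := by
  have hul : ∀ s ∈ Finset.range (us.length + 1), TensorProduct.map B.aug B.aug
      (opHom B 0 (B.words (us.take s)) (B.words []) ⊗ₜ (B.words (us.drop s) * B.words w₂)) =
      ((augOp B 0).flip (B.aug (B.words w₂))).lTensor _
        (B.aug (B.words (us.take s)) ⊗ₜ B.aug (B.words (us.drop s))) +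
      (if s = us.length then B.aug (B.words us) ⊗ₜ B.aug (B.words w₂) else 0) := by
    intro s hs
    rw [Finset.mem_range] at hs
    rw [TensorProduct.map_tmul, opHom_zero, B.words_nil, mul_one, LinearMap.lTensor_tmul,
      LinearMap.flip_apply]
    by_cases h0 : s = us.length
    · subst h0
      rw [if_pos rfl, List.take_length, List.drop_length, B.aug_words_nil, B.words_nil,
        one_mul, map_zero, LinearMap.zero_apply, tmul_zero, zero_add]
    · rw [if_neg h0, add_zero, augOp_aug_aug B _ (drop_ne_nil (by omega)) hw₂, opHom_zero]
  rw [splitTerm, if_neg (Nat.not_lt_zero _), if_pos B.wdeg_nil, map_sum, Finset.sum_congr rfl hul,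
    Finset.sum_add_distrib, Finset.sum_ite_eq', if_pos (by simp), map_sum]

end PrimOps

namespace PrimPshAlgebra

open TensorAlgebra GrSpace TensorProduct PrimOps

variable {K : Type u} [Field K] (V : PrimPshAlgebra.{u, v} K)
  (B : HomogBasis.{u, v, w} V.toGrSpace)

theorem copPart_augΔ (a : ℕ) {ws : List B.X} (hw : ws ≠ []) :
    (V.augPsh B).toGrSpace.copPart B.augΔ a (B.aug (B.words ws)) =
      ∑ r ∈ Finset.range (ws.length + 1), if B.wdeg (ws.take r) = a then
        B.aug (B.words (ws.take r)) ⊗ₜ[K] B.aug (B.words (ws.drop r)) else 0 := by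
  have h1 : B.augΔ (B.aug (B.words ws)) = ∑ r ∈ Finset.range (ws.length + 1),
      B.aug (B.words (ws.take r)) ⊗ₜ[K] B.aug (B.words (ws.drop r)) := by
    rw [B.aug_words hw, B.augΔ_single]
  unfold GrSpace.copPart
  erw [h1, map_sum]
  refine Finset.sum_congr rfl fun r _ => ?_
  have h2 := (V.augPsh B).toGrSpace.proj_of_mem_eq_ite (n := a)
    (show B.aug (B.words (ws.take r)) ∈ (V.augPsh B).gr (B.wdeg (ws.take r)) from
      B.aug_mem (B.words_mem_tgr _))
  erw [LinearMap.rTensor_tmul, h2]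
  by_cases h : B.wdeg (ws.take r) = a
  · erw [if_pos h, if_pos h]; rfl
  · erw [if_neg h, if_neg h]
    exact zero_tmul _ _

theorem augΔ_augOp_words (i : ℕ) {us ws : List B.X} (hu : us ≠ []) (hw : ws ≠ []) :
    B.augΔ (augOp B i (B.aug (B.words us)) (B.aug (B.words ws))) =
      ∑ r ∈ Finset.range (ws.length + 1),
        TensorProduct.map B.aug B.aug (splitTerm B i us (ws.take r) (ws.drop r)) := by
  rw [augOp_aug_aug B _ hu hw, B.augΔ_aug, deconc_opHom_words B V.isGraded, map_sum]

theorem augΔ_words {us : List B.X} (hu : us ≠ []) :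
    B.augΔ (B.aug (B.words us)) = ∑ s ∈ Finset.range (us.length + 1),
      B.aug (B.words (us.take s)) ⊗ₜ[K] B.aug (B.words (us.drop s)) := by
  rw [B.aug_words hu, B.augΔ_single]

/-- For each cut of `ws`, the degree of the left part is compared with `i`. The inequalities `0 < i
< |ws|` guarantee that the part receiving letters is not empty, and a single cut contributes to all
three sums exactly when that degree is `i`. -/
theorem augΔ_augOp_mid_words {i : ℕ} {us ws : List B.X} (hu : us ≠ []) (hw : ws ≠ [])
    (h0 : 0 < i) (hi : i < B.wdeg ws) (cp : ℕ → B.Aug ⊗[K] B.Aug)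
    (hcp : ∀ a, cp a = ∑ r ∈ Finset.range (ws.length + 1), if B.wdeg (ws.take r) = a then
        B.aug (B.words (ws.take r)) ⊗ₜ[K] B.aug (B.words (ws.drop r)) else 0) :
    B.augΔ (augOp B i (B.aug (B.words us)) (B.aug (B.words ws))) =
      ∑ a ∈ Finset.range (i + 1), (augOp B (i - a) (B.aug (B.words us))).lTensor B.Aug (cp a)
      + TensorProduct.map₂ (augOp B i) (augOp B 0) (B.augΔ (B.aug (B.words us))) (cp i)
      + ∑ a ∈ Finset.Icc i (B.wdeg ws), (augOp B i (B.aug (B.words us))).rTensor B.Aug (cp a) := by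
  have hle : ∀ r, B.wdeg (ws.take r) + B.wdeg (ws.drop r) = B.wdeg ws := fun r => by
    rw [← B.wdeg_append, List.take_append_drop]
  rw [augΔ_augOp_words V B i hu hw]
  simp only [hcp, map_sum, apply_ite, map_zero]
  rw [Finset.sum_comm, Finset.sum_comm (s := Finset.Icc _ _), ← Finset.sum_add_distrib,
    ← Finset.sum_add_distrib]
  refine Finset.sum_congr rfl fun r _ => ?_
  rw [Finset.sum_ite_eq, Finset.sum_ite_eq]
  have hr := hle r
  simp only [Finset.mem_range, Finset.mem_Icc]
  rcases lt_trichotomy (B.wdeg (ws.take r)) i with h | h | h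
  · have hd : ws.drop r ≠ [] := by
      intro hd
      rw [hd, B.wdeg_nil] at hr
      omega
    rw [if_pos (by omega), if_neg (by omega), if_neg (by omega), add_zero, add_zero,
      map_aug_splitTerm_lt B hu hd h, LinearMap.lTensor_tmul]
  · have hd : ws.drop r ≠ [] := by
      intro hd
      rw [hd, B.wdeg_nil] at hr
      omega
    have ht : ws.take r ≠ [] := by
      intro ht
      rw [ht, B.wdeg_nil] at h
      omega
    rw [if_pos (by omega), if_pos h, if_pos (by omega), map_aug_splitTerm_eq B hu ht hd h, h,
      Nat.sub_self, LinearMap.lTensor_tmul, LinearMap.rTensor_tmul, augΔ_words V B hu]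
  · have ht : ws.take r ≠ [] := by
      intro ht
      rw [ht, B.wdeg_nil] at h
      omega
    rw [if_neg (by omega), if_neg (by omega), if_pos (by omega), add_zero, zero_add,
      map_aug_splitTerm_gt B hu ht h, LinearMap.rTensor_tmul]

/-- By positivity of the degrees, the only cut of `ws` whose left part reaches the degree `|ws|` is
the one at the end. -/
theorem augΔ_augOp_top_words {us ws : List B.X} (hu : us ≠ []) (hw : ws ≠ [])
    (cp : ℕ → B.Aug ⊗[K] B.Aug)
    (hcp : ∀ a, cp a = ∑ r ∈ Finset.range (ws.length + 1), if B.wdeg (ws.take r) = a then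
        B.aug (B.words (ws.take r)) ⊗ₜ[K] B.aug (B.words (ws.drop r)) else 0) :
    B.augΔ (augOp B (B.wdeg ws) (B.aug (B.words us)) (B.aug (B.words ws))) =
      ∑ a ∈ Finset.range (B.wdeg ws + 1),
        (augOp B (B.wdeg ws - a) (B.aug (B.words us))).lTensor B.Aug (cp a)
      + B.aug (B.words ws) ⊗ₜ B.aug (B.words us)
      + ((augOp B (B.wdeg ws)).flip (B.aug (B.words ws))).rTensor B.Aug
          (B.augΔ (B.aug (B.words us))) := by
  rw [augΔ_augOp_words V B _ hu hw]
  simp only [hcp, map_sum, apply_ite, map_zero]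
  rw [Finset.sum_comm, Finset.sum_range_succ, Finset.sum_range_succ (fun r => ∑ a ∈ _, _),
    List.take_length, List.drop_length, map_aug_splitTerm_nil B hu hw rfl, add_assoc, add_assoc,
    augΔ_words V B hu]
  congr 1
  · refine Finset.sum_congr rfl fun r hr => ?_
    have hle : B.wdeg (ws.take r) + B.wdeg (ws.drop r) = B.wdeg ws := by
      rw [← B.wdeg_append, List.take_append_drop]
    have hd : ws.drop r ≠ [] := drop_ne_nil (Finset.mem_range.1 hr)
    have := B.wdeg_pos V.positive hd
    rw [Finset.sum_ite_eq, if_pos (by rw [Finset.mem_range]; omega),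
      map_aug_splitTerm_lt B hu hd (by omega), LinearMap.lTensor_tmul]
  · rw [Finset.sum_ite_eq, if_pos (by simp), LinearMap.lTensor_tmul, B.aug_words_nil, map_zero,
      tmul_zero, zero_add]

theorem augΔ_augOp_zero_words {us ws : List B.X} (hu : us ≠ []) (hw : ws ≠ []) :
    B.augΔ (augOp B 0 (B.aug (B.words us)) (B.aug (B.words ws))) =
      ((augOp B 0).flip (B.aug (B.words ws))).lTensor B.Aug (B.augΔ (B.aug (B.words us)))
      + B.aug (B.words us) ⊗ₜ B.aug (B.words ws)
      + (augOp B 0 (B.aug (B.words us))).rTensor B.Aug (B.augΔ (B.aug (B.words ws))) := by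
  rw [augΔ_augOp_words V B _ hu hw, Finset.sum_range_succ', augΔ_words V B hw,
    Finset.sum_range_succ' _ ws.length, List.take_zero, List.drop_zero,
    map_aug_splitTerm_zero B hw, augΔ_words V B hu, map_add, LinearMap.rTensor_tmul,
    B.aug_words_nil, map_zero, zero_tmul, add_zero, add_comm, map_sum (LinearMap.rTensor _ _)]
  congr 1
  refine Finset.sum_congr rfl fun r _ => ?_
  have ht : ws.take (r + 1) ≠ [] := take_ne_nil hw (by omega)
  rw [map_aug_splitTerm_gt B hu ht (B.wdeg_pos V.positive ht), LinearMap.rTensor_tmul]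

/-- Two bilinear maps agree on `A × A_m` if they agree on pairs of words. -/
theorem augPsh_ext₂ {M : Type*} [AddCommMonoid M] [Module K M] {m : ℕ}
    (F G : B.Aug →ₗ[K] B.Aug →ₗ[K] M)
    (h : ∀ us ws : List B.X, us ≠ [] → ws ≠ [] → B.wdeg ws = m →
      F (B.aug (B.words us)) (B.aug (B.words ws)) = G (B.aug (B.words us)) (B.aug (B.words ws)))
    (x : B.Aug) {y : B.Aug} (hy : y ∈ B.augGr m) : F x y = G x y := by
  have : F.flip y = G.flip y := by
    ext a : 2
    refine B.augGr_le (M := LinearMap.eqLocus (F (Finsupp.single a 1)) (G (Finsupp.single a 1)))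
      (fun b hb => ?_) hy
    have := h a.1 b.1 a.2 b.2 hb
    rwa [B.aug_words a.2, B.aug_words b.2] at this
  exact LinearMap.congr_fun this x

/-- The augmentation ideal of the tensor algebra of `V` as a preshuffle bialgebra. -/
noncomputable def augBialg : PreshuffleBialgebra.{u, max u w} K where
  toPreshuffleAlgebra := V.augPsh B
  positive := B.augGr_zero V.positive
  Δ := B.augΔ
  Δ_graded := fun _ _ hx => B.augΔ_graded hx
  coassoc := B.augΔ_coassoc
  Δ_op_zero := by
    intro x y
    obtain ⟨F, hF⟩ := (V.augPsh B).zeroRhs_bilin B.augΔ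
    have key : ∀ m, ∀ y ∈ B.augGr m, B.augΔ (augOp B 0 x y) = F x y := fun m y hy =>
      augPsh_ext₂ V B ((augOp B 0).compr₂ B.augΔ) F
        (fun us ws hu hw _ => (augΔ_augOp_zero_words V B hu hw).trans (hF _ _).symm) x hy
    have hadd : ∀ a b : B.Aug, B.augΔ (augOp B 0 x a) = F x a → B.augΔ (augOp B 0 x b) = F x b →
        B.augΔ (augOp B 0 x (a + b)) = F x (a + b) := by
      intro a b ha hb
      erw [map_add, map_add, ha, hb]
      exact ((F x).map_add a b).symm
    refine Eq.trans ?_ (hF x y)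
    refine (V.augPsh B).toGrSpace.induction_homog
      (p := fun y => B.augΔ (augOp B 0 x y) = F x y) y key hadd
  Δ_op_mid := by
    intro i m x y hy h0 hi
    obtain ⟨F, hF⟩ := (V.augPsh B).midRhs_bilin B.augΔ i m
    refine Eq.trans ?_ (hF x y)
    refine augPsh_ext₂ V B ((augOp B i).compr₂ B.augΔ) F (fun us ws hu hw hm => ?_) x hy
    subst hm
    exact (augΔ_augOp_mid_words V B hu hw h0 hi _ fun a => copPart_augΔ V B a hw).trans
      (hF _ _).symm
  Δ_op_top := by
    intro m x y hy
    obtain ⟨F, hF⟩ := (V.augPsh B).topRhs_bilin B.augΔ m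
    refine Eq.trans ?_ (hF x y)
    refine augPsh_ext₂ V B ((augOp B m).compr₂ B.augΔ) F (fun us ws hu hw hm => ?_) x hy
    subst hm
    exact (augΔ_augOp_top_words V B hu hw _ fun a => copPart_augΔ V B a hw).trans
      (hF _ _).symm

end PrimPshAlgebra

/-! ### The filtration of a bialgebra -/

namespace PreshuffleBialgebra

variable {K : Type u} [Field K] (H : PreshuffleBialgebra.{u, v} K)

theorem filt_le_succ (p : ℕ) : H.filt p ≤ H.filt (p + 1) := by
  induction p with
  | zero =>
    intro x hx
    rw [filt, Submodule.mem_comap, (LinearMap.mem_ker.1 hx : H.Δ x = 0)]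
    exact zero_mem _
  | succ p ih =>
    refine Submodule.comap_mono ?_
    have : TensorProduct.map (H.filt p).subtype (H.filt p).subtype =
        TensorProduct.map (H.filt (p + 1)).subtype (H.filt (p + 1)).subtype ∘ₗ
          TensorProduct.map (Submodule.inclusion ih) (Submodule.inclusion ih) := by
      rw [← TensorProduct.map_comp, Submodule.subtype_comp_inclusion]
    rw [this]
    exact LinearMap.range_comp_le_range _ _

theorem filt_mono {p q : ℕ} (h : p ≤ q) : H.filt p ≤ H.filt q :=
  monotone_nat_of_le_succ H.filt_le_succ h

end PreshuffleBialgebra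

/-! ### Primitive elements of the coalgebra of words -/

namespace HomogBasis

open TensorAlgebra TensorProduct GrSpace

variable {K : Type u} [Field K] {V : GrSpace.{u, v} K} (B : HomogBasis.{u, v, w} V)

/-- The words of length one. -/
noncomputable def letter : V.carrier →ₗ[K] B.Aug := B.aug ∘ₗ ι K

theorem letter_apply (v : V.carrier) : B.letter v = B.aug (ι K v) := rfl

theorem words_singleton (x : B.X) : B.words [x] = ι K (B.b x) := by
  rw [B.words_cons, B.words_nil, mul_one]

theorem letter_b (x : B.X) : B.letter (B.b x) = B.aug (B.words [x]) := by
  rw [letter_apply, words_singleton]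

theorem incl_aug_mul_ι (a : TensorAlgebra K V.carrier) (v : V.carrier) :
    B.incl (B.aug (a * ι K v)) = a * ι K v := by
  have : ((LinearMap.mul K _).compr₂ (B.incl ∘ₗ B.aug)).flip ∘ₗ ι K =
      (LinearMap.mul K _).flip ∘ₗ ι K := by
    refine B.b.ext fun x => B.words.ext fun xs => ?_
    simp only [LinearMap.comp_apply, LinearMap.compr₂_apply, LinearMap.flip_apply,
      LinearMap.mul_apply', ← B.words_singleton, ← B.words_append]
    exact B.incl_aug_words (by simp)
  exact LinearMap.congr_fun (LinearMap.congr_fun this v) a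

theorem incl_letter (v : V.carrier) : B.incl (B.letter v) = ι K v := by
  rw [letter_apply, ← one_mul (ι K v), incl_aug_mul_ι]

theorem letter_injective : Function.Injective B.letter := by
  intro v v' h
  have := congrArg B.incl h
  rw [incl_letter, incl_letter] at this
  exact TensorAlgebra.ι_leftInverse.injective this

theorem letter_mem {d : ℕ} {v : V.carrier} (hv : v ∈ V.gr d) : B.letter v ∈ B.augGr d :=
  B.aug_mem (B.ι_mem_tgr hv)

/-- The projection to the words of length one. -/
noncomputable def proj₁ : TensorAlgebra K V.carrier →ₗ[K] TensorAlgebra K V.carrier :=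
  B.words.constr K fun xs => if xs.length = 1 then B.words xs else 0

theorem proj₁_words (xs : List B.X) :
    B.proj₁ (B.words xs) = if xs.length = 1 then B.words xs else 0 := by
  rw [proj₁, Module.Basis.constr_basis]

theorem proj₁_mem_range (a : TensorAlgebra K V.carrier) :
    B.proj₁ a ∈ LinearMap.range (ι K : V.carrier →ₗ[K] TensorAlgebra K V.carrier) := by
  have h : Submodule.span K (Set.range B.words) ≤
      (LinearMap.range (ι K : V.carrier →ₗ[K] TensorAlgebra K V.carrier)).comap B.proj₁ := by
    rw [Submodule.span_le]
    rintro _ ⟨xs, rfl⟩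
    rw [SetLike.mem_coe, Submodule.mem_comap, proj₁_words]
    split_ifs with h
    · obtain ⟨x, rfl⟩ := List.length_eq_one_iff.1 h
      exact ⟨B.b x, (B.words_singleton x).symm⟩
    · exact zero_mem _
  exact h (B.words.mem_span a)

/-- The multiplication after the projection of the first factor to the words of length one. -/
noncomputable def contr : B.Aug ⊗[K] B.Aug →ₗ[K] B.Aug :=
  TensorProduct.lift ((LinearMap.mul K _).compl₁₂ (B.proj₁ ∘ₗ B.incl) B.incl |>.compr₂ B.aug)

theorem contr_tmul (a b : B.Aug) : B.contr (a ⊗ₜ b) = B.aug (B.proj₁ (B.incl a) * B.incl b) := rfl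

/-- Among the cuts of a word only the one behind the first letter survives the projection, and
multiplying the two parts restores the word. For words of length one this cut has an empty right
part. So `contr` is a contracting homotopy away from the letters. -/
theorem contr_augΔ (x : B.Aug) :
    B.contr (B.augΔ x) = x - B.aug (B.proj₁ (B.incl x)) := by
  have : B.contr ∘ₗ B.augΔ = LinearMap.id - B.aug ∘ₗ B.proj₁ ∘ₗ B.incl := by
    ext a : 2
    obtain ⟨xs, hxs⟩ := a
    simp only [LinearMap.comp_apply, Finsupp.lsingle_apply, augΔ_single, map_sum, contr_tmul,
      LinearMap.sub_apply, LinearMap.id_apply, incl_single, proj₁_words]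
    obtain ⟨x, ys, rfl⟩ := List.exists_cons_of_ne_nil hxs
    rw [Finset.sum_eq_single 1]
    · rw [List.take_succ_cons, List.take_zero, List.drop_succ_cons, List.drop_zero,
        B.incl_aug_words (by simp), proj₁_words, if_pos (show [x].length = 1 from rfl)]
      by_cases h : ys = []
      · subst h
        rw [if_pos (show [x].length = 1 from rfl), B.words_nil, B.aug_one, map_zero, mul_zero,
          map_zero, B.aug_words hxs,
          sub_self]
      · rw [B.incl_aug_words h, if_neg (by simpa using h), map_zero, sub_zero, ← B.words_append,
          List.singleton_append, B.aug_words]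
    · intro r hr hr1
      by_cases h0 : r = 0
      · subst h0
        rw [List.take_zero, B.words_nil, B.aug_one, map_zero, map_zero, zero_mul, map_zero]
      · rw [B.incl_aug_words (by simpa using h0), proj₁_words, if_neg, zero_mul, map_zero]
        rw [List.length_take]
        rw [Finset.mem_range] at hr
        omega
    · simp
  exact LinearMap.congr_fun this x

/-- If the reduced coproduct of `x` is zero, then the homotopy formula `contr_augΔ` says that `x`
equals its component of length one. -/
theorem range_letter : LinearMap.range B.letter = LinearMap.ker B.augΔ := by
  apply le_antisymm
  · rintro _ ⟨v, rfl⟩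
    have : B.augΔ ∘ₗ B.letter = 0 := by
      refine B.b.ext fun x => ?_
      rw [LinearMap.comp_apply, letter_b, B.aug_words (by simp), augΔ_single]
      simp [Finset.sum_range_succ, B.words_nil, B.aug_one]
    exact LinearMap.congr_fun this v
  · intro x hx
    have h := B.contr_augΔ x
    rw [LinearMap.mem_ker.1 hx, map_zero, eq_comm, sub_eq_zero] at h
    obtain ⟨v, hv⟩ := B.proj₁_mem_range (B.incl x)
    exact ⟨v, by rw [h, ← hv]; rfl⟩

end HomogBasis

/-! ### The bialgebra of words is connected with primitive part `V` -/

namespace PrimPshAlgebra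

open TensorAlgebra GrSpace TensorProduct PrimOps

variable {K : Type u} [Field K] (V : PrimPshAlgebra.{u, v} K)
  (B : HomogBasis.{u, v, w} V.toGrSpace)

/-- Both parts of a proper cut are shorter than the word. The shift comes from `filt p` being
`F_{p+1}`. -/
theorem single_mem_filt (p : ℕ) (a : B.NEWord) (ha : a.1.length ≤ p + 1) :
    (Finsupp.single a 1 : B.Aug) ∈ (V.augBialg B).filt p := by
  induction p generalizing a with
  | zero =>
    obtain ⟨xs, hxs⟩ := a
    obtain ⟨x, ys, rfl⟩ := List.exists_cons_of_ne_nil hxs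
    obtain rfl : ys = [] := by simpa using ha
    have : B.letter (B.b x) ∈ LinearMap.ker B.augΔ := by rw [← B.range_letter]; exact ⟨_, rfl⟩
    rwa [B.letter_b, B.aug_words (by simp)] at this
  | succ p ih =>
    have : B.augΔ (Finsupp.single a 1) ∈ LinearMap.range
        (TensorProduct.map ((V.augBialg B).filt p).subtype ((V.augBialg B).filt p).subtype) := by
      rw [B.augΔ_single]
      refine Submodule.sum_mem _ fun r hr => ?_
      rw [Finset.mem_range] at hr
      by_cases h1 : a.1.take r = []
      · rw [h1, B.aug_words_nil, zero_tmul]; exact Submodule.zero_mem _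
      by_cases h2 : a.1.drop r = []
      · rw [h2, B.aug_words_nil, tmul_zero]; exact Submodule.zero_mem _
      rw [B.aug_words h1, B.aug_words h2]
      have h1' := List.take_eq_nil_iff.not.1 h1
      have h2' := List.drop_eq_nil_iff.not.1 h2
      refine ⟨⟨_, ih ⟨_, h1⟩ ?_⟩ ⊗ₜ ⟨_, ih ⟨_, h2⟩ ?_⟩, rfl⟩
      · simp only [List.length_take]; omega
      · simp only [List.length_drop]; omega
    exact this

theorem augBialg_isConnected : (V.augBialg B).IsConnected := by
  intro x
  have key : ∀ x : B.Aug, ∃ p, x ∈ (V.augBialg B).filt p := by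
    intro x
    induction x using Finsupp.induction_linear with
    | zero => exact ⟨0, zero_mem _⟩
    | add x y hx hy =>
      obtain ⟨p, hp⟩ := hx
      obtain ⟨q, hq⟩ := hy
      exact ⟨max p q, add_mem (PreshuffleBialgebra.filt_mono _ (le_max_left _ _) hp)
        (PreshuffleBialgebra.filt_mono _ (le_max_right _ _) hq)⟩
    | single a c =>
      refine ⟨a.1.length, ?_⟩
      have := Submodule.smul_mem _ c (V.single_mem_filt B a.1.length a (by omega))
      have h2 : (c • Finsupp.single a 1 : B.Aug) = Finsupp.single a c := by simp
      exact h2 ▸ this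
  exact key x

/-- The augmentation ideal of the tensor algebra of `V` as a connected preshuffle bialgebra. -/
noncomputable def augConn : ConnPshBialg.{u, max u w} K where
  toPreshuffleBialgebra := V.augBialg B
  connected := V.augBialg_isConnected B

/-- The inclusion of `V` in the augmentation ideal of its tensor algebra. -/
noncomputable def letterHom : GrHom V.toGrSpace (V.augConn B).toGrSpace where
  lin := B.letter
  map_gr := fun _ _ h => B.letter_mem h

theorem augPsh_word (xs : List V.toGrSpace.Homog) (y : V.carrier) :
    (V.augPsh B).word (vals (xs.map (V.letterHom B).onHomog)) (B.letter y) =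
      B.aug (tword (vals xs) * ι K y) := by
  induction xs with
  | nil => simp [vals, PreshuffleAlgebra.word, tword_nil]; rfl
  | cons x xs ih =>
    change augOp B 0 (B.letter x.val)
      ((V.augPsh B).word (vals (xs.map (V.letterHom B).onHomog)) (B.letter y)) = _
    rw [ih, augOp_apply, B.incl_letter, opHom_ι, insOp_zero, B.incl_aug_mul_ι]
    simp only [vals, List.map_cons, tword_cons, mul_assoc]

theorem augOp_letter_aug (i : ℕ) (z : V.carrier) (a : TensorAlgebra K V.carrier) (y : V.carrier) :
    augOp B i (B.letter z) (B.aug (a * ι K y)) = B.aug (insOp B i z (a * ι K y)) := by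
  rw [augOp_apply, B.incl_letter, opHom_ι, B.incl_aug_mul_ι]

/-- The subtracted term of `L_q^j` removes all words of the insertion except the one in which
everything has been absorbed in a single letter. For `q = 0` and `j = |y|` it removes the word `y
z`. -/
theorem augPsh_Lop {j : ℕ} (xs : List V.toGrSpace.Homog) (y z : V.toGrSpace.Homog) (hj : 1 ≤ j)
    (hj' : j ≤ y.deg) : (V.augPsh B).Lop j (xs.map (V.letterHom B).onHomog)
      ((V.letterHom B).onHomog y) (B.letter z.val) = B.letter (V.Lw j (vals xs) y.val z.val) := by
  have hι : ∀ v : V.carrier, B.letter v = B.aug (1 * ι K v) := fun v => by rw [one_mul]; rfl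
  cases xs with
  | nil =>
    have h1 : augOp B j (B.letter z.val) (B.letter y.val) = B.letter (V.Lw j [] y.val z.val) +
        if j = y.deg then B.aug (ι K y.val * ι K z.val) else 0 := by
      rw [hι y.val, augOp_letter_aug, one_mul, insOp_ι B y hj hj', map_add]
      split_ifs <;> simp [B.letter_apply]
    have h2 : augOp B 0 (B.letter y.val) (B.letter z.val) = B.aug (ι K y.val * ι K z.val) := by
      rw [hι z.val, augOp_letter_aug, one_mul, insOp_zero]
    change (if j < y.deg then augOp B j (B.letter z.val) (B.letter y.val) else
      augOp B j (B.letter z.val) (B.letter y.val) - augOp B 0 (B.letter y.val) (B.letter z.val)) = _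
    rw [h1, h2]
    by_cases h : j < y.deg
    · rw [if_pos h, if_neg (by omega), add_zero]; rfl
    · rw [if_neg h, if_pos (by omega), add_sub_cancel_right]; rfl
  | cons x xs =>
    have hw := fun xs => V.augPsh_word B xs y.val
    have hd : ∀ xs : List V.toGrSpace.Homog,
        degSum (xs.map (V.letterHom B).onHomog) = degSum xs := fun xs => by
      simp [degSum, Function.comp_def]; rfl
    change augOp B (j + degSum ((x :: xs).map (V.letterHom B).onHomog)) (B.letter z.val)
        ((V.augPsh B).word (vals ((x :: xs).map (V.letterHom B).onHomog)) (B.letter y.val)) -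
      augOp B 0 (B.letter x.val) (augOp B (j + degSum (xs.map (V.letterHom B).onHomog))
        (B.letter z.val)
        ((V.augPsh B).word (vals (xs.map (V.letterHom B).onHomog)) (B.letter y.val))) = _
    rw [hw, hw, hd, hd, augOp_letter_aug, augOp_letter_aug, augOp_apply B 0, B.incl_letter,
      opHom_ι, insOp_zero, B.incl_aug_of_mem (n := z.deg + (degSum xs + y.deg)) (by omega),
      ← map_sub, add_comm j, add_comm j, insOp_tword_cons_mul B x xs y hj hj', add_sub_cancel_right]
    · rfl
    · exact insOp_mem B V.isGraded (by omega) z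
        (B.mul_mem_tgr (B.tword_mem_tgr xs) (B.ι_mem_tgr y.mem))

theorem isPrim_augConn : IsPrim (V.augConn B).toPreshuffleBialgebra V (V.letterHom B) where
  injective := B.letter_injective
  range_eq := B.range_letter
  map_L := fun _ xs y z hj hj' => (V.augPsh_Lop B xs y z hj hj').symm

end PrimPshAlgebra

/-! ### Primitive elements -/

theorem GrHom.degSum_onHomog {K : Type u} [Field K] {A : GrSpace.{u, v} K} {B : GrSpace.{u, w} K}
    (f : GrHom A B) (xs : List A.Homog) :
    GrSpace.degSum (xs.map f.onHomog) = GrSpace.degSum xs := by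
  rw [GrSpace.degSum, List.map_map]; rfl

namespace GrSpace

open TensorProduct

variable {K : Type u} [Field K] (A : GrSpace.{u, v} K)

/-- The projection of `A ⊗ A` to its component of degree `n`. -/
noncomputable def projTensor (n : ℕ) : A.carrier ⊗[K] A.carrier →ₗ[K] A.carrier ⊗[K] A.carrier :=
  ∑ p ∈ Finset.HasAntidiagonal.antidiagonal n, TensorProduct.map (A.proj p.1) (A.proj p.2)

theorem projTensor_of_mem {m n : ℕ} {c : A.carrier ⊗[K] A.carrier}
    (hc : c ∈ ⨆ p : {p : ℕ × ℕ // p.1 + p.2 = m},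
      LinearMap.range (TensorProduct.map (A.gr p.1.1).subtype (A.gr p.1.2).subtype)) :
    A.projTensor n c = if m = n then c else 0 := by
  have key : (⨆ p : {p : ℕ × ℕ // p.1 + p.2 = m},
      LinearMap.range (TensorProduct.map (A.gr p.1.1).subtype (A.gr p.1.2).subtype)) ≤
      LinearMap.eqLocus (A.projTensor n) (if m = n then LinearMap.id else 0) := by
    refine iSup_le ?_
    rintro ⟨⟨a, b⟩, hab⟩ _ ⟨t, rfl⟩
    rw [LinearMap.mem_eqLocus]
    simp only at hab
    induction t with
    | zero => simp
    | add s t hs ht => rw [map_add, map_add, map_add, hs, ht]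
    | tmul x y =>
      obtain ⟨x, hx⟩ := x
      obtain ⟨y, hy⟩ := y
      simp only [map_tmul, Submodule.subtype_apply, projTensor, LinearMap.sum_apply]
      by_cases h : m = n
      · rw [if_pos h, Finset.sum_eq_single_of_mem (a, b) (Finset.HasAntidiagonal.mem_antidiagonal.2 (hab.trans h)),
          A.proj_of_mem hx,
          A.proj_of_mem hy]
        · rfl
        · rintro ⟨p, q⟩ hpq hne
          rw [Finset.HasAntidiagonal.mem_antidiagonal] at hpq
          simp only at hpq
          have : a ≠ p := by
            rintro rfl
            exact hne (Prod.ext rfl (by simp only; omega))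
          rw [A.proj_of_mem_ne hx this, zero_tmul]
      · rw [if_neg h, LinearMap.zero_apply]
        refine Finset.sum_eq_zero ?_
        rintro ⟨p, q⟩ hpq
        rw [Finset.HasAntidiagonal.mem_antidiagonal] at hpq
        simp only at hpq ⊢
        by_cases hap : a = p
        · rw [A.proj_of_mem_ne (show y ∈ A.gr b from hy) (n := q) (by omega), tmul_zero]
        · rw [A.proj_of_mem_ne hx hap, zero_tmul]
  have h := key hc
  rw [LinearMap.mem_eqLocus] at h
  rw [h]
  split_ifs <;> rfl

end GrSpace

namespace PreshuffleAlgebra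

open TensorProduct

variable {K : Type u} [Field K] (A : PreshuffleAlgebra.{u, v} K)

theorem proj_op_zero {e : ℕ} {x : A.carrier} (hx : x ∈ A.gr e) (a : ℕ) (y : A.carrier) :
    A.proj a (A.op 0 x y) = if e ≤ a then A.op 0 x (A.proj (a - e) y) else 0 := by
  have : A.proj a ∘ₗ A.op 0 x = if e ≤ a then A.op 0 x ∘ₗ A.proj (a - e) else 0 := by
    refine A.toGrSpace.linearMap_ext fun m y hy => ?_
    rw [LinearMap.comp_apply, A.proj_of_mem_eq_ite (A.op_mem 0 e m x y hx hy (Nat.zero_le _))]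
    by_cases h : e ≤ a
    · rw [if_pos h, LinearMap.comp_apply, A.proj_of_mem_eq_ite hy]
      by_cases h' : e + m = a
      · rw [if_pos h', if_pos (by omega)]
      · rw [if_neg h', if_neg (by omega), map_zero]
    · rw [if_neg h, if_neg (by omega), LinearMap.zero_apply]
  have h := LinearMap.congr_fun this y
  rw [LinearMap.comp_apply] at h
  rw [h]
  split_ifs <;> rfl

theorem word_mem (xs : List A.toGrSpace.Homog) (y : A.toGrSpace.Homog) :
    A.word (GrSpace.vals xs) y.val ∈ A.gr (GrSpace.degSum xs + y.deg) := by
  induction xs with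
  | nil => simpa [word, GrSpace.vals, GrSpace.degSum] using y.mem
  | cons x xs ih =>
    rw [GrSpace.degSum_cons, add_assoc]
    exact A.op_mem 0 _ _ _ _ x.mem ih (Nat.zero_le _)

/-- `Lop` as a linear map in the last argument. -/
noncomputable def LopLin (p : ℕ) :
    List A.toGrSpace.Homog → A.toGrSpace.Homog → A.carrier →ₗ[K] A.carrier
  | [], y => if p < y.deg then (A.op p).flip y.val else (A.op p).flip y.val - A.op 0 y.val
  | x :: xs, y =>
      (A.op (p + GrSpace.degSum (x :: xs))).flip (A.word (GrSpace.vals (x :: xs)) y.val)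
        - A.op 0 x.val ∘ₗ
          (A.op (p + GrSpace.degSum xs)).flip (A.word (GrSpace.vals xs) y.val)

theorem LopLin_apply (p : ℕ) (xs : List A.toGrSpace.Homog) (y : A.toGrSpace.Homog)
    (z : A.carrier) : A.LopLin p xs y z = A.Lop p xs y z := by
  cases xs with
  | nil => rw [LopLin, Lop]; split_ifs <;> rfl
  | cons x xs => rfl

theorem Lop_mem {p : ℕ} (xs : List A.toGrSpace.Homog) (y z : A.toGrSpace.Homog)
    (hp' : p ≤ y.deg) : A.Lop p xs y z.val ∈ A.gr (GrSpace.degSum xs + y.deg + z.deg) := by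
  cases xs with
  | nil =>
    have h1 := A.op_mem p _ _ _ _ z.mem y.mem hp'
    have h2 := A.op_mem 0 _ _ _ _ y.mem z.mem (Nat.zero_le _)
    rw [add_comm] at h1
    rw [Lop, GrSpace.degSum_nil, zero_add]
    split_ifs
    · exact h1
    · exact sub_mem h1 h2
  | cons x xs =>
    have h1 := A.op_mem (p + GrSpace.degSum (x :: xs)) _ _ _ _ z.mem (A.word_mem (x :: xs) y)
      (by omega)
    have h2 := A.op_mem (p + GrSpace.degSum xs) _ _ _ _ z.mem (A.word_mem xs y) (by omega)
    have h3 := A.op_mem 0 _ _ _ _ x.mem h2 (Nat.zero_le _)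
    rw [Lop]
    refine sub_mem ?_ ?_
    · convert h1 using 2; omega
    · convert h3 using 2; rw [GrSpace.degSum_cons]; omega

end PreshuffleAlgebra

namespace PreshuffleBialgebra

open TensorProduct

variable {K : Type u} [Field K] (H : PreshuffleBialgebra.{u, v} K)

theorem Δ_proj (n : ℕ) (x : H.carrier) : H.Δ (H.proj n x) = H.projTensor n (H.Δ x) := by
  have : H.Δ ∘ₗ H.proj n = H.projTensor n ∘ₗ H.Δ := by
    refine H.toGrSpace.linearMap_ext fun m x hx => ?_
    rw [LinearMap.comp_apply, LinearMap.comp_apply, H.projTensor_of_mem (H.Δ_graded m x hx),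
      H.proj_of_mem_eq_ite hx]
    split_ifs <;> simp
  exact LinearMap.congr_fun this x

theorem proj_mem_ker (n : ℕ) (x : H.carrier) (hx : x ∈ LinearMap.ker H.Δ) :
    H.proj n x ∈ LinearMap.ker H.Δ := by
  rw [LinearMap.mem_ker] at hx ⊢
  rw [Δ_proj, hx, map_zero]

theorem Δ_op_zero_prim {x : H.carrier} (hx : H.Δ x = 0) (w : H.carrier) :
    H.Δ (H.op 0 x w) = x ⊗ₜ w + (H.op 0 x).rTensor H.carrier (H.Δ w) := by
  rw [H.Δ_op_zero, hx, map_zero, zero_add]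

/-- For primitive `x` the left factors of `Δ(x •₀ w)` are `x` and the `x •₀ w₍₁₎`, so degrees are
shifted by `|x|`. -/
theorem copPart_op_zero {e : ℕ} {x : H.carrier} (hx : x ∈ H.gr e) (hx' : H.Δ x = 0) (a : ℕ)
    (w : H.carrier) : H.copPart H.Δ a (H.op 0 x w) = (if a = e then x ⊗ₜ w else 0) +
      if e ≤ a then (H.op 0 x).rTensor H.carrier (H.copPart H.Δ (a - e) w) else 0 := by
  rw [GrSpace.copPart, Δ_op_zero_prim H hx', map_add, LinearMap.rTensor_tmul,
    H.proj_of_mem_eq_ite hx]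
  congr 1
  · by_cases h : e = a
    · rw [if_pos h, if_pos h.symm]
    · rw [if_neg h, if_neg (Ne.symm h), zero_tmul]
  · rw [GrSpace.copPart, ← LinearMap.comp_apply, ← LinearMap.rTensor_comp]
    have : H.proj a ∘ₗ H.op 0 x = if e ≤ a then H.op 0 x ∘ₗ H.proj (a - e) else 0 := by
      ext y
      rw [LinearMap.comp_apply, H.proj_op_zero hx]
      split_ifs <;> rfl
    rw [this]
    split_ifs
    · rw [LinearMap.rTensor_comp, LinearMap.comp_apply]
    · rw [LinearMap.rTensor_zero, LinearMap.zero_apply]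

theorem copPart_of_prim {x : H.carrier} (hx : H.Δ x = 0) (a : ℕ) : H.copPart H.Δ a x = 0 := by
  rw [GrSpace.copPart, hx, map_zero]

/-- A product of primitive elements is cut in front of its last factor at the latest. -/
theorem copPart_word {xs : List H.toGrSpace.Homog} {y : H.carrier}
    (hxs : ∀ x ∈ xs, H.Δ x.val = 0) (hy : H.Δ y = 0) {a : ℕ} (ha : GrSpace.degSum xs < a) :
    H.copPart H.Δ a (H.word (GrSpace.vals xs) y) = 0 := by
  induction xs generalizing a with
  | nil => exact H.copPart_of_prim hy a
  | cons x xs ih =>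
    rw [GrSpace.degSum_cons] at ha
    change H.copPart H.Δ a (H.op 0 x.val (H.word (GrSpace.vals xs) y)) = 0
    rw [H.copPart_op_zero x.mem (hxs x (by simp)), if_neg (by omega), if_pos (by omega),
      ih (fun x hx => hxs x (by simp [hx])) (by omega), map_zero, zero_add]

/-- Primitivity of `z` removes the terms with `Δ z`, and the assumption on `w` removes the sum over
`|y₍₁₎| ≥ i`. What remains has one form for `0 < i < m` and `i = m`. -/
theorem Δ_op_of_copPart {m i : ℕ} {z w : H.carrier} (hz : H.Δ z = 0) (hw : w ∈ H.gr m)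
    (hi : 0 < i) (hi' : i ≤ m) (h : ∀ a, i ≤ a → H.copPart H.Δ a w = 0) :
    H.Δ (H.op i z w) = ∑ a ∈ Finset.range (i + 1),
      (H.op (i - a) z).lTensor H.carrier (H.copPart H.Δ a w) + if i = m then w ⊗ₜ z else 0 := by
  rcases hi'.lt_or_eq with hlt | rfl
  · rw [H.Δ_op_mid i m z w hw hi hlt, hz, if_neg (by omega), add_zero]
    have : ∑ a ∈ Finset.Icc i m, (H.op i z).rTensor H.carrier (H.copPart H.Δ a w) = 0 :=
      Finset.sum_eq_zero fun a ha => by rw [h a (Finset.mem_Icc.1 ha).1, map_zero]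
    rw [this, map_zero, LinearMap.zero_apply, add_zero, add_zero]
  · rw [H.Δ_op_top i z w hw, hz, map_zero, add_zero, if_pos rfl]

/-- The two terms of `L` have the same coproduct. With `w' = x₂ •₀ ⋯ •₀ y`, the part of `Δ(x •₀ w')`
equal to `x ⊗ w'` yields `x ⊗ (z • w')`. In the other parts `x •₀` stands on the left factor and
commutes with the action of `z` on the right factor. Both agree with `Δ(x •₀ (z • w'))`, and so do
the boundary terms for `j = |y|`. -/
theorem Δ_Lop {j : ℕ} (xs : List H.toGrSpace.Homog) (y : H.toGrSpace.Homog) {z : H.carrier}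
    (hxs : ∀ x ∈ xs, H.Δ x.val = 0) (hy : H.Δ y.val = 0) (hz : H.Δ z = 0)
    (hj : 1 ≤ j) (hj' : j ≤ y.deg) : H.Δ (H.Lop j xs y z) = 0 := by
  cases xs with
  | nil =>
    have h1 := H.Δ_op_of_copPart hz y.mem hj hj' fun a _ => H.copPart_of_prim hy a
    simp only [H.copPart_of_prim hy, map_zero, Finset.sum_const_zero, zero_add] at h1
    rw [PreshuffleAlgebra.Lop]
    split_ifs with h
    · rw [h1, if_neg (by omega)]
    · rw [map_sub, h1, if_pos (by omega), H.Δ_op_zero_prim hy, hz, map_zero, add_zero, sub_self]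
  | cons x xs =>
    have hx := hxs x (by simp)
    have hxs' : ∀ x ∈ xs, H.Δ x.val = 0 := fun x hx => hxs x (by simp [hx])
    have h1 := H.Δ_op_of_copPart hz (H.word_mem (x :: xs) y) (i := j + GrSpace.degSum (x :: xs))
      (by omega) (by omega) fun a ha => H.copPart_word hxs hy (by omega)
    have h2 := H.Δ_op_of_copPart hz (H.word_mem xs y) (i := j + GrSpace.degSum xs)
      (by omega) (by omega) fun a ha => H.copPart_word hxs' hy (by omega)
    have hw : H.word (GrSpace.vals (x :: xs)) y.val =
      H.op 0 x.val (H.word (GrSpace.vals xs) y.val) := rfl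
    rw [PreshuffleAlgebra.Lop, map_sub, H.Δ_op_zero_prim hx, h1, h2, sub_eq_zero]
    generalize H.word (GrSpace.vals xs) y.val = w' at *
    rw [hw, GrSpace.degSum_cons,
      show j + (x.deg + GrSpace.degSum xs) + 1 = x.deg + (j + GrSpace.degSum xs + 1) by omega,
      Finset.sum_range_add]
    simp only [H.copPart_op_zero x.mem hx]
    -- All left factors of `Δ(x •₀ w')` have degree at least `|x|`.
    have h3 : ∑ a ∈ Finset.range x.deg, (H.op (j + (x.deg + GrSpace.degSum xs) - a) z).lTensor
        H.carrier ((if a = x.deg then x.val ⊗ₜ w' else 0) + if x.deg ≤ a then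
          (H.op 0 x.val).rTensor H.carrier (H.copPart H.Δ (a - x.deg) w') else 0) = 0 := by
      refine Finset.sum_eq_zero fun a ha => ?_
      rw [Finset.mem_range] at ha
      rw [if_neg (by omega), if_neg (by omega), add_zero, map_zero]
    have h4 : ∀ a ∈ Finset.range (j + GrSpace.degSum xs + 1),
        (H.op (j + (x.deg + GrSpace.degSum xs) - (x.deg + a)) z).lTensor
          H.carrier ((if x.deg + a = x.deg then x.val ⊗ₜ w' else 0) + if x.deg ≤ x.deg + a then
            (H.op 0 x.val).rTensor H.carrier (H.copPart H.Δ (x.deg + a - x.deg) w') else 0) =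
        (if a = 0 then x.val ⊗ₜ H.op (j + GrSpace.degSum xs) z w' else 0) +
        (H.op 0 x.val).rTensor H.carrier ((H.op (j + GrSpace.degSum xs - a) z).lTensor H.carrier
          (H.copPart H.Δ a w')) := by
      intro a _
      rw [if_pos (Nat.le_add_right _ _), map_add, Nat.add_sub_cancel_left,
        show j + (x.deg + GrSpace.degSum xs) - (x.deg + a) = j + GrSpace.degSum xs - a by omega]
      congr 1
      · by_cases h : a = 0
        · subst h
          rw [if_pos (Nat.add_zero _), if_pos rfl, LinearMap.lTensor_tmul, Nat.sub_zero]
        · rw [if_neg (by omega), if_neg h, map_zero]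
      · rw [← LinearMap.comp_apply, ← LinearMap.comp_apply, LinearMap.lTensor_comp_rTensor,
          LinearMap.rTensor_comp_lTensor]
    rw [h3, Finset.sum_congr rfl h4, Finset.sum_add_distrib, Finset.sum_ite_eq', if_pos (by simp),
      zero_add, map_add, map_sum, add_assoc]
    congr 2
    by_cases h : j = y.deg
    · rw [if_pos (by omega), if_pos (by omega), LinearMap.rTensor_tmul]
    · rw [if_neg (by omega), if_neg (by omega), map_zero]

end PreshuffleBialgebra

/-! ### The operations `L` on the primitive elements -/

namespace PreshuffleBialgebra

open TensorProduct TensorAlgebra GrSpace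

variable {K : Type u} [Field K] (H : PreshuffleBialgebra.{u, v} K)

/-- The graded vector space of the primitive elements. -/
noncomputable def primSpace : GrSpace.{u, v} K where
  carrier := LinearMap.ker H.Δ
  gr n := (H.gr n).comap (LinearMap.ker H.Δ).subtype
  internal := H.isInternal_comap _ H.proj_mem_ker

/-- The inclusion of the primitive elements. -/
noncomputable def primIncl : GrHom H.primSpace H.toGrSpace where
  lin := (LinearMap.ker H.Δ).subtype
  map_gr := fun _ _ h => h

theorem primIncl_injective : Function.Injective H.primIncl.lin := Subtype.val_injective

theorem Δ_primIncl (x : H.primSpace.carrier) : H.Δ (H.primIncl.lin x) = 0 :=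
  LinearMap.mem_ker.1 (Subtype.property x)

theorem range_primIncl : LinearMap.range H.primIncl.lin = LinearMap.ker H.Δ :=
  Submodule.range_subtype _

theorem Lop_primIncl_mem {j : ℕ} (xs : List H.primSpace.Homog) (y : H.primSpace.Homog)
    (hj : 1 ≤ j ∧ j ≤ y.deg) (z : H.primSpace.carrier) :
    H.LopLin j (xs.map H.primIncl.onHomog) (H.primIncl.onHomog y) (H.primIncl.lin z) ∈
      LinearMap.ker H.Δ := by
  rw [PreshuffleAlgebra.LopLin_apply, LinearMap.mem_ker]
  refine H.Δ_Lop _ _ ?_ (H.Δ_primIncl _) (H.Δ_primIncl _) hj.1 hj.2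
  intro x hx
  obtain ⟨x', _, rfl⟩ := List.mem_map.1 hx
  exact H.Δ_primIncl _

/-- A linear map with values in the primitive elements. -/
noncomputable def primRestrict (f : H.primSpace.carrier →ₗ[K] H.carrier)
    (hf : ∀ z, f z ∈ LinearMap.ker H.Δ) : H.primSpace.carrier →ₗ[K] H.primSpace.carrier :=
  LinearMap.codRestrict (LinearMap.ker H.Δ) f hf

theorem primIncl_primRestrict (f : H.primSpace.carrier →ₗ[K] H.carrier)
    (hf : ∀ z, f z ∈ LinearMap.ker H.Δ) (z : H.primSpace.carrier) :
    H.primIncl.lin (H.primRestrict f hf z) = f z := rfl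

/-- The operations on the primitive elements, as linear maps in the last argument. -/
noncomputable def primLin (j : ℕ) (xs : List H.primSpace.Homog) (y : H.primSpace.Homog) :
    H.primSpace.carrier →ₗ[K] H.primSpace.carrier :=
  if h : 1 ≤ j ∧ j ≤ y.deg then
    H.primRestrict
      (H.LopLin j (xs.map H.primIncl.onHomog) (H.primIncl.onHomog y) ∘ₗ H.primIncl.lin)
      (H.Lop_primIncl_mem xs y h)
  else 0

theorem primIncl_primLin {j : ℕ} (xs : List H.primSpace.Homog) (y : H.primSpace.Homog)
    (hj : 1 ≤ j) (hj' : j ≤ y.deg) (z : H.primSpace.carrier) :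
    H.primIncl.lin (H.primLin j xs y z) =
      H.Lop j (xs.map H.primIncl.onHomog) (H.primIncl.onHomog y) (H.primIncl.lin z) := by
  rw [primLin, dif_pos ⟨hj, hj'⟩, primIncl_primRestrict, ← PreshuffleAlgebra.LopLin_apply]
  rfl

variable (B : HomogBasis.{u, v, w} H.primSpace)

/-- The operations on the primitive elements, as linear maps on the tensor algebra. -/
noncomputable def primLhat (j : ℕ) : TensorAlgebra K H.primSpace.carrier →ₗ[K]
    H.primSpace.carrier →ₗ[K] H.primSpace.carrier →ₗ[K] H.primSpace.carrier :=
  B.words.constr K fun xs => B.b.constr K fun y => H.primLin j (xs.map B.homog) (B.homog y)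

theorem primLhat_words (j : ℕ) (xs : List B.X) (y : B.X) :
    H.primLhat B j (B.words xs) (B.b y) = H.primLin j (xs.map B.homog) (B.homog y) := by
  rw [primLhat, Module.Basis.constr_basis, Module.Basis.constr_basis]

/-- The primitive elements with the operations `L_n^j`. -/
noncomputable def primOps : PrimOps.{u, v} K where
  toGrSpace := H.primSpace
  L n j := (H.primLhat B j).compMultilinearMap (tprod K H.primSpace.carrier n)

theorem primOps_Lw (j : ℕ) (vs : List H.primSpace.carrier) (y z : H.primSpace.carrier) :
    (H.primOps B).Lw j vs y z = H.primLhat B j (tword vs) y z := by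
  have h1 : tprod K H.primSpace.carrier vs.length vs.get = tword vs := by
    rw [TensorAlgebra.tprod_apply, tword]
    conv_rhs => rw [← List.ofFn_get vs, List.map_ofFn]
    rfl
  rw [← h1]
  rfl

/-- The left multiplications by words of primitive elements. -/
noncomputable def primMul : TensorAlgebra K H.primSpace.carrier →ₐ[K] Module.End K H.carrier :=
  TensorAlgebra.lift K (H.op 0 ∘ₗ H.primIncl.lin)

theorem primMul_ι (v : H.primSpace.carrier) : H.primMul (ι K v) = H.op 0 (H.primIncl.lin v) := by
  rw [primMul, TensorAlgebra.lift_ι_apply]; rfl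

theorem primMul_tword (xs : List H.primSpace.Homog) (y : H.carrier) :
    H.primMul (tword (vals xs)) y = H.word (vals (xs.map H.primIncl.onHomog)) y := by
  induction xs with
  | nil => rw [vals, List.map_nil, tword_nil, map_one]; rfl
  | cons x xs ih =>
    rw [vals, List.map_cons, tword_cons, map_mul, primMul_ι, Module.End.mul_apply]
    exact congrArg (H.op 0 _) ih

/-- The operation `u ↦ z •_{j + |a|} (a u)`, for a word `a`. -/
noncomputable def primIns (j : ℕ) (z : H.carrier) :
    TensorAlgebra K H.primSpace.carrier →ₗ[K] Module.End K H.carrier :=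
  B.words.constr K fun xs => (H.op (j + B.wdeg xs) z : Module.End K H.carrier) * H.primMul (B.words xs)

theorem primIns_of_mem (j : ℕ) (z : H.carrier) {d : ℕ}
    {a : TensorAlgebra K H.primSpace.carrier} (ha : a ∈ B.tgr d) :
    H.primIns B j z a = (H.op (j + d) z : Module.End K H.carrier) * H.primMul a := by
  refine B.ext_of_mem_tgr (f := H.primIns B j z)
    (g := LinearMap.mulLeft K (H.op (j + d) z : Module.End K H.carrier) ∘ₗ H.primMul.toLinearMap)
    (fun xs hxs => ?_) ha
  rw [primIns, Module.Basis.constr_basis, hxs]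
  rfl

/-- The operation `u ↦ x •₀ (z •_{j + |a|} (a u))`, for a word `x a`. -/
noncomputable def primInsTail (j : ℕ) (z : H.carrier) :
    TensorAlgebra K H.primSpace.carrier →ₗ[K] Module.End K H.carrier :=
  B.words.constr K fun
    | [] => 0
    | x :: xs => H.primMul (ι K (B.b x)) * H.primIns B j z (B.words xs)

theorem primInsTail_ι_mul (j : ℕ) (z : H.carrier) (v : H.primSpace.carrier)
    (a : TensorAlgebra K H.primSpace.carrier) :
    H.primInsTail B j z (ι K v * a) = H.primMul (ι K v) * H.primIns B j z a := by
  have : ((LinearMap.mul K _).compr₂ (H.primInsTail B j z)) ∘ₗ ι K =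
      ((LinearMap.mul K (Module.End K H.carrier)).compl₁₂
        H.primMul.toLinearMap (H.primIns B j z)) ∘ₗ ι K := by
    refine B.b.ext fun x => B.words.ext fun xs => ?_
    simp only [LinearMap.comp_apply, LinearMap.compr₂_apply, LinearMap.mul_apply', ← B.words_cons,
      LinearMap.compl₁₂_apply]
    rw [primInsTail, Module.Basis.constr_basis]
    rfl
  exact LinearMap.congr_fun (LinearMap.congr_fun this v) a

theorem primIncl_primLhat_one {j m : ℕ} (hj : 1 ≤ j) (hj' : j ≤ m) {y : H.primSpace.carrier}
    (hy : y ∈ H.primSpace.gr m) (z : H.primSpace.carrier) :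
    H.primIncl.lin (H.primLhat B j 1 y z) =
      H.Lop j [] (H.primIncl.onHomog ⟨m, y, hy⟩) (H.primIncl.lin z) := by
  have h : ∀ y' : H.carrier, ∀ hy', H.Lop j [] ⟨m, y', hy'⟩ (H.primIncl.lin z) =
      (H.op j (H.primIncl.lin z) - if j < m then 0 else (H.op 0).flip (H.primIncl.lin z)) y' := by
    intro y' hy'
    rw [PreshuffleAlgebra.Lop]
    split_ifs <;> simp
  rw [GrHom.onHomog, h]
  refine B.ext_of_mem (f := H.primIncl.lin ∘ₗ (H.primLhat B j 1).flip z)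
    (g := (H.op j (H.primIncl.lin z) - if j < m then 0 else (H.op 0).flip (H.primIncl.lin z)) ∘ₗ
      H.primIncl.lin) (fun x hx => ?_) hy
  subst hx
  rw [LinearMap.comp_apply, LinearMap.flip_apply, ← B.words_nil, primLhat_words,
    primIncl_primLin _ _ _ hj hj', LinearMap.comp_apply, ← h]
  rfl

/-- The two terms of `L`, with their degree-dependent positions, are packaged as linear maps in the
word, so that it is enough to compare them on words in the basis. -/
theorem primIncl_primLhat_ι_mul {j m : ℕ} (hj : 1 ≤ j) (hj' : j ≤ m) {y : H.primSpace.carrier}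
    (hy : y ∈ H.primSpace.gr m) (z : H.primSpace.carrier) (v : H.primSpace.carrier)
    (a : TensorAlgebra K H.primSpace.carrier) :
    H.primIncl.lin (H.primLhat B j (ι K v * a) y z) =
      (H.primIns B j (H.primIncl.lin z) (ι K v * a) -
        H.primInsTail B j (H.primIncl.lin z) (ι K v * a)) (H.primIncl.lin y) := by
  have h1 : ∀ (x : B.X) (xs : List B.X), H.primIncl.lin (H.primLhat B j (B.words (x :: xs)) y z) =
      (H.primIns B j (H.primIncl.lin z) (B.words (x :: xs)) -
        H.primInsTail B j (H.primIncl.lin z) (B.words (x :: xs))) (H.primIncl.lin y) := by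
    intro x xs
    refine B.ext_of_mem (f := H.primIncl.lin ∘ₗ (H.primLhat B j (B.words (x :: xs))).flip z)
      (g := (H.primIns B j (H.primIncl.lin z) (B.words (x :: xs)) -
        H.primInsTail B j (H.primIncl.lin z) (B.words (x :: xs))) ∘ₗ H.primIncl.lin)
      (fun y hy => ?_) hy
    subst hy
    have hd : ∀ xs : List B.X, degSum ((xs.map B.homog).map H.primIncl.onHomog) = B.wdeg xs := by
      intro xs
      rw [GrHom.degSum_onHomog, B.degSum_homog]
    have hw : ∀ xs : List B.X, H.primMul (B.words xs) (H.primIncl.lin (B.b y)) =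
        H.word (vals ((xs.map B.homog).map H.primIncl.onHomog)) (H.primIncl.lin (B.b y)) := by
      intro xs
      rw [B.words_eq_tword_homog, primMul_tword]
    rw [LinearMap.comp_apply, LinearMap.flip_apply, primLhat_words,
      primIncl_primLin _ _ _ hj hj', LinearMap.comp_apply, LinearMap.sub_apply,
      H.primIns_of_mem B _ _ (B.words_mem_tgr _), B.words_cons, primInsTail_ι_mul,
      ← B.words_cons, H.primIns_of_mem B _ _ (B.words_mem_tgr xs), primMul_ι, Module.End.mul_apply,
      Module.End.mul_apply, Module.End.mul_apply, hw, hw, ← hd, ← hd]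
    rfl
  have : ((LinearMap.mul K _).compr₂ (H.primIncl.lin ∘ₗ ((LinearMap.applyₗ z) ∘ₗ
        (LinearMap.applyₗ y) ∘ₗ H.primLhat B j))) ∘ₗ ι K =
      ((LinearMap.mul K _).compr₂ ((LinearMap.applyₗ (H.primIncl.lin y)) ∘ₗ
        (H.primIns B j (H.primIncl.lin z) - H.primInsTail B j (H.primIncl.lin z)))) ∘ₗ ι K := by
    refine B.b.ext fun x => B.words.ext fun xs => ?_
    simp only [LinearMap.comp_apply, LinearMap.compr₂_apply, LinearMap.mul_apply', ← B.words_cons]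
    exact h1 x xs
  exact LinearMap.congr_fun (LinearMap.congr_fun this v) a

/-- The formula for `L` involves the degrees of its arguments and is not visibly multilinear, so the
operations were defined through a basis. This removes the dependence on it. -/
theorem primIncl_Lw {j : ℕ} (xs : List H.primSpace.Homog) (y : H.primSpace.Homog)
    (hj : 1 ≤ j) (hj' : j ≤ y.deg) (z : H.primSpace.carrier) :
    H.primIncl.lin ((H.primOps B).Lw j (vals xs) y.val z) =
      H.Lop j (xs.map H.primIncl.onHomog) (H.primIncl.onHomog y) (H.primIncl.lin z) := by
  refine Eq.trans (congrArg H.primIncl.lin (H.primOps_Lw B j _ _ _)) ?_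
  cases xs with
  | nil => exact H.primIncl_primLhat_one B hj hj' y.mem z
  | cons x xs =>
    have hd : ∀ xs : List H.primSpace.Homog, degSum (xs.map H.primIncl.onHomog) = degSum xs :=
      H.primIncl.degSum_onHomog
    have h0 := B.tword_mem_tgr (x :: xs)
    have hc : tword (vals (x :: xs)) = ι K x.val * tword (vals xs) := tword_cons _ _
    change H.primIncl.lin (H.primLhat B j (tword (vals (x :: xs))) y.val z) = _
    rw [hc, H.primIncl_primLhat_ι_mul B hj hj' y.mem, LinearMap.sub_apply, primInsTail_ι_mul, ← hc,
      H.primIns_of_mem B _ _ h0, H.primIns_of_mem B _ _ (B.tword_mem_tgr xs), Module.End.mul_apply,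
      Module.End.mul_apply, Module.End.mul_apply, primMul_ι, primMul_tword, primMul_tword, ← hd,
      ← hd]
    rfl

end PreshuffleBialgebra

namespace PreshuffleBialgebra

open TensorProduct TensorAlgebra GrSpace

variable {K : Type u} [Field K] (H : PreshuffleBialgebra.{u, v} K)
  (B : HomogBasis.{u, v, w} H.primSpace)

theorem primOps_isGraded : (H.primOps B).IsGraded where
  positive := by
    rw [eq_bot_iff]
    intro x hx
    have hx' : H.primIncl.lin x ∈ H.gr 0 := H.primIncl.map_gr 0 x hx
    rw [H.positive, Submodule.mem_bot] at hx'
    exact H.primIncl_injective (hx'.trans (map_zero _).symm)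
  L_mem := by
    have key : ∀ (j : ℕ) (xs : List H.primSpace.Homog) (y z : H.primSpace.Homog), 1 ≤ j →
        j ≤ y.deg → H.primIncl.lin ((H.primOps B).Lw j (vals xs) y.val z.val) ∈
        H.gr (degSum xs + y.deg + z.deg) := by
      intro j xs y z hj hj'
      rw [H.primIncl_Lw B xs y hj hj' z.val, ← H.primIncl.degSum_onHomog]
      exact H.Lop_mem (xs.map H.primIncl.onHomog) (H.primIncl.onHomog y)
        (H.primIncl.onHomog z) hj'
    exact key
  L_eq_zero := by
    intro n j x m y z hy hj
    have : (LinearMap.flip (H.primLhat B j)) y = 0 := by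
      refine B.ext_of_mem (g := 0) (fun y hy => B.words.ext fun xs => ?_) hy
      rw [LinearMap.flip_apply, primLhat_words, primLin, dif_neg (by rw [← hy] at hj; exact hj)]
      rfl
    exact LinearMap.congr_fun (LinearMap.congr_fun this (tprod K H.primSpace.carrier n x)) z

end PreshuffleBialgebra

/-! ### Comparison of the tensor algebra with a preshuffle algebra -/

namespace PrimOps

open TensorProduct TensorAlgebra GrSpace

variable {K : Type u} [Field K] {V : PrimOps.{u, v} K} (B : HomogBasis.{u, v, w} V.toGrSpace)
  (A : PreshuffleAlgebra.{u, w'} K) (h : V.carrier →ₗ[K] A.carrier)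

/-- The product, with respect to `•₀`, of the images of the letters of a word. -/
noncomputable def zeroWord : List B.X → A.carrier
  | [] => 0
  | [x] => h (B.b x)
  | x :: y :: xs => A.op 0 (h (B.b x)) (zeroWord (y :: xs))

/-- The linear map that sends a nonempty word to the product, with respect to `•₀`, of the images
of its letters. -/
noncomputable def zeroMap : TensorAlgebra K V.carrier →ₗ[K] A.carrier :=
  B.words.constr K (zeroWord B A h)

theorem zeroMap_words (xs : List B.X) : zeroMap B A h (B.words xs) = zeroWord B A h xs := by
  rw [zeroMap, Module.Basis.constr_basis]

theorem zeroMap_one : zeroMap B A h 1 = 0 := by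
  rw [← B.words_nil, zeroMap_words, zeroWord]

theorem zeroMap_ι (v : V.carrier) : zeroMap B A h (ι K v) = h v := by
  have : zeroMap B A h ∘ₗ ι K = h := B.b.ext fun x => by
    rw [LinearMap.comp_apply, ← B.words_singleton, zeroMap_words, zeroWord]
  exact LinearMap.congr_fun this v

theorem zeroMap_words_cons (x : B.X) {xs : List B.X} (hxs : xs ≠ []) :
    zeroMap B A h (B.words (x :: xs)) = A.op 0 (h (B.b x)) (zeroMap B A h (B.words xs)) := by
  obtain ⟨y, ys, rfl⟩ := List.exists_cons_of_ne_nil hxs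
  rw [zeroMap_words, zeroMap_words, zeroWord]

/-- The map `zeroMap` on the span of the nonempty words. -/
noncomputable def augMap : B.Aug →ₗ[K] A.carrier := zeroMap B A h ∘ₗ B.incl

theorem augMap_aug (a : TensorAlgebra K V.carrier) :
    augMap B A h (B.aug a) = zeroMap B A h a := by
  have : augMap B A h ∘ₗ B.aug = zeroMap B A h := by
    refine B.words.ext fun xs => ?_
    rw [LinearMap.comp_apply, augMap, LinearMap.comp_apply]
    by_cases hx : xs = []
    · subst hx
      rw [B.aug_words_nil, map_zero, map_zero, B.words_nil, zeroMap_one]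
    · rw [B.incl_aug_words hx]
  exact LinearMap.congr_fun this a

/-- The hypothesis says that `a` has no constant term. The operation `•₀` has no unit, the empty
word is sent to `0`, and the product formula would fail for it. -/
theorem zeroMap_ι_mul (v : V.carrier) {a : TensorAlgebra K V.carrier}
    (ha : B.incl (B.aug a) = a) :
    zeroMap B A h (ι K v * a) = A.op 0 (h v) (zeroMap B A h a) := by
  have : ((LinearMap.mul K _).compl₁₂ (ι K) B.incl).compr₂ (zeroMap B A h) =
      (A.op 0).compl₁₂ h (zeroMap B A h ∘ₗ B.incl) := by
    refine B.b.ext fun x => ?_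
    ext a : 2
    simp only [LinearMap.comp_apply, LinearMap.compl₁₂_apply, LinearMap.compr₂_apply,
      LinearMap.mul_apply', Finsupp.lsingle_apply, B.incl_single, ← B.words_cons]
    exact zeroMap_words_cons B A h x a.2
  have := LinearMap.congr_fun (LinearMap.congr_fun this v) (B.aug a)
  simpa [ha] using this

/-- The operation on `A` that corresponds to the right multiplication by a word. -/
noncomputable def rightOp (vs : List B.X) : A.carrier →ₗ[K] A.carrier :=
  if vs = [] then LinearMap.id else (A.op 0).flip (zeroMap B A h (B.words vs))

/-- Associativity with second index `0`: `(u •ᵢ y) •₀ z = u •ᵢ (y •₀ z)`. -/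
theorem op_rightOp {i m : ℕ} (u : A.carrier) {y : A.carrier} (hy : y ∈ A.gr m) (hi : i ≤ m)
    (vs : List B.X) : A.op i u (rightOp B A h vs y) = rightOp B A h vs (A.op i u y) := by
  rw [rightOp]
  split_ifs
  · rfl
  · have hz : ∀ z, A.op i u (A.op 0 y z) = A.op 0 (A.op i u y) z := by
      intro z
      induction z using A.toGrSpace.induction_homog with
      | hom r z hz => exact (A.op_assoc i 0 m r u y z hy hz hi (Nat.zero_le _)).symm
      | add a b ha hb => rw [map_add, map_add, map_add, ha, hb]
    exact hz _

theorem op_zero_rightOp (u y : A.carrier) (vs : List B.X) :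
    A.op 0 u (rightOp B A h vs y) = rightOp B A h vs (A.op 0 u y) := by
  induction y using A.toGrSpace.induction_homog with
  | hom r y hy => exact op_rightOp B A h u hy (Nat.zero_le _) vs
  | add a b ha hb => simp only [map_add, ha, hb]

theorem zeroMap_words_append {us : List B.X} (hu : us ≠ []) (vs : List B.X) :
    zeroMap B A h (B.words (us ++ vs)) = rightOp B A h vs (zeroMap B A h (B.words us)) := by
  induction us with
  | nil => exact absurd rfl hu
  | cons x us ih =>
    by_cases hus : us = []
    · subst hus
      rw [rightOp]
      split_ifs with hv
      · subst hv; rfl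
      · rw [List.singleton_append, zeroMap_words_cons B A h x hv, B.words_singleton, zeroMap_ι]; rfl
    · rw [List.cons_append, zeroMap_words_cons B A h x (by simp [hus]), ih hus,
        zeroMap_words_cons B A h x hus, op_zero_rightOp]

theorem zeroMap_mul_words {a : TensorAlgebra K V.carrier} (ha : B.incl (B.aug a) = a)
    (vs : List B.X) :
    zeroMap B A h (a * B.words vs) = rightOp B A h vs (zeroMap B A h a) := by
  have : zeroMap B A h ∘ₗ LinearMap.mulRight K (B.words vs) ∘ₗ B.incl =
      rightOp B A h vs ∘ₗ zeroMap B A h ∘ₗ B.incl := by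
    ext a : 2
    simp only [LinearMap.comp_apply, Finsupp.lsingle_apply, B.incl_single,
      LinearMap.mulRight_apply, ← B.words_append]
    exact zeroMap_words_append B A h a.2 vs
  have := LinearMap.congr_fun this (B.aug a)
  simpa [ha] using this

end PrimOps

/-! ### Compatibility with insertion, modulo an ideal -/

namespace PrimOps

open TensorProduct TensorAlgebra GrSpace

variable {K : Type u} [Field K] {V : PrimOps.{u, v} K} (B : HomogBasis.{u, v, w} V.toGrSpace)
  (A : PreshuffleAlgebra.{u, w'} K) (h : GrHom V.toGrSpace A.toGrSpace)

theorem zeroMap_mem {n : ℕ} {a : TensorAlgebra K V.carrier} (ha : a ∈ B.tgr n) :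
    zeroMap B A h.lin a ∈ A.gr n := by
  refine B.tgr_le (M := (A.gr n).comap (zeroMap B A h.lin)) (fun xs hxs => ?_) ha
  rw [Submodule.mem_comap]
  clear ha
  induction xs generalizing n with
  | nil => rw [B.words_nil, zeroMap_one]; exact zero_mem _
  | cons x xs ih =>
    subst hxs
    rw [B.wdeg_cons]
    by_cases h0 : xs = []
    · subst h0
      rw [B.words_singleton, zeroMap_ι, B.wdeg_nil]
      exact h.map_gr _ _ (B.mem x)
    · rw [zeroMap_words_cons B A _ x h0]
      exact A.op_mem 0 _ _ _ _ (h.map_gr _ _ (B.mem x)) (ih rfl) (Nat.zero_le _)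

theorem word_eq_zeroMap (xs : List B.X) (y : B.X) :
    A.word (vals ((xs.map B.homog).map h.onHomog)) (h.lin (B.b y)) =
      zeroMap B A h.lin (B.words (xs ++ [y])) := by
  induction xs with
  | nil => rw [List.nil_append, B.words_singleton, zeroMap_ι]; rfl
  | cons x xs ih =>
    rw [List.cons_append, zeroMap_words_cons B A h.lin x (by simp), ← ih]; rfl

theorem incl_aug_insOp (hV : V.IsGraded) {i m : ℕ} (hi : i ≤ m) (hm : 0 < m) (z : V.carrier)
    {a : TensorAlgebra K V.carrier} (ha : a ∈ B.tgr m) :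
    B.incl (B.aug (insOp B i z a)) = insOp B i z a := by
  induction z using V.toGrSpace.induction_homog with
  | hom d z hz => exact B.incl_aug_of_mem (by omega) (insOp_mem B hV hi ⟨d, z, hz⟩ ha)
  | add z z' hz hz' => simp only [map_add, LinearMap.add_apply, hz, hz']

/-- `h` is compatible with the operations `L_n^j`, on basis elements, modulo `J`. -/
def LCompat (J : Submodule K A.carrier) : Prop :=
  ∀ (j : ℕ) (xs : List B.X) (y z : B.X), 1 ≤ j → j ≤ B.deg y →
    A.Lop j ((xs.map B.homog).map h.onHomog) (h.onHomog (B.homog y)) (h.lin (B.b z)) -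
      h.lin (V.Lw j (xs.map B.b) (B.b y) (B.b z)) ∈ J

variable {B A h} {J : Submodule K A.carrier}

theorem LCompat.lop_sub_mem (hJ : LCompat B A h J) {j : ℕ} (xs : List B.X) (y : B.X)
    (hj : 1 ≤ j) (hj' : j ≤ B.deg y) (z : V.carrier) :
    A.Lop j ((xs.map B.homog).map h.onHomog) (h.onHomog (B.homog y)) (h.lin z) -
      h.lin (V.Lw j (xs.map B.b) (B.b y) z) ∈ J := by
  have : Submodule.span K (Set.range B.b) ≤ J.comap
      (A.LopLin j ((xs.map B.homog).map h.onHomog) (h.onHomog (B.homog y)) ∘ₗ h.lin -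
        h.lin ∘ₗ V.L (xs.map B.b).length j (xs.map B.b).get (B.b y)) := by
    rw [Submodule.span_le]
    rintro _ ⟨z, rfl⟩
    have := hJ j xs y z hj hj'
    rwa [← A.LopLin_apply] at this
  have := this (B.b.mem_span z)
  rw [← A.LopLin_apply]
  exact this

/-- The definition of `L_q^p` in `A` and the recursion for insertion in the tensor algebra have the
same shape: an insertion into `x us y` is a new letter plus `x` times an insertion into `us y`. The
new letters agree modulo `J` by hypothesis, and the ideal property takes care of the multiplication
by `x`. -/
theorem LCompat.op_zeroMap_append_singleton (hV : V.IsGraded) (hA : A.IsIdeal J)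
    (hJ : LCompat B A h J) {p : ℕ} (us : List B.X) (y : B.X) (hp : 1 ≤ p) (hp' : p ≤ B.deg y)
    (z : V.carrier) : A.op (B.wdeg us + p) (h.lin z) (zeroMap B A h.lin (B.words (us ++ [y]))) -
      zeroMap B A h.lin (insOp B (B.wdeg us + p) z (B.words (us ++ [y]))) ∈ J := by
  induction us with
  | nil =>
    have h1 := hJ.lop_sub_mem [] y hp hp' z
    have h2 := insOp_ι B (B.homog y) hp hp' z
    have h2' : insOp B p z (ι K (B.b y)) = ι K (V.Lw p [] (B.b y) z) +
      if p = B.deg y then ι K (B.b y) * ι K z else 0 := h2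
    have h3 : zeroMap B A h.lin (ι K (B.b y) * ι K z) = A.op 0 (h.lin (B.b y)) (h.lin z) := by
      rw [zeroMap_ι_mul, zeroMap_ι]
      exact B.incl_letter z
    have h4 : A.Lop p (([].map B.homog).map h.onHomog) (h.onHomog (B.homog y)) (h.lin z) =
        if p < B.deg y then A.op p (h.lin z) (h.lin (B.b y))
        else A.op p (h.lin z) (h.lin (B.b y)) - A.op 0 (h.lin (B.b y)) (h.lin z) := rfl
    rw [h4] at h1
    rw [List.nil_append, B.words_singleton, zeroMap_ι, B.wdeg_nil, zero_add, h2', map_add,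
      zeroMap_ι]
    by_cases hlt : p < B.deg y
    · rw [if_pos hlt] at h1
      rw [if_neg (by omega), map_zero, add_zero]
      exact h1
    · rw [if_neg hlt] at h1
      rw [if_pos (by omega), h3, add_comm, ← sub_sub]
      exact h1
  | cons x us ih =>
    have h1 := hJ.lop_sub_mem (x :: us) y hp hp' z
    have h2 := insOp_tword_cons_mul B (B.homog x) (us.map B.homog) (B.homog y) hp hp' z
    rw [← List.map_cons, B.degSum_homog, B.degSum_homog, ← B.words_eq_tword_homog,
      ← B.words_eq_tword_homog] at h2
    have hw : ∀ xs : List B.X, B.words xs * ι K (B.homog y).val = B.words (xs ++ [y]) := fun xs => by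
      rw [B.words_append, B.words_singleton]; rfl
    rw [hw, hw] at h2
    have h3 : A.Lop p (((x :: us).map B.homog).map h.onHomog) (h.onHomog (B.homog y)) (h.lin z) =
        A.op (B.wdeg (x :: us) + p) (h.lin z) (zeroMap B A h.lin (B.words (x :: us ++ [y]))) -
        A.op 0 (h.lin (B.b x)) (A.op (B.wdeg us + p) (h.lin z)
          (zeroMap B A h.lin (B.words (us ++ [y])))) := by
      rw [← word_eq_zeroMap, ← word_eq_zeroMap, add_comm (B.wdeg _), add_comm (B.wdeg _),
        ← B.degSum_homog, ← B.degSum_homog, ← h.degSum_onHomog, ← h.degSum_onHomog]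
      rfl
    have h4 : vals (B.homog x :: us.map B.homog) = (x :: us).map B.b := by
      rw [vals, ← List.map_cons, List.map_map]; rfl
    rw [h3] at h1
    have h5 := (hA 0 (h.lin (B.b x)) _ ih).1
    rw [map_sub] at h5
    rw [List.cons_append] at h1 h2 ⊢
    rw [h2, map_add, zeroMap_ι, List.map_cons, h4, zeroMap_ι_mul]
    · have h6 := add_mem h1 h5
      convert h6 using 1
      change _ - (h.lin (V.Lw p _ (B.b y) z) + A.op 0 (h.lin (B.b x)) _) = _
      rw [sub_sub, add_comm (h.lin _), ← sub_sub, ← sub_sub]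
      abel
    · have hm := B.words_mem_tgr (us ++ [y])
      have hd : B.wdeg (us ++ [y]) = B.wdeg us + B.deg y := by
        rw [B.wdeg_append, B.wdeg_cons, B.wdeg_nil, add_zero]
      rw [hd] at hm
      exact incl_aug_insOp B hV (by omega) (by omega) z hm

theorem rightOp_mem (hA : A.IsIdeal J) {c : A.carrier} (hc : c ∈ J) (vs : List B.X) :
    rightOp B A h.lin vs c ∈ J := by
  rw [rightOp]
  split_ifs
  · exact hc
  · exact (hA 0 _ c hc).2

/-- The word is cut behind the letter that contains the position; on both sides the rest is a right
factor for `•₀`. The ideal is kept general because `⊥` gives the comparison with a bialgebra and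
`envIdeal` the reduction in the free algebra. -/
theorem LCompat.op_zeroMap (hV : V.IsGraded) (hA : A.IsIdeal J) (hJ : LCompat B A h J) {i m : ℕ}
    (hi : i ≤ m) (hm : 0 < m) (z : V.carrier) {a : TensorAlgebra K V.carrier} (ha : a ∈ B.tgr m) :
    A.op i (h.lin z) (zeroMap B A h.lin a) - zeroMap B A h.lin (insOp B i z a) ∈ J := by
  rcases Nat.eq_zero_or_pos i with rfl | hi0
  · rw [insOp_zero, zeroMap_ι_mul _ _ _ _ (B.incl_aug_of_mem hm ha), sub_self]
    exact zero_mem _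
  refine B.tgr_le (M := J.comap (A.op i (h.lin z) ∘ₗ zeroMap B A h.lin -
    zeroMap B A h.lin ∘ₗ insOp B i z)) (fun xs hxs => ?_) ha
  obtain ⟨us, y, vs, p, rfl, rfl, hp, hp'⟩ := B.exists_split xs hi0 (hi.trans hxs.ge)
  have h1 := hJ.op_zeroMap_append_singleton hV hA us y hp hp' z
  have hm := B.words_mem_tgr (us ++ [y])
  have hd : B.wdeg (us ++ [y]) = B.wdeg us + B.deg y := by
    rw [B.wdeg_append, B.wdeg_cons, B.wdeg_nil, add_zero]
  rw [hd] at hm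
  have h2 := rightOp_mem (h := h) hA h1 vs
  rw [map_sub, ← op_rightOp B A h.lin _ (zeroMap_mem B A h hm) (by omega),
    ← zeroMap_words_append B A h.lin (by simp),
    ← zeroMap_mul_words B A h.lin (incl_aug_insOp B hV (by omega) (by omega) z hm)] at h2
  rw [Submodule.mem_comap, LinearMap.sub_apply, LinearMap.comp_apply, LinearMap.comp_apply]
  have h3 : us ++ y :: vs = us ++ [y] ++ vs := by simp
  rw [h3, B.words_append (us ++ [y]) vs, insOp_mul_right B (by omega) (by omega) z hm,
    ← B.words_append]
  exact h2

end PrimOps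

/-! ### Cohomological properties of the coalgebra of words -/

theorem TensorProduct.map_subtype_eq_zero {K M N : Type*} [Field K] [AddCommGroup M] [Module K M]
    [AddCommGroup N] [Module K N] (F : Submodule K M) (ψ : M →ₗ[K] N)
    (hψ : ∀ x ∈ F, ψ x = 0 → x = 0) (t : F ⊗[K] F)
    (ht : TensorProduct.map ψ ψ (TensorProduct.map F.subtype F.subtype t) = 0) :
    TensorProduct.map F.subtype F.subtype t = 0 := by
  have hi : Function.Injective (ψ ∘ₗ F.subtype) := by
    rw [← LinearMap.ker_eq_bot, LinearMap.ker_eq_bot']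
    intro a ha
    exact Subtype.ext (hψ a.1 a.2 ha)
  rw [← LinearMap.comp_apply, ← TensorProduct.map_comp] at ht
  have h2 := TensorProduct.map_injective_of_flat_flat _ _ hi hi
  rw [h2 (ht.trans (map_zero _).symm), map_zero]

theorem LinearMap.rTensor_id_sub {K M : Type*} [Field K] [AddCommGroup M] [Module K M]
    (f : M →ₗ[K] M) (c : M ⊗[K] M) :
    (LinearMap.id - f).rTensor M c = c - f.rTensor M c := by
  rw [LinearMap.rTensor_sub, LinearMap.rTensor_id, LinearMap.sub_apply, LinearMap.id_apply]

namespace HomogBasis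

open TensorAlgebra TensorProduct GrSpace

variable {K : Type u} [Field K] {V : GrSpace.{u, v} K} (B : HomogBasis.{u, v, w} V)

/-- The span of the words of length at most `n`. -/
def lenFilt (n : ℕ) : Submodule K B.Aug := Finsupp.supported K K {a | a.1.length ≤ n}

theorem exists_mem_lenFilt (x : B.Aug) : ∃ n, x ∈ B.lenFilt n := by
  refine ⟨x.support.sup fun a => a.1.length, ?_⟩
  rw [lenFilt, Finsupp.mem_supported]
  intro a ha
  exact Finset.le_sup (f := fun a : B.NEWord => a.1.length) ha

theorem augΔ_mem_lenFilt {n : ℕ} {x : B.Aug} (hx : x ∈ B.lenFilt (n + 1)) :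
    B.augΔ x ∈ LinearMap.range
      (TensorProduct.map (B.lenFilt n).subtype (B.lenFilt n).subtype) := by
  rw [lenFilt, Finsupp.supported_eq_span_single] at hx
  rw [← Submodule.mem_comap]
  refine Submodule.span_le.2 ?_ hx
  rintro _ ⟨a, ha, rfl⟩
  have ha' : a.1.length ≤ n + 1 := ha
  rw [SetLike.mem_coe, Submodule.mem_comap, augΔ_single]
  refine Submodule.sum_mem _ fun r hr => ?_
  rw [Finset.mem_range] at hr
  by_cases h1 : a.1.take r = []
  · rw [h1, B.aug_words_nil, zero_tmul]; exact Submodule.zero_mem _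
  by_cases h2 : a.1.drop r = []
  · rw [h2, B.aug_words_nil, tmul_zero]; exact Submodule.zero_mem _
  rw [B.aug_words h1, B.aug_words h2]
  have h1' := List.take_eq_nil_iff.not.1 h1
  have h2' := List.drop_eq_nil_iff.not.1 h2
  refine ⟨⟨_, Finsupp.single_mem_supported K _ ?_⟩ ⊗ₜ ⟨_, Finsupp.single_mem_supported K _ ?_⟩,
    rfl⟩
  · simp only [Set.mem_ofPred_eq, List.length_take]; omega
  · simp only [Set.mem_ofPred_eq, List.length_drop]; omega

/-- A map from the coalgebra of nonempty words, compatible with the coproducts, is injective if it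
is injective on the words of length one. -/
theorem injective_of_augΔ {M : Type*} [AddCommGroup M] [Module K M] (D : M →ₗ[K] M ⊗[K] M)
    (ψ : B.Aug →ₗ[K] M) (hψ : ∀ x, D (ψ x) = TensorProduct.map ψ ψ (B.augΔ x))
    (hinj : Function.Injective (ψ ∘ₗ B.letter)) : Function.Injective ψ := by
  have key : ∀ n, ∀ x ∈ B.lenFilt n, ψ x = 0 → x = 0 := by
    intro n
    induction n with
    | zero =>
      intro x hx _
      rw [lenFilt, Finsupp.mem_supported] at hx
      rw [← Finsupp.support_eq_empty, ← Finset.coe_eq_empty, Set.eq_empty_iff_forall_notMem]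
      intro a ha
      have : a.1.length ≤ 0 := hx ha
      exact a.2 (List.length_eq_zero_iff.1 (by omega))
    | succ n ih =>
      intro x hx h0
      obtain ⟨t, ht⟩ := B.augΔ_mem_lenFilt hx
      -- The coproduct of `x` is a tensor of shorter words, on which `ψ ⊗ ψ` is injective by
      -- induction, since tensor products over a field preserve injectivity. Hence `x` is primitive,
      -- that is, a letter.
      have h3 := TensorProduct.map_subtype_eq_zero (B.lenFilt n) ψ ih t
        (by rw [ht]; exact (hψ x).symm.trans (by rw [h0, map_zero]))
      rw [ht] at h3
      have h4 : x ∈ LinearMap.ker B.augΔ := h3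
      rw [← range_letter] at h4
      obtain ⟨v, rfl⟩ := h4
      have h5 : v = 0 := hinj (h0.trans (map_zero _).symm)
      rw [h5, map_zero]
  rw [← LinearMap.ker_eq_bot, LinearMap.ker_eq_bot']
  intro x hx
  obtain ⟨n, hn⟩ := B.exists_mem_lenFilt x
  exact key n x hn hx

/-- With `v` the component of `a` of length one, a word `v b` is cut directly behind `v` or inside
`b`. This is the homotopy formula one degree higher than `contr_augΔ`. -/
theorem augΔ_contr_tmul (a b : B.Aug) : B.augΔ (B.contr (a ⊗ₜ b)) =
    B.aug (B.proj₁ (B.incl a)) ⊗ₜ b +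
      B.contr.rTensor _ ((TensorProduct.assoc K _ _ _).symm (a ⊗ₜ B.augΔ b)) := by
  obtain ⟨v, hv⟩ := B.proj₁_mem_range (B.incl a)
  rw [contr_tmul, ← hv, augΔ_aug, deconc_ι_mul, map_add, TensorProduct.map_tmul, B.aug_one,
    zero_tmul, zero_add]
  have h1 : ∀ c : B.Aug ⊗[K] B.Aug,
      B.contr.rTensor B.Aug ((TensorProduct.assoc K _ _ _).symm (a ⊗ₜ c)) =
      TensorProduct.map (B.aug ∘ₗ LinearMap.mulLeft K (ι K v) ∘ₗ B.incl) LinearMap.id c := by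
    intro c
    induction c with
    | zero => simp
    | add c d hc hd => rw [tmul_add, map_add, map_add, map_add, hc, hd]
    | tmul c d =>
      rw [TensorProduct.assoc_symm_tmul, LinearMap.rTensor_tmul, contr_tmul, ← hv,
        TensorProduct.map_tmul]
      rfl
  rw [h1]
  have h2 : TensorProduct.map B.aug B.aug ∘ₗ (LinearMap.mulLeft K (ι K v)).rTensor _ ∘ₗ B.deconc =
      TensorProduct.mk K _ _ (B.letter v) ∘ₗ B.aug +
      TensorProduct.map (B.aug ∘ₗ LinearMap.mulLeft K (ι K v) ∘ₗ B.incl) LinearMap.id ∘ₗ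
        B.augΔ ∘ₗ B.aug := by
    refine B.words.ext fun xs => ?_
    simp only [LinearMap.comp_apply, LinearMap.add_apply, augΔ_aug, deconc_words_eq_sum, map_sum,
      LinearMap.rTensor_tmul, TensorProduct.map_tmul, LinearMap.mulLeft_apply, LinearMap.id_apply,
      TensorProduct.mk_apply]
    rw [Finset.sum_range_succ' _ xs.length, Finset.sum_range_succ' _ xs.length, List.take_zero,
      List.drop_zero, B.aug_words_nil, map_zero, mul_zero, map_zero, zero_tmul, add_zero, add_comm,
      B.words_nil, mul_one]
    congr 1
    refine Finset.sum_congr rfl fun r hr => ?_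
    rw [B.incl_aug_words]
    rw [Ne, List.take_eq_nil_iff]
    rintro (h | rfl)
    · omega
    · simp at hr
  have h3 := LinearMap.congr_fun h2 (B.incl b)
  simp only [LinearMap.comp_apply, LinearMap.add_apply, aug_incl, TensorProduct.mk_apply] at h3
  exact h3

/-- The coalgebra of nonempty words has no cohomology in degree two. -/
theorem augΔ_contr {c : B.Aug ⊗[K] B.Aug}
    (hc : TensorProduct.assoc K _ _ _ (B.augΔ.rTensor _ c) = B.augΔ.lTensor _ c) :
    B.augΔ (B.contr c) = c := by
  have h1 : ∀ c : B.Aug ⊗[K] B.Aug, B.augΔ (B.contr c) =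
      (B.aug ∘ₗ B.proj₁ ∘ₗ B.incl).rTensor _ c +
      B.contr.rTensor _ ((TensorProduct.assoc K _ _ _).symm (B.augΔ.lTensor _ c)) := by
    intro c
    induction c with
    | zero => simp
    | add c d hc hd => simp only [map_add, hc, hd]; abel
    | tmul a b => rw [augΔ_contr_tmul]; rfl
  -- The cocycle condition moves the coproduct to the left factor, where `contr` undoes it up to the
  -- projection to letters; that projection cancels with the first term.
  rw [h1, ← hc, LinearEquiv.symm_apply_apply, ← LinearMap.comp_apply, ← LinearMap.rTensor_comp]
  have h2 : B.contr ∘ₗ B.augΔ = LinearMap.id - B.aug ∘ₗ B.proj₁ ∘ₗ B.incl :=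
    LinearMap.ext fun x => B.contr_augΔ x
  rw [h2, LinearMap.rTensor_id_sub, add_sub_cancel]

end HomogBasis

/-! ### The comparison map from words to a bialgebra -/

namespace PrimOps

open TensorProduct TensorAlgebra GrSpace

variable {K : Type u} [Field K] {V : PrimOps.{u, v} K} {B : HomogBasis.{u, v, w} V.toGrSpace}
  {A : PreshuffleAlgebra.{u, w'} K} {h : GrHom V.toGrSpace A.toGrSpace}

theorem LCompat.op_zeroMap_bot (hJ : LCompat B A h ⊥) (hV : V.IsGraded) {i m : ℕ} (hi : i ≤ m)
    (hm : 0 < m) (z : V.carrier) {a : TensorAlgebra K V.carrier} (ha : a ∈ B.tgr m) :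
    A.op i (h.lin z) (zeroMap B A h.lin a) = zeroMap B A h.lin (insOp B i z a) := by
  have hA : A.IsIdeal ⊥ := by
    intro i a c hc
    rw [Submodule.mem_bot] at hc
    simp [hc]
  exact sub_eq_zero.1 ((Submodule.mem_bot K).1 (hJ.op_zeroMap hV hA hi hm z ha))

/-- Letters of the left factor are split off one at a time by associativity with first index `0`:
`(x •₀ u) •ᵢ b = x •ᵢ (u •ᵢ b)`. Outside the range of positions both sides are zero by convention.
-/
theorem LCompat.augMap_augOp (hJ : LCompat B A h ⊥) (hV : V.IsGraded) (i : ℕ) (x y : B.Aug) :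
    augMap B A h.lin (augOp B i x y) =
      A.op i (augMap B A h.lin x)
        (augMap B A h.lin y) := by
  have key : ∀ m, 0 < m → i ≤ m → ∀ b ∈ B.tgr m, ∀ us : List B.X, us ≠ [] →
      zeroMap B A h.lin (opHom B i (B.words us) b) =
      A.op i (zeroMap B A h.lin (B.words us))
        (zeroMap B A h.lin b) := by
    intro m hm hi b hb us hus
    induction us with
    | nil => exact absurd rfl hus
    | cons x us ih =>
      rw [B.words_cons, opHom_ι_mul]
      by_cases h0 : us = []
      · subst h0
        rw [B.words_nil, opHom_one, mul_one, zeroMap_ι, hJ.op_zeroMap_bot hV hi hm _ hb]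
      · have hmem := opHom_mem B hV hi (B.words_mem_tgr us) hb
        rw [← hJ.op_zeroMap_bot hV (by omega) (by omega) _ hmem, ih h0, ← B.words_cons,
          zeroMap_words_cons B _ _ x h0,
          A.op_assoc 0 i _ _ _ _ _ (zeroMap_mem B _ h (B.words_mem_tgr us))
            (zeroMap_mem B _ h hb) (Nat.zero_le _) hi, zero_add]
  have : (augOp B i).compr₂ (augMap B A h.lin) =
      (A.op i).compl₁₂ (augMap B A h.lin)
        (augMap B A h.lin) := by
    ext a b : 4
    simp only [LinearMap.comp_apply, LinearMap.compl₁₂_apply, LinearMap.compr₂_apply,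
      Finsupp.lsingle_apply]
    have hb := B.single_mem_augGr b
    rcases le_or_gt i (B.wdeg b.1) with hi | hi
    · have hb0 := B.wdeg_pos hV.positive b.2
      rw [augOp_apply, augMap_aug, B.incl_single, B.incl_single, augMap, LinearMap.comp_apply,
        LinearMap.comp_apply, B.incl_single, B.incl_single,
        key _ hb0 hi _ (B.words_mem_tgr b.1) a.1 a.2]
    · rw [augOp_eq_zero B _ hb hi, map_zero, A.op_eq_zero i _ _ _
        (show augMap B A h.lin (Finsupp.single b 1) ∈ A.gr _ from
          zeroMap_mem B _ h (B.incl_mem hb)) hi]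
  exact LinearMap.congr_fun (LinearMap.congr_fun this x) y

end PrimOps

namespace PreshuffleBialgebra

open TensorProduct TensorAlgebra GrSpace PrimOps

variable {K : Type u} [Field K] {H : PreshuffleBialgebra.{u, w'} K} {V : PrimOps.{u, v} K}

/-- For primitive `x` the condition for `x •₀ w` reads `Δ(x •₀ w) = x ⊗ w + ∑ (x •₀ w₍₁₎) ⊗ w₍₂₎`,
which is the recursion for reduced deconcatenation. -/
theorem Δ_augMap_of_prim (B : HomogBasis.{u, v, w} V.toGrSpace) (h : V.carrier →ₗ[K] H.carrier)
    (hΔ : ∀ v, H.Δ (h v) = 0) (x : B.Aug) : H.Δ (augMap B H.toPreshuffleAlgebra h x) =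
    TensorProduct.map (augMap B H.toPreshuffleAlgebra h)
      (augMap B H.toPreshuffleAlgebra h) (B.augΔ x) := by
  have key : ∀ us : List B.X, H.Δ (zeroMap B H.toPreshuffleAlgebra h (B.words us)) =
      ∑ r ∈ Finset.range (us.length + 1),
        zeroMap B H.toPreshuffleAlgebra h (B.words (us.take r)) ⊗ₜ
          zeroMap B H.toPreshuffleAlgebra h (B.words (us.drop r)) := by
    intro us
    induction us with
    | nil => simp [B.words_nil, zeroMap_one]
    | cons x us ih =>
      by_cases h0 : us = []
      · subst h0
        rw [B.words_singleton, zeroMap_ι, hΔ]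
        simp [Finset.sum_range_succ, B.words_nil, zeroMap_one]
      · rw [zeroMap_words_cons B _ _ x h0, H.Δ_op_zero_prim (hΔ _), ih,
          List.length_cons, Finset.sum_range_succ' _ (us.length + 1),
          Finset.sum_range_succ' _ us.length, Finset.sum_range_succ' _ us.length, map_add, map_sum]
        simp only [LinearMap.rTensor_tmul, List.take_zero, List.drop_zero, B.words_nil,
          zeroMap_one, zero_tmul, map_zero, add_zero, List.take_succ_cons, List.drop_succ_cons,
          zero_add]
        rw [B.words_singleton, zeroMap_ι, add_comm]
        congr 1
        refine Finset.sum_congr rfl fun r hr => ?_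
        rw [zeroMap_words_cons B _ _ x (take_ne_nil h0 (by omega))]
  have : H.Δ ∘ₗ augMap B H.toPreshuffleAlgebra h =
      TensorProduct.map (augMap B H.toPreshuffleAlgebra h)
        (augMap B H.toPreshuffleAlgebra h) ∘ₗ B.augΔ := by
    ext a : 2
    simp only [LinearMap.comp_apply, Finsupp.lsingle_apply, B.augΔ_single, map_sum,
      TensorProduct.map_tmul, augMap_aug]
    rw [augMap, LinearMap.comp_apply, B.incl_single, key]
  exact LinearMap.congr_fun this x

/-- `V` is the space of primitive elements of `H` with the operations `L_n^j`. -/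
structure IsPrimOps (H : PreshuffleBialgebra.{u, w'} K) (V : PrimOps.{u, v} K)
    (h : GrHom V.toGrSpace H.toGrSpace) : Prop where
  graded : V.IsGraded
  injective : Function.Injective h.lin
  range_eq : LinearMap.range h.lin = LinearMap.ker H.Δ
  map_L : ∀ (j : ℕ) (xs : List V.toGrSpace.Homog) (y z : V.toGrSpace.Homog),
    1 ≤ j → j ≤ y.deg →
    h.lin (V.Lw j (vals xs) y.val z.val) =
      H.Lop j (xs.map h.onHomog) (h.onHomog y) (h.lin z.val)

namespace IsPrimOps

variable {h : GrHom V.toGrSpace H.toGrSpace} (B : HomogBasis.{u, v, w} V.toGrSpace)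

theorem lCompat (hP : IsPrimOps H V h) : LCompat B H.toPreshuffleAlgebra h ⊥ := by
  intro j xs y z hj hj'
  rw [Submodule.mem_bot, sub_eq_zero]
  have := hP.map_L j (xs.map B.homog) (B.homog y) (B.homog z) hj hj'
  have h4 : vals (xs.map B.homog) = xs.map B.b := by
    rw [vals, List.map_map]; rfl
  rw [h4] at this
  exact this.symm

theorem op_zeroMap (hP : IsPrimOps H V h) {i m : ℕ} (hi : i ≤ m) (hm : 0 < m) (z : V.carrier)
    {a : TensorAlgebra K V.carrier} (ha : a ∈ B.tgr m) :
    H.op i (h.lin z) (zeroMap B H.toPreshuffleAlgebra h.lin a) =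
      zeroMap B H.toPreshuffleAlgebra h.lin (insOp B i z a) :=
  (hP.lCompat B).op_zeroMap_bot hP.graded hi hm z ha

theorem augMap_augOp (hP : IsPrimOps H V h) (i : ℕ) (x y : B.Aug) :
    augMap B H.toPreshuffleAlgebra h.lin (augOp B i x y) =
      H.op i (augMap B H.toPreshuffleAlgebra h.lin x)
        (augMap B H.toPreshuffleAlgebra h.lin y) :=
  (hP.lCompat B).augMap_augOp hP.graded i x y

theorem Δ_apply (hP : IsPrimOps H V h) (v : V.carrier) : H.Δ (h.lin v) = 0 := by
  have : h.lin v ∈ LinearMap.ker H.Δ := hP.range_eq ▸ ⟨v, rfl⟩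
  exact this

theorem Δ_augMap (hP : IsPrimOps H V h) (x : B.Aug) :
    H.Δ (augMap B H.toPreshuffleAlgebra h.lin x) =
    TensorProduct.map (augMap B H.toPreshuffleAlgebra h.lin)
      (augMap B H.toPreshuffleAlgebra h.lin) (B.augΔ x) :=
  Δ_augMap_of_prim B h.lin hP.Δ_apply x

theorem augMap_letter (v : V.carrier) :
    augMap B H.toPreshuffleAlgebra h.lin (B.letter v) = h.lin v := by
  rw [B.letter_apply, augMap_aug, zeroMap_ι]

theorem augMap_injective (hP : IsPrimOps H V h) :
    Function.Injective (augMap B H.toPreshuffleAlgebra h.lin) := by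
  refine B.injective_of_augΔ H.Δ _ (hP.Δ_augMap B) ?_
  intro v v' hv
  simp only [LinearMap.comp_apply, augMap_letter] at hv
  exact hP.injective hv

/-- Induction along the filtration: `Δ x` is the image of some tensor `c` of words. Coassociativity
of `H` and injectivity of the comparison map make `c` a cocycle, so `c` is the coproduct of `contr
c`. Then `x` differs from the image of `contr c` by a primitive element, which is the image of a
letter. -/
theorem augMap_surjective (hP : IsPrimOps H V h) (hH : H.IsConnected) :
    Function.Surjective (augMap B H.toPreshuffleAlgebra h.lin) := by
  set ψ := augMap B H.toPreshuffleAlgebra h.lin with hψ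
  have hinj := hP.augMap_injective B
  have h0 : LinearMap.ker H.Δ ≤ LinearMap.range ψ := by
    rw [← hP.range_eq]
    rintro _ ⟨v, rfl⟩
    exact ⟨B.letter v, augMap_letter B v⟩
  have key : ∀ p, H.filt p ≤ LinearMap.range ψ := by
    intro p
    induction p with
    | zero => exact h0
    | succ p ih =>
      intro x hx
      have hx' : H.Δ x ∈ LinearMap.range (TensorProduct.map ψ ψ) := by
        have h1 : (H.filt p).subtype = (LinearMap.range ψ).subtype ∘ₗ Submodule.inclusion ih := by
          rw [Submodule.subtype_comp_inclusion]
        have h2 : LinearMap.range (TensorProduct.map (H.filt p).subtype (H.filt p).subtype) ≤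
            LinearMap.range (TensorProduct.map ψ ψ) := by
          rintro _ ⟨t, rfl⟩
          induction t with
          | zero => rw [map_zero]; exact Submodule.zero_mem _
          | add s t hs ht => rw [map_add]; exact Submodule.add_mem _ hs ht
          | tmul a b =>
            obtain ⟨a', ha'⟩ := ih a.2
            obtain ⟨b', hb'⟩ := ih b.2
            exact ⟨a' ⊗ₜ b', by rw [TensorProduct.map_tmul, TensorProduct.map_tmul, ha', hb']; rfl⟩
        exact h2 hx
      obtain ⟨c, hc⟩ := hx'
      have e1 : ∀ c, H.Δ.rTensor _ (TensorProduct.map ψ ψ c) =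
          TensorProduct.map (TensorProduct.map ψ ψ) ψ (B.augΔ.rTensor _ c) := by
        intro c
        induction c with
        | zero => simp
        | add c d hc hd => simp only [map_add, hc, hd]
        | tmul c d => simp [hψ, hP.Δ_augMap B]
      have e2 : ∀ c, H.Δ.lTensor _ (TensorProduct.map ψ ψ c) =
          TensorProduct.map ψ (TensorProduct.map ψ ψ) (B.augΔ.lTensor _ c) := by
        intro c
        induction c with
        | zero => simp
        | add c d hc hd => simp only [map_add, hc, hd]
        | tmul c d => simp [hψ, hP.Δ_augMap B]
      have h3 := H.coassoc x
      rw [← hc, e1, e2, ← TensorProduct.map_map_assoc] at h3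
      have h4 := TensorProduct.map_injective_of_flat_flat _ _ hinj
        (TensorProduct.map_injective_of_flat_flat _ _ hinj hinj) h3
      have h5 := B.augΔ_contr h4
      have h6 : x - ψ (B.contr c) ∈ LinearMap.ker H.Δ := by
        rw [LinearMap.mem_ker, map_sub, hψ, hP.Δ_augMap B, h5, ← hψ, hc, sub_self]
      have := Submodule.add_mem _ (h0 h6) (LinearMap.mem_range_self ψ (B.contr c))
      rwa [sub_add_cancel] at this
  intro x
  obtain ⟨p, hp⟩ := hH x
  exact key p hp

end IsPrimOps

end PreshuffleBialgebra

/-! ### The relations (A) and (B) for primitive elements -/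

namespace PrimOps

open GrSpace

variable {K : Type u} [Field K] {V : PrimOps.{u, v} K}

theorem Lw_add_right (j : ℕ) (xs : List V.carrier) (y z z' : V.carrier) :
    V.Lw j xs y (z + z') = V.Lw j xs y z + V.Lw j xs y z' := by simp [Lw]

theorem Lw_add_left (j : ℕ) (xs : List V.carrier) (y y' z : V.carrier) :
    V.Lw j xs (y + y') z = V.Lw j xs y z + V.Lw j xs y' z := by simp [Lw]

theorem RelA.add {j k : ℕ} {xs : List V.toGrSpace.Homog} {y w : V.toGrSpace.Homog}
    {t t' : V.carrier} (h : V.RelA j k xs y w t) (h' : V.RelA j k xs y w t') :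
    V.RelA j k xs y w (t + t') := by
  unfold RelA at *
  simp only [Lw_add_right, Lw_add_left, Finset.sum_add_distrib, h, h']
  split_ifs <;> abel

theorem nestTop_add (j k : ℕ) (xs : List V.toGrSpace.Homog) (y : V.carrier)
    (zs : List V.toGrSpace.Homog) (w t t' : V.carrier) :
    V.nestTop j k xs y zs w (t + t') = V.nestTop j k xs y zs w t + V.nestTop j k xs y zs w t' := by
  simp only [nestTop, Lw_add_right, Finset.sum_add_distrib]

theorem nestMid_add (k : ℕ) (xs : List V.toGrSpace.Homog) (y : V.toGrSpace.Homog)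
    (zs : List V.toGrSpace.Homog) (w t t' : V.carrier) :
    V.nestMid k xs y zs w (t + t') = V.nestMid k xs y zs w t + V.nestMid k xs y zs w t' := by
  simp only [nestMid, Lw_add_right, Finset.sum_add_distrib]

theorem RelB.add {j k : ℕ} {xs : List V.toGrSpace.Homog} {y z : V.toGrSpace.Homog}
    {zs : List V.toGrSpace.Homog} {w : V.toGrSpace.Homog}
    {t t' : V.carrier} (h : V.RelB j k xs y z zs w t) (h' : V.RelB j k xs y z zs w t') :
    V.RelB j k xs y z zs w (t + t') := by
  unfold RelB at *
  simp only [nestTop_add, nestMid_add, Lw_add_right, Lw_add_left, Finset.sum_add_distrib, h, h']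
  split_ifs <;> abel

end PrimOps

namespace PreshuffleBialgebra

open TensorProduct TensorAlgebra GrSpace PrimOps

namespace IsPrimOps

variable {K : Type u} [Field K] {H : PreshuffleBialgebra.{u, w'} K} {V : PrimOps.{u, v} K}
  {h : GrHom V.toGrSpace H.toGrSpace} (B : HomogBasis.{u, v, w} V.toGrSpace)

/-- Here associativity on words is not deduced from the relations, which are not yet known; it is
pulled back from `H` along the injective comparison map. -/
theorem opHom_insOp (hP : IsPrimOps H V h) {i k m n : ℕ} (t : V.toGrSpace.Homog)
    {u a : TensorAlgebra K V.carrier} (hu : u ∈ B.tgr m) (hm : 0 < m) (hk : k ≤ m)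
    (ha : a ∈ B.tgr n) (hn : 0 < n) (hi : i ≤ n) :
    opHom B i (insOp B k t.val u) a = insOp B (k + i) t.val (opHom B i u a) := by
  have e1 := insOp_mem B hP.graded hk t hu
  have e2 := opHom_mem B hP.graded hi e1 ha
  have e3 := opHom_mem B hP.graded hi hu ha
  have e4 := insOp_mem B hP.graded (show k + i ≤ m + n by omega) t e3
  rw [← B.incl_aug_of_mem (by omega) e2, ← B.incl_aug_of_mem (by omega) e4]
  congr 1
  apply hP.augMap_injective B
  have key : ∀ (i d e : ℕ) (b c : TensorAlgebra K V.carrier), b ∈ B.tgr d → c ∈ B.tgr e → 0 < d →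
      0 < e → augMap B H.toPreshuffleAlgebra h.lin (B.aug (opHom B i b c)) =
        H.op i (zeroMap B H.toPreshuffleAlgebra h.lin b)
          (zeroMap B H.toPreshuffleAlgebra h.lin c) := by
    intro i d e b c hb hc hd he
    rw [← augMap_aug, ← augMap_aug, ← hP.augMap_augOp, augOp_apply, B.incl_aug_of_mem hd hb,
      B.incl_aug_of_mem he hc]
  rw [key i _ _ _ _ e1 ha (by omega) hn, augMap_aug, ← hP.op_zeroMap B (by omega) (by omega) _ e3,
    ← hP.op_zeroMap B hk hm _ hu, ← augMap_aug B _ _ (opHom B i u a), key i _ _ _ _ hu ha hm hn]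
  exact H.op_assoc k i _ _ _ _ _ (zeroMap_mem B _ h hu) (zeroMap_mem B _ h ha) hk hi

/-- Associativity makes the operator side of `insOp_insSeq_sub` zero. So the `tailSum` of the
differences of the two sides of (B) is zero, and so is its coefficient for the full list. -/
theorem relB_homog (hP : IsPrimOps H V h) {j k : ℕ} (xs : List V.toGrSpace.Homog)
    (y z : V.toGrSpace.Homog) (zs : List V.toGrSpace.Homog) (w t : V.toGrSpace.Homog)
    (hj : 1 ≤ j) (hj' : j ≤ y.deg) (hk : 1 ≤ k) (hk' : k ≤ w.deg) :
    V.RelB j k xs y z zs w t.val := by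
  obtain ⟨B⟩ := V.toGrSpace.exists_homogBasis
  have h1 := insOp_insSeq_sub B hP.graded xs y z zs w t hj hj' hk hk'
  have ha := B.mul_mem_tgr (B.tword_mem_tgr xs) (B.ι_mem_tgr y.mem)
  have hW : ∀ zs : List V.toGrSpace.Homog, tword (vals (zs ++ [w])) =
      tword (vals zs) * ι K w.val := fun zs => by
    rw [vals, List.map_append, tword_append, List.map_singleton, tword_cons, tword_nil, mul_one]
    rfl
  have hm : ∀ zs : List V.toGrSpace.Homog, tword (vals zs) * ι K w.val ∈
      B.tgr (degSum zs + w.deg) := fun zs =>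
    B.mul_mem_tgr (B.tword_mem_tgr zs) (B.ι_mem_tgr w.mem)
  have hk2 : ∀ d, degSum xs + j + (d + k) = d + k + (degSum xs + j) := fun d => by omega
  rw [← opHom_tword, ← opHom_tword, hW, hW, hk2, hk2,
    ← hP.opHom_insOp B t (hm _) (by omega) (by omega) ha (by omega) (by omega),
    ← hP.opHom_insOp B t (hm _) (by omega) (by omega) ha (by omega) (by omega),
    insOp_tword_cons_mul B z zs w hk hk', map_add, LinearMap.add_apply, opHom_ι, opHom_ι_mul,
    add_sub_cancel_right, sub_self, ← tailSum_zero xs] at h1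
  have h2 := tailSum_injective h1
  rw [relB_iff, eq_comm, ← sub_eq_zero]
  exact h2.symm

theorem relA_homog (hP : IsPrimOps H V h) {j k : ℕ} (xs : List V.toGrSpace.Homog)
    (y w t : V.toGrSpace.Homog) (hj : 1 ≤ j) (hj' : j ≤ y.deg) (hk : 1 ≤ k) (hk' : k ≤ w.deg) :
    V.RelA j k xs y w t.val := by
  obtain ⟨B⟩ := V.toGrSpace.exists_homogBasis
  have h1 := insOp_insOp_sub B hP.graded xs y w t hj hj' hk hk'
  have ha := B.mul_mem_tgr (B.tword_mem_tgr xs) (B.ι_mem_tgr y.mem)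
  have h3 : opHom B (degSum xs + j) (ι K w.val * ι K t.val) (tword (vals xs) * ι K y.val) =
      insOp B (degSum xs + j) w.val (insOp B (degSum xs + j) t.val
        (tword (vals xs) * ι K y.val)) := by
    rw [opHom_ι_mul, opHom_ι]
  have h4 : (if k = w.deg then opHom B (degSum xs + j) (ι K w.val * ι K t.val)
      (tword (vals xs) * ι K y.val) else 0) = opHom B (degSum xs + j)
      (if k = w.deg then ι K w.val * ι K t.val else 0) (tword (vals xs) * ι K y.val) := by
    split_ifs <;> simp
  rw [← h3, h4, ← opHom_ι B _ w.val, add_comm _ k,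
    ← hP.opHom_insOp B t (B.ι_mem_tgr w.mem) (by omega) hk' ha (by omega) (by omega),
    insOp_ι B w hk hk', map_add, LinearMap.add_apply, opHom_ι,
    add_sub_cancel_right, sub_self, ← tailSum_zero xs] at h1
  have h2 := tailSum_injective h1
  rw [relA_iff, eq_comm, ← sub_eq_zero]
  exact h2.symm

theorem relB (hP : IsPrimOps H V h) {j k : ℕ} (xs : List V.toGrSpace.Homog)
    (y z : V.toGrSpace.Homog) (zs : List V.toGrSpace.Homog) (w : V.toGrSpace.Homog) (t : V.carrier)
    (hj : 1 ≤ j) (hj' : j ≤ y.deg) (hk : 1 ≤ k) (hk' : k ≤ w.deg) :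
    V.RelB j k xs y z zs w t := by
  induction t using V.toGrSpace.induction_homog with
  | hom n t ht => exact hP.relB_homog xs y z zs w ⟨n, t, ht⟩ hj hj' hk hk'
  | add t t' h h' => exact h.add h'

theorem relA (hP : IsPrimOps H V h) {j k : ℕ} (xs : List V.toGrSpace.Homog)
    (y w : V.toGrSpace.Homog) (t : V.carrier)
    (hj : 1 ≤ j) (hj' : j ≤ y.deg) (hk : 1 ≤ k) (hk' : k ≤ w.deg) :
    V.RelA j k xs y w t := by
  induction t using V.toGrSpace.induction_homog with
  | hom n t ht => exact hP.relA_homog xs y w ⟨n, t, ht⟩ hj hj' hk hk'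
  | add t t' h h' => exact h.add h'

end IsPrimOps

variable {K : Type u} [Field K] (H : PreshuffleBialgebra.{u, v} K)

theorem primOps_isPrimOps (B : HomogBasis.{u, v, w} H.primSpace) :
    IsPrimOps H (H.primOps B) H.primIncl where
  graded := H.primOps_isGraded B
  injective := H.primIncl_injective
  range_eq := H.range_primIncl
  map_L := fun _ xs y z hj hj' => H.primIncl_Lw B xs y hj hj' z.val

/-- The `Prim_psh` algebra of the primitive elements of a preshuffle bialgebra. -/
noncomputable def prim : PrimPshAlgebra.{u, v} K where
  toPrimOps := H.primOps H.primSpace.exists_homogBasis.some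
  positive := (H.primOps_isGraded _).positive
  L_mem := (H.primOps_isGraded _).L_mem
  L_eq_zero := (H.primOps_isGraded _).L_eq_zero
  relA := fun _ _ xs y w t => (H.primOps_isPrimOps _).relA xs y w t
  relB := fun _ _ xs y z zs w t => (H.primOps_isPrimOps _).relB xs y z zs w t

theorem isPrim_prim : IsPrim H H.prim H.primIncl where
  injective := H.primIncl_injective
  range_eq := H.range_primIncl
  map_L := fun _ xs y z hj hj' => H.primIncl_Lw _ xs y hj hj' z.val

end PreshuffleBialgebra

theorem IsPrim.isPrimOps {K : Type u} [Field K] {H : PreshuffleBialgebra.{u, v} K}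
    {P : PrimPshAlgebra.{u, w} K} {ι : GrHom P.toGrSpace H.toGrSpace} (hι : IsPrim H P ι) :
    PreshuffleBialgebra.IsPrimOps H P.toPrimOps ι where
  graded := P.isGraded
  injective := hι.injective
  range_eq := hι.range_eq
  map_L := hι.map_L

/-! ### The functor of primitive elements -/

section Maps

open TensorProduct GrSpace

variable {K : Type u} [Field K]

theorem GrHom.map_proj {A : GrSpace.{u, v} K} {B : GrSpace.{u, w} K} (f : GrHom A B) (n : ℕ)
    (x : A.carrier) : f.lin (A.proj n x) = B.proj n (f.lin x) := by
  have : f.lin ∘ₗ A.proj n = B.proj n ∘ₗ f.lin := by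
    refine A.linearMap_ext fun m x hx => ?_
    rw [LinearMap.comp_apply, LinearMap.comp_apply, A.proj_of_mem_eq_ite hx,
      B.proj_of_mem_eq_ite (f.map_gr m x hx)]
    split_ifs <;> simp
  exact LinearMap.congr_fun this x

theorem GrHom.mem_gr_of_injective {A : GrSpace.{u, v} K} {B : GrSpace.{u, w} K} (f : GrHom A B)
    (hf : Function.Injective f.lin) {n : ℕ} {x : A.carrier} (hx : f.lin x ∈ B.gr n) :
    x ∈ A.gr n := by
  have : A.proj n x = x := hf (by rw [f.map_proj, B.proj_of_mem hx])
  rw [← this]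
  exact A.proj_mem n x

/-- The composition of degree-preserving linear maps. -/
def GrHom.comp {A : GrSpace.{u, v} K} {B : GrSpace.{u, w} K} {C : GrSpace.{u, w'} K}
    (g : GrHom B C) (f : GrHom A B) : GrHom A C where
  lin := g.lin ∘ₗ f.lin
  map_gr := fun n x hx => g.map_gr n _ (f.map_gr n x hx)

variable {A : PreshuffleAlgebra.{u, v} K} {A' : PreshuffleAlgebra.{u, w} K}
  (f : GrHom A.toGrSpace A'.toGrSpace)

theorem GrHom.map_word (hf : ∀ i x y, f.lin (A.op i x y) = A'.op i (f.lin x) (f.lin y))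
    (xs : List A.toGrSpace.Homog) (y : A.carrier) :
    f.lin (A.word (vals xs) y) = A'.word (vals (xs.map f.onHomog)) (f.lin y) := by
  induction xs with
  | nil => rfl
  | cons x xs ih =>
    change f.lin (A.op 0 x.val (A.word (vals xs) y)) = _
    rw [hf, ih]
    rfl

theorem GrHom.map_Lop (hf : ∀ i x y, f.lin (A.op i x y) = A'.op i (f.lin x) (f.lin y))
    (j : ℕ) (xs : List A.toGrSpace.Homog) (y : A.toGrSpace.Homog) (z : A.carrier) :
    f.lin (A.Lop j xs y z) = A'.Lop j (xs.map f.onHomog) (f.onHomog y) (f.lin z) := by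
  cases xs with
  | nil =>
    change _ = if j < y.deg then _ else _
    rw [PreshuffleAlgebra.Lop]
    split_ifs
    · exact hf _ _ _
    · rw [map_sub, hf, hf]; rfl
  | cons x xs =>
    rw [PreshuffleAlgebra.Lop, map_sub, hf, hf, hf, f.map_word hf, f.map_word hf,
      ← f.degSum_onHomog, ← f.degSum_onHomog]
    rfl

/-- A degree-preserving linear map that is compatible with the operations on homogeneous elements
is a morphism of `Prim_psh` algebras. -/
def PrimPshHom.ofHomog {P Q : PrimPshAlgebra.{u, v} K} (g : GrHom P.toGrSpace Q.toGrSpace)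
    (hg : ∀ (j : ℕ) (xs : List P.toGrSpace.Homog) (y z : P.toGrSpace.Homog), 1 ≤ j → j ≤ y.deg →
      g.lin (P.Lw j (vals xs) y.val z.val) =
        Q.Lw j (vals (xs.map g.onHomog)) (g.lin y.val) (g.lin z.val)) : P ⟶ Q where
  toGrHom := g
  map_L := by
    obtain ⟨B⟩ := P.toGrSpace.exists_homogBasis
    intro n j x y z
    have h1 : ∀ (v : Fin n → B.X) (y z : P.carrier),
        g.lin (P.L n j (fun i => B.b (v i)) y z) =
          Q.L n j (fun i => g.lin (B.b (v i))) (g.lin y) (g.lin z) := by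
      intro v y z
      have : (P.L n j (fun i => B.b (v i))).compr₂ g.lin =
          (Q.L n j (fun i => g.lin (B.b (v i)))).compl₁₂ g.lin g.lin := by
        refine B.b.ext fun y => B.b.ext fun z => ?_
        rw [LinearMap.compr₂_apply, LinearMap.compl₁₂_apply]
        -- Outside this range both operations vanish by convention.
        by_cases hj : 1 ≤ j ∧ j ≤ B.deg y
        · have := hg j (List.ofFn fun i => B.homog (v i)) (B.homog y) (B.homog z) hj.1 hj.2
          rw [vals, vals, List.map_map, List.map_ofFn, List.map_ofFn] at this
          exact (congrArg g.lin (PrimOps.Lw_ofFn j _ _ _)).symm.trans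
            (this.trans (PrimOps.Lw_ofFn j _ _ _))
        · rw [P.L_eq_zero n j _ _ _ _ (B.mem y) hj, map_zero,
            Q.L_eq_zero n j _ _ _ _ (g.map_gr _ _ (B.mem y)) hj]
      exact LinearMap.congr_fun (LinearMap.congr_fun this y) z
    have h2 : (g.lin ∘ₗ LinearMap.applyₗ z ∘ₗ LinearMap.applyₗ y).compMultilinearMap (P.L n j) =
        (LinearMap.applyₗ (g.lin z) ∘ₗ LinearMap.applyₗ (g.lin y)).compMultilinearMap
          ((Q.L n j).compLinearMap fun _ => g.lin) :=
      Module.Basis.ext_multilinear (fun _ => B.b) fun v => h1 v y z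
    exact congrArg (fun F => F x) h2

end Maps

namespace IsPrim

open TensorProduct GrSpace

variable {K : Type u} [Field K] {H : PreshuffleBialgebra.{u, w'} K} {P Q : PrimPshAlgebra.{u, v} K}
  {ι : GrHom P.toGrSpace H.toGrSpace}

/-- The inverse of the inclusion on the primitive elements. -/
noncomputable def liftLin (hι : IsPrim H P ι) {M : Type*} [AddCommGroup M] [Module K M]
    (f : M →ₗ[K] H.carrier) (hf : ∀ x, H.Δ (f x) = 0) : M →ₗ[K] P.carrier :=
  (LinearEquiv.ofInjective ι.lin hι.injective).symm.toLinearMap ∘ₗ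
    f.codRestrict (LinearMap.range ι.lin) fun x => by
      rw [hι.range_eq]
      exact hf x

theorem liftLin_spec (hι : IsPrim H P ι) {M : Type*} [AddCommGroup M] [Module K M]
    (f : M →ₗ[K] H.carrier) (hf : ∀ x, H.Δ (f x) = 0) (x : M) :
    ι.lin (hι.liftLin f hf x) = f x := by
  have := (LinearEquiv.ofInjective ι.lin hι.injective).apply_symm_apply
    (f.codRestrict (LinearMap.range ι.lin) (fun x => by rw [hι.range_eq]; exact hf x) x)
  exact congrArg Subtype.val this

/-- The degree-preserving map to the primitive elements that corresponds to a degree-preserving map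
with primitive values. -/
noncomputable def liftGr (hι : IsPrim H P ι) {Q : GrSpace.{u, v} K}
    (f : GrHom Q H.toGrSpace) (hf : ∀ x, H.Δ (f.lin x) = 0) : GrHom Q P.toGrSpace where
  lin := hι.liftLin f.lin hf
  map_gr := fun n x hx => ι.mem_gr_of_injective hι.injective (by
    rw [hι.liftLin_spec]
    exact f.map_gr n x hx)

theorem onHomog_liftGr (hι : IsPrim H P ι) {Q : GrSpace.{u, v} K}
    (f : GrHom Q H.toGrSpace) (hf : ∀ x, H.Δ (f.lin x) = 0) (x : Q.Homog) :
    ι.onHomog ((hι.liftGr f hf).onHomog x) = f.onHomog x := by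
  obtain ⟨d, x, hx⟩ := x
  simp only [GrHom.onHomog, liftGr, hι.liftLin_spec]

/-- Maps to the primitive elements that are compatible with the operations `L_n^j` are morphisms
of `Prim_psh` algebras. -/
noncomputable def lift (hι : IsPrim H P ι) (f : GrHom Q.toGrSpace H.toGrSpace)
    (hf : ∀ x, H.Δ (f.lin x) = 0)
    (hL : ∀ (j : ℕ) (xs : List Q.toGrSpace.Homog) (y z : Q.toGrSpace.Homog), 1 ≤ j → j ≤ y.deg →
      f.lin (Q.Lw j (vals xs) y.val z.val) =
        H.Lop j (xs.map f.onHomog) (f.onHomog y) (f.lin z.val)) : Q ⟶ P :=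
  PrimPshHom.ofHomog (hι.liftGr f hf) fun j xs y z hj hj' => by
    apply hι.injective
    have h := hι.map_L j (xs.map (hι.liftGr f hf).onHomog) ((hι.liftGr f hf).onHomog y)
      ((hι.liftGr f hf).onHomog z) hj hj'
    rw [List.map_map, onHomog_liftGr, show ι.onHomog ∘ (hι.liftGr f hf).onHomog = f.onHomog from
      funext (hι.onHomog_liftGr f hf)] at h
    refine Eq.trans ?_ (h.trans (congrArg _ (hι.liftLin_spec f.lin hf z.val))).symm
    exact (hι.liftLin_spec f.lin hf _).trans (hL j xs y z hj hj')

theorem lift_spec (hι : IsPrim H P ι) (f : GrHom Q.toGrSpace H.toGrSpace)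
    (hf : ∀ x, H.Δ (f.lin x) = 0)
    (hL : ∀ (j : ℕ) (xs : List Q.toGrSpace.Homog) (y z : Q.toGrSpace.Homog), 1 ≤ j → j ≤ y.deg →
      f.lin (Q.Lw j (vals xs) y.val z.val) =
        H.Lop j (xs.map f.onHomog) (f.onHomog y) (f.lin z.val)) (x : Q.carrier) :
    ι.lin ((PrimPshHom.toGrHom (hι.lift f hf hL)).lin x) = f.lin x :=
  hι.liftLin_spec f.lin hf x

end IsPrim

/-! ### Morphisms of bialgebras and their restrictions -/

section Bialgebras

open TensorProduct GrSpace PrimOps CategoryTheory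

variable {K : Type u} [Field K]

theorem PshBialgHom.Δ_eq_zero {H H' : ConnPshBialg.{u, v} K} (f : H ⟶ H') {x : H.carrier}
    (hx : H.Δ x = 0) : H'.Δ ((PshBialgHom.toGrHom f).lin x) = 0 := by
  rw [PshBialgHom.map_Δ f, hx, map_zero]

/-- The inverse of a bijective morphism of preshuffle bialgebras. -/
noncomputable def PshBialgHom.inverse {H H' : ConnPshBialg.{u, v} K} (f : H ⟶ H')
    (hf : Function.Bijective (PshBialgHom.toGrHom f).lin) : H' ⟶ H :=
  let e := LinearEquiv.ofBijective (PshBialgHom.toGrHom f).lin hf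
  have he : ∀ y, (PshBialgHom.toGrHom f).lin (e.symm y) = y := e.apply_symm_apply
  { lin := e.symm.toLinearMap
    map_gr := fun n y hy => (PshBialgHom.toGrHom f).mem_gr_of_injective hf.1 (by
      rw [LinearEquiv.coe_coe, he]; exact hy)
    map_op := fun i x y => hf.1 (by
      rw [LinearEquiv.coe_coe, he, PshBialgHom.map_op f, he, he])
    map_Δ := fun y => by
      obtain ⟨x, rfl⟩ := hf.2 y
      have hx : e.symm ((PshBialgHom.toGrHom f).lin x) = x := e.symm_apply_apply x
      have h1 := PshBialgHom.map_Δ f x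
      have h2 : e.symm.toLinearMap ∘ₗ (PshBialgHom.toGrHom f).lin = LinearMap.id :=
        LinearMap.ext e.symm_apply_apply
      rw [h1, LinearEquiv.coe_coe, hx, ← LinearMap.comp_apply, ← TensorProduct.map_comp, h2,
        TensorProduct.map_id, LinearMap.id_apply] }

theorem PshBialgHom.inverse_apply {H H' : ConnPshBialg.{u, v} K} (f : H ⟶ H')
    (hf : Function.Bijective (PshBialgHom.toGrHom f).lin) (x : H.carrier) :
    (PshBialgHom.toGrHom (PshBialgHom.inverse f hf)).lin ((PshBialgHom.toGrHom f).lin x) = x :=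
  (LinearEquiv.ofBijective (PshBialgHom.toGrHom f).lin hf).symm_apply_apply x

/-- The morphism from the bialgebra of nonempty words to a bialgebra that is determined by its
restriction to the words of length one. -/
noncomputable def PrimPshAlgebra.augLift {P : PrimPshAlgebra.{u, v} K}
    (B : HomogBasis.{u, v, w} P.toGrSpace) {H : ConnPshBialg.{u, max u w} K}
    (h : GrHom P.toGrSpace H.toGrSpace) (hJ : LCompat B H.toPreshuffleAlgebra h ⊥)
    (hΔ : ∀ v, H.Δ (h.lin v) = 0) : P.augConn B ⟶ H :=
  { lin := augMap B H.toPreshuffleAlgebra h.lin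
    map_gr := fun _ _ hx => zeroMap_mem B _ h (B.incl_mem hx)
    map_op := hJ.augMap_augOp P.isGraded
    map_Δ := PreshuffleBialgebra.Δ_augMap_of_prim B h.lin hΔ }

theorem GrHom.map_zeroWord {P : PrimOps.{u, v} K}
    (B : HomogBasis.{u, v, w} P.toGrSpace) {A : PreshuffleAlgebra.{u, w'} K}
    {A' : PreshuffleAlgebra.{u, w''} K} (h : P.carrier →ₗ[K] A.carrier)
    (f : GrHom A.toGrSpace A'.toGrSpace)
    (hf : ∀ i x y, f.lin (A.op i x y) = A'.op i (f.lin x) (f.lin y)) (xs : List B.X) :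
    f.lin (zeroWord B A h xs) = zeroWord B A' (f.lin ∘ₗ h) xs := by
  induction xs with
  | nil => exact map_zero _
  | cons x xs ih =>
    cases xs with
    | nil => rfl
    | cons y xs => rw [zeroWord, hf, ih]; rfl

theorem GrHom.map_augMap {P : PrimOps.{u, v} K}
    (B : HomogBasis.{u, v, w} P.toGrSpace) {A : PreshuffleAlgebra.{u, w'} K}
    {A' : PreshuffleAlgebra.{u, w''} K} (h : P.carrier →ₗ[K] A.carrier)
    (f : GrHom A.toGrSpace A'.toGrSpace)
    (hf : ∀ i x y, f.lin (A.op i x y) = A'.op i (f.lin x) (f.lin y)) (x : B.Aug) :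
    f.lin (augMap B A h x) = augMap B A' (f.lin ∘ₗ h) x := by
  have : f.lin ∘ₗ augMap B A h = augMap B A' (f.lin ∘ₗ h) := by
    ext a : 2
    simp only [LinearMap.comp_apply, Finsupp.lsingle_apply, augMap, B.incl_single]
    rw [zeroMap_words, zeroMap_words, f.map_zeroWord B h hf]
  exact LinearMap.congr_fun this x

theorem IsPrim.Δ_apply {H : PreshuffleBialgebra.{u, v} K} {P : PrimPshAlgebra.{u, w} K}
    {ι : GrHom P.toGrSpace H.toGrSpace} (hι : IsPrim H P ι) (x : P.carrier) :
    H.Δ (ι.lin x) = 0 := hι.isPrimOps.Δ_apply x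

theorem IsPrim.lop_comp {H : PreshuffleBialgebra.{u, v} K} {P Q : PrimPshAlgebra.{u, w} K}
    {ι : GrHom P.toGrSpace H.toGrSpace} (hι : IsPrim H P ι) (g : Q ⟶ P) (j : ℕ)
    (xs : List Q.toGrSpace.Homog) (y z : Q.toGrSpace.Homog) (hj : 1 ≤ j) (hj' : j ≤ y.deg) :
    (ι.comp (PrimPshHom.toGrHom g)).lin (Q.Lw j (vals xs) y.val z.val) =
      H.Lop j (xs.map (ι.comp (PrimPshHom.toGrHom g)).onHomog)
        ((ι.comp (PrimPshHom.toGrHom g)).onHomog y)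
        ((ι.comp (PrimPshHom.toGrHom g)).lin z.val) := by
  have h1 := hι.map_L j (xs.map (PrimPshHom.toGrHom g).onHomog)
    ((PrimPshHom.toGrHom g).onHomog y) ((PrimPshHom.toGrHom g).onHomog z) hj hj'
  rw [List.map_map] at h1
  refine Eq.trans (congrArg ι.lin ?_) h1
  refine (PrimPshHom.map_L g _ _ _ _ _).trans ?_
  rw [PrimOps.Lw_eq_of_length (n := (vals xs).length) _ (by simp [vals])]
  congr 3
  funext i
  have hi : i.1 < xs.length := by simpa [vals] using i.2
  have e1 : (vals xs).get i = xs[i.1].val := List.getElem_map (l := xs) Homog.val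
  rw [e1]
  simp only [vals, List.map_map]
  exact (List.getElem_map (l := xs) (i := i.1) (h := by simpa using hi)
    (Homog.val ∘ (PrimPshHom.toGrHom g).onHomog)).symm

theorem IsPrim.lCompat_comp {H : PreshuffleBialgebra.{u, v} K} {P Q : PrimPshAlgebra.{u, w} K}
    {ι : GrHom P.toGrSpace H.toGrSpace} (hι : IsPrim H P ι) (g : Q ⟶ P)
    (B : HomogBasis.{u, w, w'} Q.toGrSpace) :
    LCompat B H.toPreshuffleAlgebra (ι.comp (PrimPshHom.toGrHom g)) ⊥ := by
  intro j xs y z hj hj'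
  rw [Submodule.mem_bot, sub_eq_zero]
  have := hι.lop_comp g j (xs.map B.homog) (B.homog y) (B.homog z) hj hj'
  have h4 : vals (xs.map B.homog) = xs.map B.b := by
    rw [vals, List.map_map]; rfl
  rw [h4] at this
  exact this.symm

theorem IsPrim.comp_lop {H H' : PreshuffleBialgebra.{u, v} K} {P : PrimPshAlgebra.{u, w} K}
    {ι : GrHom P.toGrSpace H.toGrSpace} (hι : IsPrim H P ι)
    (f : GrHom H.toGrSpace H'.toGrSpace)
    (hf : ∀ i x y, f.lin (H.op i x y) = H'.op i (f.lin x) (f.lin y)) (j : ℕ)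
    (xs : List P.toGrSpace.Homog) (y z : P.toGrSpace.Homog) (hj : 1 ≤ j) (hj' : j ≤ y.deg) :
    (f.comp ι).lin (P.Lw j (vals xs) y.val z.val) =
      H'.Lop j (xs.map (f.comp ι).onHomog) ((f.comp ι).onHomog y) ((f.comp ι).lin z.val) := by
  have h1 := f.map_Lop hf j (xs.map ι.onHomog) (ι.onHomog y) (ι.lin z.val)
  rw [List.map_map] at h1
  exact (congrArg f.lin (hι.map_L j xs y z hj hj')).trans h1

/-- Two descriptions of the primitive elements are isomorphic. -/
noncomputable def IsPrim.iso {H : PreshuffleBialgebra.{u, v} K} {P Q : PrimPshAlgebra.{u, w} K}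
    {ι : GrHom P.toGrSpace H.toGrSpace} {κ : GrHom Q.toGrSpace H.toGrSpace} (hι : IsPrim H P ι)
    (hκ : IsPrim H Q κ) : P ≅ Q where
  hom := hκ.lift ι hι.Δ_apply hι.map_L
  inv := hι.lift κ hκ.Δ_apply hκ.map_L
  hom_inv_id := by
    refine PrimPshHom.ext (LinearMap.ext fun x => hι.injective ?_)
    exact (hι.lift_spec κ hκ.Δ_apply hκ.map_L _).trans
      (hκ.lift_spec ι hι.Δ_apply hι.map_L _)
  inv_hom_id := by
    refine PrimPshHom.ext (LinearMap.ext fun x => hκ.injective ?_)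
    exact (hκ.lift_spec ι hι.Δ_apply hι.map_L _).trans
      (hι.lift_spec κ hκ.Δ_apply hκ.map_L _)

end Bialgebras

/-! ### Taking primitive elements is an equivalence -/

section Functor

open TensorProduct GrSpace PrimOps CategoryTheory

variable {K : Type u} [Field K]

/-- The restriction of a morphism to the primitive elements. -/
noncomputable def primMap {H H' : ConnPshBialg.{u, v} K} (f : H ⟶ H') : H.prim ⟶ H'.prim :=
  H'.isPrim_prim.lift ((PshBialgHom.toGrHom f).comp H.primIncl)
    (fun x => PshBialgHom.Δ_eq_zero f (H.Δ_primIncl x))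
    (H.isPrim_prim.comp_lop _ (PshBialgHom.map_op f))

theorem primIncl_primMap {H H' : ConnPshBialg.{u, v} K} (f : H ⟶ H') (x : H.prim.carrier) :
    H'.primIncl.lin ((PrimPshHom.toGrHom (primMap f)).lin x) =
      (PshBialgHom.toGrHom f).lin (H.primIncl.lin x) :=
  H'.isPrim_prim.lift_spec _ (fun x => PshBialgHom.Δ_eq_zero f (H.Δ_primIncl x))
    (H.isPrim_prim.comp_lop _ (PshBialgHom.map_op f)) x

theorem primMap_ext {H : PreshuffleBialgebra.{u, v} K} {Q : PrimPshAlgebra.{u, v} K}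
    {f g : Q ⟶ H.prim} (h : ∀ x, H.primIncl.lin ((PrimPshHom.toGrHom f).lin x) =
      H.primIncl.lin ((PrimPshHom.toGrHom g).lin x)) : f = g :=
  PrimPshHom.ext (LinearMap.ext fun x => H.primIncl_injective (h x))

theorem primMap_id (H : ConnPshBialg.{u, v} K) : primMap (𝟙 H) = 𝟙 H.prim :=
  primMap_ext fun x => primIncl_primMap (𝟙 H) x

theorem primMap_comp {H H' H'' : ConnPshBialg.{u, v} K} (f : H ⟶ H') (g : H' ⟶ H'') :
    primMap (f ≫ g) = primMap f ≫ primMap g :=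
  primMap_ext fun x => (primIncl_primMap (f ≫ g) x).trans
    ((congrArg (PshBialgHom.toGrHom g).lin (primIncl_primMap f x).symm).trans
      (primIncl_primMap g ((PrimPshHom.toGrHom (primMap f)).lin x)).symm)

/-- By surjectivity of the comparison map, `H` is spanned by `•₀`-products of primitive elements. -/
theorem primMap_injective {H H' : ConnPshBialg.{u, v} K} {f g : H ⟶ H'}
    (hfg : primMap f = primMap g) : f = g := by
  obtain ⟨B⟩ := H.prim.toGrSpace.exists_homogBasis
  refine PshBialgHom.ext (LinearMap.ext fun x => ?_)
  obtain ⟨a, rfl⟩ := H.isPrim_prim.isPrimOps.augMap_surjective B H.connected x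
  have h1 := (PshBialgHom.toGrHom f).map_augMap B (A := H.toPreshuffleAlgebra)
    (A' := H'.toPreshuffleAlgebra) H.primIncl.lin (PshBialgHom.map_op f) a
  have h2 := (PshBialgHom.toGrHom g).map_augMap B (A := H.toPreshuffleAlgebra)
    (A' := H'.toPreshuffleAlgebra) H.primIncl.lin (PshBialgHom.map_op g) a
  have h3 : (PshBialgHom.toGrHom f).lin ∘ₗ H.primIncl.lin =
      (PshBialgHom.toGrHom g).lin ∘ₗ H.primIncl.lin :=
    LinearMap.ext fun x => (primIncl_primMap f x).symm.trans
      ((congrArg (fun φ : H.prim ⟶ H'.prim =>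
        H'.primIncl.lin ((PrimPshHom.toGrHom φ).lin x)) hfg).trans (primIncl_primMap g x))
  exact h1.trans ((congrArg (fun φ => augMap B H'.toPreshuffleAlgebra φ a) h3).trans h2.symm)

/-- The bialgebra of words over `Prim(H)` maps isomorphically to `H`, and to `H'` through `g`; the
extension of `g` is the quotient of these two maps. The universe is large enough to contain this
bialgebra, whose elements have coefficients in `K`. -/
theorem primMap_surjective {H H' : ConnPshBialg.{u, max u v} K} (g : H.prim ⟶ H'.prim) :
    ∃ f : H ⟶ H', primMap f = g := by
  obtain ⟨B⟩ := H.prim.toGrSpace.exists_homogBasis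
  have hP := H.isPrim_prim.isPrimOps
  let ψ : H.prim.augConn B ⟶ H := H.prim.augLift B H.primIncl (hP.lCompat B) hP.Δ_apply
  have hψ : Function.Bijective (PshBialgHom.toGrHom ψ).lin :=
    ⟨hP.augMap_injective B, hP.augMap_surjective B H.connected⟩
  let φ : H.prim.augConn B ⟶ H' :=
    H.prim.augLift B (H'.primIncl.comp (PrimPshHom.toGrHom g))
      (H'.isPrim_prim.lCompat_comp g B) fun v => H'.Δ_primIncl _
  refine ⟨PshBialgHom.inverse ψ hψ ≫ φ, primMap_ext fun x => ?_⟩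
  refine (primIncl_primMap _ x).trans ?_
  have h1 : H.primIncl.lin x = (PshBialgHom.toGrHom ψ).lin (B.letter x) :=
    (PreshuffleBialgebra.IsPrimOps.augMap_letter (H := H.toPreshuffleBialgebra)
      (h := H.primIncl) B x).symm
  rw [h1]
  exact (congrArg (PshBialgHom.toGrHom φ).lin (PshBialgHom.inverse_apply ψ hψ _)).trans
    (PreshuffleBialgebra.IsPrimOps.augMap_letter (H := H'.toPreshuffleBialgebra)
      (h := H'.primIncl.comp (PrimPshHom.toGrHom g)) B x)

variable (K)

/-- The functor of primitive elements. -/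
noncomputable def primFunctor : ConnPshBialg.{u, v} K ⥤ PrimPshAlgebra.{u, v} K where
  obj H := H.prim
  map f := primMap f
  map_id H := primMap_id H
  map_comp f g := primMap_comp f g

instance primFunctor_faithful : (primFunctor.{u, v} K).Faithful where
  map_injective h := primMap_injective h

instance primFunctor_full : (primFunctor.{u, max u v} K).Full where
  map_surjective g := primMap_surjective g

instance primFunctor_essSurj : (primFunctor.{u, max u v} K).EssSurj where
  mem_essImage V := by
    obtain ⟨B⟩ := V.toGrSpace.exists_homogBasis
    have e : (V.augConn B).prim ≅ V := (V.augConn B).isPrim_prim.iso (V.isPrim_augConn B)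
    exact ⟨V.augConn B, ⟨e⟩⟩

instance primFunctor_isEquivalence : (primFunctor.{u, max u v} K).IsEquivalence where

end Functor

/-! ### The basis of the free preshuffle algebra -/

namespace KWord

/-- The formulation by sublists contains no indices and passes at once to sublists and to words with
shifted values. -/
theorem nested_iff_sublist (f : List ℕ) :
    (∀ (i k j : ℕ) (hj : j < f.length) (hik : i ≤ k) (hkj : k ≤ j), f[i] = f[j] → f[k] ≤ f[i]) ↔
      ∀ c d, [c, d, c].Sublist f → d ≤ c := by
  constructor
  · intro h c d hs
    obtain ⟨g, hg⟩ := List.sublist_iff_exists_orderEmbedding_getElem?_eq.1 hs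
    have h0 := hg 0
    have h1 := hg 1
    have h2 := hg 2
    simp only [List.getElem?_cons_zero, List.getElem?_cons_succ] at h0 h1 h2
    obtain ⟨l0, e0⟩ := List.getElem?_eq_some_iff.1 h0.symm
    obtain ⟨l1, e1⟩ := List.getElem?_eq_some_iff.1 h1.symm
    obtain ⟨l2, e2⟩ := List.getElem?_eq_some_iff.1 h2.symm
    have := h (g 0) (g 1) (g 2) l2 (g.monotone (by simp)) (g.monotone (by simp))
      (by rw [e0, e2])
    rwa [e0, e1] at this
  · intro h i k j hj hik hkj he
    rcases hik.eq_or_lt with rfl | hik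
    · exact le_rfl
    rcases hkj.eq_or_lt with rfl | hkj
    · exact he.symm.le
    apply h
    have h1 : f = f.take k ++ f[k] :: f.drop (k + 1) := by
      rw [← List.drop_eq_getElem_cons, List.take_append_drop]
    have h2 : f[i] ∈ f.take k := List.mem_take_iff_getElem.2 ⟨i, by omega, rfl⟩
    have h3 : f[i] ∈ f.drop (k + 1) := by
      rw [he]
      exact List.mem_drop_iff_getElem.2 ⟨j - (k + 1), by omega, by congr 1; omega⟩
    have h4 := (List.singleton_sublist.2 h2).append
      ((List.singleton_sublist.2 h3).cons_cons f[k])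
    rw [← h1] at h4
    exact h4

/-- No nonzero entry precedes a zero, so the zeros form an initial block. -/
theorem exists_replicate_append (t : List ℕ) (h : ∀ e, [e, 0].Sublist t → e = 0) :
    ∃ m q, t = List.replicate m 0 ++ q ∧ 0 ∉ q := by
  induction t with
  | nil => exact ⟨0, [], rfl, by simp⟩
  | cons e t ih =>
    by_cases he : e = 0
    · obtain ⟨m, q, rfl, hq⟩ := ih fun e' h' => h e' (h'.cons _)
      exact ⟨m + 1, q, by rw [he]; rfl, hq⟩
    · refine ⟨0, e :: t, rfl, fun h0 => ?_⟩
      rcases List.mem_cons.1 h0 with h0 | h0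
      · exact he h0.symm
      · exact he (h e ((List.singleton_sublist.2 h0).cons_cons e))

theorem exists_map_succ (s : List ℕ) (h : 0 ∉ s) : ∃ s' : List ℕ, s = s'.map (· + 1) := by
  refine ⟨s.map Nat.pred, ?_⟩
  rw [List.map_map]
  conv_lhs => rw [← List.map_id s]
  refine List.map_congr_left fun a ha => ?_
  have : a ≠ 0 := fun h0 => h (h0 ▸ ha)
  simp only [id, Function.comp_apply, Nat.pred_eq_sub_one]
  omega

variable {X : Type w} {deg : X → ℕ}

/-- The nesting condition forces every entry between two zeros to be zero. The zeros therefore form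
one block; removing it and lowering the other values by one gives `b`, and the position of the block
is `i`. -/
theorem exists_eq_ins (hdeg : ∀ x, 0 < deg x) (a : KWord X deg) (x y : X) (xs : List X)
    (ha : a.xs = x :: y :: xs) :
    ∃ i b, i ≤ b.f.length ∧ b.xs = y :: xs ∧ a = ins i (gen deg x) b := by
  have hsub := (nested_iff_sublist a.f).1 a.nested
  have hc : a.f.count 0 = deg x := by
    rw [a.count_eq 0 (by simp [ha])]
    simp [ha]
  have h0 : 0 ∈ a.f := List.count_pos_iff.1 (by rw [hc]; exact hdeg x)
  obtain ⟨s, t, hf, hs⟩ := List.eq_append_cons_of_mem h0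
  obtain ⟨m, q, rfl, hq⟩ := exists_replicate_append t fun e he => by
    have := hsub 0 e (by rw [hf]; exact ((he.cons_cons 0).trans (List.sublist_append_right _ _)))
    omega
  obtain ⟨s', rfl⟩ := exists_map_succ s hs
  obtain ⟨q', rfl⟩ := exists_map_succ q hq
  have hm : m + 1 = deg x := by
    rw [← hc, hf]
    simp [List.count_eq_zero.2 hs, List.count_eq_zero.2 hq]
  have hf' : a.f = (s'.map (· + 1)) ++ (List.replicate (deg x) 0 ++ q'.map (· + 1)) := by
    rw [hf, ← hm]; rfl
  refine ⟨s'.length, ⟨s' ++ q', y :: xs, by simp, ?_, ?_, ?_⟩, by simp, rfl, ?_⟩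
  · intro c hc
    have : c + 1 ∈ a.f := by
      rw [hf']
      rcases List.mem_append.1 hc with h | h <;> simp [h]
    have := a.lt_length _ this
    rw [ha] at this
    simpa using this
  · intro i hi
    have := a.count_eq (i + 1) (by rw [ha]; simpa using hi)
    simp only [ha, List.getElem_cons_succ] at this
    rw [← this, hf']
    simp only [List.count_append, count_map_add, List.count_replicate]
    simp
  · refine (nested_iff_sublist _).2 fun c d h => ?_
    have h1 := h.map (· + 1)
    have := hsub (c + 1) (d + 1) (h1.trans (by
      rw [hf', List.map_append]
      exact (List.Sublist.refl _).append (List.sublist_append_right _ _)))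
    omega
  · ext1
    · simp [hf', ins, insFun, gen]
    · simp [ha, ins, gen]

/-- Induction on the number of generators in a word: each basis element is an iterated insertion of
generators, `x₁ •_{i₁} (x₂ •_{i₂} ⋯)`. -/
theorem induction_ins (hdeg : ∀ x, 0 < deg x) {P : KWord X deg → Prop}
    (h1 : ∀ x, P (gen deg x))
    (h2 : ∀ i x b, i ≤ b.f.length → P b → P (ins i (gen deg x) b)) (a : KWord X deg) : P a := by
  have key : ∀ (xs : List X) (a : KWord X deg), a.xs = xs → P a := by
    intro xs
    induction xs with
    | nil => intro a ha; exact absurd ha a.xs_ne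
    | cons x xs ih =>
      intro a ha
      cases xs with
      | nil =>
        have hl : ∀ c ∈ a.f, c = 0 := fun c hc => by
          have := a.lt_length c hc
          simpa [ha] using this
        have hc : a.f.count 0 = deg x := by
          rw [a.count_eq 0 (by simp [ha])]
          simp [ha]
        have : a = gen deg x := by
          ext1
          · change a.f = List.replicate (deg x) 0
            rw [← hc]
            exact (List.eq_replicate_iff.2 ⟨(List.count_eq_length.2
              fun b hb => (hl b hb).symm).symm, hl⟩)
          · exact ha
        rw [this]
        exact h1 x
      | cons y xs =>
        obtain ⟨i, b, hi, hb, rfl⟩ := a.exists_eq_ins hdeg x y xs ha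
        exact h2 i x b hi (ih b hb)
  exact key _ a rfl

/-- `k` is obtained from the subword `g` of `a` by renumbering the values increasingly. -/
def IsStd (a : KWord X deg) (g : List ℕ) (k : KWord X deg) : Prop :=
  ∃ σ : ℕ → ℕ, (∀ i j, i < j → j < k.xs.length → σ i < σ j) ∧ k.f.map σ = g ∧
    ∀ j (hj : j < k.xs.length), a.xs[σ j]? = some k.xs[j]

theorem isStd_restrict (a : KWord X deg) (g : List ℕ) (hne hmem hcount hnested) :
    a.IsStd g (a.restrict g hne hmem hcount hnested) := by
  have hs : (labels a.xs.length g).Pairwise (· < ·) := (List.pairwise_lt_range).filter _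
  refine ⟨fun j => (labels a.xs.length g).getD j 0, ?_, ?_, ?_⟩
  · intro i j hij hj
    have hj' : j < (labels a.xs.length g).length := by simpa [restrict] using hj
    beta_reduce
    rw [List.getD_eq_getElem _ _ (by omega), List.getD_eq_getElem _ _ hj']
    exact List.pairwise_iff_getElem.1 hs _ _ _ _ hij
  · rw [restrict, List.map_map]
    conv_rhs => rw [← List.map_id g]
    refine List.map_congr_left fun c hc => ?_
    have hc' : c ∈ labels a.xs.length g := by simp [labels, hc, hmem c hc]
    rw [Function.comp_apply, List.getD_eq_getElem _ _ (List.idxOf_lt_length_iff.2 hc')]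
    exact List.getElem_idxOf _
  · intro j hj
    have hj' : j < (labels a.xs.length g).length := by simpa [restrict] using hj
    beta_reduce
    rw [List.getD_eq_getElem _ _ hj']
    simp only [restrict, List.getElem_pmap]
    exact List.getElem?_eq_getElem _

/-- The renumbering is unique, as an increasing enumeration of the values of `g`. Positivity of the
degrees is needed for every label of `k` to occur in its word. -/
theorem IsStd.restrict_eq (hdeg : ∀ x, 0 < deg x) {a : KWord X deg} {g : List ℕ} {k : KWord X deg}
    (h : a.IsStd g k) (hne hmem hcount hnested) : a.restrict g hne hmem hcount hnested = k := by
  obtain ⟨σ, hσ, hg, hx⟩ := h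
  have hl : labels a.xs.length g = (List.range k.xs.length).map σ := by
    have h1 : (labels a.xs.length g).Pairwise (· < ·) := (List.pairwise_lt_range).filter _
    have h2 : ((List.range k.xs.length).map σ).Pairwise (· < ·) := by
      rw [List.pairwise_map]
      refine List.pairwise_lt_range.imp_of_mem fun {i j} _ hj hij => ?_
      exact hσ i j hij (List.mem_range.1 hj)
    refine List.Perm.eq_of_pairwise (le := (· < ·)) (fun a b _ _ h h' => absurd h' (lt_asymm h))
      h1 h2 ?_
    refine (List.perm_ext_iff_of_nodup (h1.imp fun h => ne_of_lt h)
      (h2.imp fun h => ne_of_lt h)).2 fun c => ?_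
    simp only [labels, List.mem_filter, List.mem_range, decide_eq_true_eq, List.mem_map]
    constructor
    · rintro ⟨_, hc⟩
      rw [← hg] at hc
      obtain ⟨j, hj, rfl⟩ := List.mem_map.1 hc
      exact ⟨j, k.lt_length j hj, rfl⟩
    · rintro ⟨j, hj, rfl⟩
      refine ⟨(List.getElem?_eq_some_iff.1 (hx j hj)).1, ?_⟩
      rw [← hg]
      refine List.mem_map_of_mem (List.count_pos_iff.1 ?_)
      rw [k.count_eq j hj]
      exact hdeg _
  have hnd : ((List.range k.xs.length).map σ).Nodup := by
    rw [← hl]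
    exact List.nodup_range.filter _
  ext1
  · simp only [restrict]
    rw [hl]
    conv_lhs => rw [← hg]
    rw [List.map_map]
    conv_rhs => rw [← List.map_id k.f]
    refine List.map_congr_left fun j hj => ?_
    have hj' : j < ((List.range k.xs.length).map σ).length := by
      simpa using k.lt_length j hj
    have := hnd.idxOf_getElem j hj'
    simpa using this
  · refine List.ext_getElem (by simp [restrict, hl]) fun j h1 h2 => ?_
    simp only [restrict, List.getElem_pmap]
    have h3 : (labels a.xs.length g)[j]'(by simpa [restrict] using h1) = σ j := by
      simp [hl]
    have h4 := (List.getElem?_eq_some_iff.1 (hx j h2)).2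
    simp only [h3, h4]

end KWord

/-! ### Cuts of an inserted word -/

namespace KWord

variable {X : Type w} {deg : X → ℕ}

theorem isStd_left (a : KWord X deg) {p : ℕ} (h : a.IsCut p) :
    a.IsStd (a.f.take p) (a.left p h) :=
  a.isStd_restrict _ _ _ _ _

theorem isStd_right (a : KWord X deg) {p : ℕ} (h : a.IsCut p) :
    a.IsStd (a.f.drop p) (a.right p h) :=
  a.isStd_restrict _ _ _ _ _

theorem left_f_length (a : KWord X deg) {p : ℕ} (h : a.IsCut p) : (a.left p h).f.length = p := by
  have := h.2.1
  simp only [left, restrict, List.length_map, List.length_take]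
  omega

theorem right_f_length (a : KWord X deg) {p : ℕ} (h : a.IsCut p) :
    (a.right p h).f.length = a.f.length - p := by
  simp [right, restrict]

theorem ins_gen_f (i : ℕ) (x : X) (b : KWord X deg) : (ins i (gen deg x) b).f =
    (b.f.take i).map (· + 1) ++ (List.replicate (deg x) 0 ++ (b.f.drop i).map (· + 1)) := rfl

theorem ins_gen_xs (i : ℕ) (x : X) (b : KWord X deg) : (ins i (gen deg x) b).xs = x :: b.xs := rfl

theorem IsStd.succ {b : KWord X deg} {g : List ℕ} {k : KWord X deg} (h : b.IsStd g k) (i : ℕ)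
    (x : X) : (ins i (gen deg x) b).IsStd (g.map (· + 1)) k := by
  obtain ⟨σ, hσ, rfl, hx⟩ := h
  refine ⟨fun j => σ j + 1, fun i j hij hj => Nat.succ_lt_succ (hσ i j hij hj), ?_, fun j hj => ?_⟩
  · rw [List.map_map]; rfl
  · rw [ins_gen_xs, List.getElem?_cons_succ, hx j hj]

theorem isStd_self (b : KWord X deg) : b.IsStd b.f b :=
  ⟨id, fun _ _ h _ => h, List.map_id _, fun _ hj => List.getElem?_eq_getElem hj⟩

theorem isStd_gen (i : ℕ) (x : X) (b : KWord X deg) :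
    (ins i (gen deg x) b).IsStd (List.replicate (deg x) 0) (gen deg x) := by
  refine ⟨id, fun _ _ h _ => h, List.map_id _, fun j hj => ?_⟩
  have : j = 0 := by simpa [gen] using hj
  subst this
  rfl

theorem IsStd.ins_gen {b : KWord X deg} {g : List ℕ} {k : KWord X deg} (h : b.IsStd g k) (i j : ℕ)
    (x : X) : (ins i (gen deg x) b).IsStd
      ((g.take j).map (· + 1) ++ (List.replicate (deg x) 0 ++ (g.drop j).map (· + 1)))
      (ins j (gen deg x) k) := by
  obtain ⟨σ, hσ, rfl, hx⟩ := h
  -- The new smallest label is sent to itself, and the old renumbering is shifted by one.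
  refine ⟨fun j => Nat.casesOn j 0 fun j => σ j + 1, ?_, ?_, ?_⟩
  · intro i' j' hij hj
    rw [ins_gen_xs, List.length_cons] at hj
    obtain ⟨j', rfl⟩ : ∃ l, j' = l + 1 := ⟨j' - 1, by omega⟩
    cases i' with
    | zero => exact Nat.succ_pos _
    | succ i' => exact Nat.succ_lt_succ (hσ i' j' (by omega) (by omega))
  · rw [ins_gen_f]
    simp only [List.map_append, List.map_map, List.map_replicate, List.map_take, List.map_drop]
    rfl
  · intro l hl
    cases l with
    | zero => rfl
    | succ l => exact hx l (by simpa [ins_gen_xs] using hl)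

section Cuts

variable {i : ℕ} {x : X} {b : KWord X deg}

theorem ins_gen_take_of_le (hi : i ≤ b.f.length) {p : ℕ} (hp : p ≤ i) :
    (ins i (gen deg x) b).f.take p = (b.f.take p).map (· + 1) := by
  rw [ins_gen_f, List.take_append_of_le_length (by simp; omega), ← List.map_take, List.take_take,
    min_eq_left hp]

theorem ins_gen_drop_of_le (hi : i ≤ b.f.length) {p : ℕ} (hp : p ≤ i) :
    (ins i (gen deg x) b).f.drop p = ((b.f.drop p).take (i - p)).map (· + 1) ++
      (List.replicate (deg x) 0 ++ ((b.f.drop p).drop (i - p)).map (· + 1)) := by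
  rw [ins_gen_f, List.drop_append_of_le_length (by simp; omega), ← List.map_drop, List.drop_take,
    List.drop_drop, show p + (i - p) = i by omega]

theorem ins_gen_take_of_ge (hi : i ≤ b.f.length) {p : ℕ} (hp : i ≤ p) :
    (ins i (gen deg x) b).f.take (deg x + p) = ((b.f.take p).take i).map (· + 1) ++
      (List.replicate (deg x) 0 ++ ((b.f.take p).drop i).map (· + 1)) := by
  have hl : ((b.f.take i).map (· + 1)).length = i := by simp [hi]
  rw [ins_gen_f, List.take_append, List.take_append, hl, List.length_replicate, List.take_take,
    min_eq_left hp, List.drop_take,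
    List.take_of_length_le (l := (b.f.take i).map (· + 1)) (by omega),
    List.take_of_length_le (l := List.replicate (deg x) 0) (by simp; omega),
    show deg x + p - i - deg x = p - i by omega, List.map_take (l := b.f.drop i)]

theorem ins_gen_drop_of_ge (hi : i ≤ b.f.length) {p : ℕ} (hp : i ≤ p) :
    (ins i (gen deg x) b).f.drop (deg x + p) = (b.f.drop p).map (· + 1) := by
  rw [ins_gen_f, List.drop_append, List.drop_append, List.drop_of_length_le (by simp; omega),
    List.drop_of_length_le (by simp; omega), List.nil_append, List.nil_append, ← List.map_drop,
    List.drop_drop]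
  congr 2
  simp
  omega

/-- The block of the new generator lies entirely to the right of the cut, so it creates no common
value. The excluded case `p = i = |b|` is a new cut, not inherited from `b`. -/
theorem isCut_ins_gen_of_le (hi : i ≤ b.f.length) {p : ℕ} (hp : p ≤ i)
    (hpb : p < b.f.length) : (ins i (gen deg x) b).IsCut p ↔ b.IsCut p := by
  have hl : (ins i (gen deg x) b).f.length = deg x + b.f.length := by
    rw [ins_length]; simp [gen]
  rw [IsCut, IsCut, ins_gen_take_of_le hi hp, ins_gen_drop_of_le hi hp, hl]
  refine and_congr Iff.rfl (and_congr (by omega) ?_)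
  conv_rhs => rw [← List.take_append_drop (i - p) (b.f.drop p)]
  simp only [List.mem_map, List.mem_append, List.mem_replicate]
  constructor
  · intro h c hc hc'
    refine h (c + 1) ⟨c, hc, rfl⟩ ?_
    rcases hc' with hc' | hc'
    · exact Or.inl ⟨c, hc', rfl⟩
    · exact Or.inr (Or.inr ⟨c, hc', rfl⟩)
  · rintro h _ ⟨c, hc, rfl⟩ (⟨c', hc', e⟩ | ⟨_, e⟩ | ⟨c', hc', e⟩)
    · obtain rfl : c' = c := by omega
      exact h c' hc (Or.inl hc')
    · omega
    · obtain rfl : c' = c := by omega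
      exact h c' hc (Or.inr hc')

/-- The mirror image, with the block on the left of the cut. The excluded case `p = i = 0` is again
a new cut. -/
theorem isCut_ins_gen_of_ge (hi : i ≤ b.f.length) {p : ℕ} (hp : i ≤ p)
    (hpb : 0 < p) : (ins i (gen deg x) b).IsCut (deg x + p) ↔ b.IsCut p := by
  have hl : (ins i (gen deg x) b).f.length = deg x + b.f.length := by
    rw [ins_length]; simp [gen]
  rw [IsCut, IsCut, ins_gen_take_of_ge hi hp, ins_gen_drop_of_ge hi hp, hl]
  refine and_congr (by omega) (and_congr (by omega) ?_)
  conv_rhs => rw [← List.take_append_drop i (b.f.take p)]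
  simp only [List.mem_map, List.mem_append, List.mem_replicate]
  constructor
  · intro h c hc hc'
    refine h (c + 1) ?_ ⟨c, hc', rfl⟩
    rcases hc with hc | hc
    · exact Or.inl ⟨c, hc, rfl⟩
    · exact Or.inr (Or.inr ⟨c, hc, rfl⟩)
  · rintro h c (⟨c', hc', rfl⟩ | ⟨_, rfl⟩ | ⟨c', hc', rfl⟩) ⟨c, hc, e⟩
    · obtain rfl : c = c' := by omega
      exact h c (Or.inl hc') hc
    · omega
    · obtain rfl : c = c' := by omega
      exact h c (Or.inr hc') hc

theorem not_isCut_ins_gen (hi : i ≤ b.f.length) {p : ℕ} (hp : i < p) (hp' : p < deg x + i) :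
    ¬ (ins i (gen deg x) b).IsCut p := by
  rintro ⟨_, _, h⟩
  have hl : ((b.f.take i).map (· + 1)).length = i := by simp [hi]
  refine h 0 ?_ ?_
  · rw [ins_gen_f, List.take_append, List.take_append, hl, List.take_replicate]
    simp only [List.mem_append, List.mem_replicate]
    right; left; constructor
    · omega
    · trivial
  · rw [ins_gen_f, List.drop_append, List.drop_append, hl, List.drop_replicate]
    simp only [List.mem_append, List.mem_replicate]
    right; left; constructor
    · omega
    · trivial

theorem left_ins_gen_of_le (hdeg : ∀ x, 0 < deg x) (hi : i ≤ b.f.length) {p : ℕ} (hp : p ≤ i)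
    (h : b.IsCut p) (h' : (ins i (gen deg x) b).IsCut p) :
    (ins i (gen deg x) b).left p h' = b.left p h := by
  refine IsStd.restrict_eq hdeg ?_ _ _ _ _
  rw [ins_gen_take_of_le hi hp]
  exact (b.isStd_left h).succ i x

theorem right_ins_gen_of_le (hdeg : ∀ x, 0 < deg x) (hi : i ≤ b.f.length) {p : ℕ} (hp : p ≤ i)
    (h : b.IsCut p) (h' : (ins i (gen deg x) b).IsCut p) :
    (ins i (gen deg x) b).right p h' = ins (i - p) (gen deg x) (b.right p h) := by
  refine IsStd.restrict_eq hdeg ?_ _ _ _ _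
  rw [ins_gen_drop_of_le hi hp]
  exact (b.isStd_right h).ins_gen i _ x

theorem left_ins_gen_of_ge (hdeg : ∀ x, 0 < deg x) (hi : i ≤ b.f.length) {p : ℕ} (hp : i ≤ p)
    (h : b.IsCut p) (h' : (ins i (gen deg x) b).IsCut (deg x + p)) :
    (ins i (gen deg x) b).left _ h' = ins i (gen deg x) (b.left p h) := by
  refine IsStd.restrict_eq hdeg ?_ _ _ _ _
  rw [ins_gen_take_of_ge hi hp]
  exact (b.isStd_left h).ins_gen i _ x

theorem right_ins_gen_of_ge (hdeg : ∀ x, 0 < deg x) (hi : i ≤ b.f.length) {p : ℕ} (hp : i ≤ p)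
    (h : b.IsCut p) (h' : (ins i (gen deg x) b).IsCut (deg x + p)) :
    (ins i (gen deg x) b).right _ h' = b.right p h := by
  refine IsStd.restrict_eq hdeg ?_ _ _ _ _
  rw [ins_gen_drop_of_ge hi hp]
  exact (b.isStd_right h).succ i x

theorem isCut_ins_gen_zero (hdeg : ∀ x, 0 < deg x) (hb : 0 < b.f.length) :
    (ins 0 (gen deg x) b).IsCut (deg x) := by
  refine ⟨hdeg x, by rw [ins_length]; simp [gen]; omega, ?_⟩
  have h1 := ins_gen_take_of_ge (x := x) (Nat.zero_le b.f.length) (le_refl 0)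
  have h2 := ins_gen_drop_of_ge (x := x) (Nat.zero_le b.f.length) (le_refl 0)
  rw [add_zero] at h1 h2
  rw [h1, h2]
  simp

theorem left_ins_gen_zero (hdeg : ∀ x, 0 < deg x) (h : (ins 0 (gen deg x) b).IsCut (deg x)) :
    (ins 0 (gen deg x) b).left _ h = gen deg x := by
  refine IsStd.restrict_eq hdeg ?_ _ _ _ _
  have h1 := ins_gen_take_of_ge (x := x) (Nat.zero_le b.f.length) (le_refl 0)
  simp only [add_zero, List.take_zero, List.map_nil, List.drop_nil, List.append_nil,
    List.nil_append] at h1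
  rw [h1]
  exact isStd_gen 0 x b

theorem right_ins_gen_zero (hdeg : ∀ x, 0 < deg x) (h : (ins 0 (gen deg x) b).IsCut (deg x)) :
    (ins 0 (gen deg x) b).right _ h = b := by
  refine IsStd.restrict_eq hdeg ?_ _ _ _ _
  have h1 := ins_gen_drop_of_ge (x := x) (Nat.zero_le b.f.length) (le_refl 0)
  rw [add_zero, List.drop_zero] at h1
  rw [h1]
  exact b.isStd_self.succ 0 x

theorem isCut_ins_gen_top (hdeg : ∀ x, 0 < deg x) (hb : 0 < b.f.length) :
    (ins b.f.length (gen deg x) b).IsCut b.f.length := by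
  refine ⟨hb, by have := hdeg x; rw [ins_length]; simp [gen]; omega, ?_⟩
  rw [ins_gen_take_of_le le_rfl le_rfl, ins_gen_drop_of_le le_rfl le_rfl]
  simp

theorem left_ins_gen_top (hdeg : ∀ x, 0 < deg x)
    (h : (ins b.f.length (gen deg x) b).IsCut b.f.length) :
    (ins b.f.length (gen deg x) b).left _ h = b := by
  refine IsStd.restrict_eq hdeg ?_ _ _ _ _
  rw [ins_gen_take_of_le le_rfl le_rfl, List.take_length]
  exact b.isStd_self.succ _ x

theorem right_ins_gen_top (hdeg : ∀ x, 0 < deg x)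
    (h : (ins b.f.length (gen deg x) b).IsCut b.f.length) :
    (ins b.f.length (gen deg x) b).right _ h = gen deg x := by
  refine IsStd.restrict_eq hdeg ?_ _ _ _ _
  rw [ins_gen_drop_of_le le_rfl le_rfl, List.drop_length]
  simpa using isStd_gen b.f.length x b

theorem not_isCut_gen (x : X) (p : ℕ) : ¬ (gen deg x).IsCut p := by
  rintro ⟨h0, h1, h⟩
  have h1' : p < deg x := by simpa [gen] using h1
  refine h 0 ?_ ?_
  · simp [gen]; omega
  · simp [gen]; omega

end Cuts

theorem f_length_pos (hdeg : ∀ x, 0 < deg x) (a : KWord X deg) : 0 < a.f.length := by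
  induction a using induction_ins hdeg with
  | h1 x => simpa [gen] using hdeg x
  | h2 i x b _ ih => rw [ins_length]; omega

end KWord

/-! ### Maps on the free preshuffle algebra -/

namespace KWord

open TensorProduct

variable {K : Type u} [Field K] {X : Type w} {deg : X → ℕ}

section Algebra

variable (A : PreshuffleAlgebra.{u, v} K) (h : X → A.carrier)

/-- The value of `(f; x₁, …, x_r)` in a preshuffle algebra, with `h x₁, …, h x_r` substituted for
the generators. -/
noncomputable def evalAux : List ℕ → List X → A.carrier
  | _, [] => 0
  | _, [x] => h x
  | f, x :: y :: xs =>
    A.op (f.idxOf 0) (h x) (evalAux ((f.filter (· ≠ 0)).map Nat.pred) (y :: xs))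

/-- The value of a basis element of the free preshuffle algebra, with `h x` substituted for the
generator `x`. -/
noncomputable def eval (a : KWord X deg) : A.carrier := evalAux A h a.f a.xs

variable {A h}

theorem eval_gen (x : X) : eval A h (gen deg x) = h x := rfl

/-- The recursion of `evalAux` inverts the insertion of a generator: the first zero stands at
position `i`, and deleting the zeros and lowering the other values restores `b`. -/
theorem eval_ins_gen (hdeg : ∀ x, 0 < deg x) {i : ℕ} {b : KWord X deg} (hi : i ≤ b.f.length)
    (x : X) : eval A h (ins i (gen deg x) b) = A.op i (h x) (eval A h b) := by
  obtain ⟨y, ys, hy⟩ := List.exists_cons_of_ne_nil b.xs_ne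
  rw [eval, ins_gen_xs, hy, evalAux, eval, hy]
  have h1 : (ins i (gen deg x) b).f.idxOf 0 = i := by
    rw [ins_gen_f, List.idxOf_append_of_notMem (by
      rw [List.mem_map]; rintro ⟨c, _, hc⟩; omega)]
    obtain ⟨d, hd⟩ : ∃ d, deg x = d + 1 := ⟨deg x - 1, by have := hdeg x; omega⟩
    rw [hd, List.replicate_succ, List.cons_append, List.idxOf_cons_self]
    simpa using hi
  have h2 : ((ins i (gen deg x) b).f.filter (· ≠ 0)).map Nat.pred = b.f := by
    have h3 : ∀ l : List ℕ, ((l.map (· + 1)).filter (· ≠ 0)).map Nat.pred = l := fun l => by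
      rw [List.filter_eq_self.2 (by simp), List.map_map]
      exact List.map_id l
    rw [ins_gen_f, List.filter_append, List.filter_append, List.map_append, List.map_append, h3, h3]
    have h4 : (List.replicate (deg x) 0).filter (· ≠ 0) = [] := by simp
    rw [h4, List.map_nil, List.nil_append, List.take_append_drop]
  rw [h1, h2]

theorem eval_mem (hdeg : ∀ x, 0 < deg x) (hh : ∀ x, h x ∈ A.gr (deg x)) (a : KWord X deg) :
    eval A h a ∈ A.gr a.f.length := by
  induction a using induction_ins hdeg with
  | h1 x =>
    rw [eval_gen]
    simpa [gen] using hh x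
  | h2 i x b hi ih =>
    rw [eval_ins_gen hdeg hi, ins_length]
    simpa [gen] using A.op_mem i _ _ _ _ (hh x) ih hi

/-- Generators are split off the left factor one by one, with the associativity law on both sides.
-/
theorem eval_ins (hdeg : ∀ x, 0 < deg x) (hh : ∀ x, h x ∈ A.gr (deg x)) {i : ℕ} (a : KWord X deg)
    {b : KWord X deg} (hi : i ≤ b.f.length) :
    eval A h (ins i a b) = A.op i (eval A h a) (eval A h b) := by
  induction a using induction_ins hdeg with
  | h1 x => exact eval_ins_gen hdeg hi x
  | h2 j x a hj ih =>
    rw [ins_assoc j i _ _ _ hj hi, eval_ins_gen hdeg (by rw [ins_length]; omega), ih,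
      eval_ins_gen hdeg hj]
    exact (A.op_assoc j i _ _ _ _ _ (eval_mem hdeg hh a) (eval_mem hdeg hh b) hj hi).symm

end Algebra

section Bialgebra

variable (H : PreshuffleBialgebra.{u, v} K) (h : X → H.carrier)

/-- The term of the coproduct of the value of `a` that corresponds to a cut. -/
noncomputable def evalCut (a : KWord X deg) (p : ℕ) : H.carrier ⊗[K] H.carrier :=
  if hp : a.IsCut p then
    eval H.toPreshuffleAlgebra h (a.left p hp) ⊗ₜ eval H.toPreshuffleAlgebra h (a.right p hp)
  else 0

variable {H h}

theorem evalCut_of_not {a : KWord X deg} {p : ℕ} (hp : ¬ a.IsCut p) : evalCut H h a p = 0 :=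
  dif_neg hp

theorem evalCut_of_ge {a : KWord X deg} {p : ℕ} (hp : a.f.length ≤ p) : evalCut H h a p = 0 :=
  evalCut_of_not fun h => by have := h.2.1; omega

theorem evalCut_zero (a : KWord X deg) : evalCut H h a 0 = 0 :=
  evalCut_of_not fun h => lt_irrefl _ h.1

variable {i : ℕ} {x : X} {b : KWord X deg}

theorem evalCut_ins_gen_of_le (hdeg : ∀ x, 0 < deg x) (hi : i ≤ b.f.length) {p : ℕ} (hp : p ≤ i)
    (hpb : p < b.f.length) : evalCut H h (ins i (gen deg x) b) p =
      (H.op (i - p) (h x)).lTensor H.carrier (evalCut H h b p) := by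
  by_cases hc : b.IsCut p
  · have hc' := (isCut_ins_gen_of_le (x := x) hi hp hpb).2 hc
    rw [evalCut, dif_pos hc', evalCut, dif_pos hc, LinearMap.lTensor_tmul,
      left_ins_gen_of_le hdeg hi hp hc, right_ins_gen_of_le hdeg hi hp hc, eval_ins_gen hdeg]
    rw [right_f_length]
    omega
  · rw [evalCut_of_not hc, map_zero, evalCut_of_not (mt (isCut_ins_gen_of_le hi hp hpb).1 hc)]

theorem evalCut_ins_gen_of_ge (hdeg : ∀ x, 0 < deg x) (hi : i ≤ b.f.length) {p : ℕ} (hp : i ≤ p)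
    (hpb : 0 < p) : evalCut H h (ins i (gen deg x) b) (deg x + p) =
      (H.op i (h x)).rTensor H.carrier (evalCut H h b p) := by
  by_cases hc : b.IsCut p
  · have hc' := (isCut_ins_gen_of_ge (x := x) hi hp hpb).2 hc
    rw [evalCut, dif_pos hc', evalCut, dif_pos hc, LinearMap.rTensor_tmul,
      left_ins_gen_of_ge hdeg hi hp hc, right_ins_gen_of_ge hdeg hi hp hc, eval_ins_gen hdeg]
    rwa [left_f_length]
  · rw [evalCut_of_not hc, map_zero, evalCut_of_not (mt (isCut_ins_gen_of_ge hi hp hpb).1 hc)]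

theorem evalCut_ins_gen_zero (hdeg : ∀ x, 0 < deg x) :
    evalCut H h (ins 0 (gen deg x) b) (deg x) =
      h x ⊗ₜ eval H.toPreshuffleAlgebra h b := by
  rw [evalCut, dif_pos (isCut_ins_gen_zero hdeg (b.f_length_pos hdeg)), left_ins_gen_zero hdeg,
    right_ins_gen_zero hdeg, eval_gen]

theorem evalCut_ins_gen_top (hdeg : ∀ x, 0 < deg x) :
    evalCut H h (ins b.f.length (gen deg x) b) b.f.length =
      eval H.toPreshuffleAlgebra h b ⊗ₜ h x := by
  rw [evalCut, dif_pos (isCut_ins_gen_top hdeg (b.f_length_pos hdeg)), left_ins_gen_top hdeg,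
    right_ins_gen_top hdeg, eval_gen]

theorem rTensor_proj_evalCut (hdeg : ∀ x, 0 < deg x) (hh : ∀ x, h x ∈ H.gr (deg x))
    (b : KWord X deg) (a p : ℕ) :
    (H.proj a).rTensor H.carrier (evalCut H h b p) = if p = a then evalCut H h b p else 0 := by
  by_cases hc : b.IsCut p
  · rw [evalCut, dif_pos hc, LinearMap.rTensor_tmul,
      H.proj_of_mem_eq_ite (eval_mem (A := H.toPreshuffleAlgebra) hdeg hh (b.left p hc)), left_f_length]
    split_ifs <;> simp_all
  · rw [evalCut_of_not hc, map_zero, ite_self]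

/-- The `|x| - 1` positions strictly inside the block of `x` are not cuts and are dropped. -/
theorem sum_evalCut_ins_gen (hi : i ≤ b.f.length) (hdeg : ∀ x, 0 < deg x) :
    ∑ p ∈ Finset.range (ins i (gen deg x) b).f.length, evalCut H h (ins i (gen deg x) b) p =
      ∑ p ∈ Finset.range (i + 1), evalCut H h (ins i (gen deg x) b) p +
      ∑ q ∈ Finset.range (b.f.length - i),
        evalCut H h (ins i (gen deg x) b) (deg x + (i + q)) := by
  have hl : (ins i (gen deg x) b).f.length = (i + 1) + ((deg x - 1) + (b.f.length - i)) := by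
    have := hdeg x
    rw [ins_length]
    simp only [gen, List.length_replicate]
    omega
  have hz : ∀ q ∈ Finset.range (deg x - 1),
      evalCut H h (ins i (gen deg x) b) (i + 1 + q) = 0 := fun q hq => by
    rw [Finset.mem_range] at hq
    exact evalCut_of_not (not_isCut_ins_gen hi (by omega) (by omega))
  rw [hl, Finset.sum_range_add, add_right_inj, Finset.sum_range_add, Finset.sum_eq_zero hz,
    zero_add]
  refine Finset.sum_congr rfl fun q _ => ?_
  congr 1
  have := hdeg x
  omega

/-- The compatibility condition for `h x •ᵢ b` matches the cuts: those in front of the block of `x`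
give the sum over `|y₍₁₎| ≤ i`, those behind it the sum over `|y₍₁₎| ≥ i`. The terms with `Δ (h x)`
vanish. For `i = 0` and `i = |b|` the new cut at the border of the block gives `x ⊗ b` and `b ⊗ x`.
-/
theorem Δ_eval (hdeg : ∀ x, 0 < deg x) (hh : ∀ x, h x ∈ H.gr (deg x)) (hΔ : ∀ x, H.Δ (h x) = 0)
    (a : KWord X deg) : H.Δ (eval H.toPreshuffleAlgebra h a) =
      ∑ p ∈ Finset.range a.f.length, evalCut H h a p := by
  induction a using induction_ins hdeg with
  | h1 x =>
    rw [eval_gen, hΔ, Finset.sum_eq_zero fun p _ => evalCut_of_not (not_isCut_gen x p)]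
  | h2 i x b hi ih =>
    -- The left part of a cut has the position of the cut as its degree, so each homogeneous part of
    -- the coproduct comes from a single cut.
    have hcop : ∀ a, H.copPart H.Δ a (eval H.toPreshuffleAlgebra h b) = evalCut H h b a := by
      intro a
      rw [GrSpace.copPart, ih, map_sum]
      simp only [rTensor_proj_evalCut hdeg hh]
      rw [Finset.sum_ite_eq']
      split_ifs with ha
      · rfl
      · rw [evalCut_of_ge (by simpa using ha)]
    have hm := eval_mem (A := H.toPreshuffleAlgebra) hdeg hh b
    have hpos := b.f_length_pos hdeg
    rw [eval_ins_gen hdeg hi, sum_evalCut_ins_gen hi hdeg]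
    rcases Nat.eq_zero_or_pos i with rfl | hi0
    · obtain ⟨m, hmm⟩ : ∃ m, b.f.length = m + 1 := ⟨b.f.length - 1, by omega⟩
      rw [H.Δ_op_zero, hΔ, map_zero, zero_add, ih, Nat.sub_zero, hmm, Finset.sum_range_succ',
        evalCut_zero, add_zero, zero_add, Finset.sum_range_one, evalCut_zero, zero_add,
        Finset.sum_range_succ', add_zero, add_zero, evalCut_ins_gen_zero hdeg, map_sum, add_comm]
      congr 1
      refine Finset.sum_congr rfl fun q _ => ?_
      rw [zero_add, evalCut_ins_gen_of_ge hdeg hi (Nat.zero_le _) (Nat.succ_pos q)]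
    rcases hi.lt_or_eq with hlt | rfl
    · rw [H.Δ_op_mid i _ _ _ hm hi0 hlt, hΔ, map_zero, LinearMap.zero_apply, add_zero]
      simp only [hcop]
      congr 1
      · refine Finset.sum_congr rfl fun p hp => ?_
        rw [Finset.mem_range] at hp
        rw [evalCut_ins_gen_of_le hdeg hi (by omega) (by omega)]
      -- The last index of the sum is the full length of `b`, where there is no cut.
      · rw [← Finset.Ico_add_one_right_eq_Icc, Finset.sum_Ico_succ_top hi,
          evalCut_of_ge le_rfl, map_zero, add_zero, Finset.sum_Ico_eq_sum_range]
        refine Finset.sum_congr rfl fun q _ => ?_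
        rw [evalCut_ins_gen_of_ge hdeg hi (Nat.le_add_right _ _) (by omega)]
    · rw [H.Δ_op_top _ _ _ hm, hΔ, map_zero, add_zero, Nat.sub_self, Finset.sum_range_zero, add_zero,
        Finset.sum_range_succ, Finset.sum_range_succ]
      simp only [hcop]
      rw [evalCut_of_ge le_rfl, map_zero, add_zero, evalCut_ins_gen_top hdeg]
      congr 1
      refine Finset.sum_congr rfl fun p hp => ?_
      rw [Finset.mem_range] at hp
      rw [evalCut_ins_gen_of_le hdeg le_rfl (by omega) hp]

end Bialgebra

end KWord

/-! ### The enveloping bialgebra -/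

section Enveloping

open TensorProduct GrSpace PrimOps

variable {K : Type u} [Field K]

/-- The degree-preserving map from the free preshuffle algebra that extends a map on the
generators. -/
noncomputable def freeMap {X : Type w} {deg : X → ℕ} (hdeg : ∀ x, 0 < deg x)
    (A : PreshuffleAlgebra.{u, v} K) (h : X → A.carrier) (hh : ∀ x, h x ∈ A.gr (deg x)) :
    GrHom (freePsh K deg).toGrSpace A.toGrSpace where
  lin := Finsupp.linearCombination K fun a : KWord X deg => KWord.eval A h a
  map_gr := by
    intro n x hx
    have hle : freeGr K deg n ≤ (A.gr n).comap
        (Finsupp.linearCombination K fun a : KWord X deg => KWord.eval A h a) := by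
      conv_lhs => rw [freeGr, Finsupp.supported_eq_span_single]
      rw [Submodule.span_le]
      rintro _ ⟨a, rfl, rfl⟩
      rw [SetLike.mem_coe, Submodule.mem_comap, Finsupp.linearCombination_single, one_smul]
      exact KWord.eval_mem hdeg hh a
    exact hle hx

section

variable (K) in
/-- A basis element of the free preshuffle algebra. -/
noncomputable def freeWord {X : Type w} {deg : X → ℕ} (a : KWord X deg) :
    (freePsh K deg).carrier :=
  (Finsupp.single a (1 : K) : KWord X deg →₀ K)

/-- Linear maps on the free preshuffle algebra that agree on the basis elements are equal. -/
theorem freePsh_ext {X : Type w} {deg : X → ℕ} {M : Type*} [AddCommGroup M] [Module K M]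
    {F G : (freePsh K deg).carrier →ₗ[K] M}
    (h : ∀ a : KWord X deg, F (freeWord K a) =
      G (freeWord K a)) : F = G :=
  Finsupp.lhom_ext' (φ := F) (ψ := G) fun a => LinearMap.ext_ring (h a)

theorem freePsh_op_word {X : Type w} {deg : X → ℕ} (i : ℕ) (a b : KWord X deg) :
    (freePsh K deg).op i (freeWord K a)
      (freeWord K b) =
      if i ≤ b.f.length then freeWord K (KWord.ins i a b) else 0 :=
  freeOp_single K deg i a b

theorem freeΔ_word {X : Type w} {deg : X → ℕ} (a : KWord X deg) :
    freeΔ K deg (freeWord K a) =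
      ∑ p ∈ Finset.range a.f.length, if h : a.IsCut p then
        freeWord K (a.left p h) ⊗ₜ[K]
          freeWord K (a.right p h)
      else 0 := by
  refine (Finsupp.linearCombination_single K 1 a).trans ?_
  exact one_smul K _

variable {X : Type w} {deg : X → ℕ} (hdeg : ∀ x, 0 < deg x)

theorem freeMap_word {A : PreshuffleAlgebra.{u, v} K} {h : X → A.carrier}
    (hh : ∀ x, h x ∈ A.gr (deg x)) (a : KWord X deg) :
    (freeMap hdeg A h hh).lin (freeWord K a) =
      KWord.eval A h a := by
  refine (Finsupp.linearCombination_single K 1 a).trans ?_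
  exact one_smul K _

theorem freeMap_op {A : PreshuffleAlgebra.{u, v} K} {h : X → A.carrier}
    (hh : ∀ x, h x ∈ A.gr (deg x)) (i : ℕ) (x y : (freePsh K deg).carrier) :
    (freeMap hdeg A h hh).lin ((freePsh K deg).op i x y) =
      A.op i ((freeMap hdeg A h hh).lin x) ((freeMap hdeg A h hh).lin y) := by
  have : ((freePsh K deg).op i).compr₂ (freeMap hdeg A h hh).lin =
      (A.op i).compl₁₂ (freeMap hdeg A h hh).lin (freeMap hdeg A h hh).lin := by
    refine freePsh_ext fun a => freePsh_ext fun b => ?_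
    rw [LinearMap.compr₂_apply, LinearMap.compl₁₂_apply, freePsh_op_word, freeMap_word,
      freeMap_word]
    split_ifs with hi
    · rw [← KWord.eval_ins hdeg hh a hi]
      exact freeMap_word hdeg hh _
    · rw [A.op_eq_zero i _ _ _ (KWord.eval_mem hdeg hh b) (by omega)]
      exact map_zero _
  exact LinearMap.congr_fun (LinearMap.congr_fun this x) y

theorem freeMap_gen {A : PreshuffleAlgebra.{u, v} K} {h : X → A.carrier}
    (hh : ∀ x, h x ∈ A.gr (deg x)) (x : X) :
    (freeMap hdeg A h hh).lin (freeGen K deg x).val = h x :=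
  (freeMap_word hdeg hh _).trans (KWord.eval_gen x)

theorem Δ_freeMap {H : PreshuffleBialgebra.{u, v} K} {h : X → H.carrier}
    (hh : ∀ x, h x ∈ H.gr (deg x)) (hΔ : ∀ x, H.Δ (h x) = 0) (a : (freePsh K deg).carrier) :
    H.Δ ((freeMap hdeg H.toPreshuffleAlgebra h hh).lin a) =
      TensorProduct.map (freeMap hdeg H.toPreshuffleAlgebra h hh).lin
        (freeMap hdeg H.toPreshuffleAlgebra h hh).lin (freeΔ K deg a) := by
  have : H.Δ ∘ₗ (freeMap hdeg H.toPreshuffleAlgebra h hh).lin =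
      TensorProduct.map (freeMap hdeg H.toPreshuffleAlgebra h hh).lin
        (freeMap hdeg H.toPreshuffleAlgebra h hh).lin ∘ₗ freeΔ K deg := by
    refine freePsh_ext fun a => ?_
    rw [LinearMap.comp_apply, LinearMap.comp_apply, freeMap_word, KWord.Δ_eval hdeg hh hΔ,
      freeΔ_word, map_sum]
    refine Finset.sum_congr rfl fun p _ => ?_
    rw [KWord.evalCut]
    split_ifs with hp
    · rw [TensorProduct.map_tmul, freeMap_word, freeMap_word]
    · exact (map_zero _).symm
  exact LinearMap.congr_fun this a

end

variable (V : PrimPshAlgebra.{u, v} K) (B : HomogBasis.{u, v, w} V.toGrSpace)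

theorem basisToFree_b (x : B.X) : basisToFree V B (B.b x) = (freeGen K B.deg x).val :=
  B.b.constr_basis K _ x

/-- The map `basisToFree` preserves the degree. -/
noncomputable def basisToFreeHom : GrHom V.toGrSpace (freePsh K B.deg).toGrSpace where
  lin := basisToFree V B
  map_gr := by
    intro n x hx
    rw [← Submodule.Quotient.mk_eq_zero]
    refine B.ext_of_mem (f := ((freePsh K B.deg).gr n).mkQ ∘ₗ basisToFree V B) (g := 0)
      (fun y hy => ?_) hx
    rw [LinearMap.comp_apply, basisToFree_b, LinearMap.zero_apply, Submodule.mkQ_apply,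
      Submodule.Quotient.mk_eq_zero, ← hy]
    exact (freeGen K B.deg y).mem

theorem isIdeal_envIdeal : (freePsh K B.deg).IsIdeal (envIdeal V B) := by
  intro i a c hc
  rw [envIdeal, Submodule.mem_sInf] at hc
  constructor <;> rw [envIdeal, Submodule.mem_sInf] <;> intro J hJ
  · exact (hJ.1 i a c (hc J hJ)).1
  · exact (hJ.1 i a c (hc J hJ)).2

theorem envRelators_subset : envRelators V B ⊆ envIdeal V B := fun c hc => by
  rw [SetLike.mem_coe, envIdeal, Submodule.mem_sInf]
  exact fun J hJ => hJ.2 hc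

theorem onHomog_basisToFreeHom (x : B.X) :
    (basisToFreeHom V B).onHomog (B.homog x) = freeGen K B.deg x := by
  have := basisToFree_b V B x
  simp only [GrHom.onHomog, HomogBasis.homog, basisToFreeHom, this]
  rfl

theorem lCompat_basisToFreeHom :
    LCompat B (freePsh K B.deg) (basisToFreeHom V B) (envIdeal V B) := by
  intro j xs y z hj hj'
  refine envRelators_subset V B ⟨j, xs, y, z, hj, hj', ?_⟩
  rw [List.map_map, onHomog_basisToFreeHom, show (basisToFreeHom V B).onHomog ∘ B.homog =
    freeGen K B.deg from funext (onHomog_basisToFreeHom V B)]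
  have := basisToFree_b V B z
  rw [show (basisToFreeHom V B).lin (B.b z) = (freeGen K B.deg z).val from this]
  rfl

/-- The ideal makes the generators compatible with the operations of `V`. So inserting a generator
into a combination of `•₀`-products gives, modulo the ideal, such a combination again, namely the
one computed by `insOp`. Induction over iterated insertions finishes the argument. -/
theorem exists_freeWord_sub_zeroMap_mem (a : KWord B.X B.deg) :
    ∃ c ∈ B.tgr a.f.length,
      freeWord K a - zeroMap B (freePsh K B.deg) (basisToFreeHom V B).lin c ∈ envIdeal V B := by
  have hdeg : ∀ x, 0 < B.deg x := B.deg_pos V.positive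
  have hgen : ∀ x, freeWord K (KWord.gen B.deg x) = (basisToFreeHom V B).lin (B.b x) :=
    fun x => (basisToFree_b V B x).symm
  induction a using KWord.induction_ins hdeg with
  | h1 x =>
    refine ⟨TensorAlgebra.ι K (B.b x), ?_, ?_⟩
    · simpa [KWord.gen] using B.ι_mem_tgr (B.mem x)
    · rw [zeroMap_ι, hgen, sub_self]
      exact zero_mem _
  | h2 i x b hi ih =>
    obtain ⟨c, hc, hcJ⟩ := ih
    refine ⟨insOp B i (B.b x) c, ?_, ?_⟩
    · rw [KWord.ins_length, show (KWord.gen B.deg x).f.length = B.deg x by simp [KWord.gen]]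
      exact insOp_mem B V.isGraded hi (B.homog x) hc
    · have h1 := (lCompat_basisToFreeHom V B).op_zeroMap V.isGraded (isIdeal_envIdeal V B) hi
        (b.f_length_pos hdeg) (B.b x) hc
      have h2 := (isIdeal_envIdeal V B i ((basisToFreeHom V B).lin (B.b x)) _ hcJ).1
      have h3 := freePsh_op_word (K := K) i (KWord.gen B.deg x) b
      rw [if_pos hi, hgen] at h3
      rw [map_sub, h3] at h2
      simpa using add_mem h2 h1

theorem exists_sub_augMap_mem (a : (freePsh K B.deg).carrier) :
    ∃ c, a - augMap B (freePsh K B.deg) (basisToFreeHom V B).lin c ∈ envIdeal V B := by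
  set R := LinearMap.range ((envIdeal V B).mkQ ∘ₗ
    augMap B (freePsh K B.deg) (basisToFreeHom V B).lin) with hR
  -- Stated as the vanishing of a linear map, the claim need only be tested on basis elements.
  have h2 : R.mkQ ∘ₗ (envIdeal V B).mkQ = 0 := by
    refine freePsh_ext fun a => ?_
    obtain ⟨c, -, hc⟩ := exists_freeWord_sub_zeroMap_mem V B a
    rw [LinearMap.comp_apply, LinearMap.zero_apply, Submodule.mkQ_apply,
      Submodule.Quotient.mk_eq_zero, hR, LinearMap.mem_range]
    refine ⟨B.aug c, ?_⟩
    rw [LinearMap.comp_apply, augMap_aug, Submodule.mkQ_apply, Submodule.mkQ_apply]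
    exact ((Submodule.Quotient.eq _).2 hc).symm
  have h3 := LinearMap.congr_fun h2 a
  rw [LinearMap.comp_apply, LinearMap.zero_apply, Submodule.mkQ_apply,
    Submodule.Quotient.mk_eq_zero, hR, LinearMap.mem_range] at h3
  obtain ⟨c, hc⟩ := h3
  rw [LinearMap.comp_apply, Submodule.mkQ_apply, Submodule.mkQ_apply] at hc
  exact ⟨c, (Submodule.Quotient.eq _).1 hc.symm⟩

variable {V}

/-- The map from words to `H` factors through the free algebra. Words span the free algebra modulo
the ideal and map injectively to `H`, so the kernel is no larger than the ideal; surjectivity comes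
from that of the comparison map. No property of the basis is used beyond homogeneity, so the
enveloping bialgebra does not depend on its choice. -/
theorem IsPrim.isEnveloping {H : PreshuffleBialgebra.{u, v} K}
    {ι : GrHom V.toGrSpace H.toGrSpace} (hι : IsPrim H V ι) (hH : H.IsConnected) :
    IsEnveloping V B H ι := by
  have hdeg : ∀ x, 0 < B.deg x := B.deg_pos V.positive
  have hh : ∀ x, ι.lin (B.b x) ∈ H.gr (B.deg x) := fun x => ι.map_gr _ _ (B.mem x)
  have hP := hι.isPrimOps
  set φ := freeMap (deg := B.deg) hdeg H.toPreshuffleAlgebra (fun x => ι.lin (B.b x)) hh with hφ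
  have hop : ∀ i a c, φ.lin ((freePsh K B.deg).op i a c) = H.op i (φ.lin a) (φ.lin c) :=
    freeMap_op hdeg hh
  have hgen : ∀ x, φ.lin (freeGen K B.deg x).val = ι.lin (B.b x) := freeMap_gen hdeg hh
  have hcomp : φ.lin ∘ₗ (basisToFreeHom V B).lin = ι.lin := B.b.ext fun x => by
    refine Eq.trans ?_ (hgen x)
    exact congrArg φ.lin (basisToFree_b V B x)
  have haug : ∀ a, φ.lin (augMap B (freePsh K B.deg) (basisToFreeHom V B).lin a) =
      augMap B H.toPreshuffleAlgebra ι.lin a := fun a =>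
    (φ.map_augMap B _ hop a).trans (by rw [hcomp])
  have hker : envIdeal V B ≤ LinearMap.ker φ.lin := by
    refine sInf_le ⟨fun i a c hc => ?_, ?_⟩
    · rw [LinearMap.mem_ker] at hc
      rw [LinearMap.mem_ker, LinearMap.mem_ker, hop, hop, hc, map_zero, map_zero,
        LinearMap.zero_apply]
      exact ⟨rfl, rfl⟩
    · rintro _ ⟨i, xs, y, z, hi, hi', rfl⟩
      have hon : ∀ x, φ.onHomog (freeGen K B.deg x) = ι.onHomog (B.homog x) := fun x => by
        simp only [GrHom.onHomog, hgen]
        rfl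
      have h1 := hP.lCompat B i xs y z hi hi'
      rw [Submodule.mem_bot, sub_eq_zero, List.map_map] at h1
      have h2 := φ.map_Lop hop i (xs.map (freeGen K B.deg)) (freeGen K B.deg y)
        (freeGen K B.deg z).val
      rw [List.map_map, hon, hgen, show φ.onHomog ∘ freeGen K B.deg = ι.onHomog ∘ B.homog from
        funext hon] at h2
      rw [SetLike.mem_coe, LinearMap.mem_ker, map_sub, sub_eq_zero]
      exact h2.trans (h1.trans (LinearMap.congr_fun hcomp _).symm)
  have hspan := exists_sub_augMap_mem V B
  refine ⟨φ, hop, Δ_freeMap hdeg hh fun x => hP.Δ_apply _, fun y => ?_, ?_, hgen⟩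
  · obtain ⟨a, rfl⟩ := hP.augMap_surjective B hH y
    exact ⟨_, haug a⟩
  · refine le_antisymm (fun a ha => ?_) hker
    obtain ⟨c, hc⟩ := hspan a
    have h1 := hker hc
    rw [LinearMap.mem_ker, map_sub, ha, zero_sub, neg_eq_zero, haug] at h1
    have h2 : c = 0 := hP.augMap_injective B (h1.trans (map_zero _).symm)
    rwa [h2, map_zero, sub_zero] at hc

end Enveloping

/-! ### The main theorem -/

section Equivalence

open TensorProduct GrSpace PrimOps CategoryTheory

theorem IsPrim.comp_iso {K : Type u} [Field K] {H : PreshuffleBialgebra.{u, v} K}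
    {P Q : PrimPshAlgebra.{u, w} K} {ι : GrHom P.toGrSpace H.toGrSpace} (hι : IsPrim H P ι)
    (e : Q ≅ P) : IsPrim H Q (ι.comp (PrimPshHom.toGrHom e.hom)) where
  injective := hι.injective.comp (Function.LeftInverse.injective (g := (PrimPshHom.toGrHom e.inv).lin)
    fun x => congrArg (fun g : Q ⟶ Q => (PrimPshHom.toGrHom g).lin x) e.hom_inv_id)
  range_eq := by
    have hs : Function.Surjective (PrimPshHom.toGrHom e.hom).lin :=
      Function.RightInverse.surjective (g := (PrimPshHom.toGrHom e.inv).lin)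
        fun x => congrArg (fun g : P ⟶ P => (PrimPshHom.toGrHom g).lin x) e.inv_hom_id
    rw [← hι.range_eq]
    exact LinearMap.range_comp_of_range_eq_top ι.lin (LinearMap.range_eq_top.2 hs)
  map_L := hι.lop_comp e.hom

end Equivalence

theorem mainTheorem3 (K : Type u) [Field K] :
    ∃ (e : CategoryTheory.Equivalence
          (ConnPshBialg.{u, max u v} K) (PrimPshAlgebra.{u, max u v} K))
      (ι : ∀ H : ConnPshBialg.{u, max u v} K,
        GrHom (e.functor.obj H).toGrSpace H.toGrSpace)
      (η : ∀ V : PrimPshAlgebra.{u, max u v} K,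
        GrHom V.toGrSpace (e.inverse.obj V).toGrSpace),
      -- the functor `e.functor` is `H ↦ Prim(H)`
      (∀ H, IsPrim H.toPreshuffleBialgebra (e.functor.obj H) (ι H)) ∧
      (∀ (H H' : ConnPshBialg.{u, max u v} K) (f : H ⟶ H') (x : (e.functor.obj H).carrier),
        (ι H').lin (PrimPshHom.toGrHom (e.functor.map f) |>.lin x) =
          (PshBialgHom.toGrHom f).lin ((ι H).lin x)) ∧
      -- the functor `e.inverse` is `V ↦ U_Psh(V)`, for every choice of a homogeneous basis
      (∀ (V : PrimPshAlgebra.{u, max u v} K) (B : HomogBasis.{u, max u v, w} V.toGrSpace),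
        IsEnveloping V B (e.inverse.obj V).toPreshuffleBialgebra (η V)) ∧
      (∀ (V W : PrimPshAlgebra.{u, max u v} K) (g : V ⟶ W) (x : V.carrier),
        (PshBialgHom.toGrHom (e.inverse.map g)).lin ((η V).lin x) =
          (η W).lin ((PrimPshHom.toGrHom g).lin x)) ∧
      -- every connected preshuffle bialgebra `H` is isomorphic to `U_Psh(Prim(H))`
      (∀ H : ConnPshBialg.{u, max u v} K, Nonempty (H ≅ e.inverse.obj (e.functor.obj H))) ∧
      -- every `Prim_psh` algebra `V` is isomorphic to `Prim(U_Psh(V))`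
      (∀ V : PrimPshAlgebra.{u, max u v} K, Nonempty (V ≅ e.functor.obj (e.inverse.obj V))) := by
  let e : CategoryTheory.Equivalence (ConnPshBialg.{u, max u v} K)
    (PrimPshAlgebra.{u, max u v} K) := (primFunctor.{u, max u v} K).asEquivalence
  -- The inverse functor is only given abstractly; the counit identifies the primitive part of its
  -- value at `V` with `V`.
  let κ (V : PrimPshAlgebra.{u, max u v} K) : V ≅ (e.inverse.obj V).prim :=
    (e.counitIso.app V).symm
  refine ⟨e, fun H => H.primIncl,
    fun V => (e.inverse.obj V).primIncl.comp (PrimPshHom.toGrHom (κ V).hom),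
    fun H => H.isPrim_prim, fun H H' f x => primIncl_primMap f x, fun V B => ?_,
    fun V W g x => ?_, fun H => ⟨e.unitIso.app H⟩, fun V => ⟨κ V⟩⟩
  -- A connected bialgebra with primitive part `V` is an enveloping bialgebra of `V` for every
  -- homogeneous basis.
  · exact ((e.inverse.obj V).isPrim_prim.comp_iso (κ V)).isEnveloping B (e.inverse.obj V).connected
  · have h1 := primIncl_primMap (e.inverse.map g) ((PrimPshHom.toGrHom (κ V).hom).lin x)
    refine h1.symm.trans (congrArg (e.inverse.obj W).primIncl.lin ?_)
    -- That `e.inverse.map g` extends `g` is the naturality of the counit.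
    have h2 := e.counitIso.inv.naturality g
    exact (congrArg (fun f : V ⟶ (e.inverse.obj W).prim => (PrimPshHom.toGrHom f).lin x) h2).symm
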